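/- **Setting.** Let $0<\rho<1$, $0\le\gamma\le1$. Let $\nu:\mathbb R^3\to\mathbb R$ be differentiable and $k:\mathbb R^3\times\mathbb R^3\to\mathbb R$ measurable, with $k(\cdot,v^*)$ differentiable on $\mathbb R^3\setminus\{v^*\}$, such that for some positive constants $\nu_0,\nu_1,c$ and all $v\ne v^*$ $$\nu_0(1+|v|)^\gamma\le\nu(v)\le\nu_1(1+|v|)^\gamma,\qquad |\nabla\nu(v)|\le c\,(1+|v|)^{\gamma-1},$$ $$|k(v,v^*)|\le \frac{c\,E_\rho(v,v^*)}{|v-v^*|(1+|v|+|v^*|)^{1-\gamma}},\qquad |\nabla_vk(v,v^*)|\le \frac{c\,(1+|v|)\,E_\rho(v,v^*)}{|v-v^*|^2(1+|v|+|v^*|)^{1-\gamma}},$$ where $E_\rho(v,v^*)=\exp\Big(-\frac{1-\rho}4\Big(|v-v^*|^2+\Big(\frac{|v|^2-|v^*|^2}{|v-v^*|}\Big)^2\Big)\Big)$. For a bounded convex domain $\Omega\subset\mathbb R^3$ with $C^2$ boundary, outward unit normal $n$ and surface measure $d\Sigma$, put $\tau(x,v)=\inf\{s>0: x-sv\notin\Omega\}$,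 $q(x,v)=x-\tau(x,v)v$, $\Gamma^-=\{(z,v)\in\partial\Omega\times\mathbb R^3: n(z)\cdot v<0\}$, $N(z,v)=|n(z)\cdot v|/|v|$, and $$Kh(x,v)=\int_{\mathbb R^3}k(v,v^*)h(x,v^*)\,dv^*,\qquad S_\Omega h(x,v)=\int_0^{\tau(x,v)}e^{-\nu(v)s}h(x-sv,v)\,ds .$$ For $1\le p<\infty$ and $\alpha\ge0$ let $\|f\|_{L^p_\alpha(\Omega\times\mathbb R^3)}^p=\int_{\Omega\times\mathbb R^3}|f|^pe^{p\alpha|v|^2}\,dx\,dv$; let $\|f\|_{W^{1,p}_\alpha(\Omega\times\mathbb R^3)}$ be the sum of the $L^p_\alpha(\Omega\times\mathbb R^3)$ norms of $f$ and of its weak gradients $\nabla_xf$ and $\nabla_vf$; let $W^{1,p}_\alpha(\Omega\times\mathbb R^3)$ be the space where this is finite; and let $\|h\|_{L^p_\alpha(\partial\Omega\times\mathbb R^3)}^p=\int_{\partial\Omega\times\mathbb R^3}|h(z,v)|^pe^{p\alpha|v|^2}\,d\Sigma(z)\,dv$, with the boundary values of $h$ taken in the sense of traces. **Lemma.** Let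 $2\le p<3$ and $0\le\alpha<(1-\rho)/2$. There is a constant $C>0$, depending only on $\nu,k,\rho,\gamma,p,\alpha$ (not on $\Omega$, $C_3$ or $h$), such that the following holds for every bounded convex domain $\Omega\subset\mathbb R^3$ with $C^2$ boundary of positive Gaussian curvature. There is a constant $C_3=C_3(\Omega)>0$ with $$|z-q(z,-v)|\le C_3\,N(z,v)\qquad\text{for all }(z,v)\in\Gamma^-,$$ and for every such constant $C_3$ and every $h\in W^{1,p}_\alpha(\Omega\times\mathbb R^3)$ the integrals that define $Kh(x,v)$ and $S_\Omega Kh(x,v)$ converge absolutely for almost every $(x,v)\in\Omega\times\mathbb R^3$, and $$\|S_\Omega Kh\|_{W^{1,p}_\alpha(\Omega\times\mathbb R^3)}\le C\Big(\operatorname{diam}(\Omega)^{1/p}\|h\|_{W^{1,p}_\alpha(\Omega\times\mathbb R^3)}+\|h\|_{L^p_\alpha(\Omega\times\mathbb R^3)}+C_3^{1/p}\|h\|_{L^p_\alpha(\partial\Omega\times\mathbb R^3)}\Big).$$ -/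

import Mathlib

open MeasureTheory Set Filter Topology
open scoped ENNReal

noncomputable section

namespace StationaryBoltzmann

/-- Physical space and velocity space: `ℝ³` with the Euclidean norm. -/
abbrev E3 : Type := EuclideanSpace ℝ (Fin 3)

/-! ### The collision operator -/

/-- The Gaussian-type factor
`E_ρ(v, w) = exp (-(1-ρ)/4 * (|v-w|² + ((|v|²-|w|²)/|v-w|)²))`, used only for `v ≠ w`. -/
def gaussFactor (ρ : ℝ) (v w : E3) : ℝ :=
  Real.exp (-((1 - ρ) / 4) * (‖v - w‖ ^ 2 + ((‖v‖ ^ 2 - ‖w‖ ^ 2) / ‖v - w‖) ^ 2))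

/-- The assumption on the collision frequency `ν` and the integral kernel `k` of the linearized
collision operator `L f = -ν f + K f`. The kernel is singular on the diagonal `v = w`, so the
conditions on it are imposed off the diagonal. The norm of a Fréchet derivative of a scalar
function is the Euclidean norm of its gradient. -/
structure AssumptionA (ρ γ : ℝ) (ν : E3 → ℝ) (k : E3 → E3 → ℝ) : Prop where
  rho_pos : 0 < ρ
  rho_lt_one : ρ < 1
  gamma_nonneg : 0 ≤ γ
  gamma_le_one : γ ≤ 1
  nu_bounds : ∃ ν₀ ν₁ : ℝ, 0 < ν₀ ∧ 0 < ν₁ ∧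
    ∀ v, ν₀ * (1 + ‖v‖) ^ γ ≤ ν v ∧ ν v ≤ ν₁ * (1 + ‖v‖) ^ γ
  nu_differentiable : Differentiable ℝ ν
  nu_deriv_bound : ∃ C : ℝ, 0 < C ∧ ∀ v, ‖fderiv ℝ ν v‖ ≤ C * (1 + ‖v‖) ^ (γ - 1)
  k_measurable : Measurable (Function.uncurry k)
  k_bound : ∃ C : ℝ, 0 < C ∧ ∀ v w, v ≠ w →
    |k v w| ≤ C * (1 / (‖v - w‖ * (1 + ‖v‖ + ‖w‖) ^ (1 - γ))) * gaussFactor ρ v w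
  k_differentiable : ∀ v w, v ≠ w → DifferentiableAt ℝ (fun u => k u w) v
  k_deriv_bound : ∃ C : ℝ, 0 < C ∧ ∀ v w, v ≠ w →
    ‖fderiv ℝ (fun u => k u w) v‖ ≤
      C * ((1 + ‖v‖) / (‖v - w‖ ^ 2 * (1 + ‖v‖ + ‖w‖) ^ (1 - γ))) * gaussFactor ρ v w

/-- `K h (x, v) = ∫ k(v, w) h(x, w) dw`. -/
def opK (k : E3 → E3 → ℝ) (h : E3 × E3 → ℝ) (y : E3 × E3) : ℝ :=
  ∫ w, k y.2 w * h (y.1, w)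

/-! ### Backward exit time and the transport operator -/

/-- `τ(x, v) = inf {s > 0 | x - s v ∉ Ω}`. -/
def exitTime (Ω : Set E3) (x v : E3) : ℝ := sInf {s : ℝ | 0 < s ∧ x - s • v ∉ Ω}

/-- `q(x, v) = x - τ(x, v) v`. -/
def exitPoint (Ω : Set E3) (x v : E3) : E3 := x - exitTime Ω x v • v

/-- `S_Ω h (x, v) = ∫_0^{τ(x, v)} e^{-ν(v) s} h(x - s v, v) ds`. -/
def opS (Ω : Set E3) (ν : E3 → ℝ) (h : E3 × E3 → ℝ) (y : E3 × E3) : ℝ :=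
  ∫ s in (0 : ℝ)..exitTime Ω y.1 y.2, Real.exp (-(ν y.2 * s)) * h (y.1 - s • y.2, y.2)

/-! ### Geometry of the domain -/

/-- `φ` is a `C²` defining function of `Ω` near the boundary point `z`:
`Ω` is `{φ < 0}` near `z`, and `∇φ(z) ≠ 0`. -/
structure IsLocalDefiningFunction (Ω : Set E3) (z : E3) (φ : E3 → ℝ) : Prop where
  contDiffAt : ContDiffAt ℝ 2 φ z
  gradient_ne_zero : gradient φ z ≠ 0
  eventually_mem_iff : ∀ᶠ x in 𝓝 z, (x ∈ Ω ↔ φ x < 0)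

/-- Bounded convex domains of `ℝ³` with `C²` boundary. -/
structure IsBoundedConvexC2Domain (Ω : Set E3) : Prop where
  isOpen : IsOpen Ω
  nonempty : Ω.Nonempty
  isBounded : Bornology.IsBounded Ω
  convex : Convex ℝ Ω
  exists_definingFunction : ∀ z ∈ frontier Ω, ∃ φ, IsLocalDefiningFunction Ω z φ

/-- The second fundamental form at `z` of the level surface of `φ` through `z`, with respect to
the unit normal `∇φ/|∇φ|`: `II(a, b) = D²φ(z)(a, b) / |∇φ(z)|` for tangent vectors `a, b`. -/
def secondFundamentalForm (φ : E3 → ℝ) (z a b : E3) : ℝ :=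
  fderiv ℝ (fderiv ℝ φ) z a b / ‖gradient φ z‖

/-- `κ` is the Gaussian curvature of `∂Ω` at `z`: the determinant of the second fundamental form
in an orthonormal basis of the tangent plane. (It depends neither on the basis nor on the
defining function.) -/
def IsGaussianCurvatureAt (Ω : Set E3) (z : E3) (κ : ℝ) : Prop :=
  ∃ (φ : E3 → ℝ) (a b : E3), IsLocalDefiningFunction Ω z φ ∧
    Orthonormal ℝ ![a, b] ∧ inner ℝ (gradient φ z) a = 0 ∧ inner ℝ (gradient φ z) b = 0 ∧
    κ = secondFundamentalForm φ z a a * secondFundamentalForm φ z b b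
      - secondFundamentalForm φ z a b ^ 2

/-- `∂Ω` has positive Gaussian curvature. -/
def HasPositiveGaussianCurvature (Ω : Set E3) : Prop :=
  ∀ z ∈ frontier Ω, ∃ κ : ℝ, 0 < κ ∧ IsGaussianCurvatureAt Ω z κ

open Classical in
/-- The outward unit normal `n(z) = ∇φ(z)/|∇φ(z)|` at `z ∈ ∂Ω`, where `φ` is any `C²` defining
function of `Ω` near `z` (the value does not depend on `φ`). -/
def outwardNormal (Ω : Set E3) (z : E3) : E3 :=
  if H : ∃ φ, IsLocalDefiningFunction Ω z φ then
    ‖gradient H.choose z‖⁻¹ • gradient H.choose z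
  else 0

/-- The incoming boundary `Γ⁻ = {(z, v) ∈ ∂Ω × ℝ³ | n(z) · v < 0}`. -/
def incomingBoundary (Ω : Set E3) : Set (E3 × E3) :=
  {y | y.1 ∈ frontier Ω ∧ inner ℝ (outwardNormal Ω y.1) y.2 < 0}

/-- `N(z, v) = |n(z) · v/|v||`. -/
def normalCosine (Ω : Set E3) (z v : E3) : ℝ :=
  |inner ℝ (outwardNormal Ω z) (‖v‖⁻¹ • v)|

/-- The positive constant `C₃` satisfies `|z - q(z, -v)| ≤ C₃ N(z, v)` on `Γ⁻`. -/
def IsChordConstant (Ω : Set E3) (C₃ : ℝ) : Prop :=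
  0 < C₃ ∧ ∀ z v, (z, v) ∈ incomingBoundary Ω →
    ‖z - exitPoint Ω z (-v)‖ ≤ C₃ * normalCosine Ω z v

/-! ### Weighted Lebesgue and Sobolev norms, with values in `[0, ∞]` -/

/-- `(∫ |f(x, v)|^p e^{pα|v|²} dμ(x, v))^{1/p}`. -/
def weightedNorm {F : Type*} [NormedAddCommGroup F] [NormedSpace ℝ F]
    (μ : Measure (E3 × E3)) (p α : ℝ) (f : E3 × E3 → F) : ℝ≥0∞ :=
  eLpNorm (fun y => Real.exp (α * ‖y.2‖ ^ 2) • f y) (ENNReal.ofReal p) μ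

/-- Lebesgue measure on `Ω × ℝ³`. -/
def phaseMeasure (Ω : Set E3) : Measure (E3 × E3) := volume.restrict (Ω ×ˢ univ)

/-- The measure `dΣ dv` on `∂Ω × ℝ³`, with `dΣ` the surface measure on `∂Ω`, i.e. the
two-dimensional Hausdorff measure in its Euclidean normalization. -/
def boundaryMeasure (Ω : Set E3) : Measure (E3 × E3) :=
  ((Measure.euclideanHausdorffMeasure 2 : Measure E3).restrict (frontier Ω)).prod volume

/-- Smooth test functions with compact support in `Ω × ℝ³`. -/
structure IsTestFunction (Ω : Set E3) (φ : E3 × E3 → ℝ) : Prop where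
  contDiff : ContDiff ℝ (⊤ : ℕ∞) φ
  hasCompactSupport : HasCompactSupport φ
  tsupport_subset : tsupport φ ⊆ Ω ×ˢ univ

/-- `G = ∇ₓ f` in the weak sense on `Ω × ℝ³`. -/
structure HasWeakGradX (Ω : Set E3) (f : E3 × E3 → ℝ) (G : E3 × E3 → E3) : Prop where
  locInt : LocallyIntegrableOn f (Ω ×ˢ univ)
  locInt_grad : LocallyIntegrableOn G (Ω ×ˢ univ)
  integral_eq : ∀ φ, IsTestFunction Ω φ → ∀ e : E3,
    ∫ y in Ω ×ˢ univ, f y * fderiv ℝ φ y (e, 0) = -∫ y in Ω ×ˢ univ, inner ℝ (G y) e * φ y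

/-- `G = ∇ᵥ f` in the weak sense on `Ω × ℝ³`. -/
structure HasWeakGradV (Ω : Set E3) (f : E3 × E3 → ℝ) (G : E3 × E3 → E3) : Prop where
  locInt : LocallyIntegrableOn f (Ω ×ˢ univ)
  locInt_grad : LocallyIntegrableOn G (Ω ×ˢ univ)
  integral_eq : ∀ φ, IsTestFunction Ω φ → ∀ e : E3,
    ∫ y in Ω ×ˢ univ, f y * fderiv ℝ φ y (0, e) = -∫ y in Ω ×ˢ univ, inner ℝ (G y) e * φ y

/-- `‖f‖_{L^p_α(Ω × ℝ³)}`. -/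
def lpAlphaNorm {F : Type*} [NormedAddCommGroup F] [NormedSpace ℝ F]
    (Ω : Set E3) (p α : ℝ) (f : E3 × E3 → F) : ℝ≥0∞ :=
  weightedNorm (phaseMeasure Ω) p α f

/-- `‖f‖_{W^{1,p}_α(Ω × ℝ³)} = ‖f‖_{L^p_α} + ‖∇ₓ f‖_{L^p_α} + ‖∇ᵥ f‖_{L^p_α}`. Weak gradients are
unique up to null sets, so each infimum is the norm of the weak gradient if there is one, and it
is `∞` if there is none. -/
def w1pNorm (Ω : Set E3) (p α : ℝ) (f : E3 × E3 → ℝ) : ℝ≥0∞ :=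
  lpAlphaNorm Ω p α f
    + (⨅ (G : E3 × E3 → E3) (_ : HasWeakGradX Ω f G), lpAlphaNorm Ω p α G)
    + (⨅ (G : E3 × E3 → E3) (_ : HasWeakGradV Ω f G), lpAlphaNorm Ω p α G)

/-- `f ∈ W^{1,p}_α(Ω × ℝ³)`. -/
def MemW1p (Ω : Set E3) (p α : ℝ) (f : E3 × E3 → ℝ) : Prop := w1pNorm Ω p α f < ∞

/-- `T` is the trace of `f` on `∂Ω × ℝ³`: it is the limit in `L^p_α(∂Ω × ℝ³)` of the boundary
values of smooth functions that converge to `f` in `W^{1,p}_α(Ω × ℝ³)`. -/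
structure IsBoundaryTrace (Ω : Set E3) (p α : ℝ) (f T : E3 × E3 → ℝ) : Prop where
  aestronglyMeasurable : AEStronglyMeasurable T (boundaryMeasure Ω)
  exists_approx : ∃ φ : ℕ → E3 × E3 → ℝ,
    (∀ n, ContDiff ℝ (⊤ : ℕ∞) (φ n) ∧ HasCompactSupport (φ n)) ∧
    Tendsto (fun n => w1pNorm Ω p α (φ n - f)) atTop (𝓝 0) ∧
    Tendsto (fun n => weightedNorm (boundaryMeasure Ω) p α (φ n - T)) atTop (𝓝 0)

/-- `‖f‖_{L^p_α(∂Ω × ℝ³)}`, the boundary values of `f` being taken in the sense of traces. The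
trace is unique up to null sets, so the infimum is the norm of the trace. On bounded `C²` domains
every `f ∈ W^{1,p}_α(Ω × ℝ³)` has a trace. -/
def boundaryNorm (Ω : Set E3) (p α : ℝ) (f : E3 × E3 → ℝ) : ℝ≥0∞ :=
  ⨅ (T : E3 × E3 → ℝ) (_ : IsBoundaryTrace Ω p α f T), weightedNorm (boundaryMeasure Ω) p α T

end StationaryBoltzmann

end

open StationaryBoltzmann

/-! Take first `h` of class `C¹` with compact support. The substitution `s = θ τ(x, v)` writes `S_Ω
K h (x, v)` as the integral over `(θ, w) ∈ (0, 1] × ℝ³` of `τ e^{-ν θ τ} k(v, w) h(x - θ τ v, w)`.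
For fixed `(θ, w)` this integrand is classically differentiable in `(x, v)` off the null sets `v =
0` and `v = w`, and Fubini turns its derivative into the weak derivative of `S_Ω K h`. The terms
that contain the derivative of `τ` form an exact `θ`-derivative (`integral_hasDerivAt_ray`) and
collapse to a boundary term at the exit point `q`. The remaining terms are integrals along the ray
of `k ∇ₓh`, `(∇ᵥk) h` and `k h`. The velocity gradient of `h` never occurs, because `h` is evaluated
at the integration variable `w`.

Interior terms. Hölder's inequality against `e^{-as} ds` and the translation `x ↦ x - s v` reduce
the `L^p` bounds to bounds for operators in the velocity alone (`lintegral_rayOp_rpow_le`). The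
kernel `|v-w|⁻¹` times a Gaussian is handled by Hölder, the kernel of `∇ᵥk` by Schur's test: its
growth `1 + |v|` is compensated because the Gaussian in `(|v|²-|w|²)/|v-w|` confines `w` to a thin
slab (`exists_lintegral_gradKernel_le`). The weight `e^{α|v|²}` costs only a part of the exponent,
since `α < (1-ρ)/2` (`gaussFactor_mul_exp_le`). A ray stays in `Ω` for a time at most `diam Ω /
|v|`, and `|v|⁻¹` is integrable against Gaussians; this gives the factor `diam(Ω)^{1/p}` in front of
`∇ₓh`.

Boundary term. The derivative of `τ` is at most `(1 + τ)/|n(q)·v|` (`hasFDerivAt_exitTime`). For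
fixed `v` the image of Lebesgue measure under `x ↦ q(x, v)` is bounded, up to a constant, by `|n·v|`
times the crossing time times `dΣ` (`map_exitPoint_le`), and the crossing time is at most `C₃
|n·v|/|v|²`. So the `p`-th power of `|n·v|⁻¹` becomes `C₃ |n·v|^{2-p} |v|⁻²`, which is integrable
against Gaussians uniformly in `n` because `p < 3`. The constant `C₃` exists since positive
curvature gives `c |z-y|² ≤ n(z)·(z-y)` on the compact boundary (`exists_inner_outwardNormal_ge`).

General `h`. Along smooth functions that converge to `h` and to its trace, the estimate applied to
differences makes the derivatives a Cauchy sequence, while `S_Ω K` is continuous on `L^p`; the limit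
is the weak derivative and inherits the bound (`exists_hasWeakPartial_of_isBoundaryTrace`). -/

/-! ### Orthonormal coordinates in `ℝ³` -/

/-- The coordinates of a vector in an orthonormal basis. -/
noncomputable def coordMap (B : OrthonormalBasis (Fin 3) ℝ E3) (v : E3) : ℝ × ℝ × ℝ :=
  (inner ℝ (B 0) v, inner ℝ (B 1) v, inner ℝ (B 2) v)

theorem measurePreserving_coordMap (B : OrthonormalBasis (Fin 3) ℝ E3) :
    MeasurePreserving (coordMap B) := by
  have h1 := B.measurePreserving_repr
  have h2 := (PiLp.volume_preserving_ofLp (Fin 3)).comp h1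
  have h3 := (volume_preserving_piFinSuccAbove (fun _ : Fin 3 => ℝ) 0).comp h2
  have h4 : MeasurePreserving (MeasurableEquiv.finTwoArrow (α := ℝ)) := volume_preserving_finTwoArrow ℝ
  have h5 := ((MeasurePreserving.id (volume : Measure ℝ)).prod h4).comp h3
  have e : coordMap B = Prod.map id MeasurableEquiv.finTwoArrow ∘
      (MeasurableEquiv.piFinSuccAbove (fun _ : Fin 3 => ℝ) 0) ∘ WithLp.ofLp ∘ B.repr := by
    funext v
    simp [coordMap, OrthonormalBasis.repr_apply_apply, MeasurableEquiv.piFinSuccAbove,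
      MeasurableEquiv.finTwoArrow, Fin.tail, Function.comp]
  rw [e]
  exact h5

theorem norm_sq_eq_coord (B : OrthonormalBasis (Fin 3) ℝ E3) (v : E3) :
    ‖v‖ ^ 2 = inner ℝ (B 0) v ^ 2 + inner ℝ (B 1) v ^ 2 + inner ℝ (B 2) v ^ 2 := by
  rw [← B.sum_sq_inner_left]
  · simp [Fin.sum_univ_three, real_inner_comm]

theorem lintegral_coord (B : OrthonormalBasis (Fin 3) ℝ E3) {F : ℝ × ℝ × ℝ → ℝ≥0∞}
    (hF : Measurable F) :
    ∫⁻ v : E3, F (inner ℝ (B 0) v, inner ℝ (B 1) v, inner ℝ (B 2) v) =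
      ∫⁻ a, ∫⁻ b, ∫⁻ c, F (a, b, c) := by
  have := (measurePreserving_coordMap B).lintegral_comp hF
  simp only [coordMap] at this
  rw [this, Measure.volume_eq_prod, lintegral_prod _ hF.aemeasurable]
  refine lintegral_congr fun a => ?_
  rw [Measure.volume_eq_prod, lintegral_prod _ (by fun_prop)]

theorem exists_orthonormalBasis_zero {n : E3} (hn : ‖n‖ = 1) :
    ∃ B : OrthonormalBasis (Fin 3) ℝ E3, B 0 = n := by
  have : Orthonormal ℝ (({0} : Set (Fin 3)).domRestrict (fun _ => n)) := by
    refine ⟨fun i => by simpa [Set.domRestrict] using hn, fun i j hij => ?_⟩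
    exact absurd (Subsingleton.elim i j) hij
  obtain ⟨B, hB⟩ := this.exists_orthonormalBasis_extension_of_card_eq (by simp)
  exact ⟨B, hB 0 rfl⟩

/-! ### Gaussian integrals with singularities -/

/-- The Gaussian `e^{-c|v|²}` with values in `[0, ∞]`. -/
noncomputable def gaussE {E : Type*} [NormedAddCommGroup E] (c : ℝ) (v : E) : ℝ≥0∞ :=
  ENNReal.ofReal (Real.exp (-c * ‖v‖ ^ 2))

@[fun_prop]
theorem measurable_gaussE {E : Type*} [NormedAddCommGroup E] [MeasurableSpace E]
    [OpensMeasurableSpace E] (c : ℝ) : Measurable (gaussE c : E → ℝ≥0∞) := by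
  unfold gaussE; fun_prop

theorem gaussE_le_one {E : Type*} [NormedAddCommGroup E] {c : ℝ} (hc : 0 ≤ c) (v : E) :
    gaussE c v ≤ 1 := by
  unfold gaussE
  rw [ENNReal.ofReal_le_one, Real.exp_le_one_iff]
  nlinarith [sq_nonneg ‖v‖]

theorem lintegral_gaussE_lt_top {c : ℝ} (hc : 0 < c) : ∫⁻ t : ℝ, gaussE c t < ∞ := by
  have := (integrable_exp_neg_mul_sq hc).lintegral_lt_top
  simpa [gaussE] using this

theorem setLIntegral_enorm_rpow_lt_top {b : ℝ} (hb : b < 1) :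
    ∫⁻ t in Icc (-1 : ℝ) 1, ‖t‖ₑ ^ (-b) < ∞ := by
  have key : ∫⁻ t in Ioc (0 : ℝ) 1, ‖t‖ₑ ^ (-b) < ∞ := by
    have h := (intervalIntegral.intervalIntegrable_rpow' (a := 0) (b := 1) (r := -b)
      (by linarith)).1.lintegral_lt_top
    refine lt_of_le_of_lt (setLIntegral_mono' measurableSet_Ioc fun t ht => ?_) h
    rw [Real.enorm_eq_ofReal ht.1.le, ENNReal.ofReal_rpow_of_pos ht.1]
  have key2 : ∫⁻ t in Ico (-1 : ℝ) 0, ‖t‖ₑ ^ (-b) < ∞ := by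
    have h := (Measure.measurePreserving_neg (volume : Measure ℝ)).setLIntegral_comp_preimage
      (s := Ioc (0:ℝ) 1) measurableSet_Ioc (f := fun t => ‖t‖ₑ ^ (-b)) (by fun_prop)
    have h2 : (Neg.neg ⁻¹' Ioc (0:ℝ) 1) = Ico (-1) 0 := by ext; simp [and_comm, neg_le]
    rw [h2] at h
    simp only [enorm_neg] at h
    rw [h]; exact key
  have : Icc (-1:ℝ) 1 ⊆ (Ico (-1) 0 ∪ Ioc 0 1) ∪ {0} := by
    intro t ht
    rcases lt_trichotomy t 0 with h | h | h
    · exact Or.inl (Or.inl ⟨ht.1, h⟩)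
    · exact Or.inr h
    · exact Or.inl (Or.inr ⟨h, ht.2⟩)
  refine lt_of_le_of_lt (lintegral_mono_set this) ?_
  refine lt_of_le_of_lt (lintegral_union_le _ _ _) ?_
  refine ENNReal.add_lt_top.2 ⟨lt_of_le_of_lt (lintegral_union_le _ _ _) (ENNReal.add_lt_top.2 ⟨key2, key⟩), ?_⟩
  simp

/-- On `|t| ≤ 1` the Gaussian is at most `1` and the power is integrable since `b < 1`; elsewhere
the power is at most `1` and the Gaussian integral is translation invariant. Neither bound sees the
centre `s`. -/
theorem exists_lintegral_rpow_mul_gaussE_le {b c : ℝ} (hb0 : 0 ≤ b) (hb : b < 1) (hc : 0 < c) :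
    ∃ C : ℝ≥0∞, C ≠ ∞ ∧ ∀ s : ℝ, ∫⁻ t : ℝ, ‖t‖ₑ ^ (-b) * gaussE c (t - s) ≤ C := by
  refine ⟨(∫⁻ t in Icc (-1 : ℝ) 1, ‖t‖ₑ ^ (-b)) + ∫⁻ t : ℝ, gaussE c t,
    (ENNReal.add_lt_top.2 ⟨setLIntegral_enorm_rpow_lt_top hb, lintegral_gaussE_lt_top hc⟩).ne,
    fun s => ?_⟩
  rw [← lintegral_add_compl _ (measurableSet_Icc (a := (-1:ℝ)) (b := 1))]
  refine add_le_add ?_ ?_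
  · exact lintegral_mono fun t => mul_le_of_le_one_right' (gaussE_le_one hc.le _)
  · rw [← lintegral_sub_right_eq_self (fun t => gaussE c t) s]
    refine (setLIntegral_mono' measurableSet_Icc.compl fun t ht => ?_).trans
      (setLIntegral_le_lintegral _ _)
    refine mul_le_of_le_one_left' ?_
    have h1 : (1 : ℝ≥0∞) ≤ ‖t‖ₑ := by
      rw [Real.enorm_eq_ofReal_abs, ENNReal.one_le_ofReal]
      by_contra! h
      exact ht ⟨by linarith [neg_abs_le t], by linarith [le_abs_self t]⟩
    rw [ENNReal.rpow_neg, ENNReal.inv_le_one]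
    simpa using ENNReal.rpow_le_rpow h1 hb0

theorem gaussE_coord (B : OrthonormalBasis (Fin 3) ℝ E3) (c : ℝ) (v w : E3) :
    gaussE c (v - w) = gaussE c (inner ℝ (B 0) v - inner ℝ (B 0) w) *
      (gaussE c (inner ℝ (B 1) v - inner ℝ (B 1) w) *
        gaussE c (inner ℝ (B 2) v - inner ℝ (B 2) w)) := by
  unfold gaussE
  rw [norm_sq_eq_coord B, ← ENNReal.ofReal_mul (Real.exp_nonneg _), ← ENNReal.ofReal_mul (Real.exp_nonneg _),
    ← Real.exp_add, ← Real.exp_add]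
  simp only [inner_sub_right, Real.norm_eq_abs, sq_abs]
  congr 2
  ring

/-- Singularities along the coordinate planes of an orthonormal basis are integrable against
Gaussians, uniformly in the basis and in the center of the Gaussian. -/
theorem exists_lintegral_coord_rpow_mul_gaussE_le {b c : ℝ} (hb0 : 0 ≤ b) (hb : b < 1)
    (hc : 0 < c) :
    ∃ C : ℝ≥0∞, C ≠ ∞ ∧ ∀ (B : OrthonormalBasis (Fin 3) ℝ E3) (w : E3),
      ∫⁻ v : E3, ‖(inner ℝ (B 0) v : ℝ)‖ₑ ^ (-b) * ‖(inner ℝ (B 1) v : ℝ)‖ₑ ^ (-b) *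
        ‖(inner ℝ (B 2) v : ℝ)‖ₑ ^ (-b) * gaussE c (v - w) ≤ C := by
  obtain ⟨C, hC, h⟩ := exists_lintegral_rpow_mul_gaussE_le hb0 hb hc
  refine ⟨C * (C * C), by finiteness, fun B w => ?_⟩
  set g : ℝ → ℝ → ℝ≥0∞ := fun s t => ‖t‖ₑ ^ (-b) * gaussE c (t - s) with hg
  have hgm : ∀ s, Measurable (g s) := fun s => by simp only [hg]; fun_prop
  have e := lintegral_coord B (F := fun x => g (inner ℝ (B 0) w) x.1 *
    (g (inner ℝ (B 1) w) x.2.1 * g (inner ℝ (B 2) w) x.2.2))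
    (((hgm _).comp measurable_fst).mul (((hgm _).comp (by fun_prop)).mul ((hgm _).comp (by fun_prop))))
  calc _ = _ := lintegral_congr fun v => ?_
    _ = _ := e
    _ ≤ _ := ?_
  · simp only [hg]
    rw [gaussE_coord B]
    ring
  · simp only
    calc _ = (∫⁻ a, g (inner ℝ (B 0) w) a) * ((∫⁻ a, g (inner ℝ (B 1) w) a) * (∫⁻ a, g (inner ℝ (B 2) w) a)) := by
          rw [← lintegral_mul_const _ (hgm _)]
          refine lintegral_congr fun x => ?_
          rw [← lintegral_mul_const _ (hgm _), ← lintegral_const_mul _ (by fun_prop)]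
          refine lintegral_congr fun y => ?_
          rw [← lintegral_const_mul _ (hgm _), ← lintegral_const_mul _ (by fun_prop)]
      _ ≤ _ := by gcongr <;> exact h _

theorem rpow_neg_enorm_le_coord {b : ℝ} (hb : 0 ≤ b) (B : OrthonormalBasis (Fin 3) ℝ E3) (i : Fin 3)
    (v : E3) : ‖v‖ₑ ^ (-b) ≤ ‖(inner ℝ (B i) v : ℝ)‖ₑ ^ (-b) := by
  rw [ENNReal.rpow_neg, ENNReal.rpow_neg, ENNReal.inv_le_inv]
  refine ENNReal.rpow_le_rpow ?_ hb
  rw [enorm_le_iff_norm_le]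
  simpa using norm_inner_le_norm (𝕜 := ℝ) (B i) v

/-- The signs matter at `v = 0`, where a negative power is `∞`: exponents of opposite sign would
produce `∞ * 0 = 0`. -/
theorem enorm_rpow_neg_add {v : E3} {a b : ℝ} (ha : 0 ≤ a) (hb : 0 ≤ b) :
    ‖v‖ₑ ^ (-(a + b)) = ‖v‖ₑ ^ (-a) * ‖v‖ₑ ^ (-b) := by
  by_cases hv : ‖v‖ₑ = 0
  · rcases ha.eq_or_lt with rfl | ha
    · simp
    rcases hb.eq_or_lt with rfl | hb
    · simp
    rw [hv, ENNReal.zero_rpow_of_neg (by linarith), ENNReal.zero_rpow_of_neg (by linarith),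
      ENNReal.zero_rpow_of_neg (by linarith)]
    simp
  · rw [neg_add, ENNReal.rpow_add _ _ hv (by simp)]

/-- Each of three equal factors `|v|^{-b/3}` is dominated by the same power of one coordinate, and
`b / 3 < 1`. This avoids polar coordinates. -/
theorem exists_lintegral_rpow_norm_mul_gaussE_le {b c : ℝ} (hb0 : 0 ≤ b) (hb : b < 3)
    (hc : 0 < c) :
    ∃ C : ℝ≥0∞, C ≠ ∞ ∧ ∀ w : E3, ∫⁻ v : E3, ‖v‖ₑ ^ (-b) * gaussE c (v - w) ≤ C := by
  obtain ⟨C, hC, h⟩ := exists_lintegral_coord_rpow_mul_gaussE_le (b := b / 3) (by linarith)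
    (by linarith) hc
  refine ⟨C, hC, fun w => (lintegral_mono fun v => ?_).trans (h (EuclideanSpace.basisFun (Fin 3) ℝ) w)⟩
  gcongr
  have : b = b / 3 + b / 3 + b / 3 := by ring
  conv_lhs => rw [this, enorm_rpow_neg_add (by linarith) (by linarith),
    enorm_rpow_neg_add (by linarith) (by linarith)]
  gcongr ?_ * ?_ * ?_ <;> exact rpow_neg_enorm_le_coord (by linarith) _ _ _

/-- This is where `p < 3` is decisive. The total homogeneity `-p` is shared equally among the
coordinates of an orthonormal basis with first vector `n`, so each carries the integrable power
`-p/3`. -/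
theorem exists_lintegral_inner_rpow_mul_gaussE_le {p c : ℝ} (hp : 2 ≤ p) (hp3 : p < 3)
    (hc : 0 < c) :
    ∃ C : ℝ≥0∞, C ≠ ∞ ∧ ∀ (n : E3) (_ : ‖n‖ = 1) (w : E3),
      ∫⁻ v : E3, ‖(inner ℝ n v : ℝ)‖ₑ ^ (2 - p) * ‖v‖ₑ ^ (-2 : ℝ) * gaussE c (v - w) ≤ C := by
  obtain ⟨C, hC, h⟩ := exists_lintegral_coord_rpow_mul_gaussE_le (b := p / 3) (by linarith)
    (by linarith) hc
  refine ⟨C, hC, fun n hn w => ?_⟩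
  obtain ⟨B, rfl⟩ := exists_orthonormalBasis_zero hn
  refine (lintegral_mono fun v => ?_).trans (h B w)
  refine mul_le_mul_left ?_ _
  -- The part `2 - 2p/3` of `|v|⁻²` is moved onto the normal coordinate, where it turns `2 - p` into
  -- `-p/3`; the other two parts `p/3` go to the tangential coordinates. It is nonnegative because
  -- `p < 3`.
  rw [show (-2 : ℝ) = -((2 - 2 * p / 3) + p / 3 + p / 3) by ring, enorm_rpow_neg_add (by linarith) (by linarith),
    enorm_rpow_neg_add (by linarith) (by linarith)]
  rw [← mul_assoc, ← mul_assoc]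
  gcongr ?_ * ?_ * ?_
  · calc _ ≤ ‖(inner ℝ (B 0) v : ℝ)‖ₑ ^ (2 - p) * ‖(inner ℝ (B 0) v : ℝ)‖ₑ ^ (-(2 - 2 * p / 3)) := by
          exact mul_le_mul_right (rpow_neg_enorm_le_coord (by linarith) _ _ _) _
      _ ≤ _ := by
          by_cases hv : ‖(inner ℝ (B 0) v : ℝ)‖ₑ = 0
          · rw [hv, ENNReal.zero_rpow_of_neg (y := -(p / 3)) (by linarith)]; exact le_top
          · rw [← ENNReal.rpow_add _ _ hv (by simp)]
            exact le_of_eq (by congr 1; ring)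
  · exact rpow_neg_enorm_le_coord (by linarith) _ _ _
  · exact rpow_neg_enorm_le_coord (by linarith) _ _ _

/-! ### The kernel of the velocity derivative -/

/-- The exponential factor `exp (-c (|v-w|² + ((|v|²-|w|²)/|v-w|)²))`. -/
noncomputable def gradKernelExp (c : ℝ) (v w : E3) : ℝ :=
  Real.exp (-c * (‖v - w‖ ^ 2 + ((‖v‖ ^ 2 - ‖w‖ ^ 2) / ‖v - w‖) ^ 2))

/-- The kernel `(1 + |v|) |v-w|⁻² exp (-c (|v-w|² + ((|v|²-|w|²)/|v-w|)²))`. -/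
noncomputable def gradKernel (c : ℝ) (v w : E3) : ℝ :=
  (1 + ‖v‖) / ‖v - w‖ ^ 2 * gradKernelExp c v w

@[fun_prop]
theorem measurable_gradKernel (c : ℝ) : Measurable fun y : E3 × E3 => gradKernel c y.1 y.2 := by
  unfold gradKernel gradKernelExp; fun_prop

theorem gradKernelExp_swap (c : ℝ) (v w : E3) : gradKernelExp c v w = gradKernelExp c w v := by
  unfold gradKernelExp
  rw [norm_sub_rev v w, ← neg_sub (‖v‖ ^ 2), neg_div, neg_sq]

/-- In the application `V = |v|`, `r = |w-v|`, `t` is the component of `w-v` along `v` and `Y` the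
squared length of the orthogonal component; then `(|w|²-|v|²)/r = 2Vt/r + r`. If `V ≤ 1` the growth
factor is harmless. If `t² ≤ Y` the exponential is a Gaussian in `t` of width about `√Y/V`. If `t² ≥
Y` the exponent is at least of order `V²` and beats the growth. -/
theorem gradKernel_bound {c V t Y r : ℝ} (hc : 0 < c) (hV : 0 ≤ V) (hY : 0 < Y) (hr : 0 < r)
    (hr2 : r ^ 2 = t ^ 2 + Y) :
    (1 + V) / r ^ 2 * Real.exp (-(3 * c) * (r ^ 2 + ((2 * V * t) / r + r) ^ 2)) ≤
      2 * V / Y * (Real.exp (-c * Y) * Real.exp (-(2 * c * V ^ 2 / Y) * t ^ 2)) +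
        (2 + 1 / c) / r ^ 2 * Real.exp (-c * r ^ 2) := by
  set a := 2 * V * t / r with ha
  -- The difference of the exponents rests on `3r² + 3(a+r)² - r² - a² = 2(a + 3r/2)² + r²/2`. This
  -- is why the constant `3c` is used on the left.
  have h1 : Real.exp (-(3 * c) * (r ^ 2 + (a + r) ^ 2)) ≤ Real.exp (-c * r ^ 2) * Real.exp (-c * a ^ 2) := by
    rw [← Real.exp_add, Real.exp_le_exp]
    nlinarith [sq_nonneg (a + 3 / 2 * r), sq_nonneg r, mul_pos hc hc, mul_nonneg hc.le (sq_nonneg (a + 3 / 2 * r)), mul_nonneg hc.le (sq_nonneg r)]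
  have ha2 : a ^ 2 = 4 * V ^ 2 * t ^ 2 / r ^ 2 := by rw [ha]; ring
  have hr' : 0 < r ^ 2 := by positivity
  have hT1 : 0 ≤ 2 * V / Y * (Real.exp (-c * Y) * Real.exp (-(2 * c * V ^ 2 / Y) * t ^ 2)) := by positivity
  have hT2 : 0 ≤ (2 + 1 / c) / r ^ 2 * Real.exp (-c * r ^ 2) := by positivity
  refine (mul_le_mul_of_nonneg_left h1 (by positivity)).trans ?_
  rcases le_total V 1 with hV1 | hV1
  · have : (1 + V) / r ^ 2 * (Real.exp (-c * r ^ 2) * Real.exp (-c * a ^ 2)) ≤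
        (2 + 1 / c) / r ^ 2 * Real.exp (-c * r ^ 2) := by
      have e1 : Real.exp (-c * a ^ 2) ≤ 1 := Real.exp_le_one_iff.2 (by nlinarith [sq_nonneg a])
      have e2 : 1 + V ≤ 2 + 1 / c := by have : 0 < 1 / c := by positivity
                                        linarith
      calc _ ≤ (2 + 1 / c) / r ^ 2 * (Real.exp (-c * r ^ 2) * 1) := by gcongr
        _ = _ := by ring
    linarith
  rcases le_total (t ^ 2) Y with hty | hty
  · have e1 : Real.exp (-c * r ^ 2) ≤ Real.exp (-c * Y) := by
      rw [Real.exp_le_exp]; nlinarith [sq_nonneg t]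
    have e2 : Real.exp (-c * a ^ 2) ≤ Real.exp (-(2 * c * V ^ 2 / Y) * t ^ 2) := by
      rw [Real.exp_le_exp]
      have : 2 * V ^ 2 / Y * t ^ 2 ≤ a ^ 2 := by
        rw [ha2, div_mul_eq_mul_div, div_le_div_iff₀ hY hr']
        have : 0 ≤ V ^ 2 * t ^ 2 := by positivity
        nlinarith
      have h3 := mul_le_mul_of_nonneg_left this hc.le
      calc _ = -(c * a ^ 2) := by ring
        _ ≤ -(c * (2 * V ^ 2 / Y * t ^ 2)) := by linarith
        _ = _ := by ring
    have : (1 + V) / r ^ 2 * (Real.exp (-c * r ^ 2) * Real.exp (-c * a ^ 2)) ≤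
        2 * V / Y * (Real.exp (-c * Y) * Real.exp (-(2 * c * V ^ 2 / Y) * t ^ 2)) := by
      gcongr
      · linarith
      · nlinarith [sq_nonneg t]
    linarith
  · have e1 : 2 * V ^ 2 ≤ a ^ 2 := by
      rw [ha2, le_div_iff₀ hr']
      nlinarith [sq_nonneg V]
    have e2 : (1 + V) * Real.exp (-c * a ^ 2) ≤ 2 + 1 / c := by
      have h3 : Real.exp (-c * a ^ 2) ≤ (c * a ^ 2 + 1)⁻¹ := by
        rw [neg_mul, Real.exp_neg]
        exact inv_anti₀ (by positivity) (Real.add_one_le_exp _)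
      have h4 : (c * a ^ 2 + 1)⁻¹ ≤ (c * (2 * V ^ 2))⁻¹ := by
        apply inv_anti₀ (by positivity)
        nlinarith
      have h5 : (1 + V) * (c * (2 * V ^ 2))⁻¹ ≤ 1 / c := by
        rw [← div_eq_mul_inv, div_le_div_iff₀ (by positivity) hc]
        have : 1 + V ≤ 2 * V ^ 2 := by nlinarith
        nlinarith
      calc _ ≤ (1 + V) * (c * (2 * V ^ 2))⁻¹ := by gcongr; exact h3.trans h4
        _ ≤ _ := by linarith
    have : (1 + V) / r ^ 2 * (Real.exp (-c * r ^ 2) * Real.exp (-c * a ^ 2)) ≤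
        (2 + 1 / c) / r ^ 2 * Real.exp (-c * r ^ 2) := by
      calc _ = ((1 + V) * Real.exp (-c * a ^ 2)) / r ^ 2 * Real.exp (-c * r ^ 2) := by ring
        _ ≤ _ := by gcongr
    linarith

theorem exists_basis_smul (v : E3) :
    ∃ B : OrthonormalBasis (Fin 3) ℝ E3, v = ‖v‖ • B 2 := by
  by_cases hv : v = 0
  · exact ⟨EuclideanSpace.basisFun (Fin 3) ℝ, by simp [hv]⟩
  · obtain ⟨B, hB⟩ := exists_orthonormalBasis_zero (n := ‖v‖⁻¹ • v)
      (by rw [norm_smul, norm_inv, norm_norm, inv_mul_cancel₀ (by simpa using hv)])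
    refine ⟨B.reindex (Equiv.swap 0 2), ?_⟩
    simp only [OrthonormalBasis.reindex_apply, Equiv.symm_swap, Equiv.swap_apply_right]
    rw [hB, smul_smul, mul_inv_cancel₀ (by simpa using hv), one_smul]

/-- Integration across the slab gains the width `√Y/V`: the factor `V` cancels and only `Y^{-1/2}`
remains, which is integrable over the plane orthogonal to `v`. -/
theorem lintegral_slab_le {c V Y : ℝ} (hc : 0 < c) (hV : 0 < V) (hY : 0 < Y) :
    ∫⁻ t : ℝ, ENNReal.ofReal (2 * V / Y * (Real.exp (-c * Y) * Real.exp (-(2 * c * V ^ 2 / Y) * t ^ 2)))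
      = ENNReal.ofReal (2 * Real.sqrt (Real.pi / (2 * c)) * (Real.sqrt Y)⁻¹ * Real.exp (-c * Y)) := by
  have hb : 0 < 2 * c * V ^ 2 / Y := by positivity
  rw [← ofReal_integral_eq_lintegral_ofReal
    (((integrable_exp_neg_mul_sq hb).const_mul _).const_mul _)
    (Eventually.of_forall fun t => by positivity)]
  congr 1
  rw [integral_const_mul, integral_const_mul, integral_gaussian]
  have : Real.sqrt (Real.pi / (2 * c * V ^ 2 / Y)) = Real.sqrt (Real.pi / (2 * c)) * Real.sqrt Y / V := by
    rw [← Real.sqrt_mul (by positivity)]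
    rw [eq_div_iff hV.ne', ← Real.sqrt_sq hV.le, ← Real.sqrt_mul (by positivity), Real.sqrt_sq hV.le]
    congr 1
    field_simp
  rw [this]
  have h2 : Real.sqrt Y * Real.sqrt Y = Y := Real.mul_self_sqrt hY.le
  have h3 : Real.sqrt Y ≠ 0 := by positivity
  field_simp
  rw [Real.sq_sqrt hY.le]

theorem exists_lintegral_gradKernel_right_le {c : ℝ} (hc : 0 < c) :
    ∃ C : ℝ≥0∞, C ≠ ∞ ∧ ∀ v : E3, ∫⁻ w : E3, ENNReal.ofReal (gradKernel (3 * c) v w) ≤ C := by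
  obtain ⟨C₁, hC₁, h₁⟩ := exists_lintegral_rpow_norm_mul_gaussE_le (b := 2) (by norm_num) (by norm_num) hc
  obtain ⟨C₂, hC₂, h₂⟩ := exists_lintegral_rpow_mul_gaussE_le (b := 1 / 2) (by norm_num) (by norm_num) hc
  refine ⟨ENNReal.ofReal (2 * Real.sqrt (Real.pi / (2 * c))) * (C₂ * C₂) +
    ENNReal.ofReal (2 + 1 / c) * C₁, by finiteness, fun v => ?_⟩
  obtain ⟨B, hB⟩ := exists_basis_smul v
  set V := ‖v‖ with hVdef
  have hV : 0 ≤ V := norm_nonneg v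
  set F : ℝ × ℝ × ℝ → ℝ≥0∞ := fun x => ENNReal.ofReal (2 * V / (x.2.1 ^ 2 + x.1 ^ 2) *
    (Real.exp (-c * (x.2.1 ^ 2 + x.1 ^ 2)) *
      Real.exp (-(2 * c * V ^ 2 / (x.2.1 ^ 2 + x.1 ^ 2)) * x.2.2 ^ 2))) with hF
  have hFm : Measurable F := by simp only [hF]; fun_prop
  -- The variable becomes `u = w - v`, in coordinates whose third axis is parallel to `v`.
  rw [← lintegral_add_left_eq_self (fun w => ENNReal.ofReal (gradKernel (3 * c) v w)) v]
  have hae : ∀ᵐ u : E3, 0 < (inner ℝ (B 1) u : ℝ) ^ 2 + (inner ℝ (B 0) u : ℝ) ^ 2 := by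
    have h0 : ∀ᵐ u : E3, inner ℝ (B 1) u ≠ (0 : ℝ) := by
      have hq : volume ((innerSL ℝ (B 1)).ker : Set E3) = 0 := by
        apply Measure.addHaar_submodule
        intro h
        have : B 1 ∈ (innerSL ℝ (B 1)).ker := by rw [h]; trivial
        simp at this
      rw [ae_iff]
      convert hq using 2
      ext u; simp
    filter_upwards [h0] with u hu
    have : 0 < (inner ℝ (B 1) u : ℝ) ^ 2 := by positivity
    positivity
  have key : ∀ᵐ u : E3, ENNReal.ofReal (gradKernel (3 * c) v (v + u)) ≤
      F (inner ℝ (B 0) u, inner ℝ (B 1) u, inner ℝ (B 2) u) +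
        ENNReal.ofReal (2 + 1 / c) * (‖u‖ₑ ^ (-2 : ℝ) * gaussE c (u - 0)) := by
    filter_upwards [hae] with u hu
    have hr : 0 < ‖u‖ := by
      rw [norm_pos_iff]; rintro rfl; simp at hu
    have hn := norm_sq_eq_coord B u
    have hb := gradKernel_bound (t := inner ℝ (B 2) u) hc hV hu hr (by rw [hn]; ring)
    have e1 : gradKernel (3 * c) v (v + u) = (1 + V) / ‖u‖ ^ 2 *
        Real.exp (-(3 * c) * (‖u‖ ^ 2 + ((2 * V * inner ℝ (B 2) u) / ‖u‖ + ‖u‖) ^ 2)) := by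
      have e2 : (‖v‖ ^ 2 - ‖v + u‖ ^ 2) / ‖u‖ = - ((2 * V * inner ℝ (B 2) u) / ‖u‖ + ‖u‖) := by
        rw [norm_add_sq_real]
        have : inner ℝ v u = V * inner ℝ (B 2) u := by
          conv_lhs => rw [hB, real_inner_smul_left]
        rw [this]
        field_simp
        ring
      rw [gradKernel, gradKernelExp, sub_add_cancel_left, norm_neg, e2, neg_sq]
    rw [e1]
    refine (ENNReal.ofReal_le_ofReal hb).trans ?_
    rw [ENNReal.ofReal_add (by positivity) (by positivity)]
    refine add_le_add le_rfl ?_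
    rw [div_eq_mul_inv, mul_assoc, ENNReal.ofReal_mul (by positivity), ENNReal.ofReal_mul (by positivity), sub_zero,
      gaussE, ENNReal.ofReal_inv_of_pos (by positivity), ENNReal.ofReal_pow (by positivity), ofReal_norm,
      ENNReal.rpow_neg, ENNReal.rpow_ofNat]
  refine (lintegral_mono_ae key).trans ?_
  rw [lintegral_add_right _ (by fun_prop), lintegral_const_mul _ (by fun_prop)]
  refine add_le_add ?_ (by gcongr; exact h₁ 0)
  rw [lintegral_coord B hFm]
  set g : ℝ → ℝ≥0∞ := fun t => ‖t‖ₑ ^ (-(1 / 2) : ℝ) * gaussE c (t - 0) with hg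
  have hgm : Measurable g := by simp only [hg]; fun_prop
  have hin : ∀ a b : ℝ, ∫⁻ t, F (a, b, t) ≤
      ENNReal.ofReal (2 * Real.sqrt (Real.pi / (2 * c))) * (g b * g a) := by
    intro a b
    by_cases hab : a = 0 ∨ b = 0
    -- On the coordinate axes the majorant equals `∞`, since `0^{-1/2} = ∞`, and there is nothing to
    -- prove.
    · have : g b * g a = ∞ := by
        have h0 : g 0 = ∞ := by
          simp [hg, gaussE]
        have hne : ∀ t, g t ≠ 0 := fun t => by
          simp [hg, gaussE, Real.exp_pos, ENNReal.rpow_eq_zero_iff]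
        rcases hab with rfl | rfl
        · rw [h0, ENNReal.mul_top (hne _)]
        · rw [h0, ENNReal.top_mul (hne _)]
      rw [this, ENNReal.mul_top]
      · exact le_top
      · simp only [ne_eq, ENNReal.ofReal_eq_zero, not_le]; positivity
    · push Not at hab
      have ha : 0 < a ^ 2 := by have := hab.1; positivity
      have hb : 0 < b ^ 2 := by have := hab.2; positivity
      rcases hV.eq_or_lt with hV0 | hV0
      · simp [hF, ← hV0]
      simp only [hF]
      rw [lintegral_slab_le hc hV0 (by positivity), mul_assoc, ENNReal.ofReal_mul (by positivity)]
      gcongr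
      -- The inequality `a² + b² ≥ |a||b|` splits the planar singularity into two integrable
      -- one-dimensional ones.
      have h1 : (Real.sqrt (b ^ 2 + a ^ 2))⁻¹ ≤ |b| ^ (-(1 / 2) : ℝ) * |a| ^ (-(1 / 2) : ℝ) := by
        rw [← Real.mul_rpow (abs_nonneg _) (abs_nonneg _), Real.rpow_neg (by positivity),
          ← Real.sqrt_eq_rpow]
        apply inv_anti₀
        · have := abs_pos.2 hab.1; have := abs_pos.2 hab.2; positivity
        · apply Real.sqrt_le_sqrt
          nlinarith [sq_nonneg (|b| - |a|), sq_abs a, sq_abs b]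
      calc _ ≤ ENNReal.ofReal ((|b| ^ (-(1 / 2) : ℝ) * |a| ^ (-(1 / 2) : ℝ)) *
              (Real.exp (-c * b ^ 2) * Real.exp (-c * a ^ 2))) := by
            apply ENNReal.ofReal_le_ofReal
            rw [← Real.exp_add, ← mul_add]
            gcongr
        _ = _ := by
            rw [ENNReal.ofReal_mul (by positivity), ENNReal.ofReal_mul (by positivity),
              ENNReal.ofReal_mul (by positivity),
              ← ENNReal.ofReal_rpow_of_pos (abs_pos.2 hab.1),
              ← ENNReal.ofReal_rpow_of_pos (abs_pos.2 hab.2)]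
            simp only [hg, gaussE, Real.enorm_eq_ofReal_abs, sub_zero, Real.norm_eq_abs, sq_abs]
            ring
  calc _ ≤ ∫⁻ a, ∫⁻ b, ENNReal.ofReal (2 * Real.sqrt (Real.pi / (2 * c))) * (g b * g a) := by
        gcongr with a b; exact hin a b
    _ = ENNReal.ofReal (2 * Real.sqrt (Real.pi / (2 * c))) * ((∫⁻ b, g b) * ∫⁻ a, g a) := by
        rw [← lintegral_const_mul _ hgm, ← lintegral_const_mul _ (by fun_prop)]
        refine lintegral_congr fun a => ?_
        rw [lintegral_const_mul _ (by fun_prop), lintegral_mul_const _ hgm]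
    _ ≤ _ := by gcongr <;> exact h₂ 0

/-- Only the factor `1 + |v|` is asymmetric, and `1 + |v| ≤ (1 + |v-w|)(1 + |w|)`. Half of the
exponent pays for `1 + |v-w|`. -/
theorem exists_gradKernel_swap_le {c : ℝ} (hc : 0 < c) :
    ∃ K : ℝ, 0 < K ∧ ∀ v w : E3, gradKernel (2 * c) v w ≤ K * gradKernel c w v := by
  refine ⟨2 + 1 / c, by positivity, fun v w => ?_⟩
  unfold gradKernel
  set r := ‖v - w‖ with hr
  have h1 : gradKernelExp (2 * c) v w ≤ Real.exp (-c * r ^ 2) * gradKernelExp c w v := by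
    rw [gradKernelExp_swap c w v, gradKernelExp, gradKernelExp, ← Real.exp_add, Real.exp_le_exp, ← hr]
    nlinarith [mul_nonneg hc.le (sq_nonneg ((‖v‖ ^ 2 - ‖w‖ ^ 2) / r))]
  have h2 : 1 + ‖v‖ ≤ (1 + r) * (1 + ‖w‖) := by
    have : ‖v‖ ≤ r + ‖w‖ := by simpa using norm_add_le (v - w) w
    nlinarith [norm_nonneg w, norm_nonneg (v - w)]
  have h3 : (1 + r) * Real.exp (-c * r ^ 2) ≤ 2 + 1 / c := by
    have h3 : Real.exp (-c * r ^ 2) ≤ (c * r ^ 2 + 1)⁻¹ := by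
      rw [neg_mul, Real.exp_neg]
      exact inv_anti₀ (by positivity) (Real.add_one_le_exp _)
    calc _ ≤ (1 + r) * (c * r ^ 2 + 1)⁻¹ := by gcongr
      _ ≤ _ := by
        rw [← div_eq_mul_inv, div_le_iff₀ (by positivity)]
        have : (2 + 1 / c) * (c * r ^ 2 + 1) = 2 * c * r ^ 2 + r ^ 2 + 2 + 1 / c := by
          field_simp; ring
        rw [this]
        have : 0 < 1 / c := by positivity
        nlinarith [sq_nonneg (r - 1 / 2), mul_nonneg hc.le (sq_nonneg r)]
  rw [norm_sub_rev w v, ← hr]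
  calc _ ≤ ((1 + r) * (1 + ‖w‖)) / r ^ 2 * (Real.exp (-c * r ^ 2) * gradKernelExp c w v) := by
        gcongr
        unfold gradKernelExp; positivity
    _ = ((1 + r) * Real.exp (-c * r ^ 2)) * ((1 + ‖w‖) / r ^ 2 * gradKernelExp c w v) := by ring
    _ ≤ _ := by
        gcongr
        unfold gradKernelExp; positivity

/-- These are the two hypotheses of Schur's test; the integral in `v` is reduced to the one in `w`
by exchanging the arguments. -/
theorem exists_lintegral_gradKernel_le {c : ℝ} (hc : 0 < c) :
    ∃ C : ℝ≥0∞, C ≠ ∞ ∧ (∀ v : E3, ∫⁻ w : E3, ENNReal.ofReal (gradKernel c v w) ≤ C) ∧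
      ∀ w : E3, ∫⁻ v : E3, ENNReal.ofReal (gradKernel c v w) ≤ C := by
  obtain ⟨C₁, hC₁, h₁⟩ := exists_lintegral_gradKernel_right_le (c := c / 3) (by positivity)
  obtain ⟨C₂, hC₂, h₂⟩ := exists_lintegral_gradKernel_right_le (c := c / 2 / 3) (by positivity)
  obtain ⟨K, hK, h⟩ := exists_gradKernel_swap_le (c := c / 2) (by positivity)
  rw [mul_div_cancel₀ _ (by norm_num)] at h h₁ h₂
  refine ⟨C₁ + ENNReal.ofReal K * C₂, by finiteness, fun v => (h₁ v).trans le_self_add, fun w => ?_⟩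
  calc _ ≤ ∫⁻ v, ENNReal.ofReal K * ENNReal.ofReal (gradKernel (c / 2) w v) := by
        gcongr with v
        rw [← ENNReal.ofReal_mul hK.le]
        exact ENNReal.ofReal_le_ofReal (h v w)
    _ ≤ _ := by
        rw [lintegral_const_mul _ (by fun_prop)]
        exact (mul_le_mul_right (h₂ w) _).trans le_add_self

/-! ### Exit times of bounded open convex sets -/

theorem exitTime_nonneg (Ω : Set E3) (x v : E3) : 0 ≤ exitTime Ω x v :=
  Real.sInf_nonneg fun _ hs => hs.1.le

theorem bddBelow_exitTime_set (Ω : Set E3) (x v : E3) :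
    BddBelow {s : ℝ | 0 < s ∧ x - s • v ∉ Ω} := ⟨0, fun _ hs => hs.1.le⟩

theorem exitTime_le {Ω : Set E3} {x v : E3} {s : ℝ} (hs : 0 < s) (h : x - s • v ∉ Ω) :
    exitTime Ω x v ≤ s := csInf_le (bddBelow_exitTime_set Ω x v) ⟨hs, h⟩

theorem sub_smul_mem_of_lt_exitTime {Ω : Set E3} {x v : E3} {s : ℝ} (hs : 0 < s)
    (h : s < exitTime Ω x v) : x - s • v ∈ Ω := by
  by_contra hn
  exact absurd (exitTime_le hs hn) (not_le.2 h)

/-- This keeps the infimum in the exit time away from its default value `0` on the empty set, which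
it does take for `v = 0` and `x ∈ Ω`. -/
theorem exitTime_set_nonempty {Ω : Set E3} (hb : Bornology.IsBounded Ω) (x : E3) {v : E3}
    (hv : v ≠ 0) : {s : ℝ | 0 < s ∧ x - s • v ∉ Ω}.Nonempty := by
  obtain ⟨R, hR⟩ := hb.subset_closedBall 0
  have hv' : 0 < ‖v‖ := norm_pos_iff.2 hv
  refine ⟨(|R| + ‖x‖ + 1) / ‖v‖, by positivity, fun h => ?_⟩
  have h1 : ‖x - ((|R| + ‖x‖ + 1) / ‖v‖) • v‖ ≤ R := by simpa using hR h
  have h2 : ‖((|R| + ‖x‖ + 1) / ‖v‖) • v‖ = |R| + ‖x‖ + 1 := by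
    rw [norm_smul, Real.norm_of_nonneg (by positivity), div_mul_cancel₀ _ hv'.ne']
  have h3 := norm_sub_norm_le (((|R| + ‖x‖ + 1) / ‖v‖) • v) x
  rw [norm_sub_rev] at h3
  linarith [le_abs_self R]

theorem le_exitTime {Ω : Set E3} (hb : Bornology.IsBounded Ω) {x v : E3} (hv : v ≠ 0) {s : ℝ}
    (h : ∀ t, 0 < t → t < s → x - t • v ∈ Ω) : s ≤ exitTime Ω x v := by
  refine le_csInf (exitTime_set_nonempty hb x hv) fun t ht => ?_
  by_contra! hlt
  exact ht.2 (h t ht.1 hlt)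

/-- A segment from a point of the closure to an interior point is interior except possibly at its
start. The start may lie on the boundary, as for the chords that begin on `Γ⁻`. -/
theorem Convex.sub_smul_mem_of_closure {Ω : Set E3} (hc : Convex ℝ Ω) (ho : IsOpen Ω) {x v : E3} {s t : ℝ}
    (hx : x ∈ closure Ω) (hs : x - s • v ∈ Ω) (ht0 : 0 < t) (hts : t ≤ s) : x - t • v ∈ Ω := by
  have hs0 : 0 < s := ht0.trans_le hts
  have h := hc.combo_closure_interior_mem_interior hx (ho.interior_eq.symm ▸ hs)
    (a := 1 - t / s) (b := t / s) (by rw [sub_nonneg, div_le_one hs0]; exact hts) (by positivity)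
    (by ring)
  rw [ho.interior_eq] at h
  convert h using 1
  rw [smul_sub, smul_smul, div_mul_cancel₀ _ hs0.ne', sub_smul, one_smul]
  abel

theorem lt_exitTime_of_mem {Ω : Set E3} (hc : Convex ℝ Ω) (ho : IsOpen Ω)
    (hb : Bornology.IsBounded Ω) {x v : E3} (hv : v ≠ 0) {s : ℝ}
    (hx : x ∈ closure Ω) (hs0 : 0 < s) (hs : x - s • v ∈ Ω) : s < exitTime Ω x v := by
  have hcont : Continuous fun t : ℝ => x - t • v := by fun_prop
  obtain ⟨ε, hε, h⟩ := Metric.isOpen_iff.1 (ho.preimage hcont) s hs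
  have h1 : x - (s + ε / 2) • v ∈ Ω := h (by simp [abs_of_pos hε]; linarith)
  have : s + ε / 2 ≤ exitTime Ω x v := le_exitTime hb hv fun t ht0 hts =>
    hc.sub_smul_mem_of_closure ho hx h1 ht0 hts.le
  linarith

namespace StationaryBoltzmann.IsBoundedConvexC2Domain

variable {Ω : Set E3} (hΩ : IsBoundedConvexC2Domain Ω)
include hΩ

theorem mem_iff_lt_exitTime {x v : E3} (hv : v ≠ 0) (hx : x ∈ closure Ω) {s : ℝ} (hs : 0 < s) :
    x - s • v ∈ Ω ↔ s < exitTime Ω x v :=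
  ⟨lt_exitTime_of_mem hΩ.convex hΩ.isOpen hΩ.isBounded hv hx hs, sub_smul_mem_of_lt_exitTime hs⟩

theorem exitTime_pos {x v : E3} (hv : v ≠ 0) (hx : x ∈ Ω) : 0 < exitTime Ω x v := by
  have hcont : Continuous fun t : ℝ => x - t • v := by fun_prop
  obtain ⟨ε, hε, h⟩ := Metric.isOpen_iff.1 (hΩ.isOpen.preimage hcont) 0 (by simpa using hx)
  refine (half_pos hε).trans (lt_exitTime_of_mem hΩ.convex hΩ.isOpen hΩ.isBounded hv
    (subset_closure hx) (half_pos hε) (h ?_))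
  simpa [abs_of_pos hε] using hε

theorem mem_iff_lt_exitTime' {x v : E3} (hv : v ≠ 0) (hx : x ∈ Ω) {s : ℝ} (hs : 0 ≤ s) :
    x - s • v ∈ Ω ↔ s < exitTime Ω x v := by
  rcases hs.eq_or_lt with rfl | hs
  · simp [hx, hΩ.exitTime_pos hv hx]
  · exact hΩ.mem_iff_lt_exitTime hv (subset_closure hx) hs

theorem exitPoint_mem_closure {x v : E3} (hx : x ∈ closure Ω) : exitPoint Ω x v ∈ closure Ω := by
  rcases (exitTime_nonneg Ω x v).eq_or_lt with h | h
  · simpa [exitPoint, ← h] using hx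
  · have hcont : ContinuousWithinAt (fun t : ℝ => x - t • v) (Ioo 0 (exitTime Ω x v)) (exitTime Ω x v) := by
      fun_prop
    refine hcont.mem_closure ?_ fun t ht => sub_smul_mem_of_lt_exitTime ht.1 ht.2
    rw [closure_Ioo h.ne]; exact right_mem_Icc.2 h.le

theorem exitPoint_mem_frontier {x v : E3} (hv : v ≠ 0) (hx : x ∈ Ω) :
    exitPoint Ω x v ∈ frontier Ω := by
  rw [frontier, hΩ.isOpen.interior_eq]
  refine ⟨hΩ.exitPoint_mem_closure (subset_closure hx), fun h => ?_⟩
  exact lt_irrefl _ ((hΩ.mem_iff_lt_exitTime' hv hx (exitTime_nonneg Ω x v)).1 h)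

theorem isBounded_closure : Bornology.IsBounded (closure Ω) := hΩ.isBounded.closure

theorem diam_pos : 0 < Metric.diam Ω := by
  obtain ⟨x, hx⟩ := hΩ.nonempty
  obtain ⟨ε, hε, h⟩ := Metric.isOpen_iff.1 hΩ.isOpen x hx
  obtain ⟨u, hu⟩ : ∃ u : E3, ‖u‖ = 1 := ⟨EuclideanSpace.single 0 1, by simp⟩
  have h1 : x + (ε / 2) • u ∈ Ω := h (by
    simpa [norm_smul, hu, abs_of_pos hε] using hε)
  have h2 := Metric.dist_le_diam_of_mem hΩ.isBounded h1 hx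
  rw [dist_eq_norm, add_sub_cancel_left, norm_smul, hu, mul_one, Real.norm_of_nonneg (by positivity)] at h2
  linarith

theorem exitTime_mul_norm_le_diam {x v : E3} (hx : x ∈ closure Ω) :
    exitTime Ω x v * ‖v‖ ≤ Metric.diam Ω := by
  have h := Metric.dist_le_diam_of_mem hΩ.isBounded.closure hx (hΩ.exitPoint_mem_closure (v := v) hx)
  rw [Metric.diam_closure] at h
  rw [dist_eq_norm, exitPoint, sub_sub_cancel, norm_smul, Real.norm_of_nonneg (exitTime_nonneg _ _ _)] at h
  exact h

theorem frontier_subset : frontier Ω ⊆ closure Ω := frontier_subset_closure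

theorem notMem_of_mem_frontier {z : E3} (hz : z ∈ frontier Ω) : z ∉ Ω := by
  rw [frontier, hΩ.isOpen.interior_eq] at hz; exact hz.2

end StationaryBoltzmann.IsBoundedConvexC2Domain

/-! ### Normals -/

namespace StationaryBoltzmann.IsLocalDefiningFunction

variable {Ω : Set E3} {z : E3} {φ : E3 → ℝ}

theorem hasFDerivAt (h : IsLocalDefiningFunction Ω z φ) :
    HasFDerivAt φ (innerSL ℝ (gradient φ z)) z := by
  have h1 : DifferentiableAt ℝ φ z := h.contDiffAt.differentiableAt (by norm_num)
  exact h1.hasGradientAt.hasFDerivAt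

theorem eq_zero (hΩ : IsBoundedConvexC2Domain Ω) (h : IsLocalDefiningFunction Ω z φ) (hz : z ∈ frontier Ω) : φ z = 0 := by
  have h0 : ¬ φ z < 0 := fun hlt => hΩ.notMem_of_mem_frontier hz (h.eventually_mem_iff.self_of_nhds.2 hlt)
  have h1 : ∃ᶠ x in 𝓝 z, x ∈ Ω := mem_closure_iff_frequently.1 hz.1
  have h2 : ∃ᶠ x in 𝓝 z, φ x < 0 := (h1.and_eventually h.eventually_mem_iff).mono fun x hx => hx.2.1 hx.1
  by_contra hne
  have h3 : 0 < φ z := lt_of_le_of_ne (not_lt.1 h0) (Ne.symm hne)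
  have h4 := h.contDiffAt.continuousAt.eventually (lt_mem_nhds h3)
  obtain ⟨x, hx1, hx2⟩ := (h2.and_eventually h4).exists
  linarith

/-- First-order expansion of `φ` at `z`: a cone below the tangent plane, however close to a
half-space, lies in `Ω` near its vertex. -/
theorem eventually_mem (hΩ : IsBoundedConvexC2Domain Ω) (h : IsLocalDefiningFunction Ω z φ) (hz : z ∈ frontier Ω) {ε : ℝ} (hε : 0 < ε) :
    ∀ᶠ y in 𝓝 z, inner ℝ (gradient φ z) (y - z) < -ε * ‖y - z‖ → y ∈ Ω := by
  have h1 := h.hasFDerivAt.isLittleO.def hε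
  filter_upwards [h1, h.eventually_mem_iff] with y hy hy2 hlt
  rw [hy2]
  rw [h.eq_zero hΩ hz, Real.norm_eq_abs] at hy
  have := (abs_le.1 hy).2
  simp only [innerSL_apply_apply] at this
  linarith

theorem eventually_add_smul_mem (hΩ : IsBoundedConvexC2Domain Ω) (h : IsLocalDefiningFunction Ω z φ) (hz : z ∈ frontier Ω) {d : E3}
    (hd : inner ℝ (gradient φ z) d < 0) : ∀ᶠ t : ℝ in 𝓝[>] 0, z + t • d ∈ Ω := by
  have hd0 : d ≠ 0 := by rintro rfl; simp at hd
  have hdn : 0 < ‖d‖ := norm_pos_iff.2 hd0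
  have ht : Tendsto (fun t : ℝ => z + t • d) (𝓝[>] 0) (𝓝 z) := by
    have : Continuous fun t : ℝ => z + t • d := by fun_prop
    simpa using this.continuousAt.tendsto (x := (0:ℝ)) |>.mono_left nhdsWithin_le_nhds
  have h1 := ht.eventually (h.eventually_mem hΩ hz (ε := -inner ℝ (gradient φ z) d / (2 * ‖d‖))
    (div_pos (by linarith) (by positivity)))
  filter_upwards [h1, self_mem_nhdsWithin] with t h2 ht0
  apply h2
  have ht0 : 0 < t := ht0
  rw [add_sub_cancel_left, real_inner_smul_right, norm_smul, Real.norm_of_nonneg ht0.le]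
  have : -(-inner ℝ (gradient φ z) d / (2 * ‖d‖)) * (t * ‖d‖) = t * (inner ℝ (gradient φ z) d / 2) := by
    field_simp
  rw [this]
  exact mul_lt_mul_of_pos_left (by linarith) ht0

theorem inner_neg (hΩ : IsBoundedConvexC2Domain Ω) (h : IsLocalDefiningFunction Ω z φ) (hz : z ∈ frontier Ω) {y : E3} (hy : y ∈ Ω) :
    inner ℝ (gradient φ z) (y - z) < 0 := by
  -- The weak inequality: were the slope of `φ` from `z` towards `y` positive, points of the segment
  -- near `z` would satisfy `φ > 0`, although convexity puts them into `Ω`.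
  have hle : ∀ y ∈ Ω, inner ℝ (gradient φ z) (y - z) ≤ 0 := by
    intro y hy
    by_contra! hpos
    have h1 := h.hasFDerivAt.hasLineDerivAt (y - z)
    have h2 : HasDerivAt (fun t : ℝ => φ (z + t • (y - z))) (inner ℝ (gradient φ z) (y - z)) 0 := by
      simpa [HasLineDerivAt] using h1
    have h3 : ∀ᶠ t : ℝ in 𝓝[>] 0, 0 < φ (z + t • (y - z)) := by
      have := (hasDerivAt_iff_tendsto_slope.1 h2).mono_left (nhdsWithin_mono _ (fun t (ht : 0 < t) => ht.ne'))
      filter_upwards [this.eventually (lt_mem_nhds hpos), self_mem_nhdsWithin] with t ht ht0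
      have ht0 : 0 < t := ht0
      rw [slope_def_field] at ht
      simp only [zero_smul, add_zero, h.eq_zero hΩ hz, sub_zero] at ht
      exact (div_pos_iff_of_pos_right ht0).1 ht
    have h4 : ∀ᶠ t : ℝ in 𝓝[>] 0, (z + t • (y - z) ∈ Ω ↔ φ (z + t • (y - z)) < 0) := by
      have ht : Tendsto (fun t : ℝ => z + t • (y - z)) (𝓝[>] 0) (𝓝 z) := by
        have : Continuous fun t : ℝ => z + t • (y - z) := by fun_prop
        simpa using this.continuousAt.tendsto (x := (0:ℝ)) |>.mono_left nhdsWithin_le_nhds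
      exact ht.eventually h.eventually_mem_iff
    have h5 : ∀ᶠ t : ℝ in 𝓝[>] 0, t ≤ 1 := nhdsWithin_le_nhds (Iic_mem_nhds one_pos)
    obtain ⟨t, ⟨⟨ht3, ht4⟩, ht5⟩, ht0⟩ := (((h3.and h4).and h5).and self_mem_nhdsWithin).exists
    have ht0 : 0 < t := ht0
    have := hΩ.convex.sub_smul_mem_of_closure hΩ.isOpen (x := z) (v := -(y - z)) (s := 1) hz.1
      (by simpa using hy) ht0 ht5
    rw [smul_neg, sub_neg_eq_add] at this
    linarith [ht4.1 this]
  obtain ⟨ε, hε, hball⟩ := Metric.isOpen_iff.1 hΩ.isOpen y hy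
  have hg : 0 < ‖gradient φ z‖ := norm_pos_iff.2 h.gradient_ne_zero
  -- Strictness: since `Ω` is open, `y` can be pushed a little in the direction of the gradient
  -- without leaving it, and the weak inequality still holds there.
  have h1 : y + (ε / 2 / ‖gradient φ z‖) • gradient φ z ∈ Ω := hball (by
    rw [mem_ball_iff_norm, add_sub_cancel_left, norm_smul, Real.norm_of_nonneg (by positivity), div_mul_cancel₀ _ hg.ne']
    linarith)
  have h2 := hle _ h1
  rw [add_sub_right_comm, inner_add_right, real_inner_smul_right, real_inner_self_eq_norm_sq] at h2
  have : 0 < ε / 2 / ‖gradient φ z‖ * ‖gradient φ z‖ ^ 2 := by positivity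
  linarith

end StationaryBoltzmann.IsLocalDefiningFunction

/-- The vector `-g` fixes the sign. The vector `n` minus slightly more than its projection onto `g`
lies in the open half-space of `g`; in the limit this gives equality in Cauchy–Schwarz. -/
theorem eq_smul_of_halfSpace_subset {g n : E3} (hn : ‖n‖ = 1) (hg : g ≠ 0)
    (h : ∀ d : E3, inner ℝ g d < 0 → inner ℝ n d < 0) : n = ‖g‖⁻¹ • g := by
  have hgn : 0 < ‖g‖ := norm_pos_iff.2 hg
  have h0 : 0 < inner ℝ n g := by
    have := h (-g) (by rw [inner_neg_right, real_inner_self_eq_norm_sq, neg_lt_zero]; positivity)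
    rw [inner_neg_right] at this; linarith
  have h1 : ∀ ε > 0, 1 - (inner ℝ n g) ^ 2 / ‖g‖ ^ 2 - ε * inner ℝ n g < 0 := by
    intro ε hε
    have := h (n - (inner ℝ n g / ‖g‖ ^ 2 + ε) • g) (by
      rw [inner_sub_right, real_inner_smul_right, real_inner_self_eq_norm_sq, real_inner_comm]
      have : (inner ℝ n g / ‖g‖ ^ 2 + ε) * ‖g‖ ^ 2 = inner ℝ n g + ε * ‖g‖ ^ 2 := by field_simp
      rw [this]
      have : 0 < ε * ‖g‖ ^ 2 := by positivity
      linarith)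
    rw [inner_sub_right, real_inner_smul_right, real_inner_self_eq_norm_sq, hn] at this
    calc _ = 1 ^ 2 - (inner ℝ n g / ‖g‖ ^ 2 + ε) * inner ℝ n g := by ring
      _ < 0 := this
  have h2 : 1 - (inner ℝ n g) ^ 2 / ‖g‖ ^ 2 ≤ 0 := by
    refine le_of_forall_pos_lt_add fun ε hε => ?_
    have := h1 (ε / inner ℝ n g) (by positivity)
    rw [div_mul_cancel₀ _ h0.ne'] at this
    linarith
  have h3 : ‖g‖ ≤ inner ℝ n g := by
    have : ‖g‖ ^ 2 ≤ (inner ℝ n g) ^ 2 := by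
      rw [sub_nonpos, le_div_iff₀ (by positivity), one_mul] at h2; exact h2
    exact abs_le_of_sq_le_sq' this h0.le |>.2
  have h4 : inner ℝ n g = ‖n‖ * ‖g‖ := le_antisymm (real_inner_le_norm _ _) (by rw [hn, one_mul]; exact h3)
  have h5 := inner_eq_norm_mul_iff_real.1 h4
  rw [hn, one_smul] at h5
  exact (eq_inv_smul_iff₀ hgn.ne').2 h5

namespace StationaryBoltzmann.IsBoundedConvexC2Domain

variable {Ω : Set E3} (hΩ : IsBoundedConvexC2Domain Ω)
include hΩ

theorem exists_outwardNormal_eq {z : E3} (hz : z ∈ frontier Ω) :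
    ∃ φ, IsLocalDefiningFunction Ω z φ ∧ outwardNormal Ω z = ‖gradient φ z‖⁻¹ • gradient φ z := by
  have H := hΩ.exists_definingFunction z hz
  exact ⟨H.choose, H.choose_spec, by rw [outwardNormal, dif_pos H]⟩

theorem norm_outwardNormal {z : E3} (hz : z ∈ frontier Ω) : ‖outwardNormal Ω z‖ = 1 := by
  obtain ⟨φ, hφ, h⟩ := hΩ.exists_outwardNormal_eq hz
  rw [h, norm_smul, norm_inv, norm_norm, inv_mul_cancel₀ (norm_ne_zero_iff.2 hφ.gradient_ne_zero)]

theorem inner_outwardNormal_neg {z y : E3} (hz : z ∈ frontier Ω) (hy : y ∈ Ω) :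
    inner ℝ (outwardNormal Ω z) (y - z) < 0 := by
  obtain ⟨φ, hφ, h⟩ := hΩ.exists_outwardNormal_eq hz
  rw [h, real_inner_smul_left]
  exact mul_neg_of_pos_of_neg (inv_pos.2 (norm_pos_iff.2 hφ.gradient_ne_zero)) (hφ.inner_neg hΩ hz hy)

theorem inner_outwardNormal_nonpos {z y : E3} (hz : z ∈ frontier Ω) (hy : y ∈ closure Ω) :
    inner ℝ (outwardNormal Ω z) (y - z) ≤ 0 := by
  have hcl : IsClosed {y : E3 | inner ℝ (outwardNormal Ω z) (y - z) ≤ 0} :=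
    isClosed_le (by fun_prop) continuous_const
  exact hcl.closure_subset_iff.2 (fun y hy => (hΩ.inner_outwardNormal_neg hz hy).le) hy

/-- Independence of the defining function: a direction that decreases `φ` enters `Ω`, and hence has
a negative product with the chosen normal. -/
theorem outwardNormal_eq {z : E3} (hz : z ∈ frontier Ω) {φ : E3 → ℝ}
    (hφ : IsLocalDefiningFunction Ω z φ) :
    outwardNormal Ω z = ‖gradient φ z‖⁻¹ • gradient φ z := by
  refine eq_smul_of_halfSpace_subset (hΩ.norm_outwardNormal hz) hφ.gradient_ne_zero fun d hd => ?_
  obtain ⟨t, ht, ht0⟩ := ((hφ.eventually_add_smul_mem hΩ hz hd).and self_mem_nhdsWithin).exists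
  have ht0 : 0 < t := ht0
  have := hΩ.inner_outwardNormal_neg hz ht
  rw [add_sub_cancel_left, real_inner_smul_right] at this
  exact (pos_iff_neg_of_mul_neg this).1 ht0

theorem eventually_mem_of_inner_lt {z : E3} (hz : z ∈ frontier Ω) {ε : ℝ} (hε : 0 < ε) :
    ∀ᶠ y in 𝓝 z, inner ℝ (outwardNormal Ω z) (y - z) < -ε * ‖y - z‖ → y ∈ Ω := by
  obtain ⟨φ, hφ, h⟩ := hΩ.exists_outwardNormal_eq hz
  have hg : 0 < ‖gradient φ z‖ := norm_pos_iff.2 hφ.gradient_ne_zero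
  filter_upwards [hφ.eventually_mem hΩ hz (mul_pos hε hg)] with y hy hlt
  apply hy
  rw [h, real_inner_smul_left, inv_mul_lt_iff₀ hg] at hlt
  linarith

end StationaryBoltzmann.IsBoundedConvexC2Domain

theorem StationaryBoltzmann.IsLocalDefiningFunction.eventually_isLocalDefiningFunction
    {Ω : Set E3} {z : E3} {φ : E3 → ℝ} (h : IsLocalDefiningFunction Ω z φ) :
    ∀ᶠ y in 𝓝 z, IsLocalDefiningFunction Ω y φ := by
  have h1 := h.contDiffAt.eventually (by simp)
  have h2 : ContinuousAt (gradient φ) z := by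
    have : ContinuousAt (fderiv ℝ φ) z := (h.contDiffAt.fderiv_right (m := 1) (by norm_num)).continuousAt
    exact (InnerProductSpace.toDual ℝ E3).symm.continuous.continuousAt.comp this
  have h3 := h2.eventually_ne h.gradient_ne_zero
  filter_upwards [h1, h3, eventually_eventually_nhds.2 h.eventually_mem_iff] with y a b c
  exact ⟨a, b, c⟩

theorem StationaryBoltzmann.IsLocalDefiningFunction.continuousAt_gradient
    {Ω : Set E3} {z : E3} {φ : E3 → ℝ} (h : IsLocalDefiningFunction Ω z φ) :
    ContinuousAt (gradient φ) z := by
  have : ContinuousAt (fderiv ℝ φ) z := (h.contDiffAt.fderiv_right (m := 1) (by norm_num)).continuousAt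
  exact (InnerProductSpace.toDual ℝ E3).symm.continuous.continuousAt.comp this

namespace StationaryBoltzmann.IsBoundedConvexC2Domain

variable {Ω : Set E3} (hΩ : IsBoundedConvexC2Domain Ω)
include hΩ

/-- A single `φ` serves as defining function at all boundary points near `z`, and its gradient is
continuous there. -/
theorem continuousOn_outwardNormal : ContinuousOn (outwardNormal Ω) (frontier Ω) := by
  intro z hz
  obtain ⟨φ, hφ⟩ := hΩ.exists_definingFunction z hz
  have h1 : ContinuousAt (fun y => ‖gradient φ y‖⁻¹ • gradient φ y) z :=
    (hφ.continuousAt_gradient.norm.inv₀ (norm_ne_zero_iff.2 hφ.gradient_ne_zero)).smul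
      hφ.continuousAt_gradient
  refine h1.continuousWithinAt.congr_of_eventuallyEq ?_ (hΩ.outwardNormal_eq hz hφ)
  filter_upwards [mem_nhdsWithin_of_mem_nhds hφ.eventually_isLocalDefiningFunction,
    self_mem_nhdsWithin] with y hy hy2
  exact hΩ.outwardNormal_eq hy2 hy

/-- The boundary is flat at small scales. -/
theorem eventually_abs_inner_sub_le {z : E3} (hz : z ∈ frontier Ω) {ε : ℝ} (hε : 0 < ε) :
    ∃ U : Set E3, IsOpen U ∧ z ∈ U ∧ ∀ a ∈ U ∩ frontier Ω, ‖outwardNormal Ω a - outwardNormal Ω z‖ < ε ∧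
      ∀ b ∈ U ∩ frontier Ω, |inner ℝ (outwardNormal Ω z) (a - b)| ≤ ε * ‖a - b‖ := by
  obtain ⟨δ, hδ, h⟩ := Metric.continuousOn_iff.1 hΩ.continuousOn_outwardNormal z hz ε hε
  -- Convexity supplies a one-sided bound at each of the two points, with its own normal; replacing
  -- that normal by the one at `z` costs `ε`, and exchanging the points gives the other side.
  have key : ∀ a ∈ Metric.ball z δ ∩ frontier Ω, ∀ b ∈ frontier Ω,
      inner ℝ (outwardNormal Ω z) (b - a) ≤ ε * ‖b - a‖ := by
    intro a ha b hb
    have h1 := hΩ.inner_outwardNormal_nonpos ha.2 (hΩ.frontier_subset hb)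
    have h2 := h a ha.2 ha.1
    rw [dist_eq_norm, norm_sub_rev] at h2
    calc inner ℝ (outwardNormal Ω z) (b - a) ≤
          inner ℝ (outwardNormal Ω z) (b - a) - inner ℝ (outwardNormal Ω a) (b - a) := by linarith
      _ = inner ℝ (outwardNormal Ω z - outwardNormal Ω a) (b - a) := by rw [inner_sub_left]
      _ ≤ ‖outwardNormal Ω z - outwardNormal Ω a‖ * ‖b - a‖ := real_inner_le_norm _ _
      _ ≤ _ := by gcongr
  refine ⟨Metric.ball z δ, Metric.isOpen_ball, Metric.mem_ball_self hδ, fun a ha => ⟨?_, fun b hb => ?_⟩⟩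
  · rw [← dist_eq_norm]; exact h a ha.2 ha.1
  · rw [abs_le]
    constructor
    · have := key a ha b hb.2
      rw [← neg_sub a b, inner_neg_right, norm_neg] at this
      linarith
    · exact key b hb a ha.2

theorem inner_outwardNormal_exitPoint_neg {x v : E3} (hv : v ≠ 0) (hx : x ∈ Ω) :
    inner ℝ (outwardNormal Ω (exitPoint Ω x v)) v < 0 := by
  have h := hΩ.inner_outwardNormal_neg (hΩ.exitPoint_mem_frontier hv hx) hx
  have h2 : x - exitPoint Ω x v = exitTime Ω x v • v := by simp [exitPoint]
  rw [h2, real_inner_smul_right] at h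
  exact (pos_iff_neg_of_mul_neg h).1 (hΩ.exitTime_pos hv hx)

end StationaryBoltzmann.IsBoundedConvexC2Domain

/-! ### Differentiability of the exit time -/

/-- The derivative of the exit time at `(x, v)`. -/
noncomputable def exitTimeDeriv (Ω : Set E3) (y : E3 × E3) : E3 × E3 →L[ℝ] ℝ :=
  (inner ℝ (outwardNormal Ω (exitPoint Ω y.1 y.2)) y.2)⁻¹ •
    ((innerSL ℝ (outwardNormal Ω (exitPoint Ω y.1 y.2))).comp (ContinuousLinearMap.fst ℝ E3 E3) -
      exitTime Ω y.1 y.2 •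
        (innerSL ℝ (outwardNormal Ω (exitPoint Ω y.1 y.2))).comp (ContinuousLinearMap.snd ℝ E3 E3))

theorem exitTimeDeriv_apply (Ω : Set E3) (y e : E3 × E3) :
    exitTimeDeriv Ω y e = (inner ℝ (outwardNormal Ω (exitPoint Ω y.1 y.2)) y.2)⁻¹ *
      (inner ℝ (outwardNormal Ω (exitPoint Ω y.1 y.2)) e.1 -
        exitTime Ω y.1 y.2 * inner ℝ (outwardNormal Ω (exitPoint Ω y.1 y.2)) e.2) := by
  simp [exitTimeDeriv]

namespace StationaryBoltzmann.IsBoundedConvexC2Domain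

variable {Ω : Set E3} (hΩ : IsBoundedConvexC2Domain Ω)
include hΩ

/-- Near `(x, v)` the exit time is compared with the time `l` at which the backward ray meets the
tangent plane at the exit point. That time is a quotient of linear expressions, and the difference
is `o(|y - (x, v)|)`. -/
theorem hasFDerivAt_exitTime {x v : E3} (hv : v ≠ 0) (hx : x ∈ Ω) :
    HasFDerivAt (fun y : E3 × E3 => exitTime Ω y.1 y.2) (exitTimeDeriv Ω (x, v)) (x, v) := by
  set q := exitPoint Ω x v with hq
  set n := outwardNormal Ω q with hn
  set τ := exitTime Ω x v with hτ
  have hτ0 : 0 < τ := hΩ.exitTime_pos hv hx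
  have hqf : q ∈ frontier Ω := hΩ.exitPoint_mem_frontier hv hx
  have hnv : inner ℝ n v < 0 := hΩ.inner_outwardNormal_exitPoint_neg hv hx
  have hxq : x - q = τ • v := by simp [hq, exitPoint, hτ]
  set L := exitTimeDeriv Ω (x, v) with hL
  set l : E3 × E3 → ℝ := fun y => inner ℝ n (y.1 - q) / inner ℝ n y.2 with hl
  have hlv : l (x, v) = τ := by
    simp only [hl]
    rw [hxq, real_inner_smul_right, mul_div_cancel_right₀ _ hnv.ne]
  have hld : HasFDerivAt l L (x, v) := by
    have h1 : HasFDerivAt (fun y : E3 × E3 => (inner ℝ n (y.1 - q) : ℝ))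
        ((innerSL ℝ n).comp (ContinuousLinearMap.fst ℝ E3 E3)) (x, v) :=
      (innerSL ℝ n).hasFDerivAt.comp (x, v) (hasFDerivAt_fst.sub_const q)
    have h2 : HasFDerivAt (fun y : E3 × E3 => (inner ℝ n y.2 : ℝ))
        ((innerSL ℝ n).comp (ContinuousLinearMap.snd ℝ E3 E3)) (x, v) :=
      (innerSL ℝ n).hasFDerivAt.comp (x, v) hasFDerivAt_snd
    have h3 := h1.mul ((hasDerivAt_inv (x := (inner ℝ n v : ℝ)) hnv.ne).comp_hasFDerivAt (x, v) h2)
    refine (h3.congr_fderiv ?_).congr_of_eventuallyEq (Eventually.of_forall fun y => ?_)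
    swap
    · simp [hl, div_eq_mul_inv]
    ext e
    · simp only [hL, ContinuousLinearMap.comp_apply, ContinuousLinearMap.inl_apply, exitTimeDeriv_apply, ← hq, ← hn, ← hτ]
      rw [hxq]
      simp [real_inner_smul_right]
    · simp only [hL, ContinuousLinearMap.comp_apply, ContinuousLinearMap.inr_apply, exitTimeDeriv_apply, ← hq, ← hn, ← hτ]
      rw [hxq]
      simp [real_inner_smul_right]
      field_simp
  have hlc : ContinuousAt l (x, v) := hld.continuousAt
  have hev : ∀ᶠ y : E3 × E3 in 𝓝 (x, v), y.1 ∈ Ω ∧ y.2 ≠ 0 ∧ inner ℝ n y.2 < inner ℝ n v / 2 ∧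
      ‖y.2‖ < ‖v‖ + 1 := by
    refine (continuousAt_fst.eventually (hΩ.isOpen.mem_nhds hx)).and
      ((continuousAt_snd.eventually_ne hv).and (Filter.Eventually.and ?_ ?_))
    · have : ContinuousAt (fun y : E3 × E3 => (inner ℝ n y.2 : ℝ)) (x, v) := by fun_prop
      exact this.eventually (gt_mem_nhds (by simp only; linarith))
    · have : ContinuousAt (fun y : E3 × E3 => ‖y.2‖) (x, v) := by fun_prop
      exact this.eventually (gt_mem_nhds (by simp only; linarith))
  -- Convexity: `Ω` lies on one side of the tangent plane, so the ray leaves `Ω` no later than it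
  -- meets the plane.
  have hupper : ∀ᶠ y : E3 × E3 in 𝓝 (x, v), exitTime Ω y.1 y.2 ≤ l y := by
    filter_upwards [hev] with y ⟨hy1, hy2, hy3, _⟩
    have h1 := hΩ.inner_outwardNormal_nonpos hqf (hΩ.exitPoint_mem_closure (v := y.2) (subset_closure hy1))
    rw [exitPoint, sub_right_comm, inner_sub_right, real_inner_smul_right] at h1
    simp only [hl]
    rw [le_div_iff_of_neg (by linarith)]
    linarith
  obtain ⟨C, hC⟩ : ∃ C : ℝ, ∀ᶠ y : E3 × E3 in 𝓝 (x, v), ‖(y.1 - l y • y.2) - q‖ ≤ C * ‖y - (x, v)‖ := by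
    have hd : DifferentiableAt ℝ (fun y : E3 × E3 => y.1 - l y • y.2) (x, v) :=
      differentiableAt_fst.sub (hld.differentiableAt.smul differentiableAt_snd)
    obtain ⟨C, hC⟩ := hd.hasFDerivAt.isBigO_sub.bound
    refine ⟨C, ?_⟩
    filter_upwards [hC] with y hy
    have e : (x, v).1 - l (x, v) • (x, v).2 = q := by rw [hlv]; rfl
    simpa only [e] using hy
  -- Let `δ = |y - (x, v)|`. At the time `l - ε δ` the ray is within `D δ` of `q` and more than `ε κ
  -- δ` below the tangent plane, so by the cone property it is still in `Ω`. The opening `ε κ / (2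
  -- D)` of the cone is chosen so that half of this depth suffices.
  have hlower : ∀ ε > 0, ∀ᶠ y : E3 × E3 in 𝓝 (x, v), l y - ε * ‖y - (x, v)‖ ≤ exitTime Ω y.1 y.2 := by
    intro ε hε
    set D := |C| + ε * (‖v‖ + 1) with hD
    have hD0 : 0 < D := by positivity
    set κ := -inner ℝ n v / 2 with hκ
    have hκ0 : 0 < κ := by rw [hκ]; linarith
    have hnear := hΩ.eventually_mem_of_inner_lt hqf (ε := ε * κ / (2 * D)) (by positivity)
    have hnc : ContinuousAt (fun y : E3 × E3 => y.1 - (l y - ε * ‖y - (x, v)‖) • y.2) (x, v) := by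
      have : ContinuousAt (fun y : E3 × E3 => ‖y - (x, v)‖) (x, v) := by fun_prop
      exact continuousAt_fst.sub ((hlc.sub (continuousAt_const.mul this)).smul continuousAt_snd)
    have hval : (x, v).1 - (l (x, v) - ε * ‖(x, v) - (x, v)‖) • (x, v).2 = q := by
      simp [hlv, hq, exitPoint, ← hτ]
    have hpos : ∀ᶠ y : E3 × E3 in 𝓝 (x, v), 0 < l y - ε * ‖y - (x, v)‖ := by
      have : ContinuousAt (fun y : E3 × E3 => l y - ε * ‖y - (x, v)‖) (x, v) := by
        have : ContinuousAt (fun y : E3 × E3 => ‖y - (x, v)‖) (x, v) := by fun_prop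
        exact hlc.sub (continuousAt_const.mul this)
      exact this.eventually (lt_mem_nhds (by simpa [hlv] using hτ0))
    rw [ContinuousAt, hval] at hnc
    have hnear2 := hnc.eventually hnear
    filter_upwards [hnear2, hpos, hC, hev] with y h1 h2 h3 ⟨h4, h5, h6, h7⟩
    by_cases hy0 : y = (x, v)
    · rw [hy0, hlv]; simp [hτ]
    have hδ : 0 < ‖y - (x, v)‖ := norm_pos_iff.2 (sub_ne_zero.2 hy0)
    refine ((hΩ.mem_iff_lt_exitTime' h5 h4 h2.le).1 (h1 ?_)).le
    have e1 : y.1 - (l y - ε * ‖y - (x, v)‖) • y.2 - q =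
        (y.1 - l y • y.2 - q) + (ε * ‖y - (x, v)‖) • y.2 := by
      rw [sub_smul]; abel
    have e2 : inner ℝ n (y.1 - l y • y.2 - q) = 0 := by
      rw [sub_right_comm, inner_sub_right, real_inner_smul_right]
      simp only [hl]
      rw [div_mul_cancel₀ _ (by linarith), sub_self]
    rw [e1, inner_add_right, e2, real_inner_smul_right, zero_add]
    have e3 : ‖(y.1 - l y • y.2 - q) + (ε * ‖y - (x, v)‖) • y.2‖ ≤ D * ‖y - (x, v)‖ := by
      refine (norm_add_le _ _).trans ?_
      rw [norm_smul, Real.norm_of_nonneg (by positivity)]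
      have : C * ‖y - (x, v)‖ ≤ |C| * ‖y - (x, v)‖ := by gcongr; exact le_abs_self C
      have h8 : ε * ‖y - (x, v)‖ * ‖y.2‖ ≤ ε * ‖y - (x, v)‖ * (‖v‖ + 1) := by gcongr
      rw [hD]; linarith
    have e4 : ε * κ / (2 * D) * ‖(y.1 - l y • y.2 - q) + (ε * ‖y - (x, v)‖) • y.2‖ ≤ ε * κ / 2 * ‖y - (x, v)‖ := by
      calc _ ≤ ε * κ / (2 * D) * (D * ‖y - (x, v)‖) := by gcongr
        _ = _ := by field_simp
    have e5 : ε * ‖y - (x, v)‖ * inner ℝ n y.2 < ε * ‖y - (x, v)‖ * -κ :=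
      mul_lt_mul_of_pos_left (by rw [hκ]; linarith) (by positivity)
    have e6 : 0 < ε * κ * ‖y - (x, v)‖ := by positivity
    rw [neg_mul]
    linarith
  have hdiff : HasFDerivAt (fun y : E3 × E3 => exitTime Ω y.1 y.2 - l y) (0 : E3 × E3 →L[ℝ] ℝ) (x, v) := by
    rw [hasFDerivAt_iff_isLittleO]
    refine Asymptotics.isLittleO_iff.2 fun ε hε => ?_
    filter_upwards [hupper, hlower ε hε] with y h1 h2
    simp only [hlv, ← hτ, sub_self, sub_zero, zero_apply]
    rw [Real.norm_eq_abs, abs_le]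
    constructor <;> linarith [mul_nonneg hε.le (norm_nonneg (y - (x, v)))]
  have := hdiff.add hld
  rw [zero_add] at this
  exact this.congr_of_eventuallyEq (Eventually.of_forall fun y => by simp)

theorem continuousOn_exitTime :
    ContinuousOn (fun y : E3 × E3 => exitTime Ω y.1 y.2) (Ω ×ˢ {0}ᶜ) := fun y hy =>
  (hΩ.hasFDerivAt_exitTime hy.2 hy.1).continuousAt.continuousWithinAt

theorem continuousOn_exitPoint :
    ContinuousOn (fun y : E3 × E3 => exitPoint Ω y.1 y.2) (Ω ×ˢ {0}ᶜ) :=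
  continuousOn_fst.sub (hΩ.continuousOn_exitTime.smul continuousOn_snd)

theorem abs_exitTimeDeriv_le {x v : E3} (hv : v ≠ 0) (hx : x ∈ Ω) {a b : E3} (ha : ‖a‖ ≤ 1)
    (hb : ‖b‖ ≤ 1) :
    |exitTimeDeriv Ω (x, v) (a, b)| ≤
      |inner ℝ (outwardNormal Ω (exitPoint Ω x v)) v|⁻¹ * (1 + exitTime Ω x v) := by
  rw [exitTimeDeriv_apply, abs_mul, abs_inv]
  have hn := hΩ.norm_outwardNormal (hΩ.exitPoint_mem_frontier hv hx)
  have h : ∀ a : E3, ‖a‖ ≤ 1 → |inner ℝ (outwardNormal Ω (exitPoint Ω x v)) a| ≤ 1 := fun a ha =>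
    (abs_real_inner_le_norm _ _).trans (by rw [hn, one_mul]; exact ha)
  gcongr
  refine (abs_sub _ _).trans (add_le_add (h a ha) ?_)
  rw [abs_mul, abs_of_nonneg (exitTime_nonneg _ _ _)]
  exact mul_le_of_le_one_right (exitTime_nonneg _ _ _) (h b hb)

/-- Away from the boundary, backward rays exit transversally. -/
theorem le_exitTime_mul_abs_inner {x v : E3} (hv : v ≠ 0) (hx : x ∈ Ω) {δ : ℝ} (hδ : 0 < δ)
    (hball : Metric.ball x δ ⊆ Ω) :
    δ ≤ exitTime Ω x v * |inner ℝ (outwardNormal Ω (exitPoint Ω x v)) v| := by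
  set n := outwardNormal Ω (exitPoint Ω x v) with hn
  have hqf := hΩ.exitPoint_mem_frontier hv hx
  have hn1 : ‖n‖ = 1 := hΩ.norm_outwardNormal hqf
  -- The ball of radius `δ` must lie behind the tangent plane at the exit point; its extreme point
  -- in the normal direction gives the inequality.
  have hcl : x + δ • n ∈ closure Ω := by
    refine closure_mono hball ?_
    rw [closure_ball _ hδ.ne', Metric.mem_closedBall, dist_eq_norm, add_sub_cancel_left, norm_smul, hn1,
      Real.norm_of_nonneg hδ.le, mul_one]
  have h := hΩ.inner_outwardNormal_nonpos hqf hcl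
  have h2 : x + δ • n - exitPoint Ω x v = exitTime Ω x v • v + δ • n := by
    simp only [exitPoint]; abel
  rw [h2, ← hn, inner_add_right, real_inner_smul_right, real_inner_smul_right, real_inner_self_eq_norm_sq, hn1] at h
  rw [abs_of_neg (hΩ.inner_outwardNormal_exitPoint_neg hv hx)]
  linarith

theorem exitTime_mul_norm_le_of_isChordConstant {C₃ : ℝ} (h : IsChordConstant Ω C₃) {z v : E3}
    (hz : z ∈ frontier Ω) (hv : inner ℝ (outwardNormal Ω z) v < 0) :
    exitTime Ω z (-v) * ‖v‖ ≤ C₃ * (|inner ℝ (outwardNormal Ω z) v| / ‖v‖) := by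
  have := h.2 z v ⟨hz, hv⟩
  rw [exitPoint, sub_sub_cancel, norm_smul, norm_neg, Real.norm_of_nonneg (exitTime_nonneg _ _ _)] at this
  refine this.trans (le_of_eq ?_)
  rw [normalCosine, real_inner_smul_right, abs_mul, abs_inv, abs_norm]
  ring

end StationaryBoltzmann.IsBoundedConvexC2Domain

/-! ### Chords of domains with positively curved boundary -/

/-- Along the segment, a lower bound on the second derivative makes first the derivative and then
the function, each minus its Taylor polynomial, monotone. -/
theorem Convex.taylor_two_le {φ : E3 → ℝ} {s : Set E3} (hs : Convex ℝ s)
    (hφ : ∀ x ∈ s, ContDiffAt ℝ 2 φ x) {x y : E3} (hx : x ∈ s) (hy : y ∈ s) {M : ℝ}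
    (hM : ∀ ξ ∈ s, M ≤ fderiv ℝ (fderiv ℝ φ) ξ (y - x) (y - x)) :
    φ x + fderiv ℝ φ x (y - x) + M / 2 ≤ φ y := by
  set δ := y - x with hδ
  have hmem : ∀ t ∈ Icc (0 : ℝ) 1, x + t • δ ∈ s := fun t ht => by
    have := hs.add_smul_sub_mem hx hy ht
    simpa using this
  have hl : ∀ t : ℝ, HasDerivAt (fun t : ℝ => x + t • δ) δ t := fun t => by
    simpa using ((hasDerivAt_id t).smul_const δ).const_add x
  have h1 : ∀ t ∈ Icc (0 : ℝ) 1, HasDerivAt (fun t : ℝ => φ (x + t • δ)) (fderiv ℝ φ (x + t • δ) δ) t :=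
    fun t ht => ((hφ _ (hmem t ht)).differentiableAt (by norm_num)).hasFDerivAt.comp_hasDerivAt t (hl t)
  have h2 : ∀ t ∈ Icc (0 : ℝ) 1, HasDerivAt (fun t : ℝ => fderiv ℝ φ (x + t • δ) δ)
      (fderiv ℝ (fderiv ℝ φ) (x + t • δ) δ δ) t := by
    intro t ht
    have hd : DifferentiableAt ℝ (fderiv ℝ φ) (x + t • δ) :=
      ((hφ _ (hmem t ht)).fderiv_right (m := 1) (by norm_num)).differentiableAt (by norm_num)
    exact (ContinuousLinearMap.apply ℝ ℝ δ).hasFDerivAt.comp_hasDerivAt t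
      (hd.hasFDerivAt.comp_hasDerivAt t (hl t))
  have hmono1 : MonotoneOn (fun t : ℝ => fderiv ℝ φ (x + t • δ) δ - M * t) (Icc 0 1) := by
    refine monotoneOn_of_hasDerivWithinAt_nonneg (convex_Icc 0 1) (f' := fun t => fderiv ℝ (fderiv ℝ φ) (x + t • δ) δ δ - M) ?_ ?_ ?_
    · exact fun t ht => (((h2 t ht).continuousAt).sub (by fun_prop)).continuousWithinAt
    · intro t ht
      rw [interior_Icc] at ht
      have h3 : HasDerivAt (fun t : ℝ => M * t) M t := by
        simpa using (hasDerivAt_id' t).const_mul M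
      exact ((h2 t (Ioo_subset_Icc_self ht)).sub h3).hasDerivWithinAt
    · intro t ht
      rw [interior_Icc] at ht
      have := hM _ (hmem t (Ioo_subset_Icc_self ht))
      linarith
  have hmono2 : MonotoneOn (fun t : ℝ => φ (x + t • δ) - (fderiv ℝ φ x δ * t + M / 2 * t ^ 2)) (Icc 0 1) := by
    refine monotoneOn_of_hasDerivWithinAt_nonneg (convex_Icc 0 1) (f' := fun t => fderiv ℝ φ (x + t • δ) δ - (fderiv ℝ φ x δ + M * t)) ?_ ?_ ?_
    · exact fun t ht => (((h1 t ht).continuousAt).sub (by fun_prop)).continuousWithinAt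
    · intro t ht
      rw [interior_Icc] at ht
      have h3 : HasDerivAt (fun t : ℝ => fderiv ℝ φ x δ * t + M / 2 * t ^ 2) (fderiv ℝ φ x δ + M * t) t := by
        have := ((hasDerivAt_id t).const_mul (fderiv ℝ φ x δ)).add ((hasDerivAt_pow 2 t).const_mul (M / 2))
        refine this.congr_deriv ?_
        simp; ring
      exact ((h1 t (Ioo_subset_Icc_self ht)).sub h3).hasDerivWithinAt
    · intro t ht
      rw [interior_Icc] at ht
      have := hmono1 (left_mem_Icc.2 zero_le_one) (Ioo_subset_Icc_self ht) ht.1.le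
      simp at this
      linarith
  have := hmono2 (left_mem_Icc.2 zero_le_one) (right_mem_Icc.2 zero_le_one) zero_le_one
  have e : x + δ = y := by rw [hδ]; abel
  simp only [zero_smul, one_smul, add_zero, mul_zero, mul_one, one_pow, e, ne_eq, OfNat.ofNat_ne_zero,
    not_false_eq_true, zero_pow] at this
  linarith

theorem StationaryBoltzmann.IsLocalDefiningFunction.continuousAt_fderiv_fderiv
    {Ω : Set E3} {z : E3} {φ : E3 → ℝ} (h : IsLocalDefiningFunction Ω z φ) :
    ContinuousAt (fderiv ℝ (fderiv ℝ φ)) z :=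
  ((h.contDiffAt.fderiv_right (m := 1) (by norm_num)).fderiv_right (m := 0) (by norm_num)).continuousAt

theorem StationaryBoltzmann.IsLocalDefiningFunction.fderiv_apply
    {Ω : Set E3} {z : E3} {φ : E3 → ℝ} (h : IsLocalDefiningFunction Ω z φ) (d : E3) :
    fderiv ℝ φ z d = inner ℝ (gradient φ z) d := by
  rw [h.hasFDerivAt.fderiv]; rfl

/-- Otherwise `d`, `g`, `a`, `b` would, after normalization, be four orthonormal vectors in `ℝ³`. -/
theorem eq_zero_of_inner_eq_zero {g a b d : E3} (hg : g ≠ 0) (hab : Orthonormal ℝ ![a, b])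
    (hga : inner ℝ g a = 0) (hgb : inner ℝ g b = 0) (h1 : inner ℝ g d = 0) (h2 : inner ℝ a d = 0)
    (h3 : inner ℝ b d = 0) : d = 0 := by
  have haa : ‖a‖ = 1 := by simpa using hab.1 0
  have hbb : ‖b‖ = 1 := by simpa using hab.1 1
  have hab0 : inner ℝ a b = 0 := by simpa using hab.2 (i := 0) (j := 1) (by simp)
  by_contra hd
  have ho : Orthonormal ℝ ![‖d‖⁻¹ • d, ‖g‖⁻¹ • g, a, b] := by
    have hd' : ‖d‖ ≠ 0 := norm_ne_zero_iff.2 hd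
    have hg' : ‖g‖ ≠ 0 := norm_ne_zero_iff.2 hg
    have hba0 : inner ℝ b a = 0 := by rw [real_inner_comm]; exact hab0
    have e1 : inner ℝ d g = 0 := by rw [real_inner_comm]; exact h1
    have e2 : inner ℝ d a = 0 := by rw [real_inner_comm]; exact h2
    have e3 : inner ℝ d b = 0 := by rw [real_inner_comm]; exact h3
    have e4 : inner ℝ a g = 0 := by rw [real_inner_comm]; exact hga
    have e5 : inner ℝ b g = 0 := by rw [real_inner_comm]; exact hgb
    rw [orthonormal_iff_ite]
    intro i j
    fin_cases i <;> fin_cases j <;>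
      simp [real_inner_smul_left, real_inner_smul_right, haa, hbb, hab0, hba0, hga, hgb, h1, h2, h3,
        e1, e2, e3, e4, e5, hd', hg', norm_smul]
  have := ho.linearIndependent.fintype_card_le_finrank
  simp at this

namespace StationaryBoltzmann.IsLocalDefiningFunction

variable {Ω : Set E3} {z : E3} {φ : E3 → ℝ}

theorem eventually_forall_closure (hΩ : IsBoundedConvexC2Domain Ω) (h : IsLocalDefiningFunction Ω z φ) :
    ∀ᶠ y in 𝓝 z, (y ∈ closure Ω → φ y ≤ 0) ∧ (y ∈ frontier Ω → φ y = 0) ∧ (φ y < 0 → y ∈ Ω) := by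
  filter_upwards [h.eventually_isLocalDefiningFunction] with y hy
  refine ⟨fun hc => ?_, hy.eq_zero hΩ, hy.eventually_mem_iff.self_of_nhds.2⟩
  by_cases hyΩ : y ∈ Ω
  · exact (hy.eventually_mem_iff.self_of_nhds.1 hyΩ).le
  · exact (hy.eq_zero hΩ ⟨hc, by rwa [hΩ.isOpen.interior_eq]⟩).le

set_option maxSynthPendingDepth 3 in
theorem exists_ball_taylor (hΩ : IsBoundedConvexC2Domain Ω) (h : IsLocalDefiningFunction Ω z φ) {ε : ℝ} (hε : 0 < ε) :
    ∃ r > 0, ∀ x ∈ Metric.ball z r, ContDiffAt ℝ 2 φ x ∧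
      ‖fderiv ℝ (fderiv ℝ φ) x - fderiv ℝ (fderiv ℝ φ) z‖ < ε ∧ IsLocalDefiningFunction Ω x φ ∧
      ‖gradient φ x‖ < ‖gradient φ z‖ + 1 ∧
      (x ∈ closure Ω → φ x ≤ 0) ∧ (x ∈ frontier Ω → φ x = 0) ∧ (φ x < 0 → x ∈ Ω) := by
  have h0 : ContinuousAt (fun x => ‖fderiv ℝ (fderiv ℝ φ) x - fderiv ℝ (fderiv ℝ φ) z‖) z :=
    (h.continuousAt_fderiv_fderiv.sub continuousAt_const).norm
  have h1 := h0.eventually (gt_mem_nhds (show _ < ε by simpa using hε))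
  have h2 := h.continuousAt_gradient.norm.eventually (gt_mem_nhds (lt_add_one _))
  obtain ⟨r, hr, H⟩ := Metric.eventually_nhds_iff_ball.1 ((h1.and h2).and
    (h.eventually_isLocalDefiningFunction.and (h.eventually_forall_closure hΩ)))
  refine ⟨r, hr, fun x hx => ?_⟩
  obtain ⟨⟨a, b⟩, c, d⟩ := H x hx
  exact ⟨c.contDiffAt, a, c, b, d⟩

theorem abs_hessian_sub_le {x z d : E3} {ε : ℝ}
    (h : ‖fderiv ℝ (fderiv ℝ φ) x - fderiv ℝ (fderiv ℝ φ) z‖ ≤ ε) :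
    |fderiv ℝ (fderiv ℝ φ) x d d - fderiv ℝ (fderiv ℝ φ) z d d| ≤ ε * ‖d‖ ^ 2 := by
  have h1 := (fderiv ℝ (fderiv ℝ φ) x - fderiv ℝ (fderiv ℝ φ) z).le_opNorm₂ d d
  simp only [sub_apply, Real.norm_eq_abs] at h1
  calc _ ≤ _ := h1
    _ = ‖fderiv ℝ (fderiv ℝ φ) x - fderiv ℝ (fderiv ℝ φ) z‖ * ‖d‖ ^ 2 := by ring
    _ ≤ _ := by gcongr

/-- If `φ` were strictly concave in a tangent direction, the points `z ± t d` would lie in `Ω` for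
small `t`, and by convexity so would their midpoint `z`. -/
theorem hessian_nonneg (hΩ : IsBoundedConvexC2Domain Ω) (h : IsLocalDefiningFunction Ω z φ)
    (hz : z ∈ frontier Ω) {d : E3} (hd : inner ℝ (gradient φ z) d = 0) :
    0 ≤ fderiv ℝ (fderiv ℝ φ) z d d := by
  by_contra! hneg
  have hd0 : d ≠ 0 := by rintro rfl; simp at hneg
  have hdn : 0 < ‖d‖ := norm_pos_iff.2 hd0
  set m := -fderiv ℝ (fderiv ℝ φ) z d d with hm
  obtain ⟨r, hr, H⟩ := h.exists_ball_taylor hΩ (ε := m / (2 * ‖d‖ ^ 2)) (by rw [hm]; apply div_pos <;> [linarith; positivity])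
  have key : ∀ t : ℝ, t ≠ 0 → |t| * ‖d‖ < r → z + t • d ∈ Ω := by
    intro t ht0 ht
    have hmem : z + t • d ∈ Metric.ball z r := by
      rw [mem_ball_iff_norm, add_sub_cancel_left, norm_smul]; exact ht
    apply (H _ hmem).2.2.2.2.2.2
    have hT := (convex_ball z r).taylor_two_le (φ := fun x => -φ x) (x := z) (y := z + t • d) (M := t ^ 2 * (m / 2))
      (fun x hx => (H x hx).1.neg) (Metric.mem_ball_self hr) hmem (by
        intro ξ hξ
        have e1 : fderiv ℝ (fun x => -φ x) = fun x => -fderiv ℝ φ x := by ext1 x; exact fderiv_fun_neg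
        rw [e1, fderiv_fun_neg, add_sub_cancel_left]
        simp only [_root_.neg_apply, map_smul, smul_apply, smul_eq_mul]
        have h3 := abs_hessian_sub_le (d := d) (H ξ hξ).2.1.le
        rw [show m / (2 * ‖d‖ ^ 2) * ‖d‖ ^ 2 = m / 2 by field_simp, abs_le] at h3
        have h4 : t ^ 2 * (m / 2) ≤ t ^ 2 * -(fderiv ℝ (fderiv ℝ φ) ξ d d) := by
          gcongr; linarith [h3.2]
        linarith)
    rw [fderiv_fun_neg, add_sub_cancel_left, _root_.neg_apply, map_smul, h.fderiv_apply, hd, h.eq_zero hΩ hz] at hT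
    simp at hT
    have : 0 < t ^ 2 * (m / 2) / 2 := by have : 0 < m := by linarith
                                         positivity
    linarith
  have ht : |r / (2 * ‖d‖)| * ‖d‖ < r := by
    rw [abs_of_pos (by positivity)]; field_simp; linarith
  have h1 := key (r / (2 * ‖d‖)) (by positivity) ht
  have h2 := key (-(r / (2 * ‖d‖))) (neg_ne_zero.2 (by positivity)) (by rwa [abs_neg])
  have h3 := hΩ.convex h1 h2 (a := 1 / 2) (b := 1 / 2) (by norm_num) (by norm_num) (by norm_num)
  refine hΩ.notMem_of_mem_frontier hz ?_
  convert h3 using 1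
  rw [← smul_add, neg_smul]
  have : z + (r / (2 * ‖d‖)) • d + (z + -((r / (2 * ‖d‖)) • d)) = (2 : ℝ) • z := by rw [two_smul]; abel
  rw [this, smul_smul]; norm_num

end StationaryBoltzmann.IsLocalDefiningFunction

/-- Convexity makes the tangential Hessian nonnegative and positive curvature makes its determinant
positive, so it is positive definite. The function `φ` is the one that the curvature hypothesis
provides. -/
theorem exists_definingFunction_hessian_pos {Ω : Set E3} (hΩ : IsBoundedConvexC2Domain Ω)
    (hc : HasPositiveGaussianCurvature Ω) {z : E3} (hz : z ∈ frontier Ω) :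
    ∃ φ, IsLocalDefiningFunction Ω z φ ∧ ∀ d : E3, d ≠ 0 → inner ℝ (gradient φ z) d = 0 →
      0 < fderiv ℝ (fderiv ℝ φ) z d d := by
  obtain ⟨κ, hκ, φ, a, b, hφ, hab, hga, hgb, rfl⟩ := hc z hz
  refine ⟨φ, hφ, fun d hd0 hd => ?_⟩
  set H := fderiv ℝ (fderiv ℝ φ) z with hH
  have hsymm : ∀ x y, H x y = H y x := fun x y =>
    (hφ.contDiffAt.isSymmSndFDerivAt (by simp)).eq x y
  have haa := hφ.hessian_nonneg hΩ hz hga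
  have hg : 0 < ‖gradient φ z‖ := norm_pos_iff.2 hφ.gradient_ne_zero
  simp only [secondFundamentalForm, ← hH] at hκ
  have hdet : 0 < H a a * H b b - H a b ^ 2 := by
    have : H a a / ‖gradient φ z‖ * (H b b / ‖gradient φ z‖) - (H a b / ‖gradient φ z‖) ^ 2 =
      (H a a * H b b - H a b ^ 2) / ‖gradient φ z‖ ^ 2 := by field_simp
    rw [this] at hκ
    exact (div_pos_iff_of_pos_right (by positivity)).1 hκ
  have haa' : 0 < H a a := by
    refine lt_of_le_of_ne haa fun h0 => ?_
    rw [← h0] at hdet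
    nlinarith [sq_nonneg (H a b)]
  have hn_a : ‖a‖ = 1 := by simpa using hab.1 0
  have hn_b : ‖b‖ = 1 := by simpa using hab.1 1
  have hab0 : inner ℝ a b = 0 := by simpa using hab.2 (i := 0) (j := 1) (by simp)
  set s : ℝ := inner ℝ a d
  set t : ℝ := inner ℝ b d
  have hdec : d = s • a + t • b := by
    have := eq_zero_of_inner_eq_zero (d := d - (s • a + t • b)) hφ.gradient_ne_zero hab hga hgb
      (by simp only [inner_sub_right, inner_add_right, real_inner_smul_right, hd, hga, hgb]; ring)
      (by simp [inner_sub_right, inner_add_right, real_inner_smul_right, hn_a, hab0, s])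
      (by simp [inner_sub_right, inner_add_right, real_inner_smul_right, hn_b, real_inner_comm a b, hab0, t])
    exact sub_eq_zero.1 this
  have hexp : H d d = s ^ 2 * H a a + 2 * s * t * H a b + t ^ 2 * H b b := by
    conv_lhs => rw [hdec]
    simp only [map_add, map_smul, add_apply, smul_apply, smul_eq_mul, hsymm b a]
    ring
  have hst : s ≠ 0 ∨ t ≠ 0 := by
    by_contra! h
    rw [h.1, h.2] at hdec
    simp at hdec
    exact hd0 hdec
  -- Completion of the square: `H(a,a) H(d,d)` is `(s H(a,a) + t H(a,b))²` plus `t²` times the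
  -- determinant.
  have hprod : 0 < H a a * H d d := by
    have : H a a * H d d = (s * H a a + t * H a b) ^ 2 + t ^ 2 * (H a a * H b b - H a b ^ 2) := by
      rw [hexp]; ring
    rw [this]
    by_cases ht : t = 0
    · have hs : s ≠ 0 := by tauto
      rw [ht]; simp; positivity
    · have : 0 < t ^ 2 * (H a a * H b b - H a b ^ 2) := by positivity
      positivity
  exact (pos_iff_pos_of_mul_pos hprod).1 haa'

namespace StationaryBoltzmann.IsBoundedConvexC2Domain

variable {Ω : Set E3} (hΩ : IsBoundedConvexC2Domain Ω) (hc : HasPositiveGaussianCurvature Ω)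
include hΩ hc

/-- Strict convexity. If `y` were on the tangent plane at `z`, the segment from `z` to `y` would lie
in that plane and in the closure, where `φ ≤ 0` near `z`, while `φ` grows quadratically in every
tangent direction. -/
theorem inner_outwardNormal_pos {z y : E3} (hz : z ∈ frontier Ω) (hy : y ∈ closure Ω) (hne : y ≠ z) :
    0 < inner ℝ (outwardNormal Ω z) (z - y) := by
  have h0 := hΩ.inner_outwardNormal_nonpos hz hy
  rw [← neg_sub, inner_neg_right, neg_nonpos] at h0
  refine lt_of_le_of_ne h0 fun heq => ?_
  obtain ⟨φ, hφ, hpos⟩ := exists_definingFunction_hessian_pos hΩ hc hz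
  have hg : 0 < ‖gradient φ z‖ := norm_pos_iff.2 hφ.gradient_ne_zero
  set d := y - z with hd
  have hdg : inner ℝ (gradient φ z) d = 0 := by
    rw [hΩ.outwardNormal_eq hz hφ, real_inner_smul_left, ← neg_sub, inner_neg_right, ← hd] at heq
    have := mul_eq_zero.1 heq.symm
    rcases this with h | h
    · exact absurd h (inv_pos.2 hg).ne'
    · linarith
  have hd0 : d ≠ 0 := sub_ne_zero.2 hne
  have hdn : 0 < ‖d‖ := norm_pos_iff.2 hd0
  have hm := hpos d hd0 hdg
  set m := fderiv ℝ (fderiv ℝ φ) z d d with hmdef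
  obtain ⟨r, hr, H⟩ := hφ.exists_ball_taylor hΩ (ε := m / (2 * ‖d‖ ^ 2)) (by positivity)
  set t := min 1 (r / (2 * ‖d‖)) with ht
  have ht0 : 0 < t := lt_min one_pos (by positivity)
  have hmem : z + t • d ∈ Metric.ball z r := by
    rw [mem_ball_iff_norm, add_sub_cancel_left, norm_smul, Real.norm_of_nonneg ht0.le]
    calc t * ‖d‖ ≤ r / (2 * ‖d‖) * ‖d‖ := by gcongr; exact min_le_right _ _
      _ < r := by field_simp; linarith
  have hcl : z + t • d ∈ closure Ω :=
    hΩ.convex.closure.add_smul_sub_mem hz.1 hy ⟨ht0.le, min_le_left _ _⟩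
  have h1 := (H _ hmem).2.2.2.2.1 hcl
  have hT := (convex_ball z r).taylor_two_le (φ := φ) (x := z) (y := z + t • d) (M := t ^ 2 * (m / 2))
      (fun x hx => (H x hx).1) (Metric.mem_ball_self hr) hmem (by
        intro ξ hξ
        rw [add_sub_cancel_left]
        simp only [map_smul, smul_apply, smul_eq_mul]
        have h3 := IsLocalDefiningFunction.abs_hessian_sub_le (d := d) (H ξ hξ).2.1.le
        rw [show m / (2 * ‖d‖ ^ 2) * ‖d‖ ^ 2 = m / 2 by field_simp, abs_le] at h3
        have h4 : t ^ 2 * (m / 2) ≤ t ^ 2 * (fderiv ℝ (fderiv ℝ φ) ξ d d) := by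
          gcongr; linarith [h3.1]
        linarith)
  rw [add_sub_cancel_left, map_smul, hφ.fderiv_apply, hdg, hφ.eq_zero hΩ hz] at hT
  simp at hT
  have : 0 < t ^ 2 * (m / 2) / 2 := by positivity
  linarith

/-- The direction `e` of `x - y` is either transversal to the tangent plane at `z`, and then the
left side is linear in `|x-y|` and dominates its square, or the Hessian is positive along `e`, and
then Taylor's formula applies with `φ(x) = 0` and `φ(y) ≤ 0`. -/
theorem exists_nhds_diagonal {z : E3} (hz : z ∈ frontier Ω) :
    ∃ c > 0, ∃ r > 0, ∀ x ∈ Metric.ball z r ∩ frontier Ω, ∀ y ∈ Metric.ball z r ∩ closure Ω,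
      c * ‖x - y‖ ^ 2 ≤ inner ℝ (outwardNormal Ω x) (x - y) := by
  obtain ⟨φ, hφ, hpos⟩ := exists_definingFunction_hessian_pos hΩ hc hz
  have hg : 0 < ‖gradient φ z‖ := norm_pos_iff.2 hφ.gradient_ne_zero
  set n := outwardNormal Ω z with hn
  have hnφ := hΩ.outwardNormal_eq hz hφ
  set H := fderiv ℝ (fderiv ℝ φ) z with hH
  -- The constant `m` is the minimum over the unit sphere of `max |n·d| D²φ(d, d)`. It is positive
  -- because the Hessian is positive wherever `n·d = 0`.
  obtain ⟨m, hm, hmax⟩ : ∃ m > 0, ∀ d : E3, ‖d‖ = 1 → m ≤ |inner ℝ n d| ∨ m ≤ H d d := by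
    have hcomp : IsCompact (Metric.sphere (0 : E3) 1) := isCompact_sphere _ _
    have hne : (Metric.sphere (0 : E3) 1).Nonempty := ⟨EuclideanSpace.single 0 1, by simp⟩
    obtain ⟨d₀, hd₀, hmin⟩ := hcomp.exists_isMinOn hne
      (f := fun d => max |inner ℝ n d| (H d d)) (by fun_prop)
    have hd₀0 : d₀ ≠ 0 := by rintro rfl; simp at hd₀
    refine ⟨max |inner ℝ n d₀| (H d₀ d₀), ?_, fun d hd => ?_⟩
    · by_cases h0 : inner ℝ n d₀ = 0
      · refine lt_max_of_lt_right (hpos d₀ hd₀0 ?_)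
        rw [hn, hnφ, real_inner_smul_left] at h0
        rcases mul_eq_zero.1 h0 with h | h
        · exact absurd h (inv_pos.2 hg).ne'
        · exact h
      · exact lt_max_of_lt_left (abs_pos.2 h0)
    · exact le_max_iff.1 (hmin (by simpa using hd : d ∈ Metric.sphere (0 : E3) 1))
  obtain ⟨r₁, hr₁, H₁⟩ := hφ.exists_ball_taylor hΩ (ε := m / 2) (by positivity)
  obtain ⟨r₂, hr₂, H₂⟩ := Metric.continuousOn_iff.1 hΩ.continuousOn_outwardNormal z hz (m / 2) (by positivity)
  refine ⟨min (m / 2) (m / 4 / (‖gradient φ z‖ + 1)), lt_min (by positivity) (by positivity),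
    min (min r₁ r₂) (1 / 2), lt_min (lt_min hr₁ hr₂) (by norm_num), fun x hx y hy => ?_⟩
  have hx1 : x ∈ Metric.ball z r₁ := Metric.ball_subset_ball ((min_le_left _ _).trans (min_le_left _ _)) hx.1
  have hy1 : y ∈ Metric.ball z r₁ := Metric.ball_subset_ball ((min_le_left _ _).trans (min_le_left _ _)) hy.1
  have hx2 : x ∈ Metric.ball z r₂ := Metric.ball_subset_ball ((min_le_left _ _).trans (min_le_right _ _)) hx.1
  have hxy : ‖x - y‖ ≤ 1 := by
    have h1 : dist x z < 1 / 2 := lt_of_lt_of_le hx.1 (min_le_right _ _)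
    have h2 : dist y z < 1 / 2 := lt_of_lt_of_le hy.1 (min_le_right _ _)
    rw [← dist_eq_norm]
    linarith [dist_triangle_right x y z]
  by_cases hne : x = y
  · simp [hne]
  have hδ : 0 < ‖x - y‖ := norm_pos_iff.2 (sub_ne_zero.2 hne)
  have hnn := hΩ.inner_outwardNormal_nonpos hx.2 hy.2
  rw [← neg_sub, inner_neg_right, neg_nonpos] at hnn
  set e : E3 := ‖x - y‖⁻¹ • (x - y) with he
  have he1 : ‖e‖ = 1 := by rw [he, norm_smul, norm_inv, norm_norm, inv_mul_cancel₀ hδ.ne']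
  have hxe : x - y = ‖x - y‖ • e := by rw [he, smul_smul, mul_inv_cancel₀ hδ.ne', one_smul]
  rcases hmax e he1 with hcase | hcase
  · have h1 : m / 2 ≤ |inner ℝ (outwardNormal Ω x) e| := by
      have h2 : |inner ℝ n e| ≤ |inner ℝ (outwardNormal Ω x) e| + m / 2 := by
        have h3 : inner ℝ n e = inner ℝ (outwardNormal Ω x) e + inner ℝ (n - outwardNormal Ω x) e := by
          rw [inner_sub_left]; ring
        rw [h3]
        refine (abs_add_le _ _).trans (add_le_add le_rfl ((abs_real_inner_le_norm _ _).trans ?_))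
        rw [he1, mul_one, ← dist_eq_norm, dist_comm]
        exact (H₂ x hx.2 hx2).le
      linarith
    have h4 : inner ℝ (outwardNormal Ω x) (x - y) = ‖x - y‖ * |inner ℝ (outwardNormal Ω x) e| := by
      rw [← abs_of_nonneg hnn]
      conv_lhs => rw [hxe, real_inner_smul_right, abs_mul, abs_norm]
    rw [h4]
    calc _ ≤ m / 2 * ‖x - y‖ ^ 2 := by gcongr; exact min_le_left _ _
      _ = ‖x - y‖ * (m / 2 * ‖x - y‖) := by ring
      _ ≤ ‖x - y‖ * (m / 2 * 1) := by gcongr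
      _ ≤ _ := by rw [mul_one]; gcongr
  · have hT := (convex_ball z r₁).taylor_two_le (φ := φ) (x := x) (y := y) (M := ‖x - y‖ ^ 2 * (m / 2))
      (fun x hx => (H₁ x hx).1) hx1 hy1 (by
        intro ξ hξ
        have h3 := IsLocalDefiningFunction.abs_hessian_sub_le (d := e) (H₁ ξ hξ).2.1.le
        rw [he1, one_pow, mul_one, abs_le] at h3
        have e1 : y - x = -(‖x - y‖ • e) := by rw [← hxe, neg_sub]
        rw [e1]
        simp only [map_neg, map_smul, _root_.neg_apply, smul_apply, smul_eq_mul]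
        have h4 : ‖x - y‖ ^ 2 * (m / 2) ≤ ‖x - y‖ ^ 2 * (fderiv ℝ (fderiv ℝ φ) ξ e e) := by
          gcongr; linarith [h3.1]
        linarith)
    have hφx := (H₁ x hx1).2.2.1
    rw [(H₁ x hx1).2.2.2.2.2.1 hx.2, hφx.fderiv_apply] at hT
    have h5 := (H₁ y hy1).2.2.2.2.1 hy.2
    have hgx : 0 < ‖gradient φ x‖ := norm_pos_iff.2 hφx.gradient_ne_zero
    have h6 : inner ℝ (gradient φ x) (y - x) = - (‖gradient φ x‖ * inner ℝ (outwardNormal Ω x) (x - y)) := by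
      rw [hΩ.outwardNormal_eq hx.2 hφx, real_inner_smul_left, ← mul_assoc, mul_inv_cancel₀ hgx.ne', one_mul,
        ← inner_neg_right, neg_sub]
    rw [h6] at hT
    have h7 : ‖gradient φ x‖ * inner ℝ (outwardNormal Ω x) (x - y) ≤ (‖gradient φ z‖ + 1) * inner ℝ (outwardNormal Ω x) (x - y) := by
      gcongr; exact (H₁ x hx1).2.2.2.1.le
    calc _ ≤ m / 4 / (‖gradient φ z‖ + 1) * ‖x - y‖ ^ 2 := by gcongr; exact min_le_right _ _
      _ = (‖x - y‖ ^ 2 * (m / 2) / 2) / (‖gradient φ z‖ + 1) := by ring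
      _ ≤ _ := by rw [div_le_iff₀ (by positivity)]; linarith

/-- Compactness of pairs: near the diagonal the curvature gives the quadratic bound, away from it
strict positivity, continuity of the normal and the bound `|z-y| ≤ diam Ω` suffice. -/
theorem exists_inner_outwardNormal_ge :
    ∃ c > 0, ∀ z ∈ frontier Ω, ∀ y ∈ closure Ω,
      c * ‖z - y‖ ^ 2 ≤ inner ℝ (outwardNormal Ω z) (z - y) := by
  have hcomp : IsCompact (frontier Ω ×ˢ closure Ω) :=
    (Metric.isCompact_of_isClosed_isBounded isClosed_frontier
      (hΩ.isBounded_closure.subset frontier_subset_closure)).prod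
      (Metric.isCompact_of_isClosed_isBounded isClosed_closure hΩ.isBounded_closure)
  suffices h : ∃ c > 0, ∀ w ∈ frontier Ω ×ˢ closure Ω, w ∈ frontier Ω ×ˢ closure Ω →
      c * ‖w.1 - w.2‖ ^ 2 ≤ inner ℝ (outwardNormal Ω w.1) (w.1 - w.2) by
    obtain ⟨c, hc0, h⟩ := h
    exact ⟨c, hc0, fun z hz y hy => h (z, y) ⟨hz, hy⟩ ⟨hz, hy⟩⟩
  refine hcomp.induction_on (p := fun s => ∃ c > 0, ∀ w ∈ s, w ∈ frontier Ω ×ˢ closure Ω →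
      c * ‖w.1 - w.2‖ ^ 2 ≤ inner ℝ (outwardNormal Ω w.1) (w.1 - w.2)) ?_ ?_ ?_ ?_
  · exact ⟨1, one_pos, by simp⟩
  · rintro s t hst ⟨c, hc0, h⟩
    exact ⟨c, hc0, fun w hw => h w (hst hw)⟩
  · rintro s t ⟨c, hc0, h⟩ ⟨c', hc'0, h'⟩
    refine ⟨min c c', lt_min hc0 hc'0, fun w hw hwS => ?_⟩
    rcases hw with hw | hw
    · exact le_trans (by gcongr; exact min_le_left _ _) (h w hw hwS)
    · exact le_trans (by gcongr; exact min_le_right _ _) (h' w hw hwS)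
  · rintro ⟨z, y⟩ ⟨hz, hy⟩
    by_cases hne : y = z
    · subst hne
      obtain ⟨c, hc0, r, hr, h⟩ := hΩ.exists_nhds_diagonal hc hz
      refine ⟨Metric.ball y r ×ˢ Metric.ball y r, mem_nhdsWithin_of_mem_nhds
        (prod_mem_nhds (Metric.ball_mem_nhds _ hr) (Metric.ball_mem_nhds _ hr)), c, hc0, fun w hw hwS => ?_⟩
      exact h w.1 ⟨hw.1, hwS.1⟩ w.2 ⟨hw.2, hwS.2⟩
    · have hpos := hΩ.inner_outwardNormal_pos hc hz hy hne
      have hcont : ContinuousWithinAt (fun w : E3 × E3 => (inner ℝ (outwardNormal Ω w.1) (w.1 - w.2) : ℝ))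
          (frontier Ω ×ˢ closure Ω) (z, y) := by
        refine ContinuousWithinAt.inner ?_ (by fun_prop)
        exact ContinuousWithinAt.comp (f := Prod.fst) (g := outwardNormal Ω) (x := (z, y))
          (hΩ.continuousOn_outwardNormal z hz) continuousWithinAt_fst (fun w hw => hw.1)
      have hev := hcont.eventually (lt_mem_nhds (half_lt_self hpos))
      set m := inner ℝ (outwardNormal Ω z) (z - y) with hm
      set D := Metric.diam Ω with hD
      have hDp : 0 < D := hΩ.diam_pos
      refine ⟨_, hev, m / 2 / D ^ 2, by positivity, fun w hw hwS => ?_⟩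
      have h1 : ‖w.1 - w.2‖ ≤ D := by
        have := Metric.dist_le_diam_of_mem hΩ.isBounded_closure hwS.1.1 hwS.2
        rwa [Metric.diam_closure, dist_eq_norm] at this
      calc _ ≤ m / 2 / D ^ 2 * D ^ 2 := by gcongr
        _ = m / 2 := by field_simp
        _ ≤ _ := le_of_lt hw

/-- For the chord from `z` to `z + t v` the quadratic bound reads `c t² |v|² ≤ -t n(z)·v`; dividing
by `t |v|` gives the estimate with `C₃ = c⁻¹`. -/
theorem exists_isChordConstant : ∃ C₃ : ℝ, IsChordConstant Ω C₃ := by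
  obtain ⟨c, hc0, h⟩ := hΩ.exists_inner_outwardNormal_ge hc
  refine ⟨c⁻¹, inv_pos.2 hc0, fun z v ⟨hz, hv⟩ => ?_⟩
  have hv0 : v ≠ 0 := by rintro rfl; simp at hv
  have hvn : 0 < ‖v‖ := norm_pos_iff.2 hv0
  have h1 := h z hz _ (hΩ.exitPoint_mem_closure (v := -v) hz.1)
  have e1 : z - exitPoint Ω z (-v) = -(exitTime Ω z (-v) • v) := by simp [exitPoint]
  set t := exitTime Ω z (-v) with ht
  have ht0 : 0 ≤ t := exitTime_nonneg _ _ _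
  rw [e1, norm_neg, norm_smul, Real.norm_of_nonneg ht0, inner_neg_right, real_inner_smul_right] at h1
  rw [e1, norm_neg, norm_smul, Real.norm_of_nonneg ht0, normalCosine, real_inner_smul_right, abs_mul,
    abs_inv, abs_norm, abs_of_neg hv]
  rcases ht0.eq_or_lt with h0 | h0
  · rw [← h0, zero_mul]
    have : 0 ≤ -inner ℝ (outwardNormal Ω z) v := by linarith
    positivity
  · have h2 : c * (t * ‖v‖) * ‖v‖ ≤ -inner ℝ (outwardNormal Ω z) v := by
      refine le_of_mul_le_mul_left ?_ h0
      calc _ = c * (t * ‖v‖) ^ 2 := by ring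
        _ ≤ _ := h1
        _ = _ := by ring
    rw [inv_mul_eq_div, inv_mul_eq_div, div_div, le_div_iff₀ (by positivity)]
    linarith

end StationaryBoltzmann.IsBoundedConvexC2Domain

open scoped ENNReal NNReal

/-! ### Surface measure and flow tubes -/

/-- The ratio between the Euclidean normalization of the two-dimensional Hausdorff measure and the
one for which `ℝ × ℝ` with the sup norm carries Lebesgue measure. -/
noncomputable def surfaceFactor : ℝ≥0 :=
  Measure.addHaarScalarFactor (volume : Measure (EuclideanSpace ℝ (Fin 2)))
    (Measure.hausdorffMeasure ((2 : ℕ) : ℝ))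

theorem surfaceFactor_ne_zero : surfaceFactor ≠ 0 :=
  Measure.addHaarScalarFactor_volume_hausdorffMeasure_ne_zero 2

theorem surface_apply (A : Set E3) : (Measure.euclideanHausdorffMeasure 2 : Measure E3) A =
    surfaceFactor * Measure.hausdorffMeasure (2 : ℝ) A := by
  rw [Measure.euclideanHausdorffMeasure_def]
  simp only [Nat.cast_ofNat, Measure.smul_apply]
  rfl

/-- The plane carries the sup norm, for which the unnormalized Hausdorff measure is Lebesgue
measure; `surfaceFactor` converts to the Euclidean normalization. -/
theorem volume_image_le_surface {f : E3 → ℝ × ℝ} {A : Set E3} {K : ℝ≥0} (hf : LipschitzOnWith K f A) :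
    volume (f '' A) ≤ (K : ℝ≥0∞) ^ (2 : ℝ) * (surfaceFactor : ℝ≥0∞)⁻¹ *
      (Measure.euclideanHausdorffMeasure 2 : Measure E3) A := by
  have h := hf.hausdorffMeasure_image_le (d := 2) (by norm_num)
  rw [hausdorffMeasure_prod_real] at h
  refine h.trans (le_of_eq ?_)
  rw [surface_apply, mul_assoc, ← mul_assoc _ (surfaceFactor : ℝ≥0∞), ENNReal.inv_mul_cancel, one_mul]
  · exact_mod_cast surfaceFactor_ne_zero
  · simp

/-- The inverse of `f` is Lipschitz on a bounded subset of the plane. -/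
theorem surface_lt_top_of_antilipschitz {f : E3 → ℝ × ℝ} {A : Set E3} {K : ℝ≥0}
    (hf : ∀ a ∈ A, ∀ b ∈ A, dist a b ≤ K * dist (f a) (f b)) (hb : Bornology.IsBounded (f '' A)) :
    (Measure.euclideanHausdorffMeasure 2 : Measure E3) A < ∞ := by
  have hinj : InjOn f A := fun a ha b hb hab => by
    have := hf a ha b hb
    rw [hab, dist_self, mul_zero] at this
    exact dist_le_zero.1 this
  have hl : LipschitzOnWith K (Function.invFunOn f A) (f '' A) := by
    refine LipschitzOnWith.of_dist_le_mul ?_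
    rintro _ ⟨a, ha, rfl⟩ _ ⟨b, hb, rfl⟩
    rw [hinj.leftInvOn_invFunOn ha, hinj.leftInvOn_invFunOn hb]
    exact hf a ha b hb
  have h := hl.hausdorffMeasure_image_le (d := 2) (by norm_num)
  rw [hinj.invFunOn_image Subset.rfl, hausdorffMeasure_prod_real] at h
  rw [surface_apply]
  refine ENNReal.mul_lt_top (by simp) (h.trans_lt (ENNReal.mul_lt_top ?_ hb.measure_lt_top))
  simp

namespace StationaryBoltzmann.IsBoundedConvexC2Domain

variable {Ω : Set E3} (hΩ : IsBoundedConvexC2Domain Ω)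
include hΩ

theorem isCompact_frontier : IsCompact (frontier Ω) :=
  Metric.isCompact_of_isClosed_isBounded isClosed_frontier
      (hΩ.isBounded_closure.subset frontier_subset_closure)

/-- By compactness it suffices to treat a flat patch. There the normal component of `a - b` is at
most `|a-b|/2`, so the projection to the tangent plane is bi-Lipschitz. -/
theorem surface_frontier_lt_top :
    (Measure.euclideanHausdorffMeasure 2 : Measure E3) (frontier Ω) < ∞ := by
  refine hΩ.isCompact_frontier.measure_lt_top_of_nhdsWithin fun z hz => ?_
  obtain ⟨U, hUo, hzU, hU⟩ := hΩ.eventually_abs_inner_sub_le hz (ε := 1 / 2) (by norm_num)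
  refine ⟨U ∩ frontier Ω, inter_comm U _ ▸ inter_mem_nhdsWithin _ (hUo.mem_nhds hzU), ?_⟩
  obtain ⟨B, hB⟩ := exists_orthonormalBasis_zero (hΩ.norm_outwardNormal hz)
  set f : E3 → ℝ × ℝ := fun x => (inner ℝ (B 1) x, inner ℝ (B 2) x) with hf
  have hfl : ∀ a b, dist (f a) (f b) ≤ dist a b := by
    intro a b
    rw [Prod.dist_eq, dist_eq_norm a b]
    refine max_le ?_ ?_ <;>
    · simp only [hf, Real.dist_eq]
      rw [← inner_sub_right]
      refine (abs_real_inner_le_norm _ _).trans ?_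
      simp
  refine surface_lt_top_of_antilipschitz (f := f) (K := 2) (fun a ha b hb => ?_) ?_
  · have h1 := (hU a ha).2 b hb
    have h2 := norm_sq_eq_coord B (a - b)
    rw [← hB] at h1
    have h3 : |inner ℝ (B 1) (a - b)| ≤ dist (f a) (f b) := by
      rw [Prod.dist_eq, inner_sub_right]; exact le_max_left _ _
    have h4 : |inner ℝ (B 2) (a - b)| ≤ dist (f a) (f b) := by
      rw [Prod.dist_eq, inner_sub_right]; exact le_max_right _ _
    rw [dist_eq_norm]
    have h5 : ‖a - b‖ ^ 2 ≤ (2 * dist (f a) (f b)) ^ 2 := by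
      have e1 := sq_le_sq' (by linarith [abs_nonneg (inner ℝ (B 0) (a - b)), norm_nonneg (a - b)]) h1
      have e2 := sq_le_sq' (by linarith [abs_nonneg (inner ℝ (B 1) (a - b)), dist_nonneg (x := f a) (y := f b)]) h3
      have e3 := sq_le_sq' (by linarith [abs_nonneg (inner ℝ (B 2) (a - b)), dist_nonneg (x := f a) (y := f b)]) h4
      rw [sq_abs] at e1 e2 e3
      nlinarith [sq_nonneg (dist (f a) (f b))]
    have := abs_le_of_sq_le_sq' h5 (by positivity)
    simpa using this.2
  · have hb : Bornology.IsBounded (U ∩ frontier Ω) :=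
      hΩ.isCompact_frontier.isBounded.subset inter_subset_right
    have : LipschitzWith 1 f := LipschitzWith.of_dist_le_mul (by simpa using hfl)
    exact this.isBounded_image hb

end StationaryBoltzmann.IsBoundedConvexC2Domain

/-- The shear that maps the unit vector `n` to `v` and fixes its orthogonal complement. -/
noncomputable def normalShear (n v : E3) : E3 →ₗ[ℝ] E3 :=
  LinearMap.id + (innerSL ℝ n : E3 →ₗ[ℝ] ℝ).smulRight (v - n)

theorem normalShear_apply (n v x : E3) : normalShear n v x = x + (inner ℝ n x : ℝ) • (v - n) := by
  simp [normalShear]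

theorem det_normalShear (B : OrthonormalBasis (Fin 3) ℝ E3) (v : E3) :
    LinearMap.det (normalShear (B 0) v) = inner ℝ (B 0) v := by
  rw [← LinearMap.det_toMatrix B.toBasis, Matrix.det_fin_three]
  have ho : ∀ i j, inner ℝ (B i) (B j) = if i = j then (1 : ℝ) else 0 := fun i j =>
    orthonormal_iff_ite.1 B.orthonormal i j
  simp [LinearMap.toMatrix_apply, normalShear_apply, OrthonormalBasis.repr_apply_apply, ho,
    inner_sub_right]

/-- One inequality of the area formula is enough here: on the image of `A`, Lebesgue measure is at
most a multiple of the image of the surface measure. -/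
theorem lintegral_le_of_lipschitz {A : Set E3} (hA : MeasurableSet A) {L : E3 → ℝ × ℝ} {K : ℝ≥0}
    (hLm : Measurable L) (hL : LipschitzOnWith K L A) {G : ℝ × ℝ → ℝ≥0∞} (hG : Measurable G)
    (hsupp : ∀ m, m ∉ L '' A → G m = 0) :
    ∫⁻ m, G m ≤ (K : ℝ≥0∞) ^ (2 : ℝ) * (surfaceFactor : ℝ≥0∞)⁻¹ *
      ∫⁻ z in A, G (L z) ∂(Measure.euclideanHausdorffMeasure 2 : Measure E3) := by
  set c := (K : ℝ≥0∞) ^ (2 : ℝ) * (surfaceFactor : ℝ≥0∞)⁻¹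
  set S : Measure E3 := Measure.euclideanHausdorffMeasure 2
  have hle : (volume : Measure (ℝ × ℝ)).restrict (L '' A) ≤ c • (S.restrict A).map L := by
    refine Measure.le_iff.2 fun s hs => ?_
    rw [Measure.restrict_apply hs, Measure.smul_apply, Measure.map_apply hLm hs, Measure.restrict_apply (hLm hs)]
    have : s ∩ L '' A = L '' (L ⁻¹' s ∩ A) := by
      rw [inter_comm (L ⁻¹' s), image_inter_preimage, inter_comm]
    rw [this]
    exact volume_image_le_surface (hL.mono inter_subset_right)
  calc ∫⁻ m, G m = ∫⁻ m in Function.support G, G m := by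
        rw [setLIntegral_eq_of_support_subset Subset.rfl]
    _ ≤ ∫⁻ m in L '' A, G m := lintegral_mono_set fun m hm => by
        by_contra h; exact hm (hsupp m h)
    _ ≤ ∫⁻ m, G m ∂(c • (S.restrict A).map L) := lintegral_mono' hle le_rfl
    _ = _ := by
        rw [lintegral_smul_measure, lintegral_map hG hLm]; rfl

namespace StationaryBoltzmann.IsBoundedConvexC2Domain

variable {Ω : Set E3} (hΩ : IsBoundedConvexC2Domain Ω)
include hΩ

theorem continuousOn_exitPoint_left {v : E3} (hv : v ≠ 0) :
    ContinuousOn (fun x => exitPoint Ω x v) Ω :=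
  hΩ.continuousOn_exitPoint.comp (f := fun x => (x, v)) (by fun_prop) fun x hx => ⟨hx, hv⟩

theorem measurableSet_exitPoint_preimage {v : E3} (hv : v ≠ 0) {A : Set E3} (hA : MeasurableSet A) :
    MeasurableSet (Ω ∩ (fun x => exitPoint Ω x v) ⁻¹' A) := by
  classical
  have h := (hΩ.continuousOn_exitPoint_left hv).measurable_piecewise (g := fun _ => (0 : E3))
    continuous_const.continuousOn hΩ.isOpen.measurableSet
  have := hΩ.isOpen.measurableSet.inter (h hA)
  convert this using 1
  ext x
  simp only [mem_inter_iff, mem_preimage, and_congr_right_iff]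
  intro hx
  rw [Set.piecewise_eq_of_mem _ _ _ hx]

/-- The tube consists of the points whose backward ray exits through `A`. In the oblique coordinates
given by the plane `n^⊥` and the direction `v`, its base is the projection of `A` along `v`, its
fibres are no longer than the crossing times, and the volume element carries the factor `|n·v|`. The
crossing time is bounded by an arbitrary function `w`, so its own measurability on the boundary
plays no role. -/
theorem volume_tube_le_local {z₀ v : E3} (hz₀ : z₀ ∈ frontier Ω)
    (hv : inner ℝ (outwardNormal Ω z₀) v < 0) {w : E3 → ℝ≥0∞}
    (hw : ∀ z ∈ frontier Ω, inner ℝ (outwardNormal Ω z) v < 0 → ENNReal.ofReal (exitTime Ω z (-v)) ≤ w z) :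
    ∃ U : Set E3, IsOpen U ∧ z₀ ∈ U ∧ ∀ A ⊆ U ∩ frontier Ω, MeasurableSet A →
      volume (Ω ∩ (fun x => exitPoint Ω x v) ⁻¹' A) ≤
        8 * (surfaceFactor : ℝ≥0∞)⁻¹ * ∫⁻ z in A, ‖(inner ℝ (outwardNormal Ω z) v : ℝ)‖ₑ * w z
          ∂(Measure.euclideanHausdorffMeasure 2 : Measure E3) := by
  obtain ⟨B, hB⟩ := exists_orthonormalBasis_zero (hΩ.norm_outwardNormal hz₀)
  set n := outwardNormal Ω z₀ with hn
  set κ : ℝ := |inner ℝ n v| with hκ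
  have hκ0 : 0 < κ := abs_pos.2 hv.ne
  have hv0 : v ≠ 0 := by rintro rfl; simp at hv
  have hvn : 0 < ‖v‖ := norm_pos_iff.2 hv0
  -- With flatness `κ/(2|v|)`, the correction along `v` in the projection of `a - b` is at most
  -- `|a-b|/2`, and the normal at each point of the patch has `|n·v| ≥ κ/2`.
  obtain ⟨U, hUo, hzU, hU⟩ := hΩ.eventually_abs_inner_sub_le hz₀ (ε := κ / (2 * ‖v‖)) (by positivity)
  refine ⟨U, hUo, hzU, fun A hAU hA => ?_⟩
  set S : Measure E3 := Measure.euclideanHausdorffMeasure 2 with hS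
  -- `M` is the projection along `v` onto the plane orthogonal to `n`, and `L` gives its
  -- coordinates; both are constant along rays.
  set M : E3 → E3 := fun x => x - (inner ℝ n x / inner ℝ n v : ℝ) • v with hM
  set L : E3 → ℝ × ℝ := fun x => (inner ℝ (B 1) (M x), inner ℝ (B 2) (M x)) with hL
  have hLm : Measurable L := by
    have : Continuous L := by simp only [hL, hM]; fun_prop
    exact this.measurable
  have hnM : ∀ x, inner ℝ n (M x) = 0 := fun x => by
    simp only [hM]; rw [inner_sub_right, real_inner_smul_right, div_mul_cancel₀ _ hv.ne, sub_self]
  have hMadd : ∀ x t, M (x + t • v) = M x := fun x t => by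
    simp only [hM]; rw [inner_add_right, real_inner_smul_right, add_div, mul_div_cancel_right₀ _ hv.ne, add_smul]; abel
  have hMsub : ∀ a b, M a - M b = (a - b) - (inner ℝ n (a - b) / inner ℝ n v : ℝ) • v := fun a b => by
    simp only [hM]; rw [inner_sub_right, sub_div, sub_smul]; abel
  have hlip : LipschitzOnWith 2 L A := by
    refine LipschitzOnWith.of_dist_le_mul fun a ha b hb => ?_
    have h1 := (hU a (hAU ha)).2 b (hAU hb)
    have h2 : ‖M a - M b‖ ≤ 2 * ‖a - b‖ := by
      rw [hMsub]
      refine (norm_sub_le _ _).trans ?_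
      rw [norm_smul, Real.norm_eq_abs, abs_div, ← hκ]
      have : |inner ℝ n (a - b)| / κ * ‖v‖ ≤ ‖a - b‖ / 2 := by
        rw [div_mul_eq_mul_div, div_le_iff₀ hκ0]
        calc _ ≤ (κ / (2 * ‖v‖) * ‖a - b‖) * ‖v‖ := by gcongr
          _ = _ := by field_simp
      linarith [norm_nonneg (a - b)]
    rw [dist_eq_norm a b]
    refine le_trans ?_ (by simpa using h2)
    rw [Prod.dist_eq]
    refine max_le ?_ ?_ <;>
    · simp only [hL, Real.dist_eq]
      rw [← inner_sub_right]
      exact (abs_real_inner_le_norm _ _).trans (by simp)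
  have hLM : ∀ a b, L a = L b → M a = M b := by
    intro a b hab
    have h1 : inner ℝ (B 1) (M a - M b) = 0 := by
      rw [inner_sub_right, sub_eq_zero]; exact congrArg Prod.fst hab
    have h2 : inner ℝ (B 2) (M a - M b) = 0 := by
      rw [inner_sub_right, sub_eq_zero]; exact congrArg Prod.snd hab
    have h3 : inner ℝ (B 0) (M a - M b) = 0 := by rw [hB, inner_sub_right, hnM, hnM, sub_self]
    have h4 := norm_sq_eq_coord B (M a - M b)
    rw [h1, h2, h3] at h4
    rw [← sub_eq_zero, ← norm_eq_zero]
    simpa using h4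
  have hinj : ∀ a ∈ A, ∀ b ∈ A, L a = L b → a = b := by
    intro a ha b hb hab
    have h1 := (hU a (hAU ha)).2 b (hAU hb)
    have h2 := hMsub a b
    rw [hLM a b hab, sub_self, eq_comm, sub_eq_zero] at h2
    have h3 : ‖a - b‖ = |inner ℝ n (a - b)| / κ * ‖v‖ := by
      conv_lhs => rw [h2, norm_smul, Real.norm_eq_abs, abs_div]
    have h4 : |inner ℝ n (a - b)| / κ * ‖v‖ ≤ ‖a - b‖ / 2 := by
      rw [div_mul_eq_mul_div, div_le_iff₀ hκ0]
      calc _ ≤ (κ / (2 * ‖v‖) * ‖a - b‖) * ‖v‖ := by gcongr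
        _ = _ := by field_simp
    have : ‖a - b‖ = 0 := by linarith [norm_nonneg (a - b)]
    exact sub_eq_zero.1 (norm_eq_zero.1 this)
  have hnorm : ∀ z ∈ A, κ ≤ 2 * |inner ℝ (outwardNormal Ω z) v| := by
    intro z hz
    have h1 := (hU z (hAU hz)).1
    have h2 : inner ℝ n v = inner ℝ (outwardNormal Ω z) v - inner ℝ (outwardNormal Ω z - n) v := by
      rw [inner_sub_left]; ring
    have h3 : κ ≤ |inner ℝ (outwardNormal Ω z) v| + κ / 2 := by
      rw [hκ, h2]
      refine (abs_sub _ _).trans (add_le_add le_rfl ((abs_real_inner_le_norm _ _).trans ?_))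
      rw [← h2, ← hκ]
      calc _ ≤ κ / (2 * ‖v‖) * ‖v‖ := by gcongr
        _ = _ := by field_simp
    linarith
  set X := Ω ∩ (fun x => exitPoint Ω x v) ⁻¹' A with hX
  have hXm : MeasurableSet X := hΩ.measurableSet_exitPoint_preimage hv0 hA
  set T := normalShear n v with hT
  have hdet : LinearMap.det T = inner ℝ n v := by rw [hT, ← hB]; exact det_normalShear B v
  have hTc : Continuous T := T.continuous_of_finiteDimensional
  -- The shear straightens the rays: it sends lines parallel to `n` to lines parallel to `v`, with
  -- determinant `n·v`.
  have hvol : volume X = ENNReal.ofReal κ * volume (T ⁻¹' X) := by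
    rw [Measure.addHaar_preimage_linearMap _ (by rw [hdet]; exact hv.ne), hdet, ← mul_assoc,
      ← ENNReal.ofReal_mul hκ0.le, abs_inv, ← hκ, mul_inv_cancel₀ hκ0.ne', ENNReal.ofReal_one, one_mul]
  set P : ℝ × ℝ × ℝ → E3 := fun m => m.1 • B 0 + m.2.1 • B 1 + m.2.2 • B 2 with hP
  have hPc : Continuous P := by simp only [hP]; fun_prop
  have hPB : ∀ y : E3, P (inner ℝ (B 0) y, inner ℝ (B 1) y, inner ℝ (B 2) y) = y := fun y => by
    have := B.sum_repr' y
    rw [Fin.sum_univ_three] at this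
    exact this
  set F : ℝ × ℝ × ℝ → ℝ≥0∞ := fun m => (T ⁻¹' X).indicator 1 (P m) with hF
  have hTX : MeasurableSet (T ⁻¹' X) := hTc.measurable hXm
  have hFm : Measurable F := (measurable_one.indicator hTX).comp hPc.measurable
  have hvol2 : volume (T ⁻¹' X) = ∫⁻ m : ℝ × ℝ, ∫⁻ a, F (a, m.1, m.2) := by
    rw [← lintegral_indicator_one hTX]
    have h1 := lintegral_coord B hFm
    have h2 : ∫⁻ y : E3, F (inner ℝ (B 0) y, inner ℝ (B 1) y, inner ℝ (B 2) y) = ∫⁻ y, (T ⁻¹' X).indicator 1 y :=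
      lintegral_congr fun y => by simp only [hF, hPB]
    rw [← h2]
    refine ((measurePreserving_coordMap B).lintegral_comp hFm).trans ?_
    rw [Measure.volume_eq_prod,
      lintegral_prod_symm _ hFm.aemeasurable]
  have hTP : ∀ a b c : ℝ, T (P (a, b, c)) = b • B 1 + c • B 2 + a • v := by
    intro a b c
    have ho : ∀ i j, inner ℝ (B i) (B j) = if i = j then (1 : ℝ) else 0 := fun i j =>
      orthonormal_iff_ite.1 B.orthonormal i j
    rw [hT, normalShear_apply, ← hB]
    simp only [hP, inner_add_right, real_inner_smul_right, ho]
    simp [smul_sub]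
    abel
  have hML : ∀ a b c : ℝ, L (T (P (a, b, c))) = (b, c) := by
    intro a b c
    have ho : ∀ i j, inner ℝ (B i) (B j) = if i = j then (1 : ℝ) else 0 := fun i j =>
      orthonormal_iff_ite.1 B.orthonormal i j
    rw [hTP]
    simp only [hL, hMadd]
    simp only [hM, ← hB, inner_add_right, real_inner_smul_right, inner_sub_right, ho]
    simp
  have hnT : ∀ a b c : ℝ, inner ℝ n (T (P (a, b, c))) = a * inner ℝ n v := by
    intro a b c
    have ho : ∀ i j, inner ℝ (B i) (B j) = if i = j then (1 : ℝ) else 0 := fun i j =>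
      orthonormal_iff_ite.1 B.orthonormal i j
    rw [hTP, ← hB]
    simp only [inner_add_right, real_inner_smul_right, ho]
    simp
  -- A point of the tube over `(b, c)` lies on the ray through some `z ∈ A`, at a time after `z`
  -- that is positive and less than the crossing time of the chord from `z` in the direction `v`.
  have hmem : ∀ a b c : ℝ, T (P (a, b, c)) ∈ X → ∃ z ∈ A, L z = (b, c) ∧
      0 < a - inner ℝ n z / inner ℝ n v ∧ a - inner ℝ n z / inner ℝ n v < exitTime Ω z (-v) := by
    intro a b c h
    set x := T (P (a, b, c)) with hx
    have hxz : x = exitPoint Ω x v + exitTime Ω x v • v := by simp [exitPoint]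
    have hpos := hΩ.exitTime_pos hv0 h.1
    have ha : a - inner ℝ n (exitPoint Ω x v) / inner ℝ n v = exitTime Ω x v := by
      have h1 := hnT a b c
      rw [← hx, hxz, inner_add_right, real_inner_smul_right] at h1
      have h2 : a = inner ℝ n (exitPoint Ω x v) / inner ℝ n v + exitTime Ω x v := by
        rw [← mul_left_inj' hv.ne, ← h1, add_mul, div_mul_cancel₀ _ hv.ne]
      linarith
    refine ⟨exitPoint Ω x v, h.2, ?_, by rw [ha]; exact hpos, ?_⟩
    · rw [← hML a b c, ← hx]
      conv_rhs => rw [hxz]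
      simp only [hL, hMadd]
    · rw [ha]
      refine (hΩ.mem_iff_lt_exitTime (neg_ne_zero.2 hv0) (hΩ.exitPoint_mem_closure (subset_closure h.1)) hpos).1 ?_
      rw [smul_neg, sub_neg_eq_add, ← hxz]
      exact h.1
  set G : ℝ × ℝ → ℝ≥0∞ := fun m => ∫⁻ a, F (a, m.1, m.2) with hG
  have hGm : Measurable G := by
    apply Measurable.lintegral_prod_left' (f := fun q : ℝ × (ℝ × ℝ) => F (q.1, q.2.1, q.2.2))
    exact hFm.comp (by fun_prop)
  have hsupp : ∀ m, m ∉ L '' A → G m = 0 := by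
    intro m hm
    simp only [hG]
    have hFa : Measurable fun a => F (a, m.1, m.2) := hFm.comp (by fun_prop)
    rw [lintegral_eq_zero_iff hFa]
    refine Eventually.of_forall fun a => ?_
    simp only [hF, Pi.zero_apply, indicator_apply_eq_zero]
    intro h
    obtain ⟨z, hz, hLz, _⟩ := hmem a m.1 m.2 h
    exact absurd ⟨z, hz, hLz⟩ hm
  have hGle : ∀ z ∈ A, G (L z) ≤ w z := by
    intro z hz
    by_cases hzv : inner ℝ (outwardNormal Ω z) v < 0
    · refine le_trans ?_ (hw z (hAU hz).2 hzv)
      have hle : G (L z) ≤ ∫⁻ a, (Ioo (inner ℝ n z / inner ℝ n v) (inner ℝ n z / inner ℝ n v + exitTime Ω z (-v))).indicator 1 a := by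
        refine lintegral_mono fun a => ?_
        simp only [hF]
        by_cases h : P (a, (L z).1, (L z).2) ∈ T ⁻¹' X
        · obtain ⟨z', hz', hLz, h1, h2⟩ := hmem a _ _ h
          have : z' = z := hinj z' hz' z hz hLz
          subst this
          rw [indicator_of_mem h, indicator_of_mem]
          · simp
          · constructor <;> linarith
        · rw [indicator_of_notMem h]; exact zero_le
      refine hle.trans (le_of_eq ?_)
      rw [lintegral_indicator_one measurableSet_Ioo, Real.volume_Ioo, add_sub_cancel_left]
    -- If `n(z)·v` is not negative, no backward ray from `Ω` exits at `z`. Since `L` is injective on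
    -- the patch, the fibre is empty.
    · have : G (L z) = 0 := by
        simp only [hG]
        have hFa : Measurable fun a => F (a, (L z).1, (L z).2) := hFm.comp (by fun_prop)
        rw [lintegral_eq_zero_iff hFa]
        refine Eventually.of_forall fun a => ?_
        simp only [hF, Pi.zero_apply, indicator_apply_eq_zero]
        intro h
        exfalso
        set x := T (P (a, (L z).1, (L z).2)) with hx
        have h' : x ∈ X := h
        have hLx : L x = L (exitPoint Ω x v) := by
          have hxz : x = exitPoint Ω x v + exitTime Ω x v • v := by simp [exitPoint]
          conv_lhs => rw [hxz]
          simp only [hL, hMadd]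
        have h1 : exitPoint Ω x v = z := hinj _ h'.2 z hz (by rw [← hLx, hx, hML])
        exact hzv (h1 ▸ hΩ.inner_outwardNormal_exitPoint_neg hv0 h'.1)
      rw [this]; exact zero_le
  rw [hvol, hvol2]
  have hmain := lintegral_le_of_lipschitz hA hLm hlip hGm hsupp
  -- The constant `8` is the square of the Lipschitz constant `2`, times the factor `2` in `κ ≤ 2
  -- |n(z)·v|`.
  calc _ ≤ ENNReal.ofReal κ * (((2 : ℝ≥0) : ℝ≥0∞) ^ (2 : ℝ) * (surfaceFactor : ℝ≥0∞)⁻¹ * ∫⁻ z in A, G (L z) ∂S) := by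
        gcongr
    _ = ((2 : ℝ≥0) : ℝ≥0∞) ^ (2 : ℝ) * (surfaceFactor : ℝ≥0∞)⁻¹ * ∫⁻ z in A, ENNReal.ofReal κ * G (L z) ∂S := by
        rw [lintegral_const_mul' _ _ ENNReal.ofReal_ne_top]; ring
    _ ≤ ((2 : ℝ≥0) : ℝ≥0∞) ^ (2 : ℝ) * (surfaceFactor : ℝ≥0∞)⁻¹ *
          ∫⁻ z in A, 2 * (‖(inner ℝ (outwardNormal Ω z) v : ℝ)‖ₑ * w z) ∂S := by
        refine mul_le_mul_right (setLIntegral_mono' hA fun z hz => ?_) _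
        rw [← mul_assoc]
        refine mul_le_mul' ?_ (hGle z hz)
        have := ENNReal.ofReal_le_ofReal (hnorm z hz)
        rw [ENNReal.ofReal_mul zero_le_two, ENNReal.ofReal_ofNat] at this
        rwa [Real.enorm_eq_ofReal_abs]
    _ = _ := by
        rw [lintegral_const_mul' _ _ (by norm_num)]
        have : ((2 : ℝ≥0) : ℝ≥0∞) ^ (2 : ℝ) = 4 := by
          rw [ENNReal.rpow_ofNat]; norm_num
        rw [this, show (8 : ℝ≥0∞) = 4 * 2 by norm_num]
        ring

/-- The local tube bounds are added up over a countable family of patches that covers all exit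
points; making the patches disjoint prevents multiple counting on the boundary. -/
theorem map_exitPoint_le {v : E3} (hv0 : v ≠ 0) {w : E3 → ℝ≥0∞}
    (hw : ∀ z ∈ frontier Ω, inner ℝ (outwardNormal Ω z) v < 0 → ENNReal.ofReal (exitTime Ω z (-v)) ≤ w z) :
    (volume.restrict Ω).map (fun x => exitPoint Ω x v) ≤ (8 * (surfaceFactor : ℝ≥0∞)⁻¹) •
      ((Measure.euclideanHausdorffMeasure 2 : Measure E3).restrict (frontier Ω)).withDensity
        (fun z => ‖(inner ℝ (outwardNormal Ω z) v : ℝ)‖ₑ * w z) := by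
  set S : Measure E3 := Measure.euclideanHausdorffMeasure 2 with hS
  set C : ℝ≥0∞ := 8 * (surfaceFactor : ℝ≥0∞)⁻¹ with hC
  set D : E3 → ℝ≥0∞ := fun z => ‖(inner ℝ (outwardNormal Ω z) v : ℝ)‖ₑ * w z with hD
  have hloc : ∀ z : {z : E3 // z ∈ frontier Ω ∧ inner ℝ (outwardNormal Ω z) v < 0}, ∃ U : Set E3,
      IsOpen U ∧ z.1 ∈ U ∧ ∀ A ⊆ U ∩ frontier Ω, MeasurableSet A →
      volume (Ω ∩ (fun x => exitPoint Ω x v) ⁻¹' A) ≤ C * ∫⁻ z in A, D z ∂S :=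
    fun z => hΩ.volume_tube_le_local z.2.1 z.2.2 hw
  choose U hUo hzU hU using hloc
  obtain ⟨T, hTc, hT⟩ := TopologicalSpace.isOpen_iUnion_countable U hUo
  have hpt : ∀ x ∈ Ω, exitPoint Ω x v ∈ frontier Ω ∩ ⋃ i ∈ T, U i := fun x hx => by
    refine ⟨hΩ.exitPoint_mem_frontier hv0 hx, ?_⟩
    rw [hT]
    exact mem_iUnion.2 ⟨⟨_, hΩ.exitPoint_mem_frontier hv0 hx, hΩ.inner_outwardNormal_exitPoint_neg hv0 hx⟩, hzU _⟩
  have hTne : T.Nonempty := by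
    obtain ⟨x, hx⟩ := hΩ.nonempty
    obtain ⟨i, hi, _⟩ := mem_iUnion₂.1 (hpt x hx).2
    exact ⟨i, hi⟩
  obtain ⟨e, he⟩ := hTc.exists_eq_range hTne
  set V : ℕ → Set E3 := disjointed fun i => U (e i) with hV
  have hVm : ∀ i, MeasurableSet (V i) := fun i =>
    MeasurableSet.disjointed (fun i => (hUo (e i)).measurableSet) i
  have hVU : ∀ i, V i ⊆ U (e i) := fun i => disjointed_subset _ i
  have hVun : ⋃ i, V i = ⋃ i ∈ T, U i := by
    rw [hV, iUnion_disjointed, he, biUnion_range]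
  refine Measure.le_iff.2 fun A hA => ?_
  have hq : AEMeasurable (fun x => exitPoint Ω x v) (volume.restrict Ω) :=
    (hΩ.continuousOn_exitPoint_left hv0).aemeasurable hΩ.isOpen.measurableSet
  have hfm : MeasurableSet (frontier Ω) := isClosed_frontier.measurableSet
  rw [Measure.map_apply_of_aemeasurable hq hA, Measure.restrict_apply' hΩ.isOpen.measurableSet,
    Measure.smul_apply, withDensity_apply _ hA, Measure.restrict_restrict hA]
  have hsub : (fun x => exitPoint Ω x v) ⁻¹' A ∩ Ω ⊆
      ⋃ i, Ω ∩ (fun x => exitPoint Ω x v) ⁻¹' (A ∩ frontier Ω ∩ V i) := by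
    rintro x ⟨hxA, hx⟩
    have h := hpt x hx
    rw [← hVun] at h
    obtain ⟨i, hi⟩ := mem_iUnion.1 h.2
    exact mem_iUnion.2 ⟨i, hx, ⟨hxA, h.1⟩, hi⟩
  calc _ ≤ volume (⋃ i, Ω ∩ (fun x => exitPoint Ω x v) ⁻¹' (A ∩ frontier Ω ∩ V i)) := measure_mono hsub
    _ ≤ ∑' i, volume (Ω ∩ (fun x => exitPoint Ω x v) ⁻¹' (A ∩ frontier Ω ∩ V i)) := measure_iUnion_le _
    _ ≤ ∑' i, C * ∫⁻ z in A ∩ frontier Ω ∩ V i, D z ∂S :=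
        ENNReal.tsum_le_tsum fun i => hU (e i) _ (fun z hz => ⟨hVU i hz.2, hz.1.2⟩)
          ((hA.inter hfm).inter (hVm i))
    _ = C * ∑' i, ∫⁻ z in A ∩ frontier Ω ∩ V i, D z ∂S := ENNReal.tsum_mul_left
    _ = C * ∫⁻ z in ⋃ i, A ∩ frontier Ω ∩ V i, D z ∂S := by
        rw [lintegral_iUnion (fun i => (hA.inter hfm).inter (hVm i))]
        intro i j hij
        exact (disjoint_disjointed _ hij).mono inter_subset_right inter_subset_right
    _ ≤ C * ∫⁻ z in A ∩ frontier Ω, D z ∂S := by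
        gcongr
        exact iUnion_subset fun i => inter_subset_left

theorem lintegral_exitPoint_le {v : E3} (hv0 : v ≠ 0) {w g : E3 → ℝ≥0∞}
    (hw : ∀ z ∈ frontier Ω, inner ℝ (outwardNormal Ω z) v < 0 → ENNReal.ofReal (exitTime Ω z (-v)) ≤ w z)
    (hwm : AEMeasurable w ((Measure.euclideanHausdorffMeasure 2 : Measure E3).restrict (frontier Ω)))
    (hg : Measurable g) :
    ∫⁻ x in Ω, g (exitPoint Ω x v) ≤ 8 * (surfaceFactor : ℝ≥0∞)⁻¹ *
      ∫⁻ z in frontier Ω, ‖(inner ℝ (outwardNormal Ω z) v : ℝ)‖ₑ * w z * g z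
        ∂(Measure.euclideanHausdorffMeasure 2 : Measure E3) := by
  have hq : AEMeasurable (fun x => exitPoint Ω x v) (volume.restrict Ω) :=
    (hΩ.continuousOn_exitPoint_left hv0).aemeasurable hΩ.isOpen.measurableSet
  have hn : AEMeasurable (outwardNormal Ω) ((Measure.euclideanHausdorffMeasure 2 : Measure E3).restrict (frontier Ω)) :=
    hΩ.continuousOn_outwardNormal.aemeasurable isClosed_frontier.measurableSet
  rw [← lintegral_map' hg.aemeasurable hq]
  refine (lintegral_mono' (hΩ.map_exitPoint_le hv0 hw) le_rfl).trans (le_of_eq ?_)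
  rw [lintegral_smul_measure, lintegral_withDensity_eq_lintegral_mul₀ _ hg.aemeasurable]
  · rfl
  · exact AEMeasurable.mul (by fun_prop) hwm

end StationaryBoltzmann.IsBoundedConvexC2Domain

open scoped ENNReal NNReal

/-! ### Weighted Hölder and Schur estimates -/

/-- Hölder's inequality for the measure `g dμ`, with conjugate exponents `p/(p-1)` and `p`. -/
theorem lintegral_mul_mul_rpow_le {X : Type*} [MeasurableSpace X] (μ : Measure X) {p : ℝ} (hp : 1 < p)
    {κ g u : X → ℝ≥0∞} (hκ : Measurable κ) (hg : Measurable g) (hu : Measurable u) :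
    (∫⁻ x, κ x * g x * u x ∂μ) ^ p ≤
      (∫⁻ x, κ x ^ (p / (p - 1)) * g x ∂μ) ^ (p - 1) * ∫⁻ x, g x * u x ^ p ∂μ := by
  have hq : (p / (p - 1)).HolderConjugate p := (Real.HolderConjugate.conjExponent hp).symm
  have h := ENNReal.lintegral_mul_le_Lp_mul_Lq (μ.withDensity g) hq hκ.aemeasurable hu.aemeasurable
  rw [lintegral_withDensity_eq_lintegral_mul _ hg (hκ.mul hu),
    lintegral_withDensity_eq_lintegral_mul _ hg (hκ.pow_const _),
    lintegral_withDensity_eq_lintegral_mul _ hg (hu.pow_const _)] at h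
  have h2 := ENNReal.rpow_le_rpow h (by linarith : 0 ≤ p)
  rw [ENNReal.mul_rpow_of_nonneg _ _ (by linarith), ← ENNReal.rpow_mul, ← ENNReal.rpow_mul,
    one_div_mul_cancel (by linarith), ENNReal.rpow_one] at h2
  have e : 1 / (p / (p - 1)) * p = p - 1 := by
    have : p ≠ 0 := by linarith
    have : p - 1 ≠ 0 := by linarith
    field_simp
  rw [e] at h2
  refine (le_of_eq ?_).trans (h2.trans (le_of_eq ?_))
  · congr 1
    refine lintegral_congr fun x => ?_
    simp only [Pi.mul_apply]; ring
  · congr 1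
    · congr 1
      refine lintegral_congr fun x => ?_
      simp only [Pi.mul_apply]; ring

theorem lintegral_mul_rpow_le {X : Type*} [MeasurableSpace X] (μ : Measure X) {p : ℝ} (hp : 1 < p)
    {g u : X → ℝ≥0∞} (hg : Measurable g) (hu : Measurable u) :
    (∫⁻ x, g x * u x ∂μ) ^ p ≤ (∫⁻ x, g x ∂μ) ^ (p - 1) * ∫⁻ x, g x * u x ^ p ∂μ := by
  simpa using lintegral_mul_mul_rpow_le μ hp (κ := fun _ => 1) measurable_const hg hu

/-- The integral operator with kernel `|v-w|⁻¹ exp (-c |v-w|²)`. -/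
noncomputable def gaussOp (c : ℝ) (u : E3 → ℝ≥0∞) (v : E3) : ℝ≥0∞ :=
  ∫⁻ w, ‖v - w‖ₑ⁻¹ * gaussE c (v - w) * u w

/-- The integral operator with kernel `gradKernel c`. -/
noncomputable def gradOp (c : ℝ) (u : E3 → ℝ≥0∞) (v : E3) : ℝ≥0∞ :=
  ∫⁻ w, ENNReal.ofReal (gradKernel c v w) * u w

theorem measurable_gaussOp {X : Type*} [MeasurableSpace X] (c : ℝ) {f : X → E3} {u : X × E3 → ℝ≥0∞}
    (hf : Measurable f) (hu : Measurable u) :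
    Measurable fun y : X => gaussOp c (fun w => u (y, w)) (f y) := by
  unfold gaussOp
  refine Measurable.lintegral_prod_right' (f := fun z : X × E3 =>
    ‖f z.1 - z.2‖ₑ⁻¹ * gaussE c (f z.1 - z.2) * u z) ?_
  fun_prop

theorem measurable_gradOp {X : Type*} [MeasurableSpace X] (c : ℝ) {f : X → E3} {u : X × E3 → ℝ≥0∞}
    (hf : Measurable f) (hu : Measurable u) :
    Measurable fun y : X => gradOp c (fun w => u (y, w)) (f y) := by
  unfold gradOp
  refine Measurable.lintegral_prod_right' (f := fun z : X × E3 =>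
    ENNReal.ofReal (gradKernel c (f z.1) z.2) * u z) ?_
  have := (measurable_gradKernel c).comp ((hf.comp measurable_fst).prodMk (measurable_snd (α := X) (β := E3)))
  exact (ENNReal.measurable_ofReal.comp this).mul hu

/-- Hölder puts the whole singularity `|v-w|⁻¹` into the first factor, with the power `p/(p-1) ≤ 2 <
3`. What is left for the integration in `v` is a pure Gaussian, so singular weights `ω` are
admissible as long as they are integrable against Gaussians. This covers both `|v|⁻¹` and
`|n·v|^{2-p} |v|⁻²`. -/
theorem exists_lintegral_mul_gaussOp_rpow_le {p c : ℝ} (hp : 2 ≤ p) (hc : 0 < c) :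
    ∃ C : ℝ≥0∞, C ≠ ∞ ∧ ∀ (ω u : E3 → ℝ≥0∞) (M : ℝ≥0∞), Measurable ω → Measurable u →
      (∀ w, ∫⁻ v, ω v * gaussE c (v - w) ≤ M) →
      ∫⁻ v, ω v * gaussOp c u v ^ p ≤ C * M * ∫⁻ w, u w ^ p := by
  have hq2 : p / (p - 1) ≤ 2 := by rw [div_le_iff₀ (by linarith)]; linarith
  obtain ⟨C, hC, h⟩ := exists_lintegral_rpow_norm_mul_gaussE_le (b := p / (p - 1)) (c := c)
    (div_nonneg (by linarith) (by linarith)) (by linarith) hc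
  refine ⟨C ^ (p - 1), ENNReal.rpow_ne_top_of_nonneg (by linarith) hC, fun ω u M hω hu hM => ?_⟩
  have h1 : ∀ v, gaussOp c u v ^ p ≤ C ^ (p - 1) * ∫⁻ w, gaussE c (v - w) * u w ^ p := fun v => by
    refine (lintegral_mul_mul_rpow_le volume (by linarith) (by fun_prop) (by fun_prop) hu).trans ?_
    gcongr ?_ ^ (p - 1) * _
    · linarith
    · have h0 := h 0
      rw [← lintegral_sub_left_eq_self _ v] at h0
      refine (le_of_eq (lintegral_congr fun w => ?_)).trans h0
      rw [sub_zero, ENNReal.inv_rpow, ENNReal.rpow_neg]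
  calc ∫⁻ v, ω v * gaussOp c u v ^ p
      ≤ ∫⁻ v, C ^ (p - 1) * ∫⁻ w, ω v * gaussE c (v - w) * u w ^ p := by
        refine lintegral_mono fun v => ?_
        simp only [mul_assoc]
        rw [lintegral_const_mul _ (by fun_prop), mul_left_comm]
        exact mul_le_mul_right (h1 v) _
    _ = C ^ (p - 1) * ∫⁻ w, (∫⁻ v, ω v * gaussE c (v - w)) * u w ^ p := by
        rw [lintegral_const_mul' _ _ (ENNReal.rpow_ne_top_of_nonneg (by linarith) hC),
          lintegral_lintegral_swap (by fun_prop)]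
        congr 1
        refine lintegral_congr fun w => ?_
        rw [lintegral_mul_const _ (by fun_prop)]
    _ ≤ C ^ (p - 1) * ∫⁻ w, M * u w ^ p := by
        gcongr with w
        exact hM w
    _ = _ := by rw [lintegral_const_mul _ (by fun_prop), mul_assoc]

/-- Schur's test: Hölder in `w` uses the bound on the rows, Fubini then uses the bound on the
columns. -/
theorem lintegral_kernel_rpow_le {p : ℝ} (hp : 1 < p) {K : E3 × E3 → ℝ≥0∞} (hK : Measurable K)
    {C : ℝ≥0∞} (hC : C ≠ ∞) (h : ∀ v, ∫⁻ w, K (v, w) ≤ C) (h' : ∀ w, ∫⁻ v, K (v, w) ≤ C)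
    {u : E3 → ℝ≥0∞} (hu : Measurable u) :
    ∫⁻ v, (∫⁻ w, K (v, w) * u w) ^ p ≤ C ^ (p - 1) * C * ∫⁻ w, u w ^ p := by
  have h1 : ∀ v, (∫⁻ w, K (v, w) * u w) ^ p ≤ C ^ (p - 1) * ∫⁻ w, K (v, w) * u w ^ p :=
    fun v => by
      refine (lintegral_mul_rpow_le volume hp (by fun_prop) hu).trans ?_
      gcongr ?_ ^ (p - 1) * _
      exact h v
  calc ∫⁻ v, (∫⁻ w, K (v, w) * u w) ^ p
      ≤ ∫⁻ v, C ^ (p - 1) * ∫⁻ w, K (v, w) * u w ^ p := lintegral_mono h1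
    _ = C ^ (p - 1) * ∫⁻ w, (∫⁻ v, K (v, w)) * u w ^ p := by
        rw [lintegral_const_mul' _ _ (ENNReal.rpow_ne_top_of_nonneg (by linarith) hC),
          lintegral_lintegral_swap (by fun_prop)]
        congr 1
        refine lintegral_congr fun w => ?_
        rw [lintegral_mul_const _ (by fun_prop)]
    _ ≤ C ^ (p - 1) * ∫⁻ w, C * u w ^ p := by
        gcongr with w
        exact h' w
    _ = _ := by rw [lintegral_const_mul _ (by fun_prop), mul_assoc]

theorem exists_lintegral_gradOp_rpow_le {p c : ℝ} (hp : 2 ≤ p) (hc : 0 < c) :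
    ∃ C : ℝ≥0∞, C ≠ ∞ ∧ ∀ u : E3 → ℝ≥0∞, Measurable u →
      ∫⁻ v, gradOp c u v ^ p ≤ C * ∫⁻ w, u w ^ p := by
  obtain ⟨C, hC, h, h'⟩ := exists_lintegral_gradKernel_le hc
  exact ⟨C ^ (p - 1) * C, ENNReal.mul_ne_top (ENNReal.rpow_ne_top_of_nonneg (by linarith) hC) hC,
    fun u hu => lintegral_kernel_rpow_le (K := fun z => ENNReal.ofReal (gradKernel c z.1 z.2))
      (by linarith) (by fun_prop) hC h h' hu⟩

/-! ### Integration along rays -/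

/-- The integral of `exp (-a s) F(x - s v, v)` over the times `0 < s ≤ diam Ω / |v|` with
`x - s v ∈ Ω`. -/
noncomputable def rayOp (Ω : Set E3) (a : ℝ) (F : E3 × E3 → ℝ≥0∞) (y : E3 × E3) : ℝ≥0∞ :=
  ∫⁻ s in Ioi (0 : ℝ), ENNReal.ofReal (Real.exp (-a * s)) *
    ((Iic (Metric.diam Ω)).indicator 1 (s * ‖y.2‖) *
      (Ω ×ˢ univ).indicator F (y.1 - s • y.2, y.2))

theorem measurable_rayOp {Ω : Set E3} (hΩ : MeasurableSet Ω) (a : ℝ) {F : E3 × E3 → ℝ≥0∞}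
    (hF : Measurable F) : Measurable (rayOp Ω a F) := by
  unfold rayOp
  refine Measurable.lintegral_prod_right' (f := fun z : (E3 × E3) × ℝ =>
    ENNReal.ofReal (Real.exp (-a * z.2)) * ((Iic (Metric.diam Ω)).indicator 1 (z.2 * ‖z.1.2‖) *
      (Ω ×ˢ univ).indicator F (z.1.1 - z.2 • z.1.2, z.1.2))) ?_
  have h1 : Measurable fun t : ℝ => (Iic (Metric.diam Ω)).indicator (1 : ℝ → ℝ≥0∞) t :=
    measurable_one.indicator measurableSet_Iic
  have h2 := hF.indicator (hΩ.prod (MeasurableSet.univ (α := E3)))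
  refine Measurable.mul (by fun_prop) (Measurable.mul ?_ ?_)
  · exact h1.comp (by fun_prop)
  · exact h2.comp (by fun_prop)

theorem lintegral_exp_neg_mul_Ioi {a : ℝ} (ha : 0 < a) :
    ∫⁻ s in Ioi (0 : ℝ), ENNReal.ofReal (Real.exp (-a * s)) = ENNReal.ofReal a⁻¹ := by
  rw [← ofReal_integral_eq_lintegral_ofReal (integrableOn_exp_mul_Ioi (by linarith) 0)
    (ae_of_all _ fun _ => (Real.exp_pos _).le), integral_exp_mul_Ioi (by linarith)]
  congr 1
  simp [neg_div_neg_eq]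

/-- A bound in terms of an arbitrary upper bound of the weighted length of the rays. -/
theorem lintegral_rayOp_rpow_le {Ω : Set E3} (hΩ : MeasurableSet Ω) {a p : ℝ} (ha : 0 < a)
    (hp : 1 < p) {F : E3 × E3 → ℝ≥0∞} (hF : Measurable F) {ℓ : E3 → ℝ≥0∞} (hℓm : Measurable ℓ)
    (hℓ : ∀ v, v ≠ 0 → ∫⁻ s in Ioi (0 : ℝ), ENNReal.ofReal (Real.exp (-a * s)) *
      (Iic (Metric.diam Ω)).indicator 1 (s * ‖v‖) ≤ ℓ v) :
    ∫⁻ y in Ω ×ˢ univ, rayOp Ω a F y ^ p ≤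
      ENNReal.ofReal a⁻¹ ^ (p - 1) * ∫⁻ y in Ω ×ˢ univ, ℓ y.2 * F y ^ p := by
  have hM : ENNReal.ofReal a⁻¹ ^ (p - 1) ≠ ∞ := ENNReal.rpow_ne_top_of_nonneg (by linarith) (by simp)
  have hI : Measurable fun t : ℝ => (Iic (Metric.diam Ω)).indicator (1 : ℝ → ℝ≥0∞) t :=
    measurable_one.indicator measurableSet_Iic
  have hI' (v : E3) : Measurable fun s : ℝ => (Iic (Metric.diam Ω)).indicator (1 : ℝ → ℝ≥0∞) (s * ‖v‖) :=
    hI.comp (by fun_prop)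
  set H : E3 × E3 → ℝ≥0∞ := (Ω ×ˢ univ).indicator F with hH
  have hHm : Measurable H := hF.indicator (hΩ.prod MeasurableSet.univ)
  -- Hölder against the finite measure `e^{-as} ds`; the indicator is its own `p`-th power.
  have h1 : ∀ y : E3 × E3, rayOp Ω a F y ^ p ≤ ENNReal.ofReal a⁻¹ ^ (p - 1) *
      ∫⁻ s in Ioi (0 : ℝ), ENNReal.ofReal (Real.exp (-a * s)) *
        ((Iic (Metric.diam Ω)).indicator 1 (s * ‖y.2‖) * H (y.1 - s • y.2, y.2) ^ p) := fun y => by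
    refine (lintegral_mul_rpow_le _ hp (by fun_prop)
      ((hI' y.2).mul (hHm.comp (by fun_prop)))).trans ?_
    rw [lintegral_exp_neg_mul_Ioi ha]
    gcongr with s
    simp only [Pi.mul_apply, Function.comp_apply]
    rw [ENNReal.mul_rpow_of_nonneg _ _ (by linarith)]
    gcongr
    by_cases hs : s * ‖y.2‖ ∈ Iic (Metric.diam Ω)
    · simp [hs]
    · simp [hs, show 0 < p by linarith]
  have hJ : Measurable fun z : (E3 × E3) × ℝ => ENNReal.ofReal (Real.exp (-a * z.2)) *
        ((Iic (Metric.diam Ω)).indicator 1 (z.2 * ‖z.1.2‖) * H (z.1.1 - z.2 • z.1.2, z.1.2) ^ p) := by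
    refine Measurable.mul (by fun_prop) (Measurable.mul (hI.comp (by fun_prop)) ?_)
    exact (hHm.comp (by fun_prop)).pow_const p
  calc ∫⁻ y in Ω ×ˢ univ, rayOp Ω a F y ^ p
      ≤ ∫⁻ y : E3 × E3, ENNReal.ofReal a⁻¹ ^ (p - 1) *
      ∫⁻ s in Ioi (0 : ℝ), ENNReal.ofReal (Real.exp (-a * s)) *
        ((Iic (Metric.diam Ω)).indicator 1 (s * ‖y.2‖) * H (y.1 - s • y.2, y.2) ^ p) :=
        (lintegral_mono h1).trans (setLIntegral_le_lintegral _ _)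
    _ = ENNReal.ofReal a⁻¹ ^ (p - 1) * ∫⁻ v : E3, ∫⁻ s in Ioi (0 : ℝ), ∫⁻ x : E3,
        ENNReal.ofReal (Real.exp (-a * s)) *
        ((Iic (Metric.diam Ω)).indicator 1 (s * ‖v‖) * H (x - s • v, v) ^ p) := by
        rw [lintegral_const_mul' _ _ hM, Measure.volume_eq_prod, lintegral_prod_symm _
          (hJ.lintegral_prod_right').aemeasurable]
        congr 1
        refine lintegral_congr fun v => ?_
        rw [lintegral_lintegral_swap]
        have : Measurable fun z : E3 × ℝ => ((z.1, v), z.2) := by fun_prop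
        exact (hJ.comp this).aemeasurable
    _ = ENNReal.ofReal a⁻¹ ^ (p - 1) * ∫⁻ v : E3, (∫⁻ s in Ioi (0 : ℝ), 
        ENNReal.ofReal (Real.exp (-a * s)) * (Iic (Metric.diam Ω)).indicator 1 (s * ‖v‖)) *
          ∫⁻ x : E3, H (x, v) ^ p := by
        congr 1
        refine lintegral_congr fun v => ?_
        have hm : Measurable fun s : ℝ => ENNReal.ofReal (Real.exp (-a * s)) *
            (Iic (Metric.diam Ω)).indicator 1 (s * ‖v‖) := Measurable.mul (by fun_prop) (hI' v)
        rw [← lintegral_mul_const _ hm]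
        refine lintegral_congr fun s => ?_
        simp only [← mul_assoc]
        have : Measurable fun x : E3 => H (x - s • v, v) ^ p := (hHm.comp (by fun_prop)).pow_const p
        rw [lintegral_const_mul _ this]
        congr 1
        -- For fixed `s` and `v` the shift by `s v` preserves Lebesgue measure. The extension by
        -- zero in `rayOp` lets the integral run over the whole space.
        exact lintegral_sub_right_eq_self (fun x => H (x, v) ^ p) (s • v)
    _ ≤ ENNReal.ofReal a⁻¹ ^ (p - 1) * ∫⁻ v : E3, ∫⁻ x : E3, ℓ v * H (x, v) ^ p := by
        gcongr 1
        refine lintegral_mono_ae ?_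
        filter_upwards [Measure.ae_ne volume (0 : E3)] with v hv
        have : Measurable fun x : E3 => H (x, v) ^ p := (hHm.comp (by fun_prop)).pow_const p
        rw [lintegral_const_mul _ this]
        gcongr
        exact hℓ v hv
    _ = _ := by
        congr 1
        rw [← lintegral_prod_symm (μ := volume) (ν := volume) (fun y : E3 × E3 => ℓ y.2 * H y ^ p)
          (by fun_prop), ← Measure.volume_eq_prod,
          ← lintegral_indicator (hΩ.prod MeasurableSet.univ)]
        refine lintegral_congr fun y => ?_
        by_cases hy : y ∈ Ω ×ˢ (univ : Set E3)
        · simp only [hH, indicator_of_mem hy]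
        · simp only [hH, indicator_of_notMem hy, ENNReal.zero_rpow_of_pos (by linarith : 0 < p), mul_zero]

theorem lintegral_rayOp_rpow_le_of_weight {Ω : Set E3} (hΩ : MeasurableSet Ω) {a p : ℝ} (ha : 0 < a)
    (hp : 1 < p) {u F : E3 × E3 → ℝ≥0∞} (hu : Measurable u) (hF : Measurable F)
    {ℓ : E3 → ℝ≥0∞} (hℓm : Measurable ℓ) {M : ℝ≥0∞}
    (hℓ : ∀ v, v ≠ 0 → ∫⁻ s in Ioi (0 : ℝ), ENNReal.ofReal (Real.exp (-a * s)) *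
      (Iic (Metric.diam Ω)).indicator 1 (s * ‖v‖) ≤ ℓ v)
    (hM : ∀ x, ∫⁻ v, ℓ v * F (x, v) ^ p ≤ M * ∫⁻ w, u (x, w) ^ p) :
    ∫⁻ y in Ω ×ˢ univ, rayOp Ω a F y ^ p ≤
      ENNReal.ofReal a⁻¹ ^ (p - 1) * M * ∫⁻ y in Ω ×ˢ univ, u y ^ p := by
  refine (lintegral_rayOp_rpow_le hΩ ha hp hF hℓm hℓ).trans ?_
  rw [mul_assoc]
  gcongr 1
  rw [Measure.volume_eq_prod, ← Measure.prod_restrict, Measure.restrict_univ,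
    lintegral_prod _ (by fun_prop), lintegral_prod _ (by fun_prop), ← lintegral_const_mul _ (by fun_prop)]
  exact lintegral_mono hM

theorem lintegral_ray_length_le_inv {a : ℝ} (ha : 0 < a) (d : ℝ) (v : E3) :
    ∫⁻ s in Ioi (0 : ℝ), ENNReal.ofReal (Real.exp (-a * s)) *
      (Iic d).indicator 1 (s * ‖v‖) ≤ ENNReal.ofReal a⁻¹ := by
  rw [← lintegral_exp_neg_mul_Ioi ha]
  refine lintegral_mono fun s => ?_
  exact (mul_le_mul_right (indicator_le_self' (fun _ _ => zero_le) _) _).trans (by simp)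

theorem lintegral_ray_length_le_diam {a : ℝ} (ha : 0 < a) (d : ℝ) {v : E3} (hv : v ≠ 0) :
    ∫⁻ s in Ioi (0 : ℝ), ENNReal.ofReal (Real.exp (-a * s)) *
      (Iic d).indicator 1 (s * ‖v‖) ≤ ENNReal.ofReal d * ‖v‖ₑ⁻¹ := by
  have hv' : 0 < ‖v‖ := norm_pos_iff.2 hv
  calc _ ≤ ∫⁻ s in Ioi (0 : ℝ), (Iic (d / ‖v‖)).indicator 1 s := by
        refine setLIntegral_mono' measurableSet_Ioi fun s hs => ?_
        have : ENNReal.ofReal (Real.exp (-a * s)) ≤ 1 := by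
          rw [← ENNReal.ofReal_one]
          exact ENNReal.ofReal_le_ofReal (Real.exp_le_one_iff.2 (by nlinarith [mem_Ioi.1 hs]))
        refine (mul_le_mul_left this _).trans (le_of_eq ?_)
        rw [one_mul]
        simp only [indicator, mem_Iic, le_div_iff₀ hv', Pi.one_apply]
    _ = ENNReal.ofReal (d / ‖v‖) := by
        rw [lintegral_indicator_one measurableSet_Iic, Measure.restrict_apply measurableSet_Iic,
          inter_comm, Ioi_inter_Iic, Real.volume_Ioc, sub_zero]
    _ = _ := by
        rw [div_eq_mul_inv, ENNReal.ofReal_mul' (by positivity), ENNReal.ofReal_inv_of_pos hv', ofReal_norm]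

/-! ### Velocity operators integrated along rays -/

theorem exists_lintegral_rayOp_gaussOp_le {p c a : ℝ} (hp : 2 ≤ p) (hc : 0 < c) (ha : 0 < a) :
    ∃ C : ℝ≥0∞, C ≠ ∞ ∧ ∀ (Ω : Set E3) (u : E3 × E3 → ℝ≥0∞), MeasurableSet Ω → Measurable u →
      ∫⁻ y in Ω ×ˢ univ, rayOp Ω a (fun y => gaussOp c (fun w => u (y.1, w)) y.2) y ^ p ≤
        C * ∫⁻ y in Ω ×ˢ univ, u y ^ p := by
  obtain ⟨C, hC, h⟩ := exists_lintegral_mul_gaussOp_rpow_le hp hc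
  obtain ⟨M, hM, hM'⟩ := exists_lintegral_rpow_norm_mul_gaussE_le (b := 0) le_rfl (by norm_num) hc
  refine ⟨ENNReal.ofReal a⁻¹ ^ (p - 1) * (C * (ENNReal.ofReal a⁻¹ * M)), ?_, fun Ω u hΩ hu => ?_⟩
  · exact ENNReal.mul_ne_top (ENNReal.rpow_ne_top_of_nonneg (by linarith) (by simp))
      (ENNReal.mul_ne_top hC (ENNReal.mul_ne_top (by simp) hM))
  refine lintegral_rayOp_rpow_le_of_weight hΩ ha (by linarith : 1 < p) hu
    (measurable_gaussOp c measurable_snd (u := fun z => u (z.1.1, z.2)) (by fun_prop))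
    (measurable_const (a := ENNReal.ofReal a⁻¹)) (fun v _ => lintegral_ray_length_le_inv ha _ v) fun x => ?_
  refine h (fun _ => ENNReal.ofReal a⁻¹) _ _ measurable_const (by fun_prop) fun w => ?_
  rw [lintegral_const_mul _ (by fun_prop)]
  gcongr
  simpa using hM' w

theorem exists_lintegral_rayOp_gradOp_le {p c a : ℝ} (hp : 2 ≤ p) (hc : 0 < c) (ha : 0 < a) :
    ∃ C : ℝ≥0∞, C ≠ ∞ ∧ ∀ (Ω : Set E3) (u : E3 × E3 → ℝ≥0∞), MeasurableSet Ω → Measurable u →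
      ∫⁻ y in Ω ×ˢ univ, rayOp Ω a (fun y => gradOp c (fun w => u (y.1, w)) y.2) y ^ p ≤
        C * ∫⁻ y in Ω ×ˢ univ, u y ^ p := by
  obtain ⟨C, hC, h⟩ := exists_lintegral_gradOp_rpow_le hp hc
  refine ⟨ENNReal.ofReal a⁻¹ ^ (p - 1) * (ENNReal.ofReal a⁻¹ * C), ?_, fun Ω u hΩ hu => ?_⟩
  · exact ENNReal.mul_ne_top (ENNReal.rpow_ne_top_of_nonneg (by linarith) (by simp))
      (ENNReal.mul_ne_top (by simp) hC)
  refine lintegral_rayOp_rpow_le_of_weight hΩ ha (by linarith : 1 < p) hu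
    (measurable_gradOp c measurable_snd (u := fun z => u (z.1.1, z.2)) (by fun_prop))
    (measurable_const (a := ENNReal.ofReal a⁻¹)) (fun v _ => lintegral_ray_length_le_inv ha _ v) fun x => ?_
  rw [lintegral_const_mul' _ _ (by simp), mul_assoc]
  gcongr
  exact h _ (by fun_prop)

/-- Here the length of the rays is measured by `diam Ω / |v|` instead of `1/a`; the singular weight
`|v|⁻¹` is absorbed by the Gaussian kernel. -/
theorem exists_lintegral_rayOp_gaussOp_le_diam {p c a : ℝ} (hp : 2 ≤ p) (hc : 0 < c) (ha : 0 < a) :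
    ∃ C : ℝ≥0∞, C ≠ ∞ ∧ ∀ (Ω : Set E3) (u : E3 × E3 → ℝ≥0∞), MeasurableSet Ω → Measurable u →
      ∫⁻ y in Ω ×ˢ univ, rayOp Ω a (fun y => gaussOp c (fun w => u (y.1, w)) y.2) y ^ p ≤
        C * ENNReal.ofReal (Metric.diam Ω) * ∫⁻ y in Ω ×ˢ univ, u y ^ p := by
  obtain ⟨C, hC, h⟩ := exists_lintegral_mul_gaussOp_rpow_le hp hc
  obtain ⟨M, hM, hM'⟩ := exists_lintegral_rpow_norm_mul_gaussE_le (b := 1) zero_le_one (by norm_num) hc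
  refine ⟨ENNReal.ofReal a⁻¹ ^ (p - 1) * (C * M), ?_, fun Ω u hΩ hu => ?_⟩
  · exact ENNReal.mul_ne_top (ENNReal.rpow_ne_top_of_nonneg (by linarith) (by simp))
      (ENNReal.mul_ne_top hC hM)
  have := lintegral_rayOp_rpow_le_of_weight (M := C * (ENNReal.ofReal (Metric.diam Ω) * M)) hΩ ha
    (by linarith : 1 < p) hu
    (measurable_gaussOp c measurable_snd (u := fun z => u (z.1.1, z.2)) (by fun_prop))
    (ℓ := fun v => ENNReal.ofReal (Metric.diam Ω) * ‖v‖ₑ⁻¹) (by fun_prop)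
    (fun v hv => lintegral_ray_length_le_diam ha _ hv) fun x => ?_
  · refine this.trans (le_of_eq ?_)
    ring
  refine h (fun v => ENNReal.ofReal (Metric.diam Ω) * ‖v‖ₑ⁻¹) _ _ (by fun_prop) (by fun_prop) fun w => ?_
  simp only [mul_assoc]
  rw [lintegral_const_mul _ (by fun_prop)]
  gcongr
  simpa [ENNReal.rpow_neg_one] using hM' w

/-! ### The boundary term -/

namespace StationaryBoltzmann.IsBoundedConvexC2Domain

variable {Ω : Set E3} (hΩ : IsBoundedConvexC2Domain Ω)
include hΩ

theorem aemeasurable_exitPoint :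
    AEMeasurable (fun y : E3 × E3 => exitPoint Ω y.1 y.2) (volume.restrict (Ω ×ˢ univ)) := by
  have h := hΩ.continuousOn_exitPoint.aemeasurable (μ := volume)
    (hΩ.isOpen.measurableSet.prod (measurableSet_singleton (0 : E3)).compl)
  have e : (volume : Measure E3).restrict {0}ᶜ = volume :=
    Measure.restrict_eq_self_of_ae_mem (Measure.ae_ne volume 0)
  rw [Measure.volume_eq_prod, ← Measure.prod_restrict, e] at h
  rwa [Measure.volume_eq_prod, ← Measure.prod_restrict, Measure.restrict_univ]

theorem measurable_indicator_outwardNormal :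
    Measurable ((frontier Ω).indicator (outwardNormal Ω)) := by
  classical
  rw [← piecewise_eq_indicator]
  exact hΩ.continuousOn_outwardNormal.measurable_piecewise continuousOn_const
    isClosed_frontier.measurableSet

theorem exitTime_neg_le {C₃ : ℝ} (hC₃ : IsChordConstant Ω C₃) {z v : E3} (hv0 : v ≠ 0)
    (hz : z ∈ frontier Ω) (hv : inner ℝ (outwardNormal Ω z) v < 0) :
    ENNReal.ofReal (exitTime Ω z (-v)) ≤
      ENNReal.ofReal C₃ * (‖(inner ℝ (outwardNormal Ω z) v : ℝ)‖ₑ * ‖v‖ₑ ^ (-2 : ℝ)) := by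
  have hv' : 0 < ‖v‖ := norm_pos_iff.2 hv0
  have h := hΩ.exitTime_mul_norm_le_of_isChordConstant hC₃ hz hv
  have h2 : exitTime Ω z (-v) ≤ C₃ * (|inner ℝ (outwardNormal Ω z) v| * (‖v‖ ^ 2)⁻¹) := by
    rw [← le_div_iff₀ hv'] at h
    refine h.trans (le_of_eq ?_)
    field_simp
  refine (ENNReal.ofReal_le_ofReal h2).trans (le_of_eq ?_)
  rw [ENNReal.ofReal_mul hC₃.1.le, ENNReal.ofReal_mul (abs_nonneg _), ENNReal.ofReal_inv_of_pos (by positivity),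
    ENNReal.ofReal_pow hv'.le, ofReal_norm, ← Real.norm_eq_abs, ofReal_norm, ENNReal.rpow_neg]
  norm_num

end StationaryBoltzmann.IsBoundedConvexC2Domain

/-- With `t = |n·v|`, one factor `t` is the Jacobian of the exit map, another comes from the chord
bound, and `t^{-p}` from the derivative of the exit time. At `t = 0` the left side vanishes because
`0 * ∞ = 0`. -/
theorem enorm_rpow_collect {p : ℝ} (hp : 2 ≤ p) {t : ℝ≥0∞} (ht : t ≠ ∞) (c y A : ℝ≥0∞) :
    t * (c * (t * y)) * (t⁻¹ * A) ^ p ≤ c * (t ^ (2 - p) * y * A ^ p) := by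
  rcases eq_or_ne t 0 with rfl | h0
  · simp
  · rw [ENNReal.mul_rpow_of_nonneg _ _ (by linarith), ENNReal.inv_rpow, ← ENNReal.rpow_neg,
      ENNReal.rpow_sub _ _ h0 ht, ENNReal.rpow_neg, ENNReal.div_eq_inv_mul]
    refine le_of_eq ?_
    norm_num
    ring

/-- The contribution of the boundary values: `|n(q)·v|⁻¹` times the integral operator with kernel
`|v-w|⁻¹ exp (-c |v-w|²)` evaluated at the exit point `q(x, v)`. -/
noncomputable def exitOp (Ω : Set E3) (c : ℝ) (u : E3 × E3 → ℝ≥0∞) (y : E3 × E3) : ℝ≥0∞ :=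
  ‖(inner ℝ (outwardNormal Ω (exitPoint Ω y.1 y.2)) y.2 : ℝ)‖ₑ⁻¹ *
    gaussOp c (fun w => u (exitPoint Ω y.1 y.2, w)) y.2

/-- A measurable function of the exit point that agrees with `exitOp`. -/
noncomputable def exitOpAux (Ω : Set E3) (c : ℝ) (u : E3 × E3 → ℝ≥0∞) (z v : E3) : ℝ≥0∞ :=
  ‖(inner ℝ ((frontier Ω).indicator (outwardNormal Ω) z) v : ℝ)‖ₑ⁻¹ * gaussOp c (fun w => u (z, w)) v

namespace StationaryBoltzmann.IsBoundedConvexC2Domain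

variable {Ω : Set E3} (hΩ : IsBoundedConvexC2Domain Ω)
include hΩ

theorem measurable_exitOpAux (c : ℝ) {u : E3 × E3 → ℝ≥0∞} (hu : Measurable u) :
    Measurable fun y : E3 × E3 => exitOpAux Ω c u y.1 y.2 := by
  have hn := hΩ.measurable_indicator_outwardNormal
  unfold exitOpAux
  have := measurable_gaussOp c measurable_snd (u := fun z : (E3 × E3) × E3 => u (z.1.1, z.2)) (by fun_prop)
  fun_prop

theorem exitOp_eq {c : ℝ} {u : E3 × E3 → ℝ≥0∞} {y : E3 × E3} (hx : y.1 ∈ Ω) (hv : y.2 ≠ 0) :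
    exitOp Ω c u y = exitOpAux Ω c u (exitPoint Ω y.1 y.2) y.2 := by
  unfold exitOp exitOpAux
  rw [indicator_of_mem (hΩ.exitPoint_mem_frontier hv hx)]

theorem exitOp_ae_eq (c : ℝ) (u : E3 × E3 → ℝ≥0∞) :
    exitOp Ω c u =ᵐ[volume.restrict (Ω ×ˢ univ)]
      fun y => exitOpAux Ω c u (exitPoint Ω y.1 y.2) y.2 := by
  have h0 : ∀ᵐ y : E3 × E3, y.2 ≠ 0 := by
    rw [Measure.volume_eq_prod]
    exact Measure.quasiMeasurePreserving_snd.ae (Measure.ae_ne volume 0)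
  filter_upwards [ae_restrict_mem (hΩ.isOpen.measurableSet.prod MeasurableSet.univ),
    ae_restrict_of_ae h0] with y hy hv
  exact hΩ.exitOp_eq hy.1 hv

theorem aemeasurable_exitOp (c : ℝ) {u : E3 × E3 → ℝ≥0∞} (hu : Measurable u) :
    AEMeasurable (exitOp Ω c u) (volume.restrict (Ω ×ˢ univ)) :=
  ((hΩ.measurable_exitOpAux c hu).comp_aemeasurable
    (hΩ.aemeasurable_exitPoint.prodMk measurable_snd.aemeasurable)).congr (hΩ.exitOp_ae_eq c u).symm

theorem lintegral_exitOp_rpow_le_fiber {p c C₃ : ℝ} (hp : 2 ≤ p) (hC₃ : IsChordConstant Ω C₃)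
    {u : E3 × E3 → ℝ≥0∞} (hu : Measurable u) {v : E3} (hv0 : v ≠ 0) :
    ∫⁻ x in Ω, exitOpAux Ω c u (exitPoint Ω x v) v ^ p ≤ 8 * (surfaceFactor : ℝ≥0∞)⁻¹ *
      ∫⁻ z in frontier Ω, ENNReal.ofReal C₃ * (‖(inner ℝ ((frontier Ω).indicator (outwardNormal Ω) z) v : ℝ)‖ₑ ^ (2 - p) *
        ‖v‖ₑ ^ (-2 : ℝ) * gaussOp c (fun w => u (z, w)) v ^ p)
        ∂(Measure.euclideanHausdorffMeasure 2 : Measure E3) := by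
  have hn := hΩ.measurable_indicator_outwardNormal
  have hm : Measurable fun z => exitOpAux Ω c u z v ^ p :=
    ((hΩ.measurable_exitOpAux c hu).comp (measurable_prodMk_right (y := v))).pow_const p
  refine (hΩ.lintegral_exitPoint_le hv0 (w := fun z => ENNReal.ofReal C₃ *
    (‖(inner ℝ ((frontier Ω).indicator (outwardNormal Ω) z) v : ℝ)‖ₑ * ‖v‖ₑ ^ (-2 : ℝ)))
    (fun z hz hv => ?_) (Measurable.aemeasurable (by fun_prop)) hm).trans ?_
  · rw [indicator_of_mem hz]
    exact hΩ.exitTime_neg_le hC₃ hv0 hz hv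
  gcongr 1
  refine setLIntegral_mono' isClosed_frontier.measurableSet fun z hz => ?_
  rw [exitOpAux, indicator_of_mem hz]
  exact enorm_rpow_collect hp enorm_ne_top _ _ _

end StationaryBoltzmann.IsBoundedConvexC2Domain

/-- For fixed `v` the integral over `Ω` is moved to the boundary; then, for fixed `z`, the velocity
integral has the weight `|n(z)·v|^{2-p} |v|⁻²`, whose Gaussian integrals are bounded uniformly in
the normal. Hence the domain enters only through `C₃`. -/
theorem exists_lintegral_exitOp_le {p c : ℝ} (hp : 2 ≤ p) (hp3 : p < 3) (hc : 0 < c) :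
    ∃ C : ℝ≥0∞, C ≠ ∞ ∧ ∀ (Ω : Set E3), IsBoundedConvexC2Domain Ω → ∀ (C₃ : ℝ), IsChordConstant Ω C₃ →
      ∀ u : E3 × E3 → ℝ≥0∞, Measurable u →
      ∫⁻ y in Ω ×ˢ univ, exitOp Ω c u y ^ p ≤
        C * ENNReal.ofReal C₃ * ∫⁻ y, u y ^ p ∂boundaryMeasure Ω := by
  obtain ⟨C, hC, h⟩ := exists_lintegral_mul_gaussOp_rpow_le hp hc
  obtain ⟨M, hM, hM'⟩ := exists_lintegral_inner_rpow_mul_gaussE_le hp hp3 hc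
  refine ⟨8 * (surfaceFactor : ℝ≥0∞)⁻¹ * (C * M), ?_, fun Ω hΩ C₃ hC₃ u hu => ?_⟩
  · refine ENNReal.mul_ne_top (ENNReal.mul_ne_top (by simp) ?_) (ENNReal.mul_ne_top hC hM)
    simpa using surfaceFactor_ne_zero
  have hn := hΩ.measurable_indicator_outwardNormal
  have : IsFiniteMeasure ((Measure.euclideanHausdorffMeasure 2 : Measure E3).restrict (frontier Ω)) :=
    ⟨by rw [Measure.restrict_apply_univ]; exact hΩ.surface_frontier_lt_top⟩
  have hg := measurable_gaussOp c measurable_snd (u := fun z : (E3 × E3) × E3 => u (z.1.1, z.2)) (by fun_prop)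
  have hJ : Measurable fun y : E3 × E3 =>
      ENNReal.ofReal C₃ * (‖(inner ℝ ((frontier Ω).indicator (outwardNormal Ω) y.1) y.2 : ℝ)‖ₑ ^ (2 - p) *
        ‖y.2‖ₑ ^ (-2 : ℝ) * gaussOp c (fun w => u (y.1, w)) y.2 ^ p) := by
    fun_prop
  have hK : 8 * (surfaceFactor : ℝ≥0∞)⁻¹ ≠ ∞ :=
    ENNReal.mul_ne_top (by simp) (by simpa using surfaceFactor_ne_zero)
  calc ∫⁻ y in Ω ×ˢ univ, exitOp Ω c u y ^ p
      = ∫⁻ v : E3, ∫⁻ x in Ω, exitOpAux Ω c u (exitPoint Ω x v) v ^ p := by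
        rw [lintegral_congr_ae (g := fun y => exitOpAux Ω c u (exitPoint Ω y.1 y.2) y.2 ^ p)
          ((hΩ.exitOp_ae_eq c u).mono fun y hy => by simp only [hy])]
        have := ((hΩ.measurable_exitOpAux c hu).pow_const p).comp_aemeasurable
          (hΩ.aemeasurable_exitPoint.prodMk measurable_snd.aemeasurable)
        rw [Measure.volume_eq_prod, ← Measure.prod_restrict, Measure.restrict_univ] at this ⊢
        exact lintegral_prod_symm _ this
    _ ≤ ∫⁻ v : E3, 8 * (surfaceFactor : ℝ≥0∞)⁻¹ *
      ∫⁻ z in frontier Ω, ENNReal.ofReal C₃ * (‖(inner ℝ ((frontier Ω).indicator (outwardNormal Ω) z) v : ℝ)‖ₑ ^ (2 - p) *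
        ‖v‖ₑ ^ (-2 : ℝ) * gaussOp c (fun w => u (z, w)) v ^ p)
        ∂(Measure.euclideanHausdorffMeasure 2 : Measure E3) := by
        refine lintegral_mono_ae ?_
        filter_upwards [Measure.ae_ne volume (0 : E3)] with v hv
        exact hΩ.lintegral_exitOp_rpow_le_fiber hp hC₃ hu hv
    _ = 8 * (surfaceFactor : ℝ≥0∞)⁻¹ * ∫⁻ z in frontier Ω, ENNReal.ofReal C₃ *
        (∫⁻ v : E3, (‖(inner ℝ ((frontier Ω).indicator (outwardNormal Ω) z) v : ℝ)‖ₑ ^ (2 - p) *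
        ‖v‖ₑ ^ (-2 : ℝ)) * gaussOp c (fun w => u (z, w)) v ^ p)
        ∂(Measure.euclideanHausdorffMeasure 2 : Measure E3) := by
        rw [lintegral_const_mul' _ _ hK, lintegral_lintegral_swap]
        · congr 1
          refine lintegral_congr fun z => ?_
          rw [lintegral_const_mul' _ _ ENNReal.ofReal_ne_top]
        · exact (hJ.comp measurable_swap).aemeasurable
    _ ≤ 8 * (surfaceFactor : ℝ≥0∞)⁻¹ * ∫⁻ z in frontier Ω, ENNReal.ofReal C₃ *
        (C * M * ∫⁻ w, u (z, w) ^ p) ∂(Measure.euclideanHausdorffMeasure 2 : Measure E3) := by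
        gcongr 1
        refine setLIntegral_mono' isClosed_frontier.measurableSet fun z hz => ?_
        gcongr 1
        refine h _ _ M (by fun_prop) (by fun_prop) fun w => ?_
        rw [indicator_of_mem hz]
        exact hM' _ (hΩ.norm_outwardNormal hz) w
    _ = _ := by
        rw [lintegral_const_mul' _ _ ENNReal.ofReal_ne_top, lintegral_const_mul' _ _ (ENNReal.mul_ne_top hC hM),
          boundaryMeasure, lintegral_prod _ (by fun_prop)]
        ring

open scoped ENNReal NNReal

/-! ### Weighted kernel bounds -/

/-- With `r = |v-w|` and `t = (|v|²-|w|²)/r` one has `|v|² - |w|² = r t ≤ (r² + t²)/2`. Transferring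
the weight from `v` to `w` therefore costs `α/2` in the exponent, and `(1-ρ)/4 - α/2` stays positive
for `α < (1-ρ)/2`. -/
theorem gaussFactor_mul_exp_le {ρ α : ℝ} (hα : 0 ≤ α) (v w : E3) (hvw : v ≠ w) :
    gaussFactor ρ v w * Real.exp (α * ‖v‖ ^ 2) ≤
      gradKernelExp ((1 - ρ) / 4 - α / 2) v w * Real.exp (α * ‖w‖ ^ 2) := by
  unfold gaussFactor gradKernelExp
  rw [← Real.exp_add, ← Real.exp_add, Real.exp_le_exp]
  have hr : 0 < ‖v - w‖ := norm_pos_iff.2 (sub_ne_zero.2 hvw)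
  set r := ‖v - w‖
  set t := (‖v‖ ^ 2 - ‖w‖ ^ 2) / r with ht
  have h1 : ‖v‖ ^ 2 = ‖w‖ ^ 2 + r * t := by rw [ht]; field_simp; ring
  rw [h1]
  nlinarith [mul_nonneg hα (sq_nonneg (r - t))]

theorem gradKernelExp_le {c : ℝ} (hc : 0 < c) (v w : E3) :
    gradKernelExp c v w ≤ Real.exp (-c * ‖v - w‖ ^ 2) := by
  unfold gradKernelExp
  rw [Real.exp_le_exp]
  nlinarith [mul_nonneg hc.le (sq_nonneg ((‖v‖ ^ 2 - ‖w‖ ^ 2) / ‖v - w‖))]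

theorem one_le_weight_rpow {γ : ℝ} (hγ : γ ≤ 1) (v w : E3) : 1 ≤ (1 + ‖v‖ + ‖w‖) ^ (1 - γ) :=
  Real.one_le_rpow (by linarith [norm_nonneg v, norm_nonneg w]) (by linarith)

/-- The factor `(1+|v|+|w|)^{1-γ}` in the denominators is at least `1` and is discarded. For `k`
only the Gaussian in `|v-w|` is kept; for `∇ᵥk` the full exponent is needed to control `1 + |v|`. -/
theorem StationaryBoltzmann.AssumptionA.exists_weighted_kernel_le {ρ γ : ℝ} {ν : E3 → ℝ} {k : E3 → E3 → ℝ}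
    (hA : AssumptionA ρ γ ν k) {α : ℝ} (hα : 0 ≤ α) (hα' : α < (1 - ρ) / 2) :
    ∃ C c : ℝ, 0 < C ∧ 0 < c ∧ ∀ v w, v ≠ w →
      Real.exp (α * ‖v‖ ^ 2) * |k v w| ≤
        C * (‖v - w‖⁻¹ * Real.exp (-c * ‖v - w‖ ^ 2)) * Real.exp (α * ‖w‖ ^ 2) ∧
      Real.exp (α * ‖v‖ ^ 2) * ‖fderiv ℝ (fun u => k u w) v‖ ≤
        C * gradKernel c v w * Real.exp (α * ‖w‖ ^ 2) := by
  obtain ⟨C₁, hC₁, h₁⟩ := hA.k_bound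
  obtain ⟨C₂, hC₂, h₂⟩ := hA.k_deriv_bound
  have hc : 0 < (1 - ρ) / 4 - α / 2 := by linarith
  refine ⟨max C₁ C₂, (1 - ρ) / 4 - α / 2, lt_max_of_lt_left hC₁, hc, fun v w hvw => ?_⟩
  have hr : 0 < ‖v - w‖ := norm_pos_iff.2 (sub_ne_zero.2 hvw)
  have hW := one_le_weight_rpow hA.gamma_le_one v w
  have hg := gaussFactor_mul_exp_le (ρ := ρ) hα v w hvw
  have hg0 : 0 < gaussFactor ρ v w := Real.exp_pos _
  constructor
  · calc Real.exp (α * ‖v‖ ^ 2) * |k v w|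
        ≤ Real.exp (α * ‖v‖ ^ 2) * (C₁ * (1 / (‖v - w‖ * (1 + ‖v‖ + ‖w‖) ^ (1 - γ))) * gaussFactor ρ v w) := by
          gcongr; exact h₁ v w hvw
      _ ≤ Real.exp (α * ‖v‖ ^ 2) * (max C₁ C₂ * (1 / (‖v - w‖ * 1)) * gaussFactor ρ v w) := by
          gcongr; exact le_max_left _ _
      _ = max C₁ C₂ * ‖v - w‖⁻¹ * (gaussFactor ρ v w * Real.exp (α * ‖v‖ ^ 2)) := by
          rw [mul_one, one_div]; ring
      _ ≤ max C₁ C₂ * ‖v - w‖⁻¹ * (Real.exp (-((1 - ρ) / 4 - α / 2) * ‖v - w‖ ^ 2) * Real.exp (α * ‖w‖ ^ 2)) := by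
          have : 0 ≤ max C₁ C₂ := hC₁.le.trans (le_max_left _ _)
          exact mul_le_mul_of_nonneg_left (hg.trans (mul_le_mul_of_nonneg_right (gradKernelExp_le hc v w)
            (Real.exp_pos _).le)) (by positivity)
      _ = _ := by ring
  · calc Real.exp (α * ‖v‖ ^ 2) * ‖fderiv ℝ (fun u => k u w) v‖
        ≤ Real.exp (α * ‖v‖ ^ 2) * (C₂ * ((1 + ‖v‖) / (‖v - w‖ ^ 2 * (1 + ‖v‖ + ‖w‖) ^ (1 - γ))) * gaussFactor ρ v w) := by
          gcongr; exact h₂ v w hvw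
      _ ≤ Real.exp (α * ‖v‖ ^ 2) * (max C₁ C₂ * ((1 + ‖v‖) / (‖v - w‖ ^ 2 * 1)) * gaussFactor ρ v w) := by
          gcongr; exact le_max_right _ _
      _ = max C₁ C₂ * ((1 + ‖v‖) / ‖v - w‖ ^ 2) * (gaussFactor ρ v w * Real.exp (α * ‖v‖ ^ 2)) := by
          rw [mul_one]; ring
      _ ≤ max C₁ C₂ * ((1 + ‖v‖) / ‖v - w‖ ^ 2) *
          (gradKernelExp ((1 - ρ) / 4 - α / 2) v w * Real.exp (α * ‖w‖ ^ 2)) := by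
          have : 0 ≤ max C₁ C₂ := hC₁.le.trans (le_max_left _ _)
          gcongr
      _ = _ := by unfold gradKernel; ring

/-! ### Functions that are differentiable along almost every line -/

/-- The exceptional points form an affine subspace through `w` of dimension at most one. -/
theorem ae_forall_add_smul_ne (b w : E3) : ∀ᵐ v : E3, ∀ t : ℝ, v + t • b ≠ w := by
  have h : (volume : Measure E3) (AffineSubspace.mk' w (Submodule.span ℝ {b}) : Set E3) = 0 := by
    refine Measure.addHaar_affineSubspace _ _ fun h => ?_
    have h2 := congrArg AffineSubspace.direction h
    rw [AffineSubspace.direction_mk', AffineSubspace.direction_top] at h2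
    have h3 := finrank_span_le_card (R := ℝ) ({b} : Set E3)
    rw [h2, finrank_top, finrank_euclideanSpace_fin] at h3
    simp at h3
  filter_upwards [measure_eq_zero_iff_ae_notMem.1 h] with v hv t ht
  apply hv
  rw [SetLike.mem_coe, AffineSubspace.mem_mk', Submodule.mem_span_singleton]
  exact ⟨-t, by rw [← ht, vsub_eq_sub]; module⟩

theorem ae_forall_add_smul_snd_ne (e : E3 × E3) (w : E3) :
    ∀ᵐ y : E3 × E3, ∀ t : ℝ, (y + t • e).2 ≠ w := by
  rw [Measure.volume_eq_prod]
  exact Measure.quasiMeasurePreserving_snd.ae (ae_forall_add_smul_ne e.2 w)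

/-- The increment `V(y+e) - V(y)` has integral zero by translation invariance, and it equals the
integral of `F` over a unit segment; Fubini concludes. Differentiability is required only along
almost every line, since other lines may hit the singularity of `k`. -/
theorem integral_eq_zero_of_hasDerivAt_line {E : Type*} [NormedAddCommGroup E] [NormedSpace ℝ E]
    [MeasurableSpace E] [BorelSpace E] [FiniteDimensional ℝ E] (μ : Measure E) [μ.IsAddHaarMeasure]
    {V F : E → ℝ} (e : E) (hV : Integrable V μ) (hF : Integrable F μ)
    (h : ∀ᵐ y ∂μ, ∀ t : ℝ, HasDerivAt (fun s : ℝ => V (y + s • e)) (F (y + t • e)) t) :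
    ∫ y, F y ∂μ = 0 := by
  have hint : Integrable (fun z : E × ℝ => F (z.1 + z.2 • e)) (μ.prod (volume.restrict (Ioc 0 1))) := by
    have hmp : MeasurePreserving (fun z : ℝ × E => (z.1, z.2 + z.1 • e))
        ((volume.restrict (Ioc (0 : ℝ) 1)).prod μ) ((volume.restrict (Ioc (0 : ℝ) 1)).prod μ) :=
      (MeasurePreserving.id _).skew_product (g := fun t y => y + t • e) (by fun_prop)
        (ae_of_all _ fun t => (measurePreserving_add_right μ (t • e)).map_eq)
    have h1 : Integrable (fun z : ℝ × E => F z.2) ((volume.restrict (Ioc (0 : ℝ) 1)).prod μ) :=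
      hF.comp_snd _
    exact (hmp.integrable_comp_of_integrable h1).swap
  have key : ∀ᵐ y ∂μ, V (y + e) - V y = ∫ t in (0 : ℝ)..1, F (y + t • e) := by
    filter_upwards [h, hint.prod_right_ae] with y hy hi
    have := intervalIntegral.integral_eq_sub_of_hasDerivAt (a := 0) (b := 1) (fun t _ => hy t)
      ((intervalIntegrable_iff_integrableOn_Ioc_of_le zero_le_one).2 hi)
    simpa using this.symm
  have h0 : ∫ y, V (y + e) - V y ∂μ = 0 := by
    rw [integral_sub (hV.comp_add_right e) hV, integral_add_right_eq_self, sub_self]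
  rw [integral_congr_ae key] at h0
  simp only [intervalIntegral.integral_of_le zero_le_one] at h0
  rw [integral_integral_swap hint] at h0
  simpa [integral_add_right_eq_self] using h0

/-! ### The integrand of `S_Ω K h` and its derivative -/

/-- The integrand of `S_Ω K h` at `(x, v)` as a function of the velocity `w` and of the time
`θ τ(x, v)`. -/
noncomputable def rayTerm (Ω : Set E3) (ν : E3 → ℝ) (k : E3 → E3 → ℝ) (h : E3 × E3 → ℝ) (π : ℝ × E3)
    (y : E3 × E3) : ℝ :=
  exitTime Ω y.1 y.2 * Real.exp (-(ν y.2 * (π.1 * exitTime Ω y.1 y.2))) * k y.2 π.2 *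
    h (y.1 - (π.1 * exitTime Ω y.1 y.2) • y.2, π.2)

/-- The derivative of `rayTerm` in the direction `e`. -/
noncomputable def rayTermDeriv (Ω : Set E3) (ν : E3 → ℝ) (k : E3 → E3 → ℝ) (h : E3 × E3 → ℝ)
    (e : E3 × E3) (π : ℝ × E3) (y : E3 × E3) : ℝ :=
  exitTimeDeriv Ω y e * k y.2 π.2 *
    (Real.exp (-(ν y.2 * (π.1 * exitTime Ω y.1 y.2))) *
        h (y.1 - (π.1 * exitTime Ω y.1 y.2) • y.2, π.2) +
      π.1 * (-(ν y.2 * exitTime Ω y.1 y.2) * Real.exp (-(ν y.2 * (π.1 * exitTime Ω y.1 y.2))) *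
          h (y.1 - (π.1 * exitTime Ω y.1 y.2) • y.2, π.2) +
        Real.exp (-(ν y.2 * (π.1 * exitTime Ω y.1 y.2))) *
          fderiv ℝ h (y.1 - (π.1 * exitTime Ω y.1 y.2) • y.2, π.2) (-(exitTime Ω y.1 y.2 • y.2), 0))) +
  exitTime Ω y.1 y.2 * (Real.exp (-(ν y.2 * (π.1 * exitTime Ω y.1 y.2))) *
    (fderiv ℝ (fun u => k u π.2) y.2 e.2 * h (y.1 - (π.1 * exitTime Ω y.1 y.2) • y.2, π.2) +
      k y.2 π.2 * (-(π.1 * exitTime Ω y.1 y.2 * fderiv ℝ ν y.2 e.2) *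
          h (y.1 - (π.1 * exitTime Ω y.1 y.2) • y.2, π.2) +
        fderiv ℝ h (y.1 - (π.1 * exitTime Ω y.1 y.2) • y.2, π.2)
          (e.1 - (π.1 * exitTime Ω y.1 y.2) • e.2, 0))))

theorem StationaryBoltzmann.IsBoundedConvexC2Domain.hasDerivAt_rayTerm {Ω : Set E3}
    (hΩ : IsBoundedConvexC2Domain Ω) {ρ γ : ℝ} {ν : E3 → ℝ} {k : E3 → E3 → ℝ}
    (hA : AssumptionA ρ γ ν k) {h : E3 × E3 → ℝ} (hh : Differentiable ℝ h) (e : E3 × E3) (π : ℝ × E3)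
    {y : E3 × E3} (hx : y.1 ∈ Ω) (hv : y.2 ≠ 0) (hw : y.2 ≠ π.2) :
    HasDerivAt (fun s : ℝ => rayTerm Ω ν k h π (y + s • e)) (rayTermDeriv Ω ν k h e π y) 0 := by
  have hl : HasDerivAt (fun s : ℝ => y + s • e) e 0 := by
    simpa using ((hasDerivAt_id (0 : ℝ)).smul_const e).const_add y
  have hy0 : y + (0 : ℝ) • e = y := by simp
  have hl1 : HasDerivAt (fun s : ℝ => (y + s • e).1) e.1 0 := hl.fst
  have hl2 : HasDerivAt (fun s : ℝ => (y + s • e).2) e.2 0 := hl.snd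
  have hτ : HasDerivAt (fun s : ℝ => exitTime Ω (y + s • e).1 (y + s • e).2) (exitTimeDeriv Ω y e) 0 := by
    have h1 : HasFDerivAt (fun y : E3 × E3 => exitTime Ω y.1 y.2) (exitTimeDeriv Ω y) (y + (0 : ℝ) • e) := by
      rw [hy0]; exact hΩ.hasFDerivAt_exitTime hv hx
    exact h1.comp_hasDerivAt (0 : ℝ) hl
  have hν : HasDerivAt (fun s : ℝ => ν (y + s • e).2) (fderiv ℝ ν y.2 e.2) 0 := by
    have h1 := (hA.nu_differentiable y.2).hasFDerivAt
    have h2 : HasFDerivAt ν (fderiv ℝ ν y.2) (y + (0 : ℝ) • e).2 := by rwa [hy0]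
    exact h2.comp_hasDerivAt (0 : ℝ) hl2
  have hk : HasDerivAt (fun s : ℝ => k (y + s • e).2 π.2) (fderiv ℝ (fun u => k u π.2) y.2 e.2) 0 := by
    have h1 := (hA.k_differentiable y.2 π.2 hw).hasFDerivAt
    have h2 : HasFDerivAt (fun u => k u π.2) (fderiv ℝ (fun u => k u π.2) y.2) (y + (0 : ℝ) • e).2 := by
      rwa [hy0]
    exact h2.comp_hasDerivAt (0 : ℝ) hl2
  have hθ := hτ.const_mul π.1
  have hE := ((hν.mul hθ).neg).exp
  have hp := (hl1.sub (hθ.smul hl2)).prodMk (hasDerivAt_const (0 : ℝ) π.2)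
  have hH := (hh ((y + (0 : ℝ) • e).1 - (π.1 * exitTime Ω (y + (0 : ℝ) • e).1 (y + (0 : ℝ) • e).2) •
    (y + (0 : ℝ) • e).2, π.2)).hasFDerivAt.comp_hasDerivAt (0 : ℝ) hp
  have := ((hτ.mul hE).mul hk).mul hH
  refine this.congr_deriv ?_
  simp only [hy0, Pi.mul_apply, Pi.neg_apply, rayTermDeriv, Pi.sub_apply, Pi.smul_apply', Function.comp_apply]
  set D := fderiv ℝ h (y.1 - (π.1 * exitTime Ω y.1 y.2) • y.2, π.2) with hD
  -- The displacement of `x - θ τ v` splits into a part at fixed time and a part due to the change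
  -- of `τ`; the latter joins the terms with the derivative of `τ`.
  have e1 : D (e.1 - ((π.1 * exitTime Ω y.1 y.2) • e.2 + (π.1 * exitTimeDeriv Ω y e) • y.2), 0) =
      D (e.1 - (π.1 * exitTime Ω y.1 y.2) • e.2, 0) - π.1 * exitTimeDeriv Ω y e * D (y.2, 0) := by
    rw [← smul_eq_mul (π.1 * exitTimeDeriv Ω y e), ← map_smul, ← map_sub]
    congr 1
    ext1 <;> simp <;> abel
  have e2 : D (-(exitTime Ω y.1 y.2 • y.2), 0) = -(exitTime Ω y.1 y.2 * D (y.2, 0)) := by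
    rw [← smul_eq_mul, ← map_smul, ← map_neg]
    congr 1
    ext1 <;> simp
  rw [e1, e2]
  ring

open scoped ENNReal NNReal

/-! ### Integrability of the integrand and of its derivative -/

theorem ofReal_inv_norm_mul_exp_le (c : ℝ) (u : E3) :
    ENNReal.ofReal (‖u‖⁻¹ * Real.exp (-c * ‖u‖ ^ 2)) ≤ ‖u‖ₑ⁻¹ * gaussE c u := by
  rcases eq_or_ne u 0 with rfl | hu
  · simp
  · rw [ENNReal.ofReal_mul (by positivity), ENNReal.ofReal_inv_of_pos (norm_pos_iff.2 hu), ofReal_norm]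
    rfl

/-- A function that dominates, near a compact set, the integrand of `S_Ω K h` and its derivative. -/
noncomputable def rayMajorant (c : ℝ) (v w : E3) : ℝ :=
  gradKernel c v w * ‖v‖⁻¹ + ‖v - w‖⁻¹ * Real.exp (-c * ‖v - w‖ ^ 2) * (‖v‖⁻¹ + ‖v‖⁻¹ ^ 2)

theorem gradKernel_nonneg (c : ℝ) (v w : E3) : 0 ≤ gradKernel c v w := by
  unfold gradKernel gradKernelExp; positivity

theorem rayMajorant_nonneg (c : ℝ) (v w : E3) : 0 ≤ rayMajorant c v w := by
  have := gradKernel_nonneg c v w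
  unfold rayMajorant; positivity

theorem measurable_gradKernel_left (c : ℝ) (v : E3) :
    Measurable fun w => ENNReal.ofReal (gradKernel c v w) := by
  unfold gradKernel gradKernelExp; fun_prop

theorem measurable_rayMajorant_left (c : ℝ) (v : E3) : Measurable fun w => rayMajorant c v w := by
  unfold rayMajorant gradKernel gradKernelExp; fun_prop

theorem measurable_rayMajorant (c : ℝ) : Measurable fun z : E3 × E3 => rayMajorant c z.1 z.2 := by
  have := measurable_gradKernel c
  unfold rayMajorant
  fun_prop

/-- After integration in `w` only the singularities `|v|⁻¹` and `|v|⁻²` remain, and these are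
locally integrable in `ℝ³`. -/
theorem exists_lintegral_rayMajorant_le {c : ℝ} (hc : 0 < c) :
    ∃ C : ℝ≥0∞, C ≠ ∞ ∧ ∀ v, v ≠ 0 → ∫⁻ w, ENNReal.ofReal (rayMajorant c v w) ≤
      C * (‖v‖ₑ ^ (-1 : ℝ) + ‖v‖ₑ ^ (-2 : ℝ)) := by
  obtain ⟨C, hC, h, -⟩ := exists_lintegral_gradKernel_le hc
  obtain ⟨M, hM, hM'⟩ := exists_lintegral_rpow_norm_mul_gaussE_le (b := 1) zero_le_one (by norm_num) hc
  refine ⟨C + M, ENNReal.add_ne_top.2 ⟨hC, hM⟩, fun v hv => ?_⟩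
  have hv' : ENNReal.ofReal ‖v‖⁻¹ = ‖v‖ₑ ^ (-1 : ℝ) := by
    rw [ENNReal.ofReal_inv_of_pos (norm_pos_iff.2 hv), ofReal_norm, ENNReal.rpow_neg_one]
  have hv2 : ENNReal.ofReal (‖v‖⁻¹ + ‖v‖⁻¹ ^ 2) = ‖v‖ₑ ^ (-1 : ℝ) + ‖v‖ₑ ^ (-2 : ℝ) := by
    rw [ENNReal.ofReal_add (by positivity) (by positivity), ENNReal.ofReal_pow (by positivity), hv',
      ← ENNReal.rpow_natCast, ← ENNReal.rpow_mul]
    norm_num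
  calc ∫⁻ w, ENNReal.ofReal (rayMajorant c v w)
      ≤ ∫⁻ w, (ENNReal.ofReal (gradKernel c v w) * (‖v‖ₑ ^ (-1 : ℝ) + ‖v‖ₑ ^ (-2 : ℝ)) +
        ‖v - w‖ₑ ^ (-1 : ℝ) * gaussE c (v - w) * (‖v‖ₑ ^ (-1 : ℝ) + ‖v‖ₑ ^ (-2 : ℝ))) := by
        refine lintegral_mono fun w => ?_
        unfold rayMajorant
        rw [ENNReal.ofReal_add (mul_nonneg (gradKernel_nonneg c v w) (by positivity)) (by positivity),
          ENNReal.ofReal_mul (gradKernel_nonneg c v w), ENNReal.ofReal_mul (by positivity), hv', hv2]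
        refine add_le_add (mul_le_mul_right le_self_add _) (mul_le_mul_left ?_ _)
        rw [ENNReal.rpow_neg_one]
        exact ofReal_inv_norm_mul_exp_le c (v - w)
    _ = ((∫⁻ w, ENNReal.ofReal (gradKernel c v w)) + ∫⁻ w, ‖v - w‖ₑ ^ (-1 : ℝ) * gaussE c (v - w)) *
        (‖v‖ₑ ^ (-1 : ℝ) + ‖v‖ₑ ^ (-2 : ℝ)) := by
        have hm := measurable_gradKernel_left c v
        rw [lintegral_add_left (hm.mul_const _), lintegral_mul_const _ hm,
          lintegral_mul_const _ (by fun_prop), add_mul]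
    _ ≤ (C + M) * (‖v‖ₑ ^ (-1 : ℝ) + ‖v‖ₑ ^ (-2 : ℝ)) := by
        gcongr ?_ * _
        gcongr
        · exact h v
        · have h0 := hM' 0
          rw [← lintegral_sub_left_eq_self _ v] at h0
          simpa using h0

theorem setLIntegral_norm_rpow_lt_top {b : ℝ} (hb : 0 ≤ b) (hb3 : b < 3) {B : Set E3}
    (hB : Bornology.IsBounded B) : ∫⁻ v in B, ‖v‖ₑ ^ (-b) < ∞ := by
  obtain ⟨C, hC, h⟩ := exists_lintegral_rpow_norm_mul_gaussE_le hb hb3 one_pos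
  obtain ⟨R, hR⟩ := hB.subset_closedBall 0
  calc ∫⁻ v in B, ‖v‖ₑ ^ (-b) ≤ ∫⁻ v in Metric.closedBall (0 : E3) R, ‖v‖ₑ ^ (-b) := lintegral_mono_set hR
    _ ≤ ∫⁻ v in Metric.closedBall (0 : E3) R, ENNReal.ofReal (Real.exp (R ^ 2)) * (‖v‖ₑ ^ (-b) * gaussE 1 v) := by
        refine setLIntegral_mono' Metric.isClosed_closedBall.measurableSet fun v hv => ?_
        have : 1 ≤ ENNReal.ofReal (Real.exp (R ^ 2)) * gaussE 1 v := by
          rw [gaussE, ← ENNReal.ofReal_mul (Real.exp_pos _).le, ← Real.exp_add, ← ENNReal.ofReal_one]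
          refine ENNReal.ofReal_le_ofReal (Real.one_le_exp ?_)
          have h1 : ‖v‖ ≤ R := by simpa using hv
          nlinarith [norm_nonneg v]
        calc ‖v‖ₑ ^ (-b) = ‖v‖ₑ ^ (-b) * 1 := (mul_one _).symm
          _ ≤ ‖v‖ₑ ^ (-b) * (ENNReal.ofReal (Real.exp (R ^ 2)) * gaussE 1 v) := mul_le_mul_right this _
          _ = _ := by ring
    _ ≤ ENNReal.ofReal (Real.exp (R ^ 2)) * C := by
        rw [lintegral_const_mul' _ _ ENNReal.ofReal_ne_top]
        gcongr
        refine (setLIntegral_le_lintegral _ _).trans ?_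
        simpa using h 0
    _ < ∞ := ENNReal.mul_lt_top (by simp) hC.lt_top

/-- The measure on the parameters `(θ, w)`. -/
noncomputable def rayMeasure : Measure (ℝ × E3) := (volume.restrict (Ioc (0 : ℝ) 1)).prod volume

instance : SFinite rayMeasure := by unfold rayMeasure; infer_instance

theorem lintegral_rayMeasure_snd {f : E3 → ℝ≥0∞} (hf : Measurable f) :
    ∫⁻ π, f π.2 ∂rayMeasure = ∫⁻ w, f w := by
  rw [rayMeasure, lintegral_prod_symm _ (by fun_prop)]
  simp

theorem integrable_rayMajorant_fiber {c : ℝ} (hc : 0 < c) {v : E3} (hv : v ≠ 0) :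
    Integrable (fun π : ℝ × E3 => rayMajorant c v π.2) rayMeasure := by
  obtain ⟨C, hC, h⟩ := exists_lintegral_rayMajorant_le hc
  have hm := measurable_rayMajorant_left c v
  refine ⟨(hm.comp measurable_snd).aestronglyMeasurable, ?_⟩
  have h0 : 0 ≤ᵐ[rayMeasure] fun π : ℝ × E3 => rayMajorant c v π.2 := by
    filter_upwards with π
    rw [Pi.zero_apply]
    exact rayMajorant_nonneg c v π.2
  rw [hasFiniteIntegral_iff_ofReal h0, lintegral_rayMeasure_snd (f := fun w => ENNReal.ofReal (rayMajorant c v w)) (by fun_prop)]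
  refine (h v hv).trans_lt (ENNReal.mul_lt_top hC.lt_top ?_)
  have hv' : ‖v‖ₑ ≠ 0 := by simpa using hv
  simp [ENNReal.rpow_neg, hv', pos_iff_ne_zero]

theorem integrable_rayMajorant {c : ℝ} (hc : 0 < c) {K : Set (E3 × E3)} (hK : IsCompact K) :
    Integrable (fun z : (ℝ × E3) × (E3 × E3) => rayMajorant c z.2.2 z.1.2)
      (rayMeasure.prod (volume.restrict K)) := by
  obtain ⟨C, hC, h⟩ := exists_lintegral_rayMajorant_le hc
  have hm := measurable_rayMajorant c
  have hm' : Measurable fun z : (ℝ × E3) × (E3 × E3) => rayMajorant c z.2.2 z.1.2 :=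
    hm.comp (f := fun z : (ℝ × E3) × (E3 × E3) => (z.2.2, z.1.2)) (by fun_prop)
  refine ⟨hm'.aestronglyMeasurable, ?_⟩
  have h0 : 0 ≤ᵐ[rayMeasure.prod (volume.restrict K)]
      fun z : (ℝ × E3) × (E3 × E3) => rayMajorant c z.2.2 z.1.2 := by
    filter_upwards with z
    rw [Pi.zero_apply]
    exact rayMajorant_nonneg c z.2.2 z.1.2
  rw [hasFiniteIntegral_iff_ofReal h0, lintegral_prod_symm _ (by fun_prop)]
  have hK1 := (hK.image continuous_fst).isBounded
  have hK2 := (hK.image continuous_snd).isBounded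
  have hsub : K ⊆ closure (Prod.fst '' K) ×ˢ closure (Prod.snd '' K) := fun y hy =>
    ⟨subset_closure ⟨y, hy, rfl⟩, subset_closure ⟨y, hy, rfl⟩⟩
  have hm2 : Measurable fun y : E3 × E3 => C * (‖y.2‖ₑ ^ (-1 : ℝ) + ‖y.2‖ₑ ^ (-2 : ℝ)) := by fun_prop
  calc ∫⁻ y in K, ∫⁻ π, ENNReal.ofReal (rayMajorant c y.2 π.2) ∂rayMeasure
      ≤ ∫⁻ y in K, C * (‖y.2‖ₑ ^ (-1 : ℝ) + ‖y.2‖ₑ ^ (-2 : ℝ)) := by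
        refine lintegral_mono_ae ?_
        have h0 : ∀ᵐ y : E3 × E3, y.2 ≠ 0 := by
          rw [Measure.volume_eq_prod]
          exact Measure.quasiMeasurePreserving_snd.ae (Measure.ae_ne volume 0)
        filter_upwards [ae_restrict_of_ae h0] with y hy
        have hmy := measurable_rayMajorant_left c y.2
        rw [lintegral_rayMeasure_snd (f := fun w => ENNReal.ofReal (rayMajorant c y.2 w)) (by fun_prop)]
        exact h y.2 hy
    _ ≤ ∫⁻ y in closure (Prod.fst '' K) ×ˢ closure (Prod.snd '' K), C * (‖y.2‖ₑ ^ (-1 : ℝ) + ‖y.2‖ₑ ^ (-2 : ℝ)) :=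
        lintegral_mono_set hsub
    _ = ∫⁻ _x in closure (Prod.fst '' K), ∫⁻ v in closure (Prod.snd '' K),
          C * (‖v‖ₑ ^ (-1 : ℝ) + ‖v‖ₑ ^ (-2 : ℝ)) := by
        rw [Measure.volume_eq_prod, ← Measure.prod_restrict, lintegral_prod _ hm2.aemeasurable]
    _ < ∞ := by
        rw [lintegral_const, lintegral_const_mul' _ _ hC, lintegral_add_left (by fun_prop),
          Measure.restrict_apply_univ]
        have h1 := setLIntegral_norm_rpow_lt_top (b := 1) (by norm_num) (by norm_num) hK2.closure
        have h2 := setLIntegral_norm_rpow_lt_top (b := 2) (by norm_num) (by norm_num) hK2.closure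
        exact ENNReal.mul_lt_top (ENNReal.mul_lt_top hC.lt_top (ENNReal.add_lt_top.2 ⟨h1, h2⟩))
          hK1.closure.measure_lt_top

/-- The factor `1 + t` comes from the derivative of the exit time or of `x - t v` in `v`; half of
the decay pays for it. -/
theorem exp_neg_mul_one_add_le {a n t : ℝ} (ha : 0 < a) (hn : a ≤ n) (ht : 0 ≤ t) :
    Real.exp (-(n * t)) * (1 + t) ≤ (1 + 2 / a) * Real.exp (-(a / 2) * t) := by
  have h1 : Real.exp (-(n * t)) ≤ Real.exp (-(a / 2) * t) * Real.exp (-(a / 2) * t) := by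
    rw [← Real.exp_add, Real.exp_le_exp]
    nlinarith
  have h2 : Real.exp (-(a / 2) * t) * (1 + t) ≤ 1 + 2 / a := by
    have h3 : Real.exp (-(a / 2) * t) ≤ (a / 2 * t + 1)⁻¹ := by
      rw [neg_mul, Real.exp_neg]
      exact inv_anti₀ (by positivity) (Real.add_one_le_exp _)
    calc _ ≤ (a / 2 * t + 1)⁻¹ * (1 + t) := by gcongr
      _ ≤ 1 + 2 / a := by
        rw [inv_mul_le_iff₀ (by positivity)]
        field_simp
        nlinarith [mul_nonneg ha.le ht]
  calc _ ≤ Real.exp (-(a / 2) * t) * Real.exp (-(a / 2) * t) * (1 + t) := by gcongr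
    _ = Real.exp (-(a / 2) * t) * (1 + t) * Real.exp (-(a / 2) * t) := by ring
    _ ≤ _ := by gcongr

theorem mul_exp_neg_le_one (x : ℝ) : x * Real.exp (-x) ≤ 1 := by
  rw [Real.exp_neg, mul_inv_le_iff₀ (Real.exp_pos _), one_mul]
  linarith [Real.add_one_le_exp x]

theorem StationaryBoltzmann.AssumptionA.exists_nu_bounds {ρ γ : ℝ} {ν : E3 → ℝ} {k : E3 → E3 → ℝ}
    (hA : AssumptionA ρ γ ν k) :
    ∃ a B : ℝ, 0 < a ∧ 0 < B ∧ ∀ v, a ≤ ν v ∧ ‖fderiv ℝ ν v‖ ≤ B := by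
  obtain ⟨a, b, ha, hb, h⟩ := hA.nu_bounds
  obtain ⟨B, hB, h'⟩ := hA.nu_deriv_bound
  refine ⟨a, B, ha, hB, fun v => ⟨?_, ?_⟩⟩
  · refine le_trans ?_ (h v).1
    have := Real.one_le_rpow (by linarith [norm_nonneg v] : 1 ≤ 1 + ‖v‖) hA.gamma_nonneg
    nlinarith
  · refine (h' v).trans ?_
    have := Real.rpow_le_one_of_one_le_of_nonpos (by linarith [norm_nonneg v] : 1 ≤ 1 + ‖v‖)
      (by linarith [hA.gamma_le_one] : γ - 1 ≤ 0)
    nlinarith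

theorem exists_weighted_bound {X : Type*} [NormedAddCommGroup X] {g : E3 × E3 → X} (hg : Continuous g)
    (hs : HasCompactSupport g) (α : ℝ) : ∃ M : ℝ, 0 < M ∧ ∀ y, Real.exp (α * ‖y.2‖ ^ 2) * ‖g y‖ ≤ M := by
  have hc : Continuous fun y : E3 × E3 => Real.exp (α * ‖y.2‖ ^ 2) * ‖g y‖ := by fun_prop
  have hs' : HasCompactSupport fun y : E3 × E3 => Real.exp (α * ‖y.2‖ ^ 2) * ‖g y‖ := hs.norm.mul_left
  obtain ⟨M, hM⟩ := hs'.exists_bound_of_continuous hc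
  exact ⟨max M 1, lt_max_of_lt_right one_pos, fun y => ((le_abs_self _).trans (hM y)).trans (le_max_left _ _)⟩

/-! ### Majorants on compact subsets of phase space -/

open scoped ENNReal NNReal

theorem prod_zero_norm (a : E3) : ‖((a, 0) : E3 × E3)‖ = ‖a‖ := by simp [Prod.norm_def]

/-- The arithmetic behind the bound on `rayTermDeriv`: `s` stands for `|v|⁻¹`, `d` for the diameter,
`T` for the derivative of `τ`, `A` and `G` for the two kernels. All powers of `τ` are converted to
powers of `s` by `τ ≤ d s`. -/
theorem le_collect {C M δ B d τ s A G T κ P Q : ℝ} (hC : 0 < C) (hM : 0 < M) (hδ : 0 < δ) (hB : 0 < B)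
    (hd : 0 < d) (hτ : 0 ≤ τ) (hs0 : 0 ≤ s) (hA0 : 0 ≤ A) (hG : 0 ≤ G) (hτd : τ ≤ d * s)
    (hτ2 : |T| ≤ τ / δ * (1 + τ)) (hk0 : |κ| ≤ C * A) (hP : |P| ≤ M * (2 + d))
    (hQ : |Q| ≤ C * M * (G + A * (B * τ + 1 + τ))) :
    |T * κ * P + τ * Q| ≤ C * M * ((2 + d) / δ + B + 2) * (d + d ^ 2) * (G * s + A * (s + s ^ 2)) := by
  have hττ : τ * (1 + τ) ≤ (d + d ^ 2) * (s + s ^ 2) := by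
    calc τ * (1 + τ) ≤ (d * s) * (1 + d * s) := by gcongr
      _ = d * s + d ^ 2 * s ^ 2 := by ring
      _ ≤ _ := by
        have : 0 ≤ d * s ^ 2 := by positivity
        have : 0 ≤ d ^ 2 * s := by positivity
        nlinarith
  have hτ3 : τ ≤ (d + d ^ 2) * s := by
    refine hτd.trans ?_
    gcongr
    nlinarith [sq_nonneg d]
  calc |T * κ * P + τ * Q|
      ≤ |T| * |κ| * |P| + τ * |Q| := by
        refine (abs_add_le _ _).trans (le_of_eq ?_)
        rw [abs_mul, abs_mul, abs_mul, abs_of_nonneg hτ]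
    _ ≤ (τ / δ * (1 + τ)) * (C * A) * (M * (2 + d)) + τ * (C * M * (G + A * (B * τ + 1 + τ))) := by gcongr
    _ = C * M * ((2 + d) / δ) * A * (τ * (1 + τ)) + C * M * A * (B * τ ^ 2 + τ * (1 + τ)) + C * M * G * τ := by
        ring
    _ ≤ C * M * ((2 + d) / δ) * A * (τ * (1 + τ)) + C * M * A * (B * (τ * (1 + τ)) + τ * (1 + τ)) + C * M * G * τ := by
        gcongr
        nlinarith
    _ = C * M * ((2 + d) / δ + B + 1) * (A * (τ * (1 + τ))) + C * M * 1 * (G * τ) := by ring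
    _ ≤ C * M * ((2 + d) / δ + B + 2) * (A * ((d + d ^ 2) * (s + s ^ 2))) +
        C * M * ((2 + d) / δ + B + 2) * (G * ((d + d ^ 2) * s)) := by
        have : 0 ≤ (2 + d) / δ := by positivity
        gcongr <;> linarith
    _ = _ := by ring

namespace StationaryBoltzmann.IsBoundedConvexC2Domain

variable {Ω : Set E3} (hΩ : IsBoundedConvexC2Domain Ω)
include hΩ

theorem exists_ball_subset_of_isCompact {K : Set (E3 × E3)} (hK : IsCompact K) (hKΩ : K ⊆ Ω ×ˢ univ) :
    ∃ δ : ℝ, 0 < δ ∧ ∀ y ∈ K, Metric.ball y.1 δ ⊆ Ω := by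
  have h1 : Prod.fst '' K ⊆ Ω := by
    rintro _ ⟨y, hy, rfl⟩
    exact (hKΩ hy).1
  obtain ⟨δ, hδ, h⟩ := (hK.image continuous_fst).exists_thickening_subset_open hΩ.isOpen h1
  exact ⟨δ, hδ, fun y hy => (Metric.ball_subset_thickening (mem_image_of_mem _ hy) δ).trans h⟩

theorem exitTime_le_diam_mul_inv {y : E3 × E3} (hx : y.1 ∈ Ω) (hv : y.2 ≠ 0) :
    exitTime Ω y.1 y.2 ≤ Metric.diam Ω * ‖y.2‖⁻¹ := by
  rw [← div_eq_mul_inv, le_div_iff₀ (norm_pos_iff.2 hv)]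
  exact hΩ.exitTime_mul_norm_le_diam (subset_closure hx)

theorem abs_rayTerm_le {ν : E3 → ℝ} {k : E3 → E3 → ℝ} {h : E3 × E3 → ℝ} {a c C M : ℝ} (ha : 0 < a)
    (hν : ∀ v, a ≤ ν v) (hC : 0 < C) (hM : 0 < M)
    (hk : ∀ v w, v ≠ w → |k v w| ≤ C * (‖v - w‖⁻¹ * Real.exp (-c * ‖v - w‖ ^ 2)))
    (hh : ∀ y, |h y| ≤ M) {π : ℝ × E3} (hπ : 0 ≤ π.1) {y : E3 × E3} (hx : y.1 ∈ Ω) (hv : y.2 ≠ 0)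
    (hw : y.2 ≠ π.2) :
    |rayTerm Ω ν k h π y| ≤ C * M * Metric.diam Ω * rayMajorant c y.2 π.2 := by
  have hτ := exitTime_nonneg Ω y.1 y.2
  have hτd := hΩ.exitTime_le_diam_mul_inv hx hv
  have hd := hΩ.diam_pos
  have hG := gradKernel_nonneg c y.2 π.2
  have hE : Real.exp (-(ν y.2 * (π.1 * exitTime Ω y.1 y.2))) ≤ 1 :=
    Real.exp_le_one_iff.2 (by have := hν y.2; have : 0 ≤ ν y.2 := by linarith
                              linarith [mul_nonneg this (mul_nonneg hπ hτ)])
  unfold rayTerm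
  rw [abs_mul, abs_mul, abs_mul, abs_of_nonneg hτ, abs_of_pos (Real.exp_pos _)]
  calc _ ≤ Metric.diam Ω * ‖y.2‖⁻¹ * 1 * (C * (‖y.2 - π.2‖⁻¹ * Real.exp (-c * ‖y.2 - π.2‖ ^ 2))) * M := by
        gcongr
        · exact hk _ _ hw
        · exact hh _
    _ = C * M * Metric.diam Ω * (‖y.2 - π.2‖⁻¹ * Real.exp (-c * ‖y.2 - π.2‖ ^ 2) * ‖y.2‖⁻¹) := by ring
    _ ≤ _ := by
        unfold rayMajorant
        gcongr
        have h1 : 0 ≤ gradKernel c y.2 π.2 * ‖y.2‖⁻¹ := by positivity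
        have h2 : 0 ≤ ‖y.2 - π.2‖⁻¹ * Real.exp (-c * ‖y.2 - π.2‖ ^ 2) * ‖y.2‖⁻¹ ^ 2 := by positivity
        linarith

/-- At distance `δ` from the boundary `1/|n·v| ≤ τ/δ`, so grazing rays do no harm. The constant may
depend on `δ` and `Ω`, since this bound serves integrability only and not the final estimate. -/
theorem abs_rayTermDeriv_le {ν : E3 → ℝ} {k : E3 → E3 → ℝ} {h : E3 × E3 → ℝ} {a B c C M δ : ℝ} (ha : 0 < a)
    (hν : ∀ v, a ≤ ν v) (hB : 0 < B) (hν' : ∀ v, ‖fderiv ℝ ν v‖ ≤ B) (hC : 0 < C) (hM : 0 < M) (hδ : 0 < δ)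
    (hk : ∀ v w, v ≠ w → |k v w| ≤ C * (‖v - w‖⁻¹ * Real.exp (-c * ‖v - w‖ ^ 2)))
    (hk' : ∀ v w, v ≠ w → ‖fderiv ℝ (fun u => k u w) v‖ ≤ C * gradKernel c v w)
    (hh : ∀ y, |h y| ≤ M) (hh' : ∀ y, ‖fderiv ℝ h y‖ ≤ M)
    {e : E3 × E3} (he1 : ‖e.1‖ ≤ 1) (he2 : ‖e.2‖ ≤ 1) {π : ℝ × E3} (hπ : 0 ≤ π.1) (hπ1 : π.1 ≤ 1)
    {y : E3 × E3} (hx : Metric.ball y.1 δ ⊆ Ω) (hv : y.2 ≠ 0) (hw : y.2 ≠ π.2) :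
    |rayTermDeriv Ω ν k h e π y| ≤
      C * M * ((2 + Metric.diam Ω) / δ + B + 2) * (Metric.diam Ω + Metric.diam Ω ^ 2) *
        rayMajorant c y.2 π.2 := by
  have hxΩ : y.1 ∈ Ω := hx (Metric.mem_ball_self hδ)
  have hτ := exitTime_nonneg Ω y.1 y.2
  have hτd := hΩ.exitTime_le_diam_mul_inv hxΩ hv
  have hτv := hΩ.exitTime_mul_norm_le_diam (v := y.2) (subset_closure hxΩ)
  have hτ' := hΩ.abs_exitTimeDeriv_le hv hxΩ he1 he2
  have hδτ := hΩ.le_exitTime_mul_abs_inner hv hxΩ hδ hx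
  have hin : 0 < |(inner ℝ (outwardNormal Ω (exitPoint Ω y.1 y.2)) y.2 : ℝ)| :=
    abs_pos.2 (hΩ.inner_outwardNormal_exitPoint_neg hv hxΩ).ne
  have hd := hΩ.diam_pos
  have hG := gradKernel_nonneg c y.2 π.2
  have hk0 := hk _ _ hw
  have hk1 := hk' _ _ hw
  unfold rayTermDeriv
  set D := fderiv ℝ h (y.1 - (π.1 * exitTime Ω y.1 y.2) • y.2, π.2) with hD
  set H := h (y.1 - (π.1 * exitTime Ω y.1 y.2) • y.2, π.2) with hH
  set τ := exitTime Ω y.1 y.2 with hτdef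
  set d := Metric.diam Ω
  set A := ‖y.2 - π.2‖⁻¹ * Real.exp (-c * ‖y.2 - π.2‖ ^ 2) with hA
  have hA0 : 0 ≤ A := by positivity
  set G := gradKernel c y.2 π.2
  set E := Real.exp (-(ν y.2 * (π.1 * τ))) with hE
  have hν0 : 0 ≤ ν y.2 := ha.le.trans (hν _)
  have hE0 : 0 < E := Real.exp_pos _
  have hE1 : E ≤ 1 := Real.exp_le_one_iff.2 (by linarith [mul_nonneg hν0 (mul_nonneg hπ hτ)])
  -- The collision frequency may grow with `|v|`; it is absorbed by `x e^{-x} ≤ 1`.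
  have hνE : π.1 * (ν y.2 * τ) * E ≤ 1 := by
    have := mul_exp_neg_le_one (ν y.2 * (π.1 * τ))
    calc _ = ν y.2 * (π.1 * τ) * E := by ring
      _ ≤ 1 := this
  have hHM : |H| ≤ M := hh _
  have hDn : ‖D‖ ≤ M := hh' _
  have hD1 : |D (-(τ • y.2), 0)| ≤ M * d := by
    refine (D.le_opNorm _).trans ?_
    rw [prod_zero_norm, norm_neg, norm_smul, Real.norm_of_nonneg hτ]
    gcongr
  have hD2 : |D (e.1 - (π.1 * τ) • e.2, 0)| ≤ M * (1 + τ) := by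
    refine (D.le_opNorm _).trans ?_
    rw [prod_zero_norm]
    gcongr
    refine (norm_sub_le _ _).trans ?_
    rw [norm_smul, Real.norm_of_nonneg (mul_nonneg hπ hτ)]
    have : π.1 * τ * ‖e.2‖ ≤ 1 * τ * 1 := by gcongr
    linarith
  have hν2 : |fderiv ℝ ν y.2 e.2| ≤ B := by
    refine ((fderiv ℝ ν y.2).le_opNorm _).trans ?_
    have : ‖fderiv ℝ ν y.2‖ * ‖e.2‖ ≤ B * 1 := by gcongr; exact hν' _
    linarith
  have hk2 : |fderiv ℝ (fun u => k u π.2) y.2 e.2| ≤ C * G := by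
    refine ((fderiv ℝ (fun u => k u π.2) y.2).le_opNorm _).trans ?_
    have : ‖fderiv ℝ (fun u => k u π.2) y.2‖ * ‖e.2‖ ≤ (C * G) * 1 := by gcongr
    linarith
  have hτ2 : |exitTimeDeriv Ω y e| ≤ τ / δ * (1 + τ) := by
    refine hτ'.trans ?_
    gcongr
    rw [inv_eq_one_div, div_le_div_iff₀ hin hδ]
    linarith
  have hP : |E * H + π.1 * (-(ν y.2 * τ) * E * H + E * D (-(τ • y.2), 0))| ≤ M * (2 + d) := by
    have h1 : |E * H| ≤ M := by
      rw [abs_mul, abs_of_pos hE0]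
      calc E * |H| ≤ 1 * M := by gcongr
        _ = M := one_mul _
    have h2 : |π.1 * (-(ν y.2 * τ) * E * H)| ≤ M := by
      have : |π.1 * (-(ν y.2 * τ) * E * H)| = π.1 * (ν y.2 * τ) * E * |H| := by
        rw [abs_mul, abs_mul, abs_mul, abs_neg, abs_of_nonneg hπ, abs_of_pos hE0,
          abs_of_nonneg (mul_nonneg hν0 hτ)]; ring
      rw [this]
      calc _ ≤ 1 * M := by gcongr
        _ = M := one_mul _
    have h3 : |π.1 * (E * D (-(τ • y.2), 0))| ≤ M * d := by
      rw [abs_mul, abs_mul, abs_of_pos hE0, abs_of_nonneg hπ]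
      calc _ ≤ 1 * (1 * (M * d)) := by gcongr
        _ = M * d := by ring
    rw [mul_add, ← add_assoc]
    calc _ ≤ |E * H| + |π.1 * (-(ν y.2 * τ) * E * H)| + |π.1 * (E * D (-(τ • y.2), 0))| := abs_add_three _ _ _
      _ ≤ _ := by linarith
  have hQ : |E * (fderiv ℝ (fun u => k u π.2) y.2 e.2 * H +
      k y.2 π.2 * (-(π.1 * τ * fderiv ℝ ν y.2 e.2) * H + D (e.1 - (π.1 * τ) • e.2, 0)))| ≤
      C * M * (G + A * (B * τ + 1 + τ)) := by
    have h1 : |fderiv ℝ (fun u => k u π.2) y.2 e.2 * H| ≤ C * G * M := by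
      rw [abs_mul]; gcongr
    have h2 : |-(π.1 * τ * fderiv ℝ ν y.2 e.2) * H| ≤ 1 * τ * B * M := by
      rw [abs_mul, abs_neg, abs_mul, abs_of_nonneg (mul_nonneg hπ hτ)]; gcongr
    have h3 : |k y.2 π.2 * (-(π.1 * τ * fderiv ℝ ν y.2 e.2) * H + D (e.1 - (π.1 * τ) • e.2, 0))| ≤
        C * A * (1 * τ * B * M + M * (1 + τ)) := by
      rw [abs_mul]
      gcongr
      exact (abs_add_le _ _).trans (add_le_add h2 hD2)
    rw [abs_mul, abs_of_pos hE0]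
    calc _ ≤ 1 * (C * G * M + C * A * (1 * τ * B * M + M * (1 + τ))) := by
          gcongr
          exact (abs_add_le _ _).trans (add_le_add h1 h3)
      _ = _ := by ring
  set P := E * H + π.1 * (-(ν y.2 * τ) * E * H + E * D (-(τ • y.2), 0))
  set Q := E * (fderiv ℝ (fun u => k u π.2) y.2 e.2 * H +
      k y.2 π.2 * (-(π.1 * τ * fderiv ℝ ν y.2 e.2) * H + D (e.1 - (π.1 * τ) • e.2, 0)))
  refine (le_collect hC hM hδ hB hd hτ (inv_nonneg.2 (norm_nonneg y.2)) hA0 hG hτd hτ2 hk0 hP hQ).trans (le_of_eq ?_)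
  rw [rayMajorant]

end StationaryBoltzmann.IsBoundedConvexC2Domain

open scoped ENNReal NNReal

theorem StationaryBoltzmann.AssumptionA.exists_rayTerm_bounds {ρ γ : ℝ} {ν : E3 → ℝ} {k : E3 → E3 → ℝ}
    (hA : AssumptionA ρ γ ν k) {h : E3 × E3 → ℝ} (hh : ContDiff ℝ 1 h) (hs : HasCompactSupport h) :
    ∃ c : ℝ, 0 < c ∧ ∀ Ω, IsBoundedConvexC2Domain Ω → ∀ K, IsCompact K → K ⊆ Ω ×ˢ univ →
      ∀ e : E3 × E3, ‖e.1‖ ≤ 1 → ‖e.2‖ ≤ 1 → ∃ D : ℝ, ∀ (π : ℝ × E3) (y : E3 × E3),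
        π.1 ∈ Ioc (0 : ℝ) 1 → y ∈ K → y.2 ≠ 0 → y.2 ≠ π.2 →
        |rayTerm Ω ν k h π y| ≤ D * rayMajorant c y.2 π.2 ∧
        |rayTermDeriv Ω ν k h e π y| ≤ D * rayMajorant c y.2 π.2 := by
  -- Local integrability needs no weight, hence `α = 0`.
  obtain ⟨C, c, hC, hc, hk⟩ := hA.exists_weighted_kernel_le (α := 0) le_rfl (by linarith [hA.rho_lt_one])
  simp only [zero_mul, Real.exp_zero, one_mul, mul_one] at hk
  obtain ⟨a, B, ha, hB, hν⟩ := hA.exists_nu_bounds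
  obtain ⟨M₁, hM₁, hh1⟩ := exists_weighted_bound hh.continuous hs 0
  obtain ⟨M₂, hM₂, hh2⟩ := exists_weighted_bound (hh.continuous_fderiv one_ne_zero) (hs.fderiv ℝ) 0
  simp only [zero_mul, Real.exp_zero, one_mul] at hh1 hh2
  set M := max M₁ M₂
  have hM : 0 < M := lt_max_of_lt_left hM₁
  refine ⟨c, hc, fun Ω hΩ K hK hKΩ e he1 he2 => ?_⟩
  obtain ⟨δ, hδ, hball⟩ := hΩ.exists_ball_subset_of_isCompact hK hKΩ
  refine ⟨max (C * M * Metric.diam Ω)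
    (C * M * ((2 + Metric.diam Ω) / δ + B + 2) * (Metric.diam Ω + Metric.diam Ω ^ 2)), fun π y hπ hy hv hw => ⟨?_, ?_⟩⟩
  · refine (hΩ.abs_rayTerm_le ha (fun v => (hν v).1) hC hM (fun v w hvw => (hk v w hvw).1)
      (fun y => (hh1 y).trans (le_max_left _ _)) hπ.1.le (hKΩ hy).1 hv hw).trans ?_
    exact mul_le_mul_of_nonneg_right (le_max_left _ _) (rayMajorant_nonneg _ _ _)
  · refine (hΩ.abs_rayTermDeriv_le ha (fun v => (hν v).1) hB (fun v => (hν v).2) hC hM hδ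
      (fun v w hvw => (hk v w hvw).1) (fun v w hvw => (hk v w hvw).2)
      (fun y => (hh1 y).trans (le_max_left _ _)) (fun y => (hh2 y).trans (le_max_right _ _)) he1 he2
      hπ.1.le hπ.2 (hball y hy) hv hw).trans ?_
    exact mul_le_mul_of_nonneg_right (le_max_right _ _) (rayMajorant_nonneg _ _ _)

theorem ae_rayMeasure_prod {K : Set (E3 × E3)} (hK : MeasurableSet K) :
    ∀ᵐ z : (ℝ × E3) × (E3 × E3) ∂(rayMeasure.prod (volume.restrict K)),
      z.1.1 ∈ Ioc (0 : ℝ) 1 ∧ z.2 ∈ K ∧ z.2.2 ≠ 0 ∧ z.2.2 ≠ z.1.2 := by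
  have h1 : ∀ᵐ π : ℝ × E3 ∂rayMeasure, π.1 ∈ Ioc (0 : ℝ) 1 :=
    Measure.quasiMeasurePreserving_fst.ae (ae_restrict_mem measurableSet_Ioc)
  have h2 : ∀ᵐ z : (ℝ × E3) × (E3 × E3) ∂(rayMeasure.prod (volume.restrict K)),
      z.2.2 ≠ 0 ∧ z.2.2 ≠ z.1.2 := by
    have hm : MeasurableSet {z : (ℝ × E3) × (E3 × E3) | z.2.2 ≠ 0 ∧ z.2.2 ≠ z.1.2} := by
      have h0 : MeasurableSet {z : (ℝ × E3) × (E3 × E3) | z.2.2 = 0} :=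
        measurableSet_eq_fun (by fun_prop) (by fun_prop)
      have h1 : MeasurableSet {z : (ℝ × E3) × (E3 × E3) | z.2.2 = z.1.2} :=
        measurableSet_eq_fun (by fun_prop) (by fun_prop)
      exact h0.compl.inter h1.compl
    refine (Measure.ae_prod_iff_ae_ae hm).2 (ae_of_all _ fun π => ae_restrict_of_ae ?_)
    rw [Measure.volume_eq_prod]
    refine Measure.quasiMeasurePreserving_snd.ae (p := fun v : E3 => v ≠ 0 ∧ v ≠ π.2) ?_
    filter_upwards [Measure.ae_ne volume (0 : E3), Measure.ae_ne volume π.2] with v h1 h2 using ⟨h1, h2⟩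
  filter_upwards [Measure.quasiMeasurePreserving_fst.ae h1,
    Measure.quasiMeasurePreserving_snd.ae (ae_restrict_mem hK), h2] with z a b c using ⟨a, b, c⟩

/-! ### Joint measurability and integrability of the integrand -/

namespace StationaryBoltzmann.IsBoundedConvexC2Domain

variable {Ω : Set E3} (hΩ : IsBoundedConvexC2Domain Ω)
include hΩ

theorem isOpen_moving : IsOpen (Ω ×ˢ ({0}ᶜ : Set E3)) :=
  hΩ.isOpen.prod isOpen_compl_singleton

theorem measurable_indicator_exitTime :
    Measurable ((Ω ×ˢ ({0}ᶜ : Set E3)).indicator fun y => exitTime Ω y.1 y.2) := by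
  classical
  rw [← piecewise_eq_indicator]
  exact hΩ.continuousOn_exitTime.measurable_piecewise continuousOn_const hΩ.isOpen_moving.measurableSet

theorem measurable_indicator_rayTerm {ρ γ : ℝ} {ν : E3 → ℝ} {k : E3 → E3 → ℝ}
    (hA : AssumptionA ρ γ ν k) {h : E3 × E3 → ℝ} (hh : Measurable h) :
    Measurable fun z : (ℝ × E3) × (E3 × E3) =>
      (Ω ×ˢ ({0}ᶜ : Set E3)).indicator (rayTerm Ω ν k h z.1) z.2 := by
  obtain ⟨τ, hτ⟩ : ∃ τ, τ = (Ω ×ˢ ({0}ᶜ : Set E3)).indicator fun y => exitTime Ω y.1 y.2 := ⟨_, rfl⟩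
  have hτm : Measurable τ := hτ ▸ hΩ.measurable_indicator_exitTime
  have hνm : Measurable ν := hA.nu_differentiable.continuous.measurable
  have hkm : Measurable fun z : (ℝ × E3) × (E3 × E3) => k z.2.2 z.1.2 :=
    hA.k_measurable.comp (f := fun z : (ℝ × E3) × (E3 × E3) => (z.2.2, z.1.2)) (by fun_prop)
  have hm : Measurable fun z : (ℝ × E3) × (E3 × E3) =>
      τ z.2 * Real.exp (-(ν z.2.2 * (z.1.1 * τ z.2))) * k z.2.2 z.1.2 *
        h (z.2.1 - (z.1.1 * τ z.2) • z.2.2, z.1.2) := by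
    have h1 : Measurable fun z : (ℝ × E3) × (E3 × E3) => τ z.2 := by fun_prop
    have h2 : Measurable fun z : (ℝ × E3) × (E3 × E3) => (z.2.1 - (z.1.1 * τ z.2) • z.2.2, z.1.2) := by
      fun_prop
    have h3 := hh.comp h2
    have h4 : Measurable fun z : (ℝ × E3) × (E3 × E3) => ν z.2.2 := by fun_prop
    have h5 : Measurable fun z : (ℝ × E3) × (E3 × E3) => -(ν z.2.2 * (z.1.1 * τ z.2)) := by fun_prop
    exact ((h1.mul h5.exp).mul hkm).mul h3
  have hS : MeasurableSet {z : (ℝ × E3) × (E3 × E3) | z.2 ∈ Ω ×ˢ ({0}ᶜ : Set E3)} :=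
    measurable_snd hΩ.isOpen_moving.measurableSet
  convert hm.indicator hS using 1
  ext z
  by_cases hz : z.2 ∈ Ω ×ˢ ({0}ᶜ : Set E3)
  · rw [indicator_of_mem hz, indicator_of_mem (by exact hz), hτ, indicator_of_mem hz, rayTerm]
  · rw [indicator_of_notMem hz, indicator_of_notMem (by exact hz)]

section Integrable

variable {ρ γ : ℝ} {ν : E3 → ℝ} {k : E3 → E3 → ℝ} (hA : AssumptionA ρ γ ν k) {h : E3 × E3 → ℝ}
  {K : Set (E3 × E3)} (hK : IsCompact K) (hKΩ : K ⊆ Ω ×ˢ univ)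
include hA hK hKΩ

theorem aestronglyMeasurable_rayTerm (hh : Measurable h) :
    AEStronglyMeasurable (fun z : (ℝ × E3) × (E3 × E3) => rayTerm Ω ν k h z.1 z.2)
      (rayMeasure.prod (volume.restrict K)) := by
  refine (hΩ.measurable_indicator_rayTerm hA hh).aestronglyMeasurable.congr ?_
  filter_upwards [ae_rayMeasure_prod hK.measurableSet] with z hz
  rw [indicator_of_mem]
  exact ⟨(hKΩ hz.2.1).1, hz.2.2.1⟩

/-- The derivative is an almost everywhere limit of difference quotients of the extension of
`rayTerm` by zero, which is measurable. So the factors of the formula need no separate treatment. -/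
theorem aestronglyMeasurable_rayTermDeriv (hh : Differentiable ℝ h) (e : E3 × E3) :
    AEStronglyMeasurable (fun z : (ℝ × E3) × (E3 × E3) => rayTermDeriv Ω ν k h e z.1 z.2)
      (rayMeasure.prod (volume.restrict K)) := by
  have hm := hΩ.measurable_indicator_rayTerm hA hh.continuous.measurable
  set Z : (ℝ × E3) × (E3 × E3) → ℝ := fun z => (Ω ×ˢ ({0}ᶜ : Set E3)).indicator (rayTerm Ω ν k h z.1) z.2
  have ht : Tendsto (fun n : ℕ => 1 / ((n : ℝ) + 1)) atTop (𝓝[≠] 0) :=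
    tendsto_nhdsWithin_iff.2 ⟨tendsto_one_div_add_atTop_nhds_zero_nat, Eventually.of_forall fun n => by
      simp only [mem_compl_iff, mem_singleton_iff]; positivity⟩
  refine AEMeasurable.aestronglyMeasurable (aemeasurable_of_tendsto_metrizable_ae atTop
    (f := fun (n : ℕ) z => (1 / ((n : ℝ) + 1))⁻¹ • (Z (z.1, z.2 + (1 / ((n : ℝ) + 1)) • e) - Z z)) (fun n => ?_) ?_)
  · have h1 : Measurable fun z : (ℝ × E3) × (E3 × E3) => Z (z.1, z.2 + (1 / ((n : ℝ) + 1)) • e) :=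
      hm.comp (by fun_prop)
    exact (Measurable.const_smul (h1.sub hm) (1 / ((n : ℝ) + 1))⁻¹).aemeasurable
  · filter_upwards [ae_rayMeasure_prod hK.measurableSet] with z hz
    have hzA : z.2 ∈ Ω ×ˢ ({0}ᶜ : Set E3) := ⟨(hKΩ hz.2.1).1, hz.2.2.1⟩
    have hd := hΩ.hasDerivAt_rayTerm hA hh e z.1 hzA.1 hzA.2 hz.2.2.2
    have hev : ∀ᶠ s : ℝ in 𝓝 0, z.2 + s • e ∈ Ω ×ˢ ({0}ᶜ : Set E3) := by
      have hc : Continuous fun s : ℝ => z.2 + s • e := by fun_prop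
      have := hc.tendsto 0
      rw [zero_smul, add_zero] at this
      exact this (hΩ.isOpen_moving.mem_nhds hzA)
    have hd2 : HasDerivAt (fun s : ℝ => Z (z.1, z.2 + s • e)) (rayTermDeriv Ω ν k h e z.1 z.2) 0 := by
      refine hd.congr_of_eventuallyEq ?_
      filter_upwards [hev] with s hs
      exact indicator_of_mem hs _
    have := (hasDerivAt_iff_tendsto_slope_zero.1 hd2).comp ht
    simp only [zero_add, zero_smul, add_zero, Function.comp_def] at this
    exact this

variable (hh : ContDiff ℝ 1 h) (hs : HasCompactSupport h)
include hh hs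

theorem integrable_rayTerm :
    Integrable (fun z : (ℝ × E3) × (E3 × E3) => rayTerm Ω ν k h z.1 z.2)
      (rayMeasure.prod (volume.restrict K)) := by
  obtain ⟨c, hc, hb⟩ := hA.exists_rayTerm_bounds hh hs
  obtain ⟨D, hD⟩ := hb Ω hΩ K hK hKΩ 0 (by simp) (by simp)
  refine ((integrable_rayMajorant hc hK).const_mul D).mono'
    (hΩ.aestronglyMeasurable_rayTerm hA hK hKΩ hh.continuous.measurable) ?_
  filter_upwards [ae_rayMeasure_prod hK.measurableSet] with z hz
  exact (hD z.1 z.2 hz.1 hz.2.1 hz.2.2.1 hz.2.2.2).1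

theorem integrable_rayTermDeriv {e : E3 × E3} (he1 : ‖e.1‖ ≤ 1) (he2 : ‖e.2‖ ≤ 1) :
    Integrable (fun z : (ℝ × E3) × (E3 × E3) => rayTermDeriv Ω ν k h e z.1 z.2)
      (rayMeasure.prod (volume.restrict K)) := by
  obtain ⟨c, hc, hb⟩ := hA.exists_rayTerm_bounds hh hs
  obtain ⟨D, hD⟩ := hb Ω hΩ K hK hKΩ e he1 he2
  refine ((integrable_rayMajorant hc hK).const_mul D).mono'
    (hΩ.aestronglyMeasurable_rayTermDeriv hA hK hKΩ (hh.differentiable one_ne_zero) e) ?_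
  filter_upwards [ae_rayMeasure_prod hK.measurableSet] with z hz
  exact (hD z.1 z.2 hz.1 hz.2.1 hz.2.2.1 hz.2.2.2).2

end Integrable

end StationaryBoltzmann.IsBoundedConvexC2Domain

open scoped ENNReal NNReal

/-! ### Weak partial derivatives -/

/-- `g` is the weak derivative of `f` in the direction `e` on `Ω × ℝ³`. -/
structure HasWeakPartial (Ω : Set E3) (e : E3 × E3) (f g : E3 × E3 → ℝ) : Prop where
  locInt : LocallyIntegrableOn f (Ω ×ˢ univ)
  locInt_deriv : LocallyIntegrableOn g (Ω ×ˢ univ)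
  integral_eq : ∀ φ, IsTestFunction Ω φ →
    ∫ y in Ω ×ˢ univ, f y * fderiv ℝ φ y e = -∫ y in Ω ×ˢ univ, g y * φ y

theorem locallyIntegrableOn_prod_univ_iff {X : Type*} [NormedAddCommGroup X] {Ω : Set E3} (hΩ : IsOpen Ω)
    {f : E3 × E3 → X} : LocallyIntegrableOn f (Ω ×ˢ univ) ↔
      ∀ K, IsCompact K → K ⊆ Ω ×ˢ univ → IntegrableOn f K := by
  rw [locallyIntegrableOn_iff (hΩ.prod isOpen_univ).isLocallyClosed]
  exact ⟨fun h K hK hs => h K hs hK, fun h K hs hK => h K hK hs⟩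

theorem HasWeakPartial.congr {Ω : Set E3} (hΩ : IsOpen Ω) {e : E3 × E3} {f f' g g' : E3 × E3 → ℝ}
    (h : HasWeakPartial Ω e f g) (hf : f =ᵐ[volume.restrict (Ω ×ˢ univ)] f')
    (hg : g =ᵐ[volume.restrict (Ω ×ˢ univ)] g') : HasWeakPartial Ω e f' g' := by
  have key : ∀ {f f' : E3 × E3 → ℝ}, f =ᵐ[volume.restrict (Ω ×ˢ univ)] f' →
      LocallyIntegrableOn f (Ω ×ˢ univ) → LocallyIntegrableOn f' (Ω ×ˢ univ) := by
    intro f f' hf h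
    rw [locallyIntegrableOn_prod_univ_iff hΩ] at h ⊢
    exact fun K hK hs => (h K hK hs).congr (ae_restrict_of_ae_restrict_of_subset hs hf)
  refine ⟨key hf h.locInt, key hg h.locInt_deriv, fun φ hφ => ?_⟩
  exact (integral_congr_ae (hf.mul (EventuallyEq.refl _ fun y => fderiv ℝ φ y e))).symm.trans
    ((h.integral_eq φ hφ).trans (congrArg Neg.neg (integral_congr_ae (hg.mul (EventuallyEq.refl _ φ)))))

theorem StationaryBoltzmann.IsTestFunction.fderiv_eq_zero {Ω : Set E3} {φ : E3 × E3 → ℝ} {y : E3 × E3}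
    (hy : y ∉ tsupport φ) : fderiv ℝ φ y = 0 := by
  by_contra h
  exact hy (support_fderiv_subset ℝ h)

theorem hasDerivAt_line_of_zero {f : E3 × E3 → ℝ} {y e : E3 × E3} {f' t : ℝ}
    (h : HasDerivAt (fun s : ℝ => f (y + t • e + s • e)) f' 0) :
    HasDerivAt (fun s : ℝ => f (y + s • e)) f' t := by
  have h0 : HasDerivAt (fun s : ℝ => f (y + t • e + s • e)) f' (t - t) := by rwa [sub_self]
  have := HasDerivAt.comp_sub_const t t h0
  refine this.congr_of_eventuallyEq (Eventually.of_forall fun s => ?_)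
  simp only
  congr 1
  module

/-! ### Weak derivatives of `S_Ω K h` for smooth `h` -/

namespace StationaryBoltzmann.IsBoundedConvexC2Domain

variable {Ω : Set E3} (hΩ : IsBoundedConvexC2Domain Ω)
  {ρ γ : ℝ} {ν : E3 → ℝ} {k : E3 → E3 → ℝ} (hA : AssumptionA ρ γ ν k) {h : E3 × E3 → ℝ}
  (hh : ContDiff ℝ 1 h) (hs : HasCompactSupport h)
include hΩ hA hh hs

/-- Integration by parts for fixed `(θ, w)`: the product with the test function is differentiable
along almost every line in the direction `e`, and it vanishes off the support. -/
theorem integral_rayTerm_mul_add_eq_zero {e : E3 × E3} {φ : E3 × E3 → ℝ} (hφ : IsTestFunction Ω φ)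
    (π : ℝ × E3) (h1 : IntegrableOn (rayTerm Ω ν k h π) (tsupport φ))
    (h2 : IntegrableOn (rayTermDeriv Ω ν k h e π) (tsupport φ)) :
    ∫ y in tsupport φ, (rayTermDeriv Ω ν k h e π y * φ y + rayTerm Ω ν k h π y * fderiv ℝ φ y e) = 0 := by
  have hφc : Continuous φ := hφ.contDiff.continuous
  have hφd : Differentiable ℝ φ := hφ.contDiff.differentiable (by simp)
  have hφ'c : Continuous fun y => fderiv ℝ φ y e := (hφ.contDiff.continuous_fderiv (by simp)).clm_apply continuous_const
  obtain ⟨C, hC⟩ := hφ.hasCompactSupport.exists_bound_of_continuous hφc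
  obtain ⟨C', hC'⟩ := (hφ.hasCompactSupport.fderiv_apply (𝕜 := ℝ) e).exists_bound_of_continuous hφ'c
  have hK : MeasurableSet (tsupport φ) := (isClosed_tsupport φ).measurableSet
  have i1 : IntegrableOn (fun y => rayTerm Ω ν k h π y * φ y) (tsupport φ) :=
    h1.mul_bdd hφc.aestronglyMeasurable (ae_of_all _ hC)
  have i2 : IntegrableOn (fun y => rayTerm Ω ν k h π y * fderiv ℝ φ y e) (tsupport φ) :=
    h1.mul_bdd hφ'c.aestronglyMeasurable (ae_of_all _ hC')
  have i3 : IntegrableOn (fun y => rayTermDeriv Ω ν k h e π y * φ y) (tsupport φ) :=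
    h2.mul_bdd hφc.aestronglyMeasurable (ae_of_all _ hC)
  have z1 : ∀ y ∉ tsupport φ, φ y = 0 := fun y hy => image_eq_zero_of_notMem_tsupport hy
  have z2 : ∀ y ∉ tsupport φ, fderiv ℝ φ y = 0 := fun y hy =>
    IsTestFunction.fderiv_eq_zero (Ω := Ω) hy
  have e1 : ∀ y ∉ tsupport φ, rayTermDeriv Ω ν k h e π y * φ y + rayTerm Ω ν k h π y * fderiv ℝ φ y e = 0 :=
    fun y hy => by rw [z1 y hy, z2 y hy]; simp
  rw [setIntegral_eq_integral_of_forall_compl_eq_zero e1]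
  have I1 : Integrable (fun y => rayTerm Ω ν k h π y * φ y) :=
    (integrableOn_iff_integrable_of_support_subset (fun y hy => by
      by_contra hn; exact hy (by simp [z1 y hn]))).1 i1
  have I2 : Integrable (fun y => rayTermDeriv Ω ν k h e π y * φ y + rayTerm Ω ν k h π y * fderiv ℝ φ y e) :=
    (integrableOn_iff_integrable_of_support_subset (fun y hy => by
      by_contra hn; exact hy (e1 y hn))).1 (i3.add i2)
  have : (volume : Measure (E3 × E3)).IsAddHaarMeasure :=
    inferInstanceAs ((volume : Measure E3).prod volume).IsAddHaarMeasure
  refine integral_eq_zero_of_hasDerivAt_line volume e I1 I2 ?_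
  -- Almost every line in the direction `e` avoids both `v = 0`, where the exit time is not
  -- differentiable, and `v = w`, where the kernel is singular.
  filter_upwards [ae_forall_add_smul_snd_ne e 0, ae_forall_add_smul_snd_ne e π.2] with y hy0 hyw t
  apply hasDerivAt_line_of_zero (f := fun y => rayTerm Ω ν k h π y * φ y)
  set y' := y + t • e with hy'
  by_cases hyt : y' ∈ tsupport φ
  · have hd := hΩ.hasDerivAt_rayTerm hA (hh.differentiable one_ne_zero) e π (hφ.tsupport_subset hyt).1
      (hy0 t) (hyw t)
    have hl : HasDerivAt (fun s : ℝ => y' + s • e) e 0 := by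
      simpa using ((hasDerivAt_id (0 : ℝ)).smul_const e).const_add y'
    have hp : HasDerivAt (fun s : ℝ => φ (y' + s • e)) (fderiv ℝ φ y' e) 0 := by
      have h3 : HasFDerivAt φ (fderiv ℝ φ y') (y' + (0 : ℝ) • e) := by
        rw [zero_smul, add_zero]; exact (hφd y').hasFDerivAt
      exact h3.comp_hasDerivAt (0 : ℝ) hl
    refine (hd.mul hp).congr_deriv ?_
    simp
  · have hev : ∀ᶠ s : ℝ in 𝓝 0, y' + s • e ∈ (tsupport φ)ᶜ := by
      have hc : Continuous fun s : ℝ => y' + s • e := by fun_prop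
      have := hc.tendsto 0
      rw [zero_smul, add_zero] at this
      exact this ((isClosed_tsupport φ).isOpen_compl.mem_nhds hyt)
    rw [e1 y' hyt]
    refine (hasDerivAt_const (0 : ℝ) (0 : ℝ)).congr_of_eventuallyEq ?_
    filter_upwards [hev] with s hs
    rw [z1 _ hs, mul_zero]

/-- The majorant makes everything integrable jointly in `(θ, w)` and `(x, v)` over the support of
the test function, so the identity for fixed `(θ, w)` can be integrated. -/
theorem hasWeakPartial_integral_rayTerm {e : E3 × E3} (he1 : ‖e.1‖ ≤ 1) (he2 : ‖e.2‖ ≤ 1) :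
    HasWeakPartial Ω e (fun y => ∫ π, rayTerm Ω ν k h π y ∂rayMeasure)
      (fun y => ∫ π, rayTermDeriv Ω ν k h e π y ∂rayMeasure) := by
  refine ⟨?_, ?_, fun φ hφ => ?_⟩
  · exact (locallyIntegrableOn_prod_univ_iff hΩ.isOpen).2 fun K hK hKΩ =>
      (hΩ.integrable_rayTerm hA hK hKΩ hh hs).integral_prod_right
  · exact (locallyIntegrableOn_prod_univ_iff hΩ.isOpen).2 fun K hK hKΩ =>
      (hΩ.integrable_rayTermDeriv hA hK hKΩ hh hs he1 he2).integral_prod_right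
  have hφc : Continuous φ := hφ.contDiff.continuous
  have hφ'c : Continuous fun y => fderiv ℝ φ y e := (hφ.contDiff.continuous_fderiv (by simp)).clm_apply continuous_const
  obtain ⟨C, hC⟩ := hφ.hasCompactSupport.exists_bound_of_continuous hφc
  obtain ⟨C', hC'⟩ := (hφ.hasCompactSupport.fderiv_apply (𝕜 := ℝ) e).exists_bound_of_continuous hφ'c
  have hKc : IsCompact (tsupport φ) := hφ.hasCompactSupport
  have hK : MeasurableSet (tsupport φ) := (isClosed_tsupport φ).measurableSet
  have hZ := hΩ.integrable_rayTerm hA hKc hφ.tsupport_subset hh hs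
  have hF := hΩ.integrable_rayTermDeriv hA hKc hφ.tsupport_subset hh hs he1 he2
  have j1 : Integrable (fun z : (ℝ × E3) × (E3 × E3) => rayTerm Ω ν k h z.1 z.2 * fderiv ℝ φ z.2 e)
      (rayMeasure.prod (volume.restrict (tsupport φ))) :=
    hZ.mul_bdd (hφ'c.comp continuous_snd).aestronglyMeasurable (ae_of_all _ fun z => hC' z.2)
  have j2 : Integrable (fun z : (ℝ × E3) × (E3 × E3) => rayTermDeriv Ω ν k h e z.1 z.2 * φ z.2)
      (rayMeasure.prod (volume.restrict (tsupport φ))) :=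
    hF.mul_bdd (hφc.comp continuous_snd).aestronglyMeasurable (ae_of_all _ fun z => hC z.2)
  have r1 : ∫ y in Ω ×ˢ univ, (∫ π, rayTerm Ω ν k h π y ∂rayMeasure) * fderiv ℝ φ y e =
      ∫ π, ∫ y in tsupport φ, rayTerm Ω ν k h π y * fderiv ℝ φ y e ∂volume ∂rayMeasure := by
    rw [integral_integral_swap j1, setIntegral_eq_of_subset_of_forall_sdiff_eq_zero
      (hΩ.isOpen.measurableSet.prod MeasurableSet.univ) hφ.tsupport_subset]
    · refine integral_congr_ae (ae_of_all _ fun y => ?_)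
      exact (integral_mul_const _ _).symm
    · intro y hy
      rw [IsTestFunction.fderiv_eq_zero (Ω := Ω) hy.2]; simp
  have r2 : ∫ y in Ω ×ˢ univ, (∫ π, rayTermDeriv Ω ν k h e π y ∂rayMeasure) * φ y =
      ∫ π, ∫ y in tsupport φ, rayTermDeriv Ω ν k h e π y * φ y ∂volume ∂rayMeasure := by
    rw [integral_integral_swap j2, setIntegral_eq_of_subset_of_forall_sdiff_eq_zero
      (hΩ.isOpen.measurableSet.prod MeasurableSet.univ) hφ.tsupport_subset]
    · refine integral_congr_ae (ae_of_all _ fun y => ?_)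
      exact (integral_mul_const _ _).symm
    · intro y hy
      rw [image_eq_zero_of_notMem_tsupport hy.2, mul_zero]
  rw [r1, r2, eq_neg_iff_add_eq_zero, add_comm, ← integral_add j2.integral_prod_left j1.integral_prod_left]
  refine integral_eq_zero_of_ae ?_
  filter_upwards [hZ.prod_right_ae, hF.prod_right_ae, j1.prod_right_ae, j2.prod_right_ae] with π a1 a2 a3 a4
  rw [← integral_add a4 a3]
  exact hΩ.integral_rayTerm_mul_add_eq_zero hA hh hs hφ π a1 a2

theorem integrable_rayTerm_fiber {y : E3 × E3} (hx : y.1 ∈ Ω) (hv : y.2 ≠ 0) :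
    Integrable (fun π => rayTerm Ω ν k h π y) rayMeasure := by
  obtain ⟨c, hc, hb⟩ := hA.exists_rayTerm_bounds hh hs
  obtain ⟨D, hD⟩ := hb Ω hΩ {y} isCompact_singleton (singleton_subset_iff.2 ⟨hx, mem_univ _⟩) 0 (by simp) (by simp)
  refine ((integrable_rayMajorant_fiber hc hv).const_mul D).mono' ?_ ?_
  · have hkm : Measurable fun w => k y.2 w := hA.k_measurable.comp measurable_prodMk_left
    have hhm : Measurable h := hh.continuous.measurable
    unfold rayTerm
    fun_prop
  · have h1 : ∀ᵐ π : ℝ × E3 ∂rayMeasure, π.1 ∈ Ioc (0 : ℝ) 1 :=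
      Measure.quasiMeasurePreserving_fst.ae (ae_restrict_mem measurableSet_Ioc)
    have h2 : ∀ᵐ π : ℝ × E3 ∂rayMeasure, π.2 ≠ y.2 :=
      Measure.quasiMeasurePreserving_snd.ae (Measure.ae_ne volume y.2)
    filter_upwards [h1, h2] with π a b
    exact (hD π y a rfl hv b.symm).1

/-- The substitution `s = θ τ` fixes the limits of integration, so that differentiation in `(x, v)`
produces no separate endpoint term. -/
theorem opS_opK_eq_integral_rayTerm {y : E3 × E3} (hx : y.1 ∈ Ω) (hv : y.2 ≠ 0) :
    opS Ω ν (opK k h) y = ∫ π, rayTerm Ω ν k h π y ∂rayMeasure := by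
  rw [rayMeasure, integral_prod _ (hΩ.integrable_rayTerm_fiber hA hh hs hx hv), opS,
    ← intervalIntegral.integral_of_le zero_le_one]
  have h1 := intervalIntegral.smul_integral_comp_mul_right (a := 0) (b := 1)
    (fun s => Real.exp (-(ν y.2 * s)) * opK k h (y.1 - s • y.2, y.2)) (exitTime Ω y.1 y.2)
  rw [zero_mul, one_mul] at h1
  rw [← h1, smul_eq_mul, ← intervalIntegral.integral_const_mul]
  refine intervalIntegral.integral_congr fun θ _ => ?_
  simp only [opK, rayTerm]
  rw [← mul_assoc, ← integral_const_mul]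
  simp only [mul_assoc]

theorem hasWeakPartial_opS_opK {e : E3 × E3} (he1 : ‖e.1‖ ≤ 1) (he2 : ‖e.2‖ ≤ 1) :
    HasWeakPartial Ω e (opS Ω ν (opK k h)) (fun y => ∫ π, rayTermDeriv Ω ν k h e π y ∂rayMeasure) := by
  refine (hΩ.hasWeakPartial_integral_rayTerm hA hh hs he1 he2).congr hΩ.isOpen ?_ EventuallyEq.rfl
  have h0 : ∀ᵐ y : E3 × E3, y.2 ≠ 0 := by
    rw [Measure.volume_eq_prod]
    exact Measure.quasiMeasurePreserving_snd.ae (Measure.ae_ne volume 0)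
  filter_upwards [ae_restrict_mem (hΩ.isOpen.measurableSet.prod MeasurableSet.univ),
    ae_restrict_of_ae h0] with y hy hv
  exact (hΩ.opS_opK_eq_integral_rayTerm hA hh hs hy.1 hv).symm

end StationaryBoltzmann.IsBoundedConvexC2Domain

open scoped ENNReal NNReal

/-! ### Pointwise bounds by the integral operators -/

/-- Quantitative bounds on the collision frequency and on the weighted kernel. -/
structure KernelBounds (ν : E3 → ℝ) (k : E3 → E3 → ℝ) (α a B C c : ℝ) : Prop where
  a_pos : 0 < a
  B_pos : 0 < B
  C_pos : 0 < C
  c_pos : 0 < c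
  le_nu : ∀ v, a ≤ ν v
  nu_deriv_le : ∀ v, ‖fderiv ℝ ν v‖ ≤ B
  k_le : ∀ v w, v ≠ w → Real.exp (α * ‖v‖ ^ 2) * |k v w| ≤
    C * (‖v - w‖⁻¹ * Real.exp (-c * ‖v - w‖ ^ 2)) * Real.exp (α * ‖w‖ ^ 2)
  k_deriv_le : ∀ v w, v ≠ w → Real.exp (α * ‖v‖ ^ 2) * ‖fderiv ℝ (fun u => k u w) v‖ ≤
    C * gradKernel c v w * Real.exp (α * ‖w‖ ^ 2)

theorem StationaryBoltzmann.AssumptionA.exists_kernelBounds {ρ γ : ℝ} {ν : E3 → ℝ} {k : E3 → E3 → ℝ}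
    (hA : AssumptionA ρ γ ν k) {α : ℝ} (hα : 0 ≤ α) (hα' : α < (1 - ρ) / 2) :
    ∃ a B C c : ℝ, KernelBounds ν k α a B C c := by
  obtain ⟨C, c, hC, hc, hk⟩ := hA.exists_weighted_kernel_le hα hα'
  obtain ⟨a, B, ha, hB, hν⟩ := hA.exists_nu_bounds
  exact ⟨a, B, C, c, ha, hB, hC, hc, fun v => (hν v).1, fun v => (hν v).2,
    fun v w h => (hk v w h).1, fun v w h => (hk v w h).2⟩

/-- `e^{α|v|²} |f(x, v)|`. -/
noncomputable def weighted {X : Type*} [NormedAddCommGroup X] (α : ℝ) (f : E3 × E3 → X) (y : E3 × E3) : ℝ≥0∞ :=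
  ENNReal.ofReal (Real.exp (α * ‖y.2‖ ^ 2)) * ‖f y‖ₑ

theorem measurable_weighted {X : Type*} [NormedAddCommGroup X] [MeasurableSpace X] [OpensMeasurableSpace X]
    (α : ℝ) {f : E3 × E3 → X} (hf : Measurable f) : Measurable (weighted α f) := by
  unfold weighted; fun_prop

/-- The derivative in the space variable. -/
noncomputable def spaceDeriv (h : E3 × E3 → ℝ) (y : E3 × E3) : E3 →L[ℝ] ℝ :=
  (fderiv ℝ h y).comp (ContinuousLinearMap.inl ℝ E3 E3)

theorem continuous_spaceDeriv {h : E3 × E3 → ℝ} (hh : ContDiff ℝ 1 h) : Continuous (spaceDeriv h) := by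
  have := hh.continuous_fderiv one_ne_zero
  unfold spaceDeriv
  fun_prop

theorem gaussOp_add (c : ℝ) {u u' : E3 → ℝ≥0∞} (hu : Measurable u) (v : E3) :
    gaussOp c (fun w => u w + u' w) v = gaussOp c u v + gaussOp c u' v := by
  unfold gaussOp
  simp only [mul_add]
  exact lintegral_add_left (by fun_prop) _

theorem lintegral_ray_le_rayOp {Ω : Set E3} (hΩ : IsBoundedConvexC2Domain Ω) (a : ℝ)
    (F : E3 × E3 → ℝ≥0∞) {y : E3 × E3} (hx : y.1 ∈ Ω) (hv : y.2 ≠ 0) :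
    ∫⁻ s in Ioc 0 (exitTime Ω y.1 y.2), ENNReal.ofReal (Real.exp (-a * s)) * F (y.1 - s • y.2, y.2) ≤
      rayOp Ω a F y := by
  rw [← restrict_Ioo_eq_restrict_Ioc, rayOp]
  refine le_trans (setLIntegral_mono' measurableSet_Ioo fun s hs => ?_)
    (lintegral_mono_set (Ioo_subset_Ioi_self : Ioo 0 (exitTime Ω y.1 y.2) ⊆ Ioi 0))
  have h1 : y.1 - s • y.2 ∈ Ω := (hΩ.mem_iff_lt_exitTime' hv hx hs.1.le).2 hs.2
  have h2 : s * ‖y.2‖ ≤ Metric.diam Ω :=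
    (mul_le_mul_of_nonneg_right hs.2.le (norm_nonneg _)).trans
      (hΩ.exitTime_mul_norm_le_diam (v := y.2) (subset_closure hx))
  rw [indicator_of_mem (show s * ‖y.2‖ ∈ Iic (Metric.diam Ω) from h2),
    indicator_of_mem (show (y.1 - s • y.2, y.2) ∈ Ω ×ˢ (univ : Set E3) from ⟨h1, mem_univ _⟩), Pi.one_apply, one_mul]

/-- This returns from `θ` to the time `s = θ t`; it is stated for arbitrary functions, without
measurability. -/
theorem lintegral_Ioc_mul_comp_mul {t : ℝ} (ht : 0 < t) (f : ℝ → ℝ≥0∞) :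
    ∫⁻ θ in Ioc (0 : ℝ) 1, ENNReal.ofReal t * f (θ * t) = ∫⁻ s in Ioc 0 t, f s := by
  have h := lintegral_image_eq_lintegral_abs_deriv_mul (s := Ioc (0 : ℝ) 1) (f := fun θ => θ * t)
    (f' := fun _ => t) measurableSet_Ioc (fun θ _ => (by
      simpa using ((hasDerivAt_id θ).mul_const t).hasDerivWithinAt)) (fun a _ b _ hab =>
      mul_right_cancel₀ ht.ne' hab) f
  have e : (fun θ => θ * t) '' Ioc (0 : ℝ) 1 = Ioc 0 t := by
    rw [image_mul_right_Ioc _ _ ht]; simp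
  rw [e, abs_of_pos ht] at h
  exact h.symm

/-- The integrand is the derivative of `θ e^{-nθt} h(x - θ t v, w)`, which vanishes at `θ = 0`. Only
the value at the exit point survives, and the term with `∇ₓh` that multiplies the derivative of `τ`
disappears. -/
theorem integral_hasDerivAt_ray {h : E3 × E3 → ℝ} (hh : ContDiff ℝ 1 h) (n t : ℝ) (x v w : E3) :
    ∫ θ in (0 : ℝ)..1, (Real.exp (-(n * (θ * t))) * h (x - (θ * t) • v, w) +
      θ * (-(n * t) * Real.exp (-(n * (θ * t))) * h (x - (θ * t) • v, w) +
        Real.exp (-(n * (θ * t))) * fderiv ℝ h (x - (θ * t) • v, w) (-(t • v), 0))) =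
      Real.exp (-(n * t)) * h (x - t • v, w) := by
  have hd : ∀ θ : ℝ, HasDerivAt (fun θ : ℝ => θ * (Real.exp (-(n * (θ * t))) * h (x - (θ * t) • v, w)))
      (Real.exp (-(n * (θ * t))) * h (x - (θ * t) • v, w) +
      θ * (-(n * t) * Real.exp (-(n * (θ * t))) * h (x - (θ * t) • v, w) +
        Real.exp (-(n * (θ * t))) * fderiv ℝ h (x - (θ * t) • v, w) (-(t • v), 0))) θ := fun θ => by
    have h1 : HasDerivAt (fun θ : ℝ => θ * t) t θ := by simpa using (hasDerivAt_id θ).mul_const t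
    have h2 := ((h1.const_mul n).neg).exp
    have h3 := ((h1.smul_const v).const_sub x).prodMk (hasDerivAt_const θ w)
    have h4 := (hh.differentiable one_ne_zero (x - (θ * t) • v, w)).hasFDerivAt.comp_hasDerivAt θ h3
    refine ((hasDerivAt_id θ).mul (h2.mul h4)).congr_deriv ?_
    simp only [id, one_mul, Pi.neg_apply, Pi.mul_apply, Function.comp_apply]
    ring
  have hc : Continuous fun θ : ℝ => (Real.exp (-(n * (θ * t))) * h (x - (θ * t) • v, w) +
      θ * (-(n * t) * Real.exp (-(n * (θ * t))) * h (x - (θ * t) • v, w) +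
        Real.exp (-(n * (θ * t))) * fderiv ℝ h (x - (θ * t) • v, w) (-(t • v), 0))) := by
    have h1 := hh.continuous
    have h2 := hh.continuous_fderiv one_ne_zero
    fun_prop
  rw [intervalIntegral.integral_eq_sub_of_hasDerivAt (fun θ _ => hd θ) (hc.intervalIntegrable _ _)]
  simp

theorem exp_mul_ofReal_enorm (m r : ℝ) (hm : 0 ≤ m) : ENNReal.ofReal m * ‖r‖ₑ = ENNReal.ofReal (m * |r|) := by
  rw [ENNReal.ofReal_mul hm, ← Real.norm_eq_abs, ofReal_norm]

namespace KernelBounds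

variable {ν : E3 → ℝ} {k : E3 → E3 → ℝ} {α a B C c : ℝ} (hb : KernelBounds ν k α a B C c)
include hb

theorem ofReal_k_le {v w : E3} (hvw : v ≠ w) (y : E3) (f : E3 × E3 → ℝ) :
    ENNReal.ofReal (Real.exp (α * ‖v‖ ^ 2)) * ‖k v w * f (y, w)‖ₑ ≤
      ENNReal.ofReal C * (‖v - w‖ₑ⁻¹ * gaussE c (v - w) * weighted α f (y, w)) := by
  rw [enorm_mul, ← mul_assoc, exp_mul_ofReal_enorm _ _ (Real.exp_pos _).le]
  calc _ ≤ ENNReal.ofReal (C * (‖v - w‖⁻¹ * Real.exp (-c * ‖v - w‖ ^ 2)) * Real.exp (α * ‖w‖ ^ 2)) *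
        ‖f (y, w)‖ₑ := mul_le_mul_left (ENNReal.ofReal_le_ofReal (hb.k_le v w hvw)) _
    _ = ENNReal.ofReal C * (ENNReal.ofReal (‖v - w‖⁻¹ * Real.exp (-c * ‖v - w‖ ^ 2)) * weighted α f (y, w)) := by
        rw [ENNReal.ofReal_mul (mul_nonneg hb.C_pos.le (by positivity)), ENNReal.ofReal_mul hb.C_pos.le, weighted]
        ring
    _ ≤ _ := by
        gcongr
        exact ofReal_inv_norm_mul_exp_le c (v - w)

/-- The derivative of the integrand without the boundary contribution. -/
theorem abs_interior_le {h : E3 × E3 → ℝ} {e : E3 × E3} (he1 : ‖e.1‖ ≤ 1) (he2 : ‖e.2‖ ≤ 1)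
    {s : ℝ} (hs : 0 ≤ s) {v w : E3} (hvw : v ≠ w) (x : E3) :
    ENNReal.ofReal (Real.exp (α * ‖v‖ ^ 2)) * ‖Real.exp (-(ν v * s)) *
      (fderiv ℝ (fun u => k u w) v e.2 * h (x, w) + k v w * (-(s * fderiv ℝ ν v e.2) * h (x, w) +
        fderiv ℝ h (x, w) (e.1 - s • e.2, 0)))‖ₑ ≤
    ENNReal.ofReal ((1 + 2 / a) * C * (1 + B)) * (ENNReal.ofReal (Real.exp (-(a / 2) * s)) *
      (ENNReal.ofReal (gradKernel c v w) * weighted α h (x, w) +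
        ‖v - w‖ₑ⁻¹ * gaussE c (v - w) * (weighted α h (x, w) + weighted α (spaceDeriv h) (x, w)))) := by
  have ha := hb.a_pos
  have hB := hb.B_pos
  have hC := hb.C_pos
  set m := Real.exp (α * ‖v‖ ^ 2)
  set m' := Real.exp (α * ‖w‖ ^ 2)
  set A := ‖v - w‖⁻¹ * Real.exp (-c * ‖v - w‖ ^ 2) with hA
  have hA0 : 0 ≤ A := by positivity
  have hG := gradKernel_nonneg c v w
  set G := gradKernel c v w
  set H := h (x, w)
  set D := ‖spaceDeriv h (x, w)‖ with hD
  have hD0 : 0 ≤ D := norm_nonneg _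
  set E := Real.exp (-(ν v * s)) with hE
  have hm : 0 < m := Real.exp_pos _
  have hm' : 0 < m' := Real.exp_pos _
  have hk : m * |k v w| ≤ C * A * m' := hb.k_le v w hvw
  have hk' : m * ‖fderiv ℝ (fun u => k u w) v‖ ≤ C * G * m' := hb.k_deriv_le v w hvw
  have hEE : E * (1 + s) ≤ (1 + 2 / a) * Real.exp (-(a / 2) * s) := exp_neg_mul_one_add_le ha (hb.le_nu v) hs
  have hD2 : |fderiv ℝ h (x, w) (e.1 - s • e.2, 0)| ≤ D * (1 + s) := by
    have : fderiv ℝ h (x, w) (e.1 - s • e.2, 0) = spaceDeriv h (x, w) (e.1 - s • e.2) := by simp [spaceDeriv]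
    rw [this]
    refine ((spaceDeriv h (x, w)).le_opNorm _).trans ?_
    gcongr
    refine (norm_sub_le _ _).trans ?_
    rw [norm_smul, Real.norm_of_nonneg hs]
    have : s * ‖e.2‖ ≤ s * 1 := by gcongr
    linarith
  have hν2 : |fderiv ℝ ν v e.2| ≤ B := by
    refine ((fderiv ℝ ν v).le_opNorm _).trans ?_
    have : ‖fderiv ℝ ν v‖ * ‖e.2‖ ≤ B * 1 := by gcongr; exact hb.nu_deriv_le v
    linarith
  have hk2 : m * |fderiv ℝ (fun u => k u w) v e.2| ≤ C * G * m' := by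
    refine le_trans ?_ hk'
    gcongr
    refine ((fderiv ℝ (fun u => k u w) v).le_opNorm _).trans ?_
    exact mul_le_of_le_one_right (norm_nonneg _) he2
  have key : m * |E * (fderiv ℝ (fun u => k u w) v e.2 * H + k v w * (-(s * fderiv ℝ ν v e.2) * H +
        fderiv ℝ h (x, w) (e.1 - s • e.2, 0)))| ≤
      (1 + 2 / a) * C * (1 + B) * (Real.exp (-(a / 2) * s) * (G * (m' * |H|) + A * (m' * |H| + m' * D))) := by
    set κ' := fderiv ℝ (fun u => k u w) v e.2
    set T := fderiv ℝ h (x, w) (e.1 - s • e.2, 0)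
    set n' := fderiv ℝ ν v e.2
    rw [abs_mul, abs_of_pos (Real.exp_pos _), ← hE]
    have hE0 : 0 < E := Real.exp_pos _
    have h1 : |κ' * H + k v w * (-(s * n') * H + T)| ≤ |κ'| * |H| + |k v w| * (s * B * |H| + D * (1 + s)) := by
      refine (abs_add_le _ _).trans ?_
      rw [abs_mul, abs_mul]
      gcongr
      refine (abs_add_le _ _).trans ?_
      rw [abs_mul, abs_neg, abs_mul, abs_of_nonneg hs]
      gcongr
    calc m * (E * |κ' * H + k v w * (-(s * n') * H + T)|)
        ≤ m * (E * (|κ'| * |H| + |k v w| * (s * B * |H| + D * (1 + s)))) := by gcongr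
      _ = E * ((m * |κ'|) * |H| + (m * |k v w|) * (s * B * |H| + D * (1 + s))) := by ring
      _ ≤ E * ((C * G * m') * |H| + (C * A * m') * (s * B * |H| + D * (1 + s))) := by gcongr
      -- All coefficients are raised to the common factor `(1+s)(1+B)`, so that the decay of `E` is
      -- used only once.
      _ ≤ E * ((C * G * m') * |H| * ((1 + s) * (1 + B)) +
          (C * A * m') * ((1 + s) * (1 + B) * |H| + D * ((1 + s) * (1 + B)))) := by
          have h1 : 1 ≤ (1 + s) * (1 + B) := by nlinarith
          have h2 : s * B ≤ (1 + s) * (1 + B) := by nlinarith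
          have h3 : 1 + s ≤ (1 + s) * (1 + B) := by nlinarith
          gcongr E * (?_ + C * A * m' * (?_ * |H| + D * ?_))
          · exact le_mul_of_one_le_right (by positivity) h1
      _ = (E * (1 + s)) * (C * (1 + B) * (G * (m' * |H|) + A * (m' * |H| + m' * D))) := by ring
      _ ≤ ((1 + 2 / a) * Real.exp (-(a / 2) * s)) * (C * (1 + B) * (G * (m' * |H|) + A * (m' * |H| + m' * D))) := by
          gcongr
      _ = _ := by ring
  rw [exp_mul_ofReal_enorm _ _ hm.le]
  refine (ENNReal.ofReal_le_ofReal key).trans ?_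
  have w1 : weighted α h (x, w) = ENNReal.ofReal (m' * |H|) := exp_mul_ofReal_enorm _ _ hm'.le
  have w2 : weighted α (spaceDeriv h) (x, w) = ENNReal.ofReal (m' * D) := by
    rw [weighted, ENNReal.ofReal_mul hm'.le, hD, ofReal_norm]
  rw [w1, w2, ENNReal.ofReal_mul (by positivity), ENNReal.ofReal_mul (Real.exp_pos _).le,
    ENNReal.ofReal_add (by positivity) (by positivity), ENNReal.ofReal_mul hG, ENNReal.ofReal_mul hA0,
    ENNReal.ofReal_add (by positivity) (by positivity)]
  gcongr
  exact ofReal_inv_norm_mul_exp_le c (v - w)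

/-- The derivative of the exit time contributes `(1 + τ)/|n·v|`. The damping `e^{-ντ}` absorbs `1 +
τ`, and the singular factor `|n·v|⁻¹` is kept. The factor `1 + B ≥ 1` only unifies the constant with
that of the interior terms. -/
theorem boundary_term_le {Ω : Set E3} (hΩ : IsBoundedConvexC2Domain Ω) {e : E3 × E3} (he1 : ‖e.1‖ ≤ 1)
    (he2 : ‖e.2‖ ≤ 1) {y : E3 × E3} (hx : y.1 ∈ Ω) (hv : y.2 ≠ 0) {w : E3} (hvw : y.2 ≠ w) (h : E3 × E3 → ℝ) :
    ENNReal.ofReal (Real.exp (α * ‖y.2‖ ^ 2)) * ‖exitTimeDeriv Ω y e * k y.2 w *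
      (Real.exp (-(ν y.2 * exitTime Ω y.1 y.2)) * h (exitPoint Ω y.1 y.2, w))‖ₑ ≤
    ENNReal.ofReal ((1 + 2 / a) * C * (1 + B)) *
      (‖(inner ℝ (outwardNormal Ω (exitPoint Ω y.1 y.2)) y.2 : ℝ)‖ₑ⁻¹ *
        (‖y.2 - w‖ₑ⁻¹ * gaussE c (y.2 - w) * weighted α h (exitPoint Ω y.1 y.2, w))) := by
  have ha := hb.a_pos
  have hτ := exitTime_nonneg Ω y.1 y.2
  have hin := (hΩ.inner_outwardNormal_exitPoint_neg hv hx).ne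
  have h1 := hΩ.abs_exitTimeDeriv_le hv hx he1 he2
  have h2 := exp_neg_mul_one_add_le ha (hb.le_nu y.2) hτ
  have h3 : Real.exp (-(a / 2) * exitTime Ω y.1 y.2) ≤ 1 :=
    Real.exp_le_one_iff.2 (by have : 0 ≤ a / 2 * exitTime Ω y.1 y.2 := by positivity
                              linarith)
  set n := (inner ℝ (outwardNormal Ω (exitPoint Ω y.1 y.2)) y.2 : ℝ)
  set τ := exitTime Ω y.1 y.2
  have h4 : |exitTimeDeriv Ω y e * Real.exp (-(ν y.2 * τ))| ≤ (1 + 2 / a) * (1 + B) * |n|⁻¹ := by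
    have hB := hb.B_pos
    rw [abs_mul, abs_of_pos (Real.exp_pos _)]
    calc _ ≤ |n|⁻¹ * (1 + τ) * Real.exp (-(ν y.2 * τ)) := by gcongr
      _ = |n|⁻¹ * (Real.exp (-(ν y.2 * τ)) * (1 + τ)) := by ring
      _ ≤ |n|⁻¹ * ((1 + 2 / a) * 1) :=
          mul_le_mul_of_nonneg_left (h2.trans (by gcongr)) (by positivity)
      _ = |n|⁻¹ * ((1 + 2 / a) * 1) * 1 := (mul_one _).symm
      _ ≤ |n|⁻¹ * ((1 + 2 / a) * 1) * (1 + B) := by gcongr; linarith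
      _ = _ := by ring
  calc _ = ‖exitTimeDeriv Ω y e * Real.exp (-(ν y.2 * τ))‖ₑ *
        (ENNReal.ofReal (Real.exp (α * ‖y.2‖ ^ 2)) * ‖k y.2 w * h (exitPoint Ω y.1 y.2, w)‖ₑ) := by
        simp only [enorm_mul]; ring
    _ ≤ ENNReal.ofReal ((1 + 2 / a) * (1 + B) * |n|⁻¹) * (ENNReal.ofReal C *
        (‖y.2 - w‖ₑ⁻¹ * gaussE c (y.2 - w) * weighted α h (exitPoint Ω y.1 y.2, w))) := by
        refine mul_le_mul' ?_ (hb.ofReal_k_le hvw _ h)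
        rw [← ofReal_norm, Real.norm_eq_abs]
        exact ENNReal.ofReal_le_ofReal h4
    _ = _ := by
        have hB := hb.B_pos
        have hC := hb.C_pos
        have : ENNReal.ofReal |n|⁻¹ = ‖n‖ₑ⁻¹ := by
          rw [ENNReal.ofReal_inv_of_pos (abs_pos.2 hin), ← Real.norm_eq_abs, ofReal_norm]
        rw [ENNReal.ofReal_mul (by positivity), this, mul_right_comm (1 + 2 / a) C,
          ENNReal.ofReal_mul (p := (1 + 2 / a) * (1 + B)) (by positivity)]
        ring

/-- The bound on the integral in `θ` of the derivative, for a fixed velocity `w`. -/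
theorem enorm_setIntegral_rayTermDeriv_le {Ω : Set E3} (hΩ : IsBoundedConvexC2Domain Ω) {e : E3 × E3}
    (he1 : ‖e.1‖ ≤ 1) (he2 : ‖e.2‖ ≤ 1) {h : E3 × E3 → ℝ} (hh : ContDiff ℝ 1 h) {y : E3 × E3} (hx : y.1 ∈ Ω)
    (hv : y.2 ≠ 0) {w : E3} (hvw : y.2 ≠ w) :
    ENNReal.ofReal (Real.exp (α * ‖y.2‖ ^ 2)) * ‖∫ θ in Ioc (0 : ℝ) 1, rayTermDeriv Ω ν k h e (θ, w) y‖ₑ ≤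
    ENNReal.ofReal ((1 + 2 / a) * C * (1 + B)) *
      (‖(inner ℝ (outwardNormal Ω (exitPoint Ω y.1 y.2)) y.2 : ℝ)‖ₑ⁻¹ *
        (‖y.2 - w‖ₑ⁻¹ * gaussE c (y.2 - w) * weighted α h (exitPoint Ω y.1 y.2, w))) +
    ∫⁻ s in Ioc 0 (exitTime Ω y.1 y.2),
      ENNReal.ofReal ((1 + 2 / a) * C * (1 + B)) * (ENNReal.ofReal (Real.exp (-(a / 2) * s)) *
      (ENNReal.ofReal (gradKernel c y.2 w) * weighted α h (y.1 - s • y.2, w) +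
        ‖y.2 - w‖ₑ⁻¹ * gaussE c (y.2 - w) *
          (weighted α h (y.1 - s • y.2, w) + weighted α (spaceDeriv h) (y.1 - s • y.2, w)))) := by
  have hc1 := hh.continuous
  have hc2 := hh.continuous_fderiv one_ne_zero
  have hτ : 0 < exitTime Ω y.1 y.2 := hΩ.exitTime_pos hv hx
  obtain ⟨x, v⟩ := y
  simp only at *
  have hbt := hb.boundary_term_le hΩ he1 he2 (y := (x, v)) hx hv hvw h
  simp only [exitPoint] at hbt ⊢
  set τ := exitTime Ω x v
  set P : ℝ → ℝ := fun θ => Real.exp (-(ν v * (θ * τ))) * h (x - (θ * τ) • v, w) +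
      θ * (-(ν v * τ) * Real.exp (-(ν v * (θ * τ))) * h (x - (θ * τ) • v, w) +
        Real.exp (-(ν v * (θ * τ))) * fderiv ℝ h (x - (θ * τ) • v, w) (-(τ • v), 0)) with hP
  set Q : ℝ → ℝ := fun s => Real.exp (-(ν v * s)) *
      (fderiv ℝ (fun u => k u w) v e.2 * h (x - s • v, w) + k v w * (-(s * fderiv ℝ ν v e.2) * h (x - s • v, w) +
        fderiv ℝ h (x - s • v, w) (e.1 - s • e.2, 0))) with hQ
  have hPc : Continuous P := by fun_prop
  have hQc : Continuous fun θ => τ * Q (θ * τ) := by fun_prop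
  have hPi : IntegrableOn P (Ioc (0 : ℝ) 1) := hPc.integrableOn_Ioc
  have hQi : IntegrableOn (fun θ => τ * Q (θ * τ)) (Ioc (0 : ℝ) 1) := hQc.integrableOn_Ioc
  -- The bracket `P` multiplies the derivative of `τ` and is an exact `θ`-derivative; `Q` collects
  -- what is differentiated at a fixed time.
  have e1 : ∫ θ in Ioc (0 : ℝ) 1, rayTermDeriv Ω ν k h e (θ, w) (x, v) =
      exitTimeDeriv Ω (x, v) e * k v w * (Real.exp (-(ν v * τ)) * h (x - τ • v, w)) +
        ∫ θ in Ioc (0 : ℝ) 1, τ * Q (θ * τ) := by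
    rw [← integral_hasDerivAt_ray hh, intervalIntegral.integral_of_le zero_le_one, ← integral_const_mul,
      ← integral_add (hPi.const_mul _) hQi]
    rfl
  rw [e1]
  refine (mul_le_mul_right (enorm_add_le _ _) _).trans ?_
  rw [mul_add]
  refine add_le_add hbt ?_
  calc ENNReal.ofReal (Real.exp (α * ‖v‖ ^ 2)) * ‖∫ θ in Ioc (0 : ℝ) 1, τ * Q (θ * τ)‖ₑ
      ≤ ENNReal.ofReal (Real.exp (α * ‖v‖ ^ 2)) * ∫⁻ θ in Ioc (0 : ℝ) 1, ‖τ * Q (θ * τ)‖ₑ := by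
        gcongr; exact enorm_integral_le_lintegral_enorm _
    _ = ∫⁻ θ in Ioc (0 : ℝ) 1, ENNReal.ofReal τ * (ENNReal.ofReal (Real.exp (α * ‖v‖ ^ 2)) * ‖Q (θ * τ)‖ₑ) := by
        rw [← lintegral_const_mul' _ _ ENNReal.ofReal_ne_top]
        refine lintegral_congr fun θ => ?_
        rw [enorm_mul, Real.enorm_of_nonneg hτ.le]
        ring
    _ = ∫⁻ s in Ioc 0 τ, ENNReal.ofReal (Real.exp (α * ‖v‖ ^ 2)) * ‖Q s‖ₑ :=
        lintegral_Ioc_mul_comp_mul hτ (fun s => ENNReal.ofReal (Real.exp (α * ‖v‖ ^ 2)) * ‖Q s‖ₑ)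
    _ ≤ _ := setLIntegral_mono' measurableSet_Ioc fun s hs => hb.abs_interior_le he1 he2 hs.1.le hvw _

end KernelBounds

theorem rayOp_add {Ω : Set E3} (hΩ : MeasurableSet Ω) (a : ℝ) {F G : E3 × E3 → ℝ≥0∞} (hF : Measurable F)
    (y : E3 × E3) : rayOp Ω a (fun y => F y + G y) y = rayOp Ω a F y + rayOp Ω a G y := by
  unfold rayOp
  rw [← lintegral_add_left]
  · refine lintegral_congr fun s => ?_
    rw [← mul_add, ← mul_add, indicator_add]
  · have h1 : Measurable fun s : ℝ => (Iic (Metric.diam Ω)).indicator (1 : ℝ → ℝ≥0∞) (s * ‖y.2‖) :=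
      (measurable_one.indicator measurableSet_Iic).comp (by fun_prop)
    have h2 : Measurable fun s : ℝ => (Ω ×ˢ univ).indicator F (y.1 - s • y.2, y.2) :=
      (hF.indicator (hΩ.prod (MeasurableSet.univ (α := E3)))).comp (by fun_prop)
    exact Measurable.mul (by fun_prop) (h1.mul h2)

-- The bound for fixed `w` is integrated in `w`; Tonelli exchanges this with the time integral and
-- makes the velocity operators appear inside the ray integrals. The gradient of `h` enters only
-- through `spaceDeriv`.
set_option maxHeartbeats 1000000 in
theorem KernelBounds.enorm_integral_rayTermDeriv_le {ν : E3 → ℝ} {k : E3 → E3 → ℝ} {α a B C c : ℝ}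
    (hb : KernelBounds ν k α a B C c) {Ω : Set E3} (hΩ : IsBoundedConvexC2Domain Ω) {e : E3 × E3}
    (he1 : ‖e.1‖ ≤ 1) (he2 : ‖e.2‖ ≤ 1) {h : E3 × E3 → ℝ} (hh : ContDiff ℝ 1 h) {y : E3 × E3} (hx : y.1 ∈ Ω)
    (hv : y.2 ≠ 0) :
    ENNReal.ofReal (Real.exp (α * ‖y.2‖ ^ 2)) * ‖∫ π, rayTermDeriv Ω ν k h e π y ∂rayMeasure‖ₑ ≤
      ENNReal.ofReal ((1 + 2 / a) * C * (1 + B)) * (exitOp Ω c (weighted α h) y +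
        (rayOp Ω (a / 2) (fun y => gradOp c (fun w => weighted α h (y.1, w)) y.2) y +
        (rayOp Ω (a / 2) (fun y => gaussOp c (fun w => weighted α h (y.1, w)) y.2) y +
        rayOp Ω (a / 2) (fun y => gaussOp c (fun w => weighted α (spaceDeriv h) (y.1, w)) y.2) y))) := by
  -- If the derivative is not integrable in `(θ, w)`, its integral has the default value `0` and the
  -- bound is trivial.
  by_cases hi : Integrable (fun π => rayTermDeriv Ω ν k h e π y) rayMeasure
  swap
  · rw [integral_undef hi]; simp
  set U := weighted α h with hU
  set U' := weighted α (spaceDeriv h) with hU'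
  have hUm : Measurable U := measurable_weighted α hh.continuous.measurable
  have hUm' : Measurable U' := measurable_weighted α (continuous_spaceDeriv hh).measurable
  set M := ENNReal.ofReal ((1 + 2 / a) * C * (1 + B)) with hM
  have hMt : M ≠ ∞ := ENNReal.ofReal_ne_top
  have hgk := measurable_gradKernel_left c y.2
  have m1 : Measurable fun y : E3 × E3 => gradOp c (fun w => U (y.1, w)) y.2 :=
    measurable_gradOp c measurable_snd (u := fun z => U (z.1.1, z.2)) (by fun_prop)
  have m2 : Measurable fun y : E3 × E3 => gaussOp c (fun w => U (y.1, w)) y.2 :=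
    measurable_gaussOp c measurable_snd (u := fun z => U (z.1.1, z.2)) (by fun_prop)
  rw [rayMeasure] at hi ⊢
  rw [integral_prod_symm _ hi]
  calc _ ≤ ENNReal.ofReal (Real.exp (α * ‖y.2‖ ^ 2)) *
        ∫⁻ w, ‖∫ θ in Ioc (0 : ℝ) 1, rayTermDeriv Ω ν k h e (θ, w) y‖ₑ := by
        gcongr; exact enorm_integral_le_lintegral_enorm _
    _ ≤ ∫⁻ w, (M * (‖(inner ℝ (outwardNormal Ω (exitPoint Ω y.1 y.2)) y.2 : ℝ)‖ₑ⁻¹ *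
          (‖y.2 - w‖ₑ⁻¹ * gaussE c (y.2 - w) * U (exitPoint Ω y.1 y.2, w))) +
        ∫⁻ s in Ioc 0 (exitTime Ω y.1 y.2), M * (ENNReal.ofReal (Real.exp (-(a / 2) * s)) *
          (ENNReal.ofReal (gradKernel c y.2 w) * U (y.1 - s • y.2, w) +
            ‖y.2 - w‖ₑ⁻¹ * gaussE c (y.2 - w) * (U (y.1 - s • y.2, w) + U' (y.1 - s • y.2, w))))) := by
        rw [← lintegral_const_mul' _ _ ENNReal.ofReal_ne_top]
        refine lintegral_mono_ae ?_
        filter_upwards [Measure.ae_ne volume y.2] with w hw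
        exact hb.enorm_setIntegral_rayTermDeriv_le hΩ he1 he2 hh hx hv hw.symm
    _ = M * exitOp Ω c U y + ∫⁻ s in Ioc 0 (exitTime Ω y.1 y.2), ∫⁻ w, M * (ENNReal.ofReal (Real.exp (-(a / 2) * s)) *
          (ENNReal.ofReal (gradKernel c y.2 w) * U (y.1 - s • y.2, w) +
            ‖y.2 - w‖ₑ⁻¹ * gaussE c (y.2 - w) * (U (y.1 - s • y.2, w) + U' (y.1 - s • y.2, w)))) := by
        rw [lintegral_add_left (by fun_prop), lintegral_const_mul' _ _ hMt, lintegral_const_mul _ (by fun_prop),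
          lintegral_lintegral_swap]
        · rfl
        · refine Measurable.aemeasurable ?_
          have g1 : Measurable fun z : E3 × ℝ => ENNReal.ofReal (gradKernel c y.2 z.1) := hgk.comp measurable_fst
          have g2 : Measurable fun z : E3 × ℝ => (y.1 - z.2 • y.2, z.1) := by fun_prop
          have g3 := hUm.comp g2
          have g4 := hUm'.comp g2
          simp only [Function.comp_def] at g3 g4
          unfold Function.uncurry
          fun_prop
    _ = M * exitOp Ω c U y + M * ∫⁻ s in Ioc 0 (exitTime Ω y.1 y.2), ENNReal.ofReal (Real.exp (-(a / 2) * s)) *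
          (gradOp c (fun w => U (y.1 - s • y.2, w)) y.2 + (gaussOp c (fun w => U (y.1 - s • y.2, w)) y.2 +
            gaussOp c (fun w => U' (y.1 - s • y.2, w)) y.2)) := by
        rw [← lintegral_const_mul' M _ hMt]
        congr 1
        refine lintegral_congr fun s => ?_
        rw [lintegral_const_mul' _ _ hMt, lintegral_const_mul' _ _ ENNReal.ofReal_ne_top,
          lintegral_add_left (by fun_prop), ← gaussOp_add c (by fun_prop)]
        rfl
    _ ≤ M * exitOp Ω c U y + M * rayOp Ω (a / 2) (fun y => gradOp c (fun w => U (y.1, w)) y.2 +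
          (gaussOp c (fun w => U (y.1, w)) y.2 + gaussOp c (fun w => U' (y.1, w)) y.2)) y := by
        gcongr
        exact lintegral_ray_le_rayOp hΩ (a / 2) (fun y => gradOp c (fun w => U (y.1, w)) y.2 +
          (gaussOp c (fun w => U (y.1, w)) y.2 + gaussOp c (fun w => U' (y.1, w)) y.2)) hx hv
    _ = _ := by
        rw [rayOp_add hΩ.isOpen.measurableSet _ m1, rayOp_add hΩ.isOpen.measurableSet _ m2, ← mul_add]

open scoped ENNReal NNReal

/-! ### Weighted norms -/

/-- The `L^p` norm of a function with values in `[0, ∞]`. -/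
noncomputable def lpE (μ : Measure (E3 × E3)) (p : ℝ) (u : E3 × E3 → ℝ≥0∞) : ℝ≥0∞ :=
  (∫⁻ y, u y ^ p ∂μ) ^ (1 / p)

theorem weightedNorm_eq_lpE {X : Type*} [NormedAddCommGroup X] [NormedSpace ℝ X] (μ : Measure (E3 × E3))
    {p : ℝ} (hp : 0 < p) (α : ℝ) (f : E3 × E3 → X) : weightedNorm μ p α f = lpE μ p (weighted α f) := by
  rw [weightedNorm, eLpNorm_eq_lintegral_rpow_enorm_toReal (by simpa using hp) ENNReal.ofReal_ne_top,
    ENNReal.toReal_ofReal hp.le, lpE]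
  congr 1
  refine lintegral_congr fun y => ?_
  rw [enorm_smul, Real.enorm_of_nonneg (Real.exp_pos _).le, weighted]

theorem lpAlphaNorm_eq_lpE {X : Type*} [NormedAddCommGroup X] [NormedSpace ℝ X] (Ω : Set E3)
    {p : ℝ} (hp : 0 < p) (α : ℝ) (f : E3 × E3 → X) :
    lpAlphaNorm Ω p α f = lpE (volume.restrict (Ω ×ˢ univ)) p (weighted α f) :=
  weightedNorm_eq_lpE _ hp α f

theorem lpE_mono_ae {μ : Measure (E3 × E3)} {p : ℝ} (hp : 0 < p) {u u' : E3 × E3 → ℝ≥0∞}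
    (h : u ≤ᵐ[μ] u') : lpE μ p u ≤ lpE μ p u' := by
  unfold lpE
  gcongr ?_ ^ _
  refine lintegral_mono_ae (h.mono fun y hy => ?_)
  gcongr

theorem lpE_add_le {μ : Measure (E3 × E3)} {p : ℝ} (hp : 1 ≤ p) {u u' : E3 × E3 → ℝ≥0∞}
    (hu : AEMeasurable u μ) (hu' : AEMeasurable u' μ) :
    lpE μ p (fun y => u y + u' y) ≤ lpE μ p u + lpE μ p u' :=
  ENNReal.lintegral_Lp_add_le hu hu' hp

theorem lpE_const_mul {μ : Measure (E3 × E3)} {p : ℝ} (hp : 0 < p) {C : ℝ≥0∞} (hC : C ≠ ∞)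
    (u : E3 × E3 → ℝ≥0∞) : lpE μ p (fun y => C * u y) = C * lpE μ p u := by
  unfold lpE
  simp only [ENNReal.mul_rpow_of_nonneg _ _ hp.le]
  rw [lintegral_const_mul' _ _ (ENNReal.rpow_ne_top_of_nonneg hp.le hC),
    ENNReal.mul_rpow_of_nonneg _ _ (by positivity), ← ENNReal.rpow_mul, mul_one_div_cancel hp.ne', ENNReal.rpow_one]

theorem lpE_le_of_lintegral_le {μ μ' : Measure (E3 × E3)} {p : ℝ} (hp : 0 < p) {C : ℝ≥0∞}
    {u u' : E3 × E3 → ℝ≥0∞} (h : ∫⁻ y, u y ^ p ∂μ ≤ C * ∫⁻ y, u' y ^ p ∂μ') :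
    lpE μ p u ≤ C ^ (1 / p) * lpE μ' p u' := by
  unfold lpE
  rw [← ENNReal.mul_rpow_of_nonneg _ _ (by positivity)]
  gcongr

theorem ofReal_rpow_one_div {d p : ℝ} (hd : 0 ≤ d) (hp : 0 < p) :
    ENNReal.ofReal d ^ (1 / p) = ENNReal.ofReal (d ^ (1 / p)) :=
  ENNReal.ofReal_rpow_of_nonneg hd (by positivity)

theorem ae_phase {Ω : Set E3} (hΩ : IsOpen Ω) :
    ∀ᵐ y : E3 × E3 ∂(volume.restrict (Ω ×ˢ univ)), y.1 ∈ Ω ∧ y.2 ≠ 0 := by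
  have h0 : ∀ᵐ y : E3 × E3, y.2 ≠ 0 := by
    rw [Measure.volume_eq_prod]
    exact Measure.quasiMeasurePreserving_snd.ae (Measure.ae_ne volume 0)
  filter_upwards [ae_restrict_mem (hΩ.measurableSet.prod MeasurableSet.univ), ae_restrict_of_ae h0]
    with y hy hv using ⟨hy.1, hv⟩

theorem lpE_le_of_le_four {μ : Measure (E3 × E3)} {p : ℝ} (hp : 1 ≤ p) {K : ℝ≥0∞} (hK : K ≠ ∞)
    {u f₁ f₂ f₃ f₄ : E3 × E3 → ℝ≥0∞} {N₁ N₂ N₃ N₄ : ℝ≥0∞}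
    (h : u ≤ᵐ[μ] fun y => K * (f₁ y + (f₂ y + (f₃ y + f₄ y)))) (m₁ : AEMeasurable f₁ μ)
    (m₂ : AEMeasurable f₂ μ) (m₃ : AEMeasurable f₃ μ) (m₄ : AEMeasurable f₄ μ) (h₁ : lpE μ p f₁ ≤ N₁)
    (h₂ : lpE μ p f₂ ≤ N₂) (h₃ : lpE μ p f₃ ≤ N₃) (h₄ : lpE μ p f₄ ≤ N₄) :
    lpE μ p u ≤ K * (N₁ + (N₂ + (N₃ + N₄))) := by
  have hp0 : 0 < p := by linarith
  refine (lpE_mono_ae hp0 h).trans ?_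
  rw [lpE_const_mul hp0 hK]
  gcongr
  have m34 : AEMeasurable (fun y => f₃ y + f₄ y) μ := m₃.add m₄
  have m234 : AEMeasurable (fun y => f₂ y + (f₃ y + f₄ y)) μ := m₂.add m34
  exact (lpE_add_le hp m₁ m234).trans (add_le_add h₁ ((lpE_add_le hp m₂ m34).trans
    (add_le_add h₂ ((lpE_add_le hp m₃ m₄).trans (add_le_add h₃ h₄)))))

theorem weighted_apply {X : Type*} [NormedAddCommGroup X] (α : ℝ) (f : E3 × E3 → X) (y : E3 × E3) :
    weighted α f y = ENNReal.ofReal (Real.exp (α * ‖y.2‖ ^ 2)) * ‖f y‖ₑ := rfl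

section
attribute [local irreducible] rayOp gaussOp gradOp exitOp weighted

/-- The estimate for smooth functions. -/
theorem KernelBounds.exists_lpAlphaNorm_rayTermDeriv_le {ν : E3 → ℝ} {k : E3 → E3 → ℝ} {α a B C c : ℝ}
    (hb : KernelBounds ν k α a B C c) {p : ℝ} (hp : 2 ≤ p) (hp3 : p < 3) :
    ∃ M : ℝ≥0∞, M ≠ ∞ ∧ ∀ Ω, IsBoundedConvexC2Domain Ω → ∀ C₃, IsChordConstant Ω C₃ →
      ∀ h, ContDiff ℝ 1 h → ∀ e : E3 × E3, ‖e.1‖ ≤ 1 → ‖e.2‖ ≤ 1 →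
      lpAlphaNorm Ω p α (fun y => ∫ π, rayTermDeriv Ω ν k h e π y ∂rayMeasure) ≤
        M * (ENNReal.ofReal (Metric.diam Ω ^ (1 / p)) * lpAlphaNorm Ω p α (spaceDeriv h) + lpAlphaNorm Ω p α h +
          ENNReal.ofReal (C₃ ^ (1 / p)) * weightedNorm (boundaryMeasure Ω) p α h) := by
  have hp0 : 0 < p := by linarith
  have ha2 : 0 < a / 2 := half_pos hb.a_pos
  obtain ⟨M₁, hM₁, h₁⟩ := exists_lintegral_exitOp_le hp hp3 hb.c_pos
  obtain ⟨M₂, hM₂, h₂⟩ := exists_lintegral_rayOp_gradOp_le hp hb.c_pos ha2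
  obtain ⟨M₃, hM₃, h₃⟩ := exists_lintegral_rayOp_gaussOp_le hp hb.c_pos ha2
  obtain ⟨M₄, hM₄, h₄⟩ := exists_lintegral_rayOp_gaussOp_le_diam hp hb.c_pos ha2
  set K := ENNReal.ofReal ((1 + 2 / a) * C * (1 + B)) with hK
  have hKt : K ≠ ∞ := ENNReal.ofReal_ne_top
  have hr : ∀ {x : ℝ≥0∞}, x ≠ ∞ → x ^ (1 / p) ≠ ∞ := fun hx => ENNReal.rpow_ne_top_of_nonneg (by positivity) hx
  refine ⟨K * (M₁ ^ (1 / p) + (M₂ ^ (1 / p) + (M₃ ^ (1 / p) + M₄ ^ (1 / p)))), ?_, fun Ω hΩ C₃ hC₃ h hh e he1 he2 => ?_⟩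
  · exact ENNReal.mul_ne_top hKt (ENNReal.add_ne_top.2 ⟨hr hM₁, ENNReal.add_ne_top.2 ⟨hr hM₂,
      ENNReal.add_ne_top.2 ⟨hr hM₃, hr hM₄⟩⟩⟩)
  have hUm : Measurable (weighted α h) := measurable_weighted α hh.continuous.measurable
  have hUm' : Measurable (weighted α (spaceDeriv h)) := measurable_weighted α (continuous_spaceDeriv hh).measurable
  have hΩm := hΩ.isOpen.measurableSet
  set U := weighted α h with hU
  set U' := weighted α (spaceDeriv h) with hU'
  set μ : Measure (E3 × E3) := volume.restrict (Ω ×ˢ univ) with hμ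
  rw [lpAlphaNorm_eq_lpE Ω hp0, lpAlphaNorm_eq_lpE Ω hp0, lpAlphaNorm_eq_lpE Ω hp0, weightedNorm_eq_lpE _ hp0]
  have b1 := lpE_le_of_lintegral_le hp0 (h₁ Ω hΩ C₃ hC₃ U hUm)
  have b2 := lpE_le_of_lintegral_le hp0 (h₂ Ω U hΩm hUm)
  have b3 := lpE_le_of_lintegral_le hp0 (h₃ Ω U hΩm hUm)
  have b4 := lpE_le_of_lintegral_le hp0 (h₄ Ω U' hΩm hUm')
  rw [ENNReal.mul_rpow_of_nonneg _ _ (by positivity), ofReal_rpow_one_div hC₃.1.le hp0] at b1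
  rw [ENNReal.mul_rpow_of_nonneg _ _ (by positivity), ofReal_rpow_one_div hΩ.diam_pos.le hp0] at b4
  have m1 : AEMeasurable (exitOp Ω c U) μ := hΩ.aemeasurable_exitOp c hUm
  have m2 : Measurable (rayOp Ω (a / 2) fun y => gradOp c (fun w => U (y.1, w)) y.2) :=
    measurable_rayOp hΩm _ (measurable_gradOp c measurable_snd (u := fun z => U (z.1.1, z.2)) (by fun_prop))
  have m3 : Measurable (rayOp Ω (a / 2) fun y => gaussOp c (fun w => U (y.1, w)) y.2) :=
    measurable_rayOp hΩm _ (measurable_gaussOp c measurable_snd (u := fun z => U (z.1.1, z.2)) (by fun_prop))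
  have m4 : Measurable (rayOp Ω (a / 2) fun y => gaussOp c (fun w => U' (y.1, w)) y.2) :=
    measurable_rayOp hΩm _ (measurable_gaussOp c measurable_snd (u := fun z => U' (z.1.1, z.2)) (by fun_prop))
  have hpt : weighted α (fun y => ∫ π, rayTermDeriv Ω ν k h e π y ∂rayMeasure) ≤ᵐ[μ] fun y =>
      K * (exitOp Ω c U y + (rayOp Ω (a / 2) (fun y => gradOp c (fun w => U (y.1, w)) y.2) y +
        (rayOp Ω (a / 2) (fun y => gaussOp c (fun w => U (y.1, w)) y.2) y +
        rayOp Ω (a / 2) (fun y => gaussOp c (fun w => U' (y.1, w)) y.2) y))) := by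
    filter_upwards [ae_phase hΩ.isOpen] with y hy
    rw [weighted_apply]
    exact hb.enorm_integral_rayTermDeriv_le hΩ he1 he2 hh hy.1 hy.2
  refine (lpE_le_of_le_four (by linarith) hKt hpt m1 m2.aemeasurable m3.aemeasurable m4.aemeasurable
    b1 b2 b3 b4).trans ?_
  rw [mul_assoc K]
  refine mul_le_mul_right ?_ K
  -- Each of the four contributions is bounded by a constant times the whole right-hand side `S`.
  set S := ENNReal.ofReal (Metric.diam Ω ^ (1 / p)) * lpE μ p U' + lpE μ p U +
    ENNReal.ofReal (C₃ ^ (1 / p)) * lpE (boundaryMeasure Ω) p U with hS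
  have s1 : ENNReal.ofReal (C₃ ^ (1 / p)) * lpE (boundaryMeasure Ω) p U ≤ S := le_add_self
  have s2 : lpE μ p U ≤ S := le_add_self.trans le_self_add
  have s3 : ENNReal.ofReal (Metric.diam Ω ^ (1 / p)) * lpE μ p U' ≤ S := le_self_add.trans le_self_add
  rw [mul_assoc, mul_assoc, add_mul, add_mul, add_mul]
  exact add_le_add (mul_le_mul_right s1 _) (add_le_add (mul_le_mul_right s2 _)
    (add_le_add (mul_le_mul_right s2 _) (mul_le_mul_right s3 _)))

end

/-! ### The operator `S_Ω K` on `L^p` -/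

/-- For fixed `s` and `v` the map is a translation in `x`. Changes of `h` on a null set are
therefore invisible along almost every ray. -/
theorem quasiMeasurePreserving_ray :
    Measure.QuasiMeasurePreserving (fun z : (E3 × E3) × ℝ => z.1.1 - z.2 • z.1.2) (volume.prod volume) volume := by
  refine QuasiMeasurePreserving.prod_of_left (by fun_prop) (ae_of_all _ fun s => ?_)
  rw [Measure.volume_eq_prod]
  refine QuasiMeasurePreserving.prod_of_left (by fun_prop) (ae_of_all _ fun v => ?_)
  exact (measurePreserving_sub_right volume (s • v)).quasiMeasurePreserving

section Congr

variable {Ω : Set E3} (hΩ : IsBoundedConvexC2Domain Ω) {h h' : E3 × E3 → ℝ}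
  (hh : h =ᵐ[volume.restrict (Ω ×ˢ univ)] h')
include hΩ hh

theorem ae_fiber_eq : ∀ᵐ x : E3, x ∈ Ω → ∀ᵐ w : E3, h (x, w) = h' (x, w) := by
  rw [Measure.volume_eq_prod, ← Measure.prod_restrict, Measure.restrict_univ] at hh
  exact (ae_restrict_iff' hΩ.isOpen.measurableSet).1 (Measure.ae_ae_of_ae_prod hh)

theorem ae_integrand_eq (k : E3 → E3 → ℝ) : ∀ᵐ y : E3 × E3 ∂(volume.restrict (Ω ×ˢ univ)),
    (fun w => k y.2 w * h (y.1, w)) =ᵐ[volume] fun w => k y.2 w * h' (y.1, w) := by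
  have h1 : ∀ᵐ y : E3 × E3, y.1 ∈ Ω → ∀ᵐ w : E3, h (y.1, w) = h' (y.1, w) := by
    rw [Measure.volume_eq_prod]
    exact Measure.quasiMeasurePreserving_fst.ae (ae_fiber_eq hΩ hh)
  filter_upwards [ae_phase hΩ.isOpen, ae_restrict_of_ae h1] with y hy h2
  filter_upwards [h2 hy.1] with w hw
  rw [hw]

theorem ae_ray_eq (ν : E3 → ℝ) (k : E3 → E3 → ℝ) : ∀ᵐ y : E3 × E3 ∂(volume.restrict (Ω ×ˢ univ)),
    (fun s => Real.exp (-(ν y.2 * s)) * opK k h (y.1 - s • y.2, y.2))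
      =ᵐ[volume.restrict (Ioc 0 (exitTime Ω y.1 y.2))]
      fun s => Real.exp (-(ν y.2 * s)) * opK k h' (y.1 - s • y.2, y.2) := by
  have h1 : ∀ᵐ y : E3 × E3, ∀ᵐ s : ℝ, y.1 - s • y.2 ∈ Ω → ∀ᵐ w : E3, h (y.1 - s • y.2, w) = h' (y.1 - s • y.2, w) :=
    Measure.ae_ae_of_ae_prod (quasiMeasurePreserving_ray.ae (ae_fiber_eq hΩ hh))
  filter_upwards [ae_phase hΩ.isOpen, ae_restrict_of_ae h1] with y hy h2
  rw [← restrict_Ioo_eq_restrict_Ioc]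
  filter_upwards [ae_restrict_mem measurableSet_Ioo, ae_restrict_of_ae h2] with s hs h3
  congr 1
  refine integral_congr_ae ?_
  filter_upwards [h3 ((hΩ.mem_iff_lt_exitTime' hy.2 hy.1 hs.1.le).2 hs.2)] with w hw
  simp only [hw]

theorem opS_opK_congr (ν : E3 → ℝ) (k : E3 → E3 → ℝ) :
    opS Ω ν (opK k h) =ᵐ[volume.restrict (Ω ×ˢ univ)] opS Ω ν (opK k h') := by
  filter_upwards [ae_ray_eq hΩ hh ν k] with y hy
  rw [opS, opS, intervalIntegral.integral_of_le (exitTime_nonneg _ _ _),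
    intervalIntegral.integral_of_le (exitTime_nonneg _ _ _)]
  exact integral_congr_ae hy

end Congr

/-- The same in phase space: for fixed `s` the free transport `(x, v) ↦ (x - s v, v)` is a shear and
preserves Lebesgue measure. -/
theorem quasiMeasurePreserving_ray_phase :
    Measure.QuasiMeasurePreserving (fun z : (E3 × E3) × ℝ => (z.1.1 - z.2 • z.1.2, z.1.2)) (volume.prod volume)
      volume := by
  refine QuasiMeasurePreserving.prod_of_left (by fun_prop) (ae_of_all _ fun s => ?_)
  have h1 : MeasurePreserving (fun z : E3 × E3 => (z.1, z.2 - s • z.1)) (volume.prod volume) (volume.prod volume) :=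
    (MeasurePreserving.id volume).skew_product (g := fun v x => x - s • v) (by fun_prop)
      (ae_of_all _ fun v => (measurePreserving_sub_right volume (s • v)).map_eq)
  have h2 := (Measure.measurePreserving_swap.comp h1).comp
    (Measure.measurePreserving_swap (μ := (volume : Measure E3)) (ν := (volume : Measure E3)))
  exact h2.quasiMeasurePreserving

theorem ae_phase_ray {Ω : Set E3} (hΩ : IsBoundedConvexC2Domain Ω) {P : E3 × E3 → Prop}
    (hP : ∀ᵐ y ∂(volume.restrict (Ω ×ˢ univ)), P y) : ∀ᵐ y : E3 × E3 ∂(volume.restrict (Ω ×ˢ univ)),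
    ∀ᵐ s ∂(volume.restrict (Ioc 0 (exitTime Ω y.1 y.2))), P (y.1 - s • y.2, y.2) := by
  rw [ae_restrict_iff' (hΩ.isOpen.measurableSet.prod MeasurableSet.univ)] at hP
  have h1 : ∀ᵐ y : E3 × E3, ∀ᵐ s : ℝ, (y.1 - s • y.2, y.2) ∈ Ω ×ˢ (univ : Set E3) → P (y.1 - s • y.2, y.2) :=
    Measure.ae_ae_of_ae_prod (quasiMeasurePreserving_ray_phase.ae hP)
  filter_upwards [ae_phase hΩ.isOpen, ae_restrict_of_ae h1] with y hy h2
  rw [← restrict_Ioo_eq_restrict_Ioc]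
  filter_upwards [ae_restrict_mem measurableSet_Ioo, ae_restrict_of_ae h2] with s hs h3
  exact h3 (mk_mem_prod ((hΩ.mem_iff_lt_exitTime' hy.2 hy.1 hs.1.le).2 hs.2) (mem_univ _))

/-- Additivity of the integrals needs convergence: of the inner integral at almost every point of
almost every ray, and of the outer one on almost every ray. -/
theorem opS_sub_ae {Ω : Set E3} (hΩ : IsBoundedConvexC2Domain Ω) {ν : E3 → ℝ} {k : E3 → E3 → ℝ}
    {f g : E3 × E3 → ℝ}
    (hf : ∀ᵐ y ∂(volume.restrict (Ω ×ˢ univ)), Integrable (fun w => k y.2 w * f (y.1, w)))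
    (hg : ∀ᵐ y ∂(volume.restrict (Ω ×ˢ univ)), Integrable (fun w => k y.2 w * g (y.1, w)))
    (hf' : ∀ᵐ y ∂(volume.restrict (Ω ×ˢ univ)), IntervalIntegrable
      (fun s => Real.exp (-(ν y.2 * s)) * opK k f (y.1 - s • y.2, y.2)) volume 0 (exitTime Ω y.1 y.2))
    (hg' : ∀ᵐ y ∂(volume.restrict (Ω ×ˢ univ)), IntervalIntegrable
      (fun s => Real.exp (-(ν y.2 * s)) * opK k g (y.1 - s • y.2, y.2)) volume 0 (exitTime Ω y.1 y.2)) :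
    opS Ω ν (opK k (f - g)) =ᵐ[volume.restrict (Ω ×ˢ univ)] opS Ω ν (opK k f) - opS Ω ν (opK k g) := by
  filter_upwards [ae_phase_ray hΩ hf, ae_phase_ray hΩ hg, hf', hg'] with y h1 h2 h3 h4
  rw [Pi.sub_apply, opS, opS, opS, ← intervalIntegral.integral_sub h3 h4,
    intervalIntegral.integral_of_le (exitTime_nonneg _ _ _), intervalIntegral.integral_of_le (exitTime_nonneg _ _ _)]
  refine integral_congr_ae ?_
  filter_upwards [h1, h2] with s a b
  rw [← mul_sub, opK, opK, opK, ← integral_sub a b]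
  congr 1
  refine integral_congr_ae (ae_of_all _ fun w => ?_)
  simp only [Pi.sub_apply]
  ring

section Measurable

variable {ρ γ : ℝ} {ν : E3 → ℝ} {k : E3 → E3 → ℝ} (hA : AssumptionA ρ γ ν k)
include hA

theorem measurable_opK {h : E3 × E3 → ℝ} (hh : Measurable h) : Measurable (opK k h) := by
  unfold opK
  have hm : Measurable fun z : (E3 × E3) × E3 => k z.1.2 z.2 * h (z.1.1, z.2) := by
    have h1 : Measurable fun z : (E3 × E3) × E3 => k z.1.2 z.2 :=
      hA.k_measurable.comp (f := fun z : (E3 × E3) × E3 => (z.1.2, z.2)) (by fun_prop)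
    exact h1.mul (hh.comp (by fun_prop))
  exact (hm.stronglyMeasurable.integral_prod_right (ν := volume)).measurable

theorem aestronglyMeasurable_opS {Ω : Set E3} (hΩ : IsBoundedConvexC2Domain Ω) {h : E3 × E3 → ℝ}
    (hh : Measurable h) : AEStronglyMeasurable (opS Ω ν h) (volume.restrict (Ω ×ˢ univ)) := by
  obtain ⟨τ, hτ⟩ : ∃ τ, τ = (Ω ×ˢ ({0}ᶜ : Set E3)).indicator fun y => exitTime Ω y.1 y.2 := ⟨_, rfl⟩
  have hτm : Measurable τ := hτ ▸ hΩ.measurable_indicator_exitTime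
  have hνm : Measurable ν := hA.nu_differentiable.continuous.measurable
  have hS : MeasurableSet {z : (E3 × E3) × ℝ | z.2 ∈ Ioc 0 (τ z.1)} :=
    (measurableSet_lt measurable_const measurable_snd).inter
      (measurableSet_le measurable_snd (hτm.comp measurable_fst))
  have hm : Measurable fun z : (E3 × E3) × ℝ => Real.exp (-(ν z.1.2 * z.2)) * h (z.1.1 - z.2 • z.1.2, z.1.2) := by
    have h1 : Measurable fun z : (E3 × E3) × ℝ => (z.1.1 - z.2 • z.1.2, z.1.2) := by fun_prop
    exact Measurable.mul (by fun_prop) (hh.comp h1)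
  have h2 := (hm.indicator hS).stronglyMeasurable.integral_prod_right' (ν := volume)
  refine h2.aestronglyMeasurable.congr ?_
  filter_upwards [ae_phase hΩ.isOpen] with y hy
  rw [opS, intervalIntegral.integral_of_le (exitTime_nonneg _ _ _), ← integral_indicator measurableSet_Ioc]
  have : τ y = exitTime Ω y.1 y.2 := by rw [hτ]; exact indicator_of_mem (mk_mem_prod hy.1 hy.2) _
  refine integral_congr_ae (ae_of_all _ fun s => ?_)
  simp only [indicator, mem_setOf_eq, this]

end Measurable

/-- Convergence of the integrals and the `L^p` bound. -/
theorem KernelBounds.exists_lpAlphaNorm_opS_opK_le_of_measurable {ρ γ : ℝ} {ν : E3 → ℝ} {k : E3 → E3 → ℝ}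
    {α a B C c : ℝ} (hA : AssumptionA ρ γ ν k)
    (hb : KernelBounds ν k α a B C c) {p : ℝ} (hp : 2 ≤ p) :
    ∃ M : ℝ≥0∞, M ≠ ∞ ∧ ∀ Ω, IsBoundedConvexC2Domain Ω → ∀ h : E3 × E3 → ℝ, Measurable h →
      lpAlphaNorm Ω p α h < ∞ →
      (∀ᵐ y ∂(volume.restrict (Ω ×ˢ univ)), Integrable (fun w => k y.2 w * h (y.1, w))) ∧
      (∀ᵐ y ∂(volume.restrict (Ω ×ˢ univ)), IntervalIntegrable
        (fun s => Real.exp (-(ν y.2 * s)) * opK k h (y.1 - s • y.2, y.2)) volume 0 (exitTime Ω y.1 y.2)) ∧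
      lpAlphaNorm Ω p α (opS Ω ν (opK k h)) ≤ M * lpAlphaNorm Ω p α h := by
  have hp0 : 0 < p := by linarith
  obtain ⟨M₁, hM₁, h₁⟩ := exists_lintegral_rayOp_gaussOp_le hp hb.c_pos hb.a_pos
  obtain ⟨M₂, hM₂, h₂⟩ := exists_lintegral_mul_gaussOp_rpow_le hp hb.c_pos
  obtain ⟨M₃, hM₃, h₃⟩ := exists_lintegral_rpow_norm_mul_gaussE_le (b := 0) le_rfl (by norm_num) hb.c_pos
  have hCt : ENNReal.ofReal C ≠ ∞ := ENNReal.ofReal_ne_top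
  refine ⟨ENNReal.ofReal C * M₁ ^ (1 / p), ENNReal.mul_ne_top hCt
    (ENNReal.rpow_ne_top_of_nonneg (by positivity) hM₁), fun Ω hΩ h hh hfin => ?_⟩
  have hΩm := hΩ.isOpen.measurableSet
  set U := weighted α h with hU
  have hUm : Measurable U := measurable_weighted α hh
  rw [lpAlphaNorm_eq_lpE Ω hp0] at hfin ⊢
  rw [lpAlphaNorm_eq_lpE Ω hp0, mul_assoc]
  have hUfin : ∫⁻ y in Ω ×ˢ univ, U y ^ p < ∞ := by
    rw [lpE, ENNReal.rpow_lt_top_iff_of_pos (by positivity)] at hfin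
    exact hfin
  have mg : Measurable fun y : E3 × E3 => gaussOp c (fun w => U (y.1, w)) y.2 :=
    measurable_gaussOp c measurable_snd (u := fun z => U (z.1.1, z.2)) (by fun_prop)
  have mr : Measurable (rayOp Ω a fun y => gaussOp c (fun w => U (y.1, w)) y.2) := measurable_rayOp hΩm _ mg
  have hk0 : ∀ (v x : E3), ENNReal.ofReal (Real.exp (α * ‖v‖ ^ 2)) * ∫⁻ w, ‖k v w * h (x, w)‖ₑ ≤
      ENNReal.ofReal C * gaussOp c (fun w => U (x, w)) v := fun v x => by
    rw [gaussOp, ← lintegral_const_mul' _ _ ENNReal.ofReal_ne_top, ← lintegral_const_mul' _ _ hCt]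
    refine lintegral_mono_ae ?_
    filter_upwards [Measure.ae_ne volume v] with w hw
    exact hb.ofReal_k_le hw.symm x h
  have hm0 : ∀ v : E3, ENNReal.ofReal (Real.exp (α * ‖v‖ ^ 2)) ≠ 0 := fun v => by
    simpa using Real.exp_pos _
  have hmf : ∀ {X : ℝ≥0∞} (v : E3), ENNReal.ofReal (Real.exp (α * ‖v‖ ^ 2)) * X < ∞ → X < ∞ := fun v hX => by
    by_contra hn
    rw [not_lt_top_iff.1 hn, ENNReal.mul_top (hm0 v)] at hX
    exact lt_irrefl _ hX
  have hray : ∀ y : E3 × E3, y.1 ∈ Ω → y.2 ≠ 0 → ENNReal.ofReal (Real.exp (α * ‖y.2‖ ^ 2)) *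
      ∫⁻ s in Ioc 0 (exitTime Ω y.1 y.2), ‖Real.exp (-(ν y.2 * s)) * opK k h (y.1 - s • y.2, y.2)‖ₑ ≤
      ENNReal.ofReal C * rayOp Ω a (fun y => gaussOp c (fun w => U (y.1, w)) y.2) y := fun y hx hv => by
    refine le_trans ?_ (mul_le_mul_right (lintegral_ray_le_rayOp hΩ a _ hx hv) _)
    rw [← lintegral_const_mul' _ _ ENNReal.ofReal_ne_top, ← lintegral_const_mul' _ _ hCt]
    refine setLIntegral_mono' measurableSet_Ioc fun s hs => ?_
    rw [enorm_mul, Real.enorm_of_nonneg (Real.exp_pos _).le]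
    calc _ ≤ ENNReal.ofReal (Real.exp (α * ‖y.2‖ ^ 2)) * (ENNReal.ofReal (Real.exp (-a * s)) *
          ∫⁻ w, ‖k y.2 w * h (y.1 - s • y.2, w)‖ₑ) := by
          refine mul_le_mul_right (mul_le_mul' (ENNReal.ofReal_le_ofReal (Real.exp_le_exp.2 ?_))
            (enorm_integral_le_lintegral_enorm _)) _
          have := mul_le_mul_of_nonneg_right (hb.le_nu y.2) hs.1.le
          linarith
      _ = ENNReal.ofReal (Real.exp (-a * s)) * (ENNReal.ofReal (Real.exp (α * ‖y.2‖ ^ 2)) *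
          ∫⁻ w, ‖k y.2 w * h (y.1 - s • y.2, w)‖ₑ) := by ring
      _ ≤ ENNReal.ofReal (Real.exp (-a * s)) * (ENNReal.ofReal C * gaussOp c (fun w => U (y.1 - s • y.2, w)) y.2) :=
          mul_le_mul_right (hk0 _ _) _
      _ = _ := by ring
  refine ⟨?_, ?_, ?_⟩
  · have hg : ∫⁻ y in Ω ×ˢ univ, gaussOp c (fun w => U (y.1, w)) y.2 ^ p < ∞ := by
      refine lt_of_le_of_lt (b := M₂ * M₃ * ∫⁻ y in Ω ×ˢ univ, U y ^ p) ?_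
        (ENNReal.mul_lt_top (ENNReal.mul_lt_top hM₂.lt_top hM₃.lt_top) hUfin)
      rw [Measure.volume_eq_prod, ← Measure.prod_restrict, Measure.restrict_univ,
        lintegral_prod _ (mg.pow_const p).aemeasurable, lintegral_prod _ (by fun_prop),
        ← lintegral_const_mul _ (by fun_prop)]
      refine lintegral_mono fun x => ?_
      simpa using h₂ (fun _ => 1) (fun w => U (x, w)) M₃ measurable_const (by fun_prop)
        (fun w => by simpa using h₃ w)
    filter_upwards [ae_lt_top (mg.pow_const p) hg.ne] with y hy
    have hkm : Measurable fun w => k y.2 w := hA.k_measurable.comp measurable_prodMk_left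
    refine ⟨(hkm.mul (hh.comp (by fun_prop))).aestronglyMeasurable, hmf y.2 ((hk0 y.2 y.1).trans_lt ?_)⟩
    exact ENNReal.mul_lt_top hCt.lt_top ((ENNReal.rpow_lt_top_iff_of_pos hp0).1 hy)
  · have hg : ∫⁻ y in Ω ×ˢ univ, rayOp Ω a (fun y => gaussOp c (fun w => U (y.1, w)) y.2) y ^ p < ∞ :=
      (h₁ Ω U hΩm hUm).trans_lt (ENNReal.mul_lt_top hM₁.lt_top hUfin)
    filter_upwards [ae_phase hΩ.isOpen, ae_lt_top (mr.pow_const p) hg.ne] with y hy hy2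
    rw [intervalIntegrable_iff_integrableOn_Ioc_of_le (exitTime_nonneg _ _ _)]
    have hKm := measurable_opK hA hh
    have h1 : Measurable fun s : ℝ => (y.1 - s • y.2, y.2) := by fun_prop
    refine ⟨(Measurable.mul (by fun_prop) (hKm.comp h1)).aestronglyMeasurable,
      hmf y.2 ((hray y hy.1 hy.2).trans_lt ?_)⟩
    exact ENNReal.mul_lt_top hCt.lt_top ((ENNReal.rpow_lt_top_iff_of_pos hp0).1 hy2)
  · have hpt : weighted α (opS Ω ν (opK k h)) ≤ᵐ[volume.restrict (Ω ×ˢ univ)] fun y =>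
        ENNReal.ofReal C * rayOp Ω a (fun y => gaussOp c (fun w => U (y.1, w)) y.2) y := by
      filter_upwards [ae_phase hΩ.isOpen] with y hy
      refine le_trans ?_ (hray y hy.1 hy.2)
      rw [weighted, opS, intervalIntegral.integral_of_le (exitTime_nonneg _ _ _)]
      exact mul_le_mul_right (enorm_integral_le_lintegral_enorm _) _
    refine (lpE_mono_ae hp0 hpt).trans ?_
    rw [lpE_const_mul hp0 hCt]
    gcongr
    exact lpE_le_of_lintegral_le hp0 (h₁ Ω U hΩm hUm)

open scoped ENNReal NNReal

/-! ### Calculus of weighted norms -/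

section WeightedNorm

variable {X : Type*} [NormedAddCommGroup X] [NormedSpace ℝ X] {μ : Measure (E3 × E3)} {p α : ℝ}

theorem aestronglyMeasurable_exp_smul {f : E3 × E3 → X} (hf : AEStronglyMeasurable f μ) :
    AEStronglyMeasurable (fun y => Real.exp (α * ‖y.2‖ ^ 2) • f y) μ :=
  Continuous.aestronglyMeasurable (by fun_prop) |>.smul hf

theorem weightedNorm_add_le (hp : 1 ≤ p) {f g : E3 × E3 → X} (hf : AEStronglyMeasurable f μ)
    (hg : AEStronglyMeasurable g μ) : weightedNorm μ p α (f + g) ≤ weightedNorm μ p α f + weightedNorm μ p α g := by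
  have : (fun y : E3 × E3 => Real.exp (α * ‖y.2‖ ^ 2) • (f + g) y) =
      (fun y => Real.exp (α * ‖y.2‖ ^ 2) • f y) + fun y => Real.exp (α * ‖y.2‖ ^ 2) • g y := by
    ext1 y; simp [smul_add]
  rw [weightedNorm, this]
  exact eLpNorm_add_le (aestronglyMeasurable_exp_smul hf) (aestronglyMeasurable_exp_smul hg)
    (ENNReal.one_le_ofReal.2 hp)

theorem weightedNorm_mono_ae {Y : Type*} [NormedAddCommGroup Y] [NormedSpace ℝ Y] {f : E3 × E3 → X}
    {g : E3 × E3 → Y} (h : ∀ᵐ y ∂μ, ‖f y‖ ≤ ‖g y‖) : weightedNorm μ p α f ≤ weightedNorm μ p α g := by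
  refine eLpNorm_mono_ae (h.mono fun y hy => ?_)
  rw [norm_smul, norm_smul]
  gcongr

theorem weightedNorm_congr_ae {f g : E3 × E3 → X} (h : f =ᵐ[μ] g) : weightedNorm μ p α f = weightedNorm μ p α g :=
  le_antisymm (weightedNorm_mono_ae (h.mono fun y hy => by rw [hy]))
    (weightedNorm_mono_ae (h.mono fun y hy => by rw [hy]))

theorem weightedNorm_smul_le {c : ℝ} (hc : ‖c‖ ≤ 1) (f : E3 × E3 → X) :
    weightedNorm μ p α (c • f) ≤ weightedNorm μ p α f := by
  refine weightedNorm_mono_ae (ae_of_all _ fun y => ?_)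
  rw [Pi.smul_apply, norm_smul]
  exact mul_le_of_le_one_left (norm_nonneg _) hc

theorem weightedNorm_sub_le (hp : 1 ≤ p) {f g : E3 × E3 → X} (hf : AEStronglyMeasurable f μ)
    (hg : AEStronglyMeasurable g μ) : weightedNorm μ p α (f - g) ≤ weightedNorm μ p α f + weightedNorm μ p α g := by
  have h1 : f - g = f + (-1 : ℝ) • g := by module
  rw [h1]
  exact (weightedNorm_add_le hp hf (hg.const_smul _)).trans
    (add_le_add_right (weightedNorm_smul_le (by simp) g) _)

theorem memLp_of_weightedNorm_lt_top (hα : 0 ≤ α) {f : E3 × E3 → X} (hf : AEStronglyMeasurable f μ)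
    (h : weightedNorm μ p α f < ∞) : MemLp f (ENNReal.ofReal p) μ := by
  refine ⟨hf, (eLpNorm_mono_ae (ae_of_all _ fun y => ?_)).trans_lt h⟩
  rw [norm_smul, Real.norm_of_nonneg (Real.exp_pos _).le]
  exact le_mul_of_one_le_left (norm_nonneg _) (Real.one_le_exp (by positivity))

theorem eLpNorm_le_weightedNorm (hα : 0 ≤ α) (f : E3 × E3 → X) :
    eLpNorm f (ENNReal.ofReal p) μ ≤ weightedNorm μ p α f := by
  refine eLpNorm_mono_ae (ae_of_all _ fun y => ?_)
  rw [norm_smul, Real.norm_of_nonneg (Real.exp_pos _).le]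
  exact le_mul_of_one_le_left (norm_nonneg _) (Real.one_le_exp (by positivity))

/-- Completeness of the weighted Lebesgue spaces. -/
theorem exists_tendsto_weightedNorm [CompleteSpace X] (hp : 1 ≤ p) {f : ℕ → E3 × E3 → X}
    (hf : ∀ n, AEStronglyMeasurable (f n) μ) (hfin : ∀ n, weightedNorm μ p α (f n) < ∞) {η : ℕ → ℝ≥0∞}
    (hη : Tendsto η atTop (𝓝 0)) (hfη : ∀ n m, weightedNorm μ p α (f n - f m) ≤ η n + η m) :
    ∃ g : E3 × E3 → X, AEStronglyMeasurable g μ ∧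
      Tendsto (fun n => weightedNorm μ p α (f n - g)) atTop (𝓝 0) := by
  have : Fact (1 ≤ ENNReal.ofReal p) := ⟨ENNReal.one_le_ofReal.2 hp⟩
  set F : ℕ → E3 × E3 → X := fun n y => Real.exp (α * ‖y.2‖ ^ 2) • f n y with hF
  have hm : ∀ n, MemLp (F n) (ENNReal.ofReal p) μ := fun n => ⟨aestronglyMeasurable_exp_smul (hf n), hfin n⟩
  have hc : CauchySeq fun n => (hm n).toLp (F n) := by
    rw [EMetric.cauchySeq_iff]
    intro ε hε
    have hε2 : 0 < ε / 2 := ENNReal.half_pos hε.ne'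
    obtain ⟨N, hN⟩ := eventually_atTop.1 (hη.eventually_lt_const hε2)
    refine ⟨N, fun m hm' n hn => ?_⟩
    rw [Lp.edist_toLp_toLp]
    have e : F m - F n = fun y => Real.exp (α * ‖y.2‖ ^ 2) • (f m - f n) y := by
      ext1 y; simp [hF, smul_sub]
    rw [e]
    calc _ ≤ η m + η n := hfη m n
      _ < ε / 2 + ε / 2 := ENNReal.add_lt_add (hN m hm') (hN n hn)
      _ = ε := ENNReal.add_halves ε
  obtain ⟨G, hG⟩ := cauchySeq_tendsto_of_complete hc
  -- The limit is taken in the unweighted space after multiplication by the weight, and the weight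
  -- is then divided out.
  refine ⟨fun y => Real.exp (-(α * ‖y.2‖ ^ 2)) • G y, ?_, ?_⟩
  · exact (Continuous.aestronglyMeasurable (by fun_prop)).smul (Lp.aestronglyMeasurable G)
  · have h1 := (Lp.tendsto_Lp_iff_tendsto_eLpNorm' _ _).1 hG
    refine h1.congr fun n => ?_
    refine eLpNorm_congr_ae ?_
    filter_upwards [(hm n).coeFn_toLp] with y hy
    rw [Pi.sub_apply, hy, Pi.sub_apply, smul_sub, smul_smul, ← Real.exp_add, add_neg_cancel, Real.exp_zero, one_smul]

end WeightedNorm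

/-! ### Weak partial derivatives: algebra, uniqueness, limits -/

section WeakPartial

variable {Ω : Set E3}

theorem integrableOn_mul_of_support {f ψ : E3 × E3 → ℝ} (hΩ : IsOpen Ω) (hf : LocallyIntegrableOn f (Ω ×ˢ univ))
    (hψ : Continuous ψ) (hs : HasCompactSupport ψ) (hΩψ : tsupport ψ ⊆ Ω ×ˢ univ) :
    Integrable (fun y => f y * ψ y) := by
  obtain ⟨C, hC⟩ := hs.exists_bound_of_continuous hψ
  have h1 := (locallyIntegrableOn_prod_univ_iff hΩ).1 hf _ hs hΩψ
  refine (integrableOn_iff_integrable_of_support_subset (s := tsupport ψ) fun y hy => ?_).1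
    (h1.mul_bdd hψ.aestronglyMeasurable (ae_of_all _ hC))
  by_contra hn
  exact hy (by simp only [image_eq_zero_of_notMem_tsupport hn, mul_zero])

theorem StationaryBoltzmann.IsTestFunction.continuous_fderiv {φ : E3 × E3 → ℝ} (hφ : IsTestFunction Ω φ)
    (e : E3 × E3) : Continuous fun y => fderiv ℝ φ y e :=
  (hφ.contDiff.continuous_fderiv (by simp)).clm_apply continuous_const

theorem tsupport_fderiv_apply_subset' (φ : E3 × E3 → ℝ) (e : E3 × E3) :
    tsupport (fun y => fderiv ℝ φ y e) ⊆ tsupport φ :=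
  closure_minimal (fun y hy => by
    by_contra hn
    exact hy (by simp only [IsTestFunction.fderiv_eq_zero (Ω := univ) hn, _root_.zero_apply]))
    (isClosed_tsupport φ)

theorem StationaryBoltzmann.IsTestFunction.integrable_mul {f φ : E3 × E3 → ℝ} (hΩ : IsOpen Ω)
    (hφ : IsTestFunction Ω φ) (hf : LocallyIntegrableOn f (Ω ×ˢ univ)) : Integrable (fun y => f y * φ y) :=
  integrableOn_mul_of_support hΩ hf hφ.contDiff.continuous hφ.hasCompactSupport hφ.tsupport_subset

theorem StationaryBoltzmann.IsTestFunction.integrable_mul_fderiv {f φ : E3 × E3 → ℝ} (hΩ : IsOpen Ω)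
    (hφ : IsTestFunction Ω φ) (hf : LocallyIntegrableOn f (Ω ×ˢ univ)) (e : E3 × E3) :
    Integrable (fun y => f y * fderiv ℝ φ y e) :=
  integrableOn_mul_of_support hΩ hf (hφ.continuous_fderiv e) (hφ.hasCompactSupport.fderiv_apply (𝕜 := ℝ) e)
    ((tsupport_fderiv_apply_subset' φ e).trans hφ.tsupport_subset)

theorem HasWeakPartial.add_smul (hΩ : IsOpen Ω) {e : E3 × E3} {f f' g g' : E3 × E3 → ℝ}
    (h : HasWeakPartial Ω e f g) (h' : HasWeakPartial Ω e f' g') (c : ℝ) :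
    HasWeakPartial Ω e (f + c • f') (g + c • g') := by
  refine ⟨h.locInt.add (h'.locInt.smul c), h.locInt_deriv.add (h'.locInt_deriv.smul c), fun φ hφ => ?_⟩
  have e1 : ∀ f f' ψ : E3 × E3 → ℝ, (fun y => (f + c • f') y * ψ y) = fun y => f y * ψ y + c * (f' y * ψ y) := by
    intro f f' ψ; ext1 y; simp only [Pi.add_apply, Pi.smul_apply, smul_eq_mul]; ring
  rw [e1 f f' fun y => fderiv ℝ φ y e, e1, integral_add (hφ.integrable_mul_fderiv hΩ h.locInt e).integrableOn
    ((hφ.integrable_mul_fderiv hΩ h'.locInt e).integrableOn.const_mul c),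
    integral_add (hφ.integrable_mul hΩ h.locInt_deriv).integrableOn
      ((hφ.integrable_mul hΩ h'.locInt_deriv).integrableOn.const_mul c), integral_const_mul, integral_const_mul,
    h.integral_eq φ hφ, h'.integral_eq φ hφ]
  ring

theorem HasWeakPartial.sub (hΩ : IsOpen Ω) {e : E3 × E3} {f f' g g' : E3 × E3 → ℝ}
    (h : HasWeakPartial Ω e f g) (h' : HasWeakPartial Ω e f' g') : HasWeakPartial Ω e (f - f') (g - g') := by
  have := h.add_smul hΩ h' (-1)
  simpa only [neg_smul, one_smul, ← sub_eq_add_neg] using this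

/-- Fundamental lemma of the calculus of variations, applied to the difference, which is a weak
derivative of `0`. -/
theorem HasWeakPartial.ae_eq (hΩ : IsOpen Ω) {e : E3 × E3} {f g g' : E3 × E3 → ℝ}
    (h : HasWeakPartial Ω e f g) (h' : HasWeakPartial Ω e f g') : g =ᵐ[volume.restrict (Ω ×ˢ univ)] g' := by
  have hm : MeasurableSet (Ω ×ˢ (univ : Set E3)) := hΩ.measurableSet.prod MeasurableSet.univ
  have key := (hΩ.prod isOpen_univ).ae_eq_zero_of_integral_contDiff_smul_eq_zero
    (μ := (volume : Measure (E3 × E3))) (h.sub hΩ h').locInt_deriv fun φ h1 h2 h3 => ?_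
  · filter_upwards [ae_restrict_of_ae key, ae_restrict_mem hm] with y hy hy'
    exact sub_eq_zero.1 (hy hy')
  · have hφ : IsTestFunction Ω φ := ⟨h1, h2, h3⟩
    have h4 := (h.sub hΩ h').integral_eq φ hφ
    simp only [sub_self, Pi.zero_apply, zero_mul, integral_zero] at h4
    rw [setIntegral_eq_integral_of_forall_compl_eq_zero] at h4
    · simpa only [smul_eq_mul, mul_comm] using neg_eq_zero.1 h4.symm
    · intro y hy
      rw [image_eq_zero_of_notMem_tsupport fun hn => hy (h3 hn), mul_zero]

theorem Continuous.locallyIntegrableOn_prod {f : E3 × E3 → ℝ} (hf : Continuous f) :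
    LocallyIntegrableOn f (Ω ×ˢ univ) :=
  hf.locallyIntegrable.locallyIntegrableOn _

theorem hasWeakPartial_of_contDiff (hΩ : IsOpen Ω) {f : E3 × E3 → ℝ} (hf : ContDiff ℝ 1 f) (e : E3 × E3) :
    HasWeakPartial Ω e f fun y => fderiv ℝ f y e := by
  have hc : Continuous fun y => fderiv ℝ f y e := (hf.continuous_fderiv one_ne_zero).clm_apply continuous_const
  have l1 : LocallyIntegrableOn f (Ω ×ˢ univ) := Continuous.locallyIntegrableOn_prod hf.continuous
  have l2 : LocallyIntegrableOn (fun y => fderiv ℝ f y e) (Ω ×ˢ univ) := Continuous.locallyIntegrableOn_prod hc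
  refine ⟨l1, l2, fun φ hφ => ?_⟩
  have : (volume : Measure (E3 × E3)).IsAddHaarMeasure :=
    inferInstanceAs ((volume : Measure E3).prod volume).IsAddHaarMeasure
  have key := integral_mul_fderiv_eq_neg_fderiv_mul_of_integrable (hφ.integrable_mul hΩ l2)
    (hφ.integrable_mul_fderiv hΩ l1 e) (hφ.integrable_mul hΩ l1)
    (fun x _ => hf.differentiable one_ne_zero x) fun x _ => hφ.contDiff.differentiable (by simp) x
  rw [setIntegral_eq_integral_of_forall_compl_eq_zero, setIntegral_eq_integral_of_forall_compl_eq_zero, key]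
  · intro y hy
    rw [image_eq_zero_of_notMem_tsupport fun hn => hy (hφ.tsupport_subset hn), mul_zero]
  · intro y hy
    rw [IsTestFunction.fderiv_eq_zero (Ω := Ω) fun hn => hy (hφ.tsupport_subset hn)]; simp

theorem MeasureTheory.MemLp.locallyIntegrableOn_prod (hΩ : IsOpen Ω) {q : ℝ≥0∞} (hq : 1 ≤ q) {f : E3 × E3 → ℝ}
    (hf : MemLp f q (volume.restrict (Ω ×ˢ univ))) : LocallyIntegrableOn f (Ω ×ˢ univ) := by
  rw [locallyIntegrableOn_prod_univ_iff hΩ]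
  intro K hK hs
  have h1 := (hf.locallyIntegrable hq).integrableOn_isCompact hK
  rwa [IntegrableOn, Measure.restrict_restrict hK.measurableSet, inter_eq_self_of_subset_left hs] at h1

theorem tendsto_setIntegral_mul {q : ℝ≥0∞} (hq : 1 ≤ q) {u : ℕ → E3 × E3 → ℝ} {f ψ : E3 × E3 → ℝ}
    (hu : ∀ n, MemLp (u n) q (volume.restrict (Ω ×ˢ univ))) (hf : MemLp f q (volume.restrict (Ω ×ˢ univ)))
    (h : Tendsto (fun n => eLpNorm (u n - f) q (volume.restrict (Ω ×ˢ univ))) atTop (𝓝 0)) (hψ : Continuous ψ)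
    (hs : HasCompactSupport ψ) :
    Tendsto (fun n => ∫ y in Ω ×ˢ univ, u n y * ψ y) atTop (𝓝 (∫ y in Ω ×ˢ univ, f y * ψ y)) := by
  have : q.HolderConjugate q.conjExponent := ENNReal.HolderConjugate.conjExponent hq
  have hm : MemLp ψ q.conjExponent (volume.restrict (Ω ×ˢ univ)) := hψ.memLp_of_hasCompactSupport hs
  refine tendsto_integral_of_L1' _ (hf.1.mul hm.1) (Eventually.of_forall fun n => (hu n).integrable_mul hm) ?_
  have h0 : Tendsto (fun n => eLpNorm (u n - f) q (volume.restrict (Ω ×ˢ univ)) *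
      eLpNorm ψ q.conjExponent (volume.restrict (Ω ×ˢ univ))) atTop (𝓝 0) := by
    have := ENNReal.Tendsto.mul_const h (Or.inr hm.2.ne)
    rwa [zero_mul] at this
  refine tendsto_of_tendsto_of_tendsto_of_le_of_le tendsto_const_nhds h0 (fun _ => zero_le) fun n => ?_
  have e : (fun y => u n y * ψ y) - (fun y => f y * ψ y) = (u n - f) • ψ := by
    ext1 y; simp [sub_mul]
  change eLpNorm ((fun y => u n y * ψ y) - (fun y => f y * ψ y)) 1 _ ≤ _
  rw [e]
  exact eLpNorm_smul_le_mul_eLpNorm hm.1 ((hu n).1.sub hf.1)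

/-- Both sides of the defining identity are pairings with bounded, compactly supported functions,
and these are continuous for `L^q` convergence. -/
theorem HasWeakPartial.of_tendsto (hΩ : IsOpen Ω) {q : ℝ≥0∞} (hq : 1 ≤ q) {e : E3 × E3} {u d : ℕ → E3 × E3 → ℝ}
    {f g : E3 × E3 → ℝ} (h : ∀ n, HasWeakPartial Ω e (u n) (d n))
    (hu : ∀ n, MemLp (u n) q (volume.restrict (Ω ×ˢ univ))) (hd : ∀ n, MemLp (d n) q (volume.restrict (Ω ×ˢ univ)))
    (hf : MemLp f q (volume.restrict (Ω ×ˢ univ))) (hg : MemLp g q (volume.restrict (Ω ×ˢ univ)))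
    (huf : Tendsto (fun n => eLpNorm (u n - f) q (volume.restrict (Ω ×ˢ univ))) atTop (𝓝 0))
    (hdg : Tendsto (fun n => eLpNorm (d n - g) q (volume.restrict (Ω ×ˢ univ))) atTop (𝓝 0)) :
    HasWeakPartial Ω e f g := by
  refine ⟨hf.locallyIntegrableOn_prod hΩ hq, hg.locallyIntegrableOn_prod hΩ hq, fun φ hφ => ?_⟩
  have h1 := tendsto_setIntegral_mul hq hu hf huf (hφ.continuous_fderiv e)
    (hφ.hasCompactSupport.fderiv_apply (𝕜 := ℝ) e)
  have h2 := tendsto_setIntegral_mul hq hd hg hdg hφ.contDiff.continuous hφ.hasCompactSupport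
  refine tendsto_nhds_unique h1 ?_
  simpa only [(h _).integral_eq φ hφ] using h2.neg

end WeakPartial

open scoped ENNReal NNReal

/-! ### Weak gradients and the Sobolev norm -/

/-- `G` is the weak gradient of `f` along the image of `L`. -/
structure HasWeakGradAlong (L : E3 →L[ℝ] E3 × E3) (Ω : Set E3) (f : E3 × E3 → ℝ) (G : E3 × E3 → E3) : Prop where
  locInt : LocallyIntegrableOn f (Ω ×ˢ univ)
  locInt_grad : LocallyIntegrableOn G (Ω ×ˢ univ)
  integral_eq : ∀ φ, IsTestFunction Ω φ → ∀ e : E3,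
    ∫ y in Ω ×ˢ univ, f y * fderiv ℝ φ y (L e) = -∫ y in Ω ×ˢ univ, inner ℝ (G y) e * φ y

theorem hasWeakGradX_iff {Ω : Set E3} {f : E3 × E3 → ℝ} {G : E3 × E3 → E3} :
    HasWeakGradX Ω f G ↔ HasWeakGradAlong (ContinuousLinearMap.inl ℝ E3 E3) Ω f G :=
  ⟨fun h => ⟨h.1, h.2, h.3⟩, fun h => ⟨h.1, h.2, h.3⟩⟩

theorem hasWeakGradV_iff {Ω : Set E3} {f : E3 × E3 → ℝ} {G : E3 × E3 → E3} :
    HasWeakGradV Ω f G ↔ HasWeakGradAlong (ContinuousLinearMap.inr ℝ E3 E3) Ω f G :=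
  ⟨fun h => ⟨h.1, h.2, h.3⟩, fun h => ⟨h.1, h.2, h.3⟩⟩

/-- The weighted norm of the weak gradient along the image of `L`. -/
noncomputable def gradNorm (L : E3 →L[ℝ] E3 × E3) (Ω : Set E3) (p α : ℝ) (f : E3 × E3 → ℝ) : ℝ≥0∞ :=
  ⨅ (G : E3 × E3 → E3) (_ : HasWeakGradAlong L Ω f G), lpAlphaNorm Ω p α G

theorem w1pNorm_eq (Ω : Set E3) (p α : ℝ) (f : E3 × E3 → ℝ) :
    w1pNorm Ω p α f = lpAlphaNorm Ω p α f + gradNorm (ContinuousLinearMap.inl ℝ E3 E3) Ω p α f +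
      gradNorm (ContinuousLinearMap.inr ℝ E3 E3) Ω p α f := by
  simp only [w1pNorm, gradNorm, hasWeakGradX_iff, hasWeakGradV_iff]

section

variable {Ω : Set E3} {L : E3 →L[ℝ] E3 × E3} {f f' : E3 × E3 → ℝ} {G G' : E3 × E3 → E3} {p α : ℝ}

theorem MeasureTheory.LocallyIntegrableOn.inner_const (hΩ : IsOpen Ω) (hG : LocallyIntegrableOn G (Ω ×ˢ univ))
    (e : E3) : LocallyIntegrableOn (fun y => (inner ℝ (G y) e : ℝ)) (Ω ×ˢ univ) := by
  rw [locallyIntegrableOn_prod_univ_iff hΩ] at hG ⊢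
  exact fun K hK hs => (hG K hK hs).inner_const e

theorem HasWeakGradAlong.hasWeakPartial (hΩ : IsOpen Ω) (h : HasWeakGradAlong L Ω f G) (e : E3) :
    HasWeakPartial Ω (L e) f fun y => inner ℝ (G y) e :=
  ⟨h.locInt, h.locInt_grad.inner_const hΩ e, fun φ hφ => h.integral_eq φ hφ e⟩

/-- Both sides of the identity are linear in the direction, so the derivatives along a basis
determine a weak gradient. -/
theorem hasWeakGradAlong_of_hasWeakPartial (hΩ : IsOpen Ω) {ι : Type*} [Fintype ι] (b : OrthonormalBasis ι ℝ E3)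
    {g : ι → E3 × E3 → ℝ} (hf : LocallyIntegrableOn f (Ω ×ˢ univ)) (h : ∀ i, HasWeakPartial Ω (L (b i)) f (g i)) :
    HasWeakGradAlong L Ω f fun y => ∑ i, g i y • b i := by
  refine ⟨hf, ?_, fun φ hφ e => ?_⟩
  · rw [locallyIntegrableOn_prod_univ_iff hΩ]
    intro K hK hs
    exact integrable_finsetSum _ fun i _ =>
      ((locallyIntegrableOn_prod_univ_iff hΩ).1 (h i).locInt_deriv K hK hs).smul_const (b i)
  · have e1 : ∀ y, f y * fderiv ℝ φ y (L e) = ∑ i, inner ℝ (b i) e * (f y * fderiv ℝ φ y (L (b i))) := by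
      intro y
      conv_lhs => rw [← b.sum_repr' e]
      simp only [map_sum, map_smul, smul_eq_mul, Finset.mul_sum]
      exact Finset.sum_congr rfl fun i _ => by ring
    have e2 : ∀ y, inner ℝ (∑ i, g i y • b i) e * φ y = ∑ i, inner ℝ (b i) e * (g i y * φ y) := by
      intro y
      simp only [sum_inner, real_inner_smul_left, Finset.sum_mul]
      exact Finset.sum_congr rfl fun i _ => by ring
    simp only [e1, e2]
    rw [integral_finsetSum _ fun i _ => (hφ.integrable_mul_fderiv hΩ hf _).integrableOn.const_mul _,
      integral_finsetSum _ fun i _ => (hφ.integrable_mul hΩ (h i).locInt_deriv).integrableOn.const_mul _,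
      ← Finset.sum_neg_distrib]
    refine Finset.sum_congr rfl fun i _ => ?_
    rw [integral_const_mul, integral_const_mul, (h i).integral_eq φ hφ, mul_neg]

theorem HasWeakGradAlong.add_smul (hΩ : IsOpen Ω) (h : HasWeakGradAlong L Ω f G) (h' : HasWeakGradAlong L Ω f' G')
    (c : ℝ) : HasWeakGradAlong L Ω (f + c • f') (G + c • G') := by
  refine ⟨h.locInt.add (h'.locInt.smul c), h.locInt_grad.add (h'.locInt_grad.smul c), fun φ hφ e => ?_⟩
  rw [((h.hasWeakPartial hΩ e).add_smul hΩ (h'.hasWeakPartial hΩ e) c).integral_eq φ hφ]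
  simp only [Pi.add_apply, Pi.smul_apply, inner_add_left, real_inner_smul_left, smul_eq_mul]

theorem lpAlphaNorm_add_smul_le {X : Type*} [NormedAddCommGroup X] [NormedSpace ℝ X] (hp : 1 ≤ p) {u u' : E3 × E3 → X}
    (hu : LocallyIntegrableOn u (Ω ×ˢ univ)) (hu' : LocallyIntegrableOn u' (Ω ×ˢ univ)) {c : ℝ} (hc : ‖c‖ ≤ 1) :
    lpAlphaNorm Ω p α (u + c • u') ≤ lpAlphaNorm Ω p α u + lpAlphaNorm Ω p α u' :=
  (weightedNorm_add_le hp hu.aestronglyMeasurable (hu'.aestronglyMeasurable.const_smul c)).trans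
    (add_le_add_right (weightedNorm_smul_le hc u') _)

theorem gradNorm_add_smul_le (hΩ : IsOpen Ω) (hp : 1 ≤ p) {c : ℝ} (hc : ‖c‖ ≤ 1) :
    gradNorm L Ω p α (f + c • f') ≤ gradNorm L Ω p α f + gradNorm L Ω p α f' := by
  refine ENNReal.le_iInf_add_iInf fun G G' => ENNReal.le_iInf_add_iInf fun h h' => ?_
  exact (iInf₂_le _ (h.add_smul hΩ h' c)).trans (lpAlphaNorm_add_smul_le hp h.locInt_grad h'.locInt_grad hc)

theorem exists_hasWeakGradAlong_of_gradNorm_lt_top (h : gradNorm L Ω p α f < ∞) : ∃ G, HasWeakGradAlong L Ω f G := by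
  by_contra! hn
  simp [gradNorm, hn] at h

theorem locallyIntegrableOn_of_memW1p (h : MemW1p Ω p α f) : LocallyIntegrableOn f (Ω ×ˢ univ) := by
  rw [MemW1p, w1pNorm_eq] at h
  obtain ⟨G, hG⟩ := exists_hasWeakGradAlong_of_gradNorm_lt_top (lt_of_le_of_lt le_add_self h)
  exact hG.locInt

theorem lpAlphaNorm_le_w1pNorm : lpAlphaNorm Ω p α f ≤ w1pNorm Ω p α f := by
  rw [w1pNorm_eq, add_assoc]; exact le_self_add

theorem w1pNorm_add_smul_le (hΩ : IsOpen Ω) (hp : 1 ≤ p) {c : ℝ} (hc : ‖c‖ ≤ 1) :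
    w1pNorm Ω p α (f + c • f') ≤ w1pNorm Ω p α f + w1pNorm Ω p α f' := by
  rcases eq_top_or_lt_top (w1pNorm Ω p α f) with h | h
  · rw [h, top_add]; exact le_top
  rcases eq_top_or_lt_top (w1pNorm Ω p α f') with h' | h'
  · rw [h', add_top]; exact le_top
  have h1 := locallyIntegrableOn_of_memW1p h
  have h2 := locallyIntegrableOn_of_memW1p h'
  rw [w1pNorm_eq, w1pNorm_eq, w1pNorm_eq]
  calc _ ≤ _ := add_le_add (add_le_add (lpAlphaNorm_add_smul_le hp h1 h2 hc) (gradNorm_add_smul_le hΩ hp hc))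
        (gradNorm_add_smul_le hΩ hp hc)
    _ = _ := by ring

theorem w1pNorm_sub_le (hΩ : IsOpen Ω) (hp : 1 ≤ p) :
    w1pNorm Ω p α (f - f') ≤ w1pNorm Ω p α f + w1pNorm Ω p α f' := by
  have h1 : f - f' = f + (-1 : ℝ) • f' := by module
  rw [h1]
  exact w1pNorm_add_smul_le hΩ hp (by simp)

theorem w1pNorm_le_add_sub (hΩ : IsOpen Ω) (hp : 1 ≤ p) :
    w1pNorm Ω p α f ≤ w1pNorm Ω p α f' + w1pNorm Ω p α (f - f') := by
  have h1 : f = f' + (1 : ℝ) • (f - f') := by module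
  conv_lhs => rw [h1]
  exact w1pNorm_add_smul_le hΩ hp (by simp)

/-- The Sobolev norm is an infimum over weak gradients; by uniqueness each of them represents the
classical derivative almost everywhere, and the Riesz identification is isometric. -/
theorem lpAlphaNorm_spaceDeriv_le_w1pNorm (hΩ : IsOpen Ω) (hf : ContDiff ℝ 1 f) :
    lpAlphaNorm Ω p α (spaceDeriv f) ≤ w1pNorm Ω p α f := by
  rw [w1pNorm_eq]
  refine le_trans (le_iInf₂ fun G hG => ?_) (le_add_self.trans le_self_add)
  set b := EuclideanSpace.basisFun (Fin 3) ℝ with hb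
  have h1 : ∀ i, ∀ᵐ y ∂(volume.restrict (Ω ×ˢ univ)), fderiv ℝ f y (b i, 0) = inner ℝ (G y) (b i) := fun i =>
    (hasWeakPartial_of_contDiff hΩ hf (b i, 0)).ae_eq hΩ (hG.hasWeakPartial hΩ (b i))
  refine weightedNorm_mono_ae ?_
  filter_upwards [ae_all_iff.2 h1] with y hy
  have h2 : spaceDeriv f y = innerSL ℝ (G y) := by
    refine ContinuousLinearMap.ext fun e => ?_
    rw [← b.sum_repr' e, map_sum, map_sum]
    refine Finset.sum_congr rfl fun i _ => ?_
    rw [map_smul, map_smul, innerSL_apply_apply, ← hy i]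
    rfl
  rw [h2, innerSL_apply_norm]

theorem gradNorm_le_sum (hΩ : IsOpen Ω) (hp : 1 ≤ p) {ι : Type*} [Fintype ι] (b : OrthonormalBasis ι ℝ E3)
    {g : ι → E3 × E3 → ℝ} (hf : LocallyIntegrableOn f (Ω ×ˢ univ)) (h : ∀ i, HasWeakPartial Ω (L (b i)) f (g i)) :
    gradNorm L Ω p α f ≤ ∑ i, lpAlphaNorm Ω p α (g i) := by
  classical
  refine (iInf₂_le _ (hasWeakGradAlong_of_hasWeakPartial hΩ b hf h)).trans ?_
  have hm : ∀ i, AEStronglyMeasurable (g i) (volume.restrict (Ω ×ˢ univ)) := fun i =>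
    (h i).locInt_deriv.aestronglyMeasurable
  have key : ∀ s : Finset ι, lpAlphaNorm Ω p α (fun y => ∑ i ∈ s, g i y • b i) ≤ ∑ i ∈ s, lpAlphaNorm Ω p α (g i) := by
    intro s
    induction s using Finset.induction_on with
    | empty => simp [lpAlphaNorm, weightedNorm]
    | insert a s ha ih =>
      simp only [Finset.sum_insert ha]
      refine (weightedNorm_add_le hp ((hm a).smul_const (b a)) ?_).trans (add_le_add ?_ ih)
      · exact Finset.aestronglyMeasurable_fun_sum s fun i _ => (hm i).smul_const (b i)
      · refine weightedNorm_mono_ae (ae_of_all _ fun y => ?_)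
        rw [norm_smul, b.norm_eq_one, mul_one]
  exact key Finset.univ

end

/-! ### The estimate for functions with a trace -/

/-- Convergence to `0` in `[0, ∞]` allows finitely many infinite terms; these are dropped. -/
theorem StationaryBoltzmann.IsBoundaryTrace.exists_approx_lt_top {Ω : Set E3} {p α : ℝ} {f T : E3 × E3 → ℝ}
    (h : IsBoundaryTrace Ω p α f T) : ∃ φ : ℕ → E3 × E3 → ℝ,
    (∀ n, ContDiff ℝ 1 (φ n) ∧ HasCompactSupport (φ n)) ∧
    (∀ n, w1pNorm Ω p α (φ n - f) < ∞) ∧ (∀ n, weightedNorm (boundaryMeasure Ω) p α (φ n - T) < ∞) ∧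
    Tendsto (fun n => w1pNorm Ω p α (φ n - f)) atTop (𝓝 0) ∧
    Tendsto (fun n => weightedNorm (boundaryMeasure Ω) p α (φ n - T)) atTop (𝓝 0) := by
  obtain ⟨φ, h1, h2, h3⟩ := h.exists_approx
  obtain ⟨N, hN⟩ := eventually_atTop.1 ((h2.eventually_lt_const ENNReal.zero_lt_top).and
    (h3.eventually_lt_const ENNReal.zero_lt_top))
  exact ⟨fun n => φ (n + N), fun n => ⟨(h1 _).1.of_le (by exact_mod_cast le_top), (h1 _).2⟩,
    fun n => (hN _ (by omega)).1, fun n => (hN _ (by omega)).2,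
    h2.comp (tendsto_add_atTop_nat N), h3.comp (tendsto_add_atTop_nat N)⟩

theorem measurableRep_lpAlphaNorm {Ω : Set E3} {p α : ℝ} {h h' : E3 × E3 → ℝ}
    (hh : h =ᵐ[volume.restrict (Ω ×ˢ univ)] h') : lpAlphaNorm Ω p α h = lpAlphaNorm Ω p α h' :=
  weightedNorm_congr_ae hh

/-- Convergence of the integrals and the `L^p` bound. -/
theorem KernelBounds.exists_lpAlphaNorm_opS_opK_le {ρ γ : ℝ} {ν : E3 → ℝ} {k : E3 → E3 → ℝ}
    {α a B C c : ℝ} (hA : AssumptionA ρ γ ν k) (hb : KernelBounds ν k α a B C c) {p : ℝ} (hp : 2 ≤ p) :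
    ∃ M : ℝ≥0∞, M ≠ ∞ ∧ ∀ Ω, IsBoundedConvexC2Domain Ω → ∀ h : E3 × E3 → ℝ,
      AEStronglyMeasurable h (volume.restrict (Ω ×ˢ univ)) → lpAlphaNorm Ω p α h < ∞ →
      AEStronglyMeasurable (opS Ω ν (opK k h)) (volume.restrict (Ω ×ˢ univ)) ∧
      (∀ᵐ y ∂(volume.restrict (Ω ×ˢ univ)), Integrable (fun w => k y.2 w * h (y.1, w))) ∧
      (∀ᵐ y ∂(volume.restrict (Ω ×ˢ univ)), IntervalIntegrable
        (fun s => Real.exp (-(ν y.2 * s)) * opK k h (y.1 - s • y.2, y.2)) volume 0 (exitTime Ω y.1 y.2)) ∧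
      lpAlphaNorm Ω p α (opS Ω ν (opK k h)) ≤ M * lpAlphaNorm Ω p α h := by
  obtain ⟨M, hM, hMb⟩ := hb.exists_lpAlphaNorm_opS_opK_le_of_measurable hA hp
  refine ⟨M, hM, fun Ω hΩ h hm hfin => ?_⟩
  obtain ⟨h', hm', hh⟩ : ∃ h', Measurable h' ∧ h =ᵐ[volume.restrict (Ω ×ˢ univ)] h' :=
    ⟨hm.mk h, hm.stronglyMeasurable_mk.measurable, hm.ae_eq_mk⟩
  rw [measurableRep_lpAlphaNorm hh] at hfin
  obtain ⟨h1, h2, h3⟩ := hMb Ω hΩ h' hm' hfin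
  have e := opS_opK_congr hΩ hh ν k
  refine ⟨?_, ?_, ?_, ?_⟩
  · exact (aestronglyMeasurable_opS hA hΩ (measurable_opK hA hm')).congr e.symm
  · filter_upwards [h1, ae_integrand_eq hΩ hh k] with y a b using a.congr b.symm
  · filter_upwards [h2, ae_ray_eq hΩ hh ν k] with y a b
    rw [intervalIntegrable_iff_integrableOn_Ioc_of_le (exitTime_nonneg _ _ _)] at a ⊢
    exact a.congr b.symm
  · rw [measurableRep_lpAlphaNorm e, measurableRep_lpAlphaNorm hh]
    exact h3

/-! ### Extension from smooth functions and the final estimate -/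

open scoped ENNReal NNReal

/-- A linear operator that is bounded on `L^p`, and whose directional derivatives on smooth functions are controlled by
the Sobolev norm and the boundary values, has weak directional derivatives on functions with a trace. -/
theorem exists_hasWeakPartial_of_isBoundaryTrace {Ω : Set E3} (hΩ : IsOpen Ω) {p α : ℝ} (hp : 1 ≤ p) (hα : 0 ≤ α)
    {S d : (E3 × E3 → ℝ) → E3 × E3 → ℝ} {M₁ M₂ D c₃ : ℝ≥0∞} (hM₁ : M₁ ≠ ∞) (hM₂ : M₂ ≠ ∞) (hD : D ≠ ∞) (hc₃ : c₃ ≠ ∞)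
    (hS : ∀ f, AEStronglyMeasurable f (volume.restrict (Ω ×ˢ univ)) → lpAlphaNorm Ω p α f < ∞ →
      AEStronglyMeasurable (S f) (volume.restrict (Ω ×ˢ univ)) ∧ lpAlphaNorm Ω p α (S f) ≤ M₂ * lpAlphaNorm Ω p α f)
    (hSsub : ∀ f g, AEStronglyMeasurable f (volume.restrict (Ω ×ˢ univ)) → lpAlphaNorm Ω p α f < ∞ →
      AEStronglyMeasurable g (volume.restrict (Ω ×ˢ univ)) → lpAlphaNorm Ω p α g < ∞ →
      S (f - g) =ᵐ[volume.restrict (Ω ×ˢ univ)] S f - S g) {e : E3 × E3}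
    (hdW : ∀ f, ContDiff ℝ 1 f → HasCompactSupport f → HasWeakPartial Ω e (S f) (d f))
    (hdB : ∀ f, ContDiff ℝ 1 f → lpAlphaNorm Ω p α (d f) ≤ M₁ * (D * lpAlphaNorm Ω p α (spaceDeriv f) +
      lpAlphaNorm Ω p α f + c₃ * weightedNorm (boundaryMeasure Ω) p α f))
    {h T : E3 × E3 → ℝ} (hh : MemW1p Ω p α h) (hT : IsBoundaryTrace Ω p α h T)
    (hTfin : weightedNorm (boundaryMeasure Ω) p α T < ∞) :
    ∃ g, HasWeakPartial Ω e (S h) g ∧ lpAlphaNorm Ω p α g ≤ M₁ * (D * w1pNorm Ω p α h + lpAlphaNorm Ω p α h +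
      c₃ * weightedNorm (boundaryMeasure Ω) p α T) := by
  obtain ⟨φ, hφ, hε, hδ, hε0, hδ0⟩ := hT.exists_approx_lt_top
  set μ : Measure (E3 × E3) := volume.restrict (Ω ×ˢ univ) with hμ
  set ε := fun n => w1pNorm Ω p α (φ n - h) with hεd
  set δ := fun n => weightedNorm (boundaryMeasure Ω) p α (φ n - T) with hδd
  have hhm : AEStronglyMeasurable h μ := (locallyIntegrableOn_of_memW1p hh).aestronglyMeasurable
  have hhfin : lpAlphaNorm Ω p α h < ∞ := lpAlphaNorm_le_w1pNorm.trans_lt hh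
  have hφm : ∀ n, AEStronglyMeasurable (φ n) μ := fun n => (hφ n).1.continuous.aestronglyMeasurable
  have hφb : ∀ n, AEStronglyMeasurable (φ n) (boundaryMeasure Ω) := fun n =>
    (hφ n).1.continuous.aestronglyMeasurable
  have hw : ∀ n, w1pNorm Ω p α (φ n) ≤ w1pNorm Ω p α h + ε n := fun n => w1pNorm_le_add_sub hΩ hp
  have hl : ∀ n, lpAlphaNorm Ω p α (φ n) ≤ lpAlphaNorm Ω p α h + ε n := fun n => by
    have e1 : φ n = h + (φ n - h) := by simp
    conv_lhs => rw [e1]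
    exact (weightedNorm_add_le hp hhm ((hφm n).sub hhm)).trans (add_le_add_right lpAlphaNorm_le_w1pNorm _)
  have hb : ∀ n, weightedNorm (boundaryMeasure Ω) p α (φ n) ≤ weightedNorm (boundaryMeasure Ω) p α T + δ n := fun n => by
    have e1 : φ n = T + (φ n - T) := by simp
    conv_lhs => rw [e1]
    exact weightedNorm_add_le hp hT.1 ((hφb n).sub hT.1)
  have hlfin : ∀ n, lpAlphaNorm Ω p α (φ n) < ∞ := fun n =>
    (hl n).trans_lt (ENNReal.add_lt_top.2 ⟨hhfin, hε n⟩)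
  have hdn : ∀ n, lpAlphaNorm Ω p α (d (φ n)) ≤ M₁ * (D * (w1pNorm Ω p α h + ε n) + (lpAlphaNorm Ω p α h + ε n) +
      c₃ * (weightedNorm (boundaryMeasure Ω) p α T + δ n)) := fun n => by
    refine (hdB _ (hφ n).1).trans (mul_le_mul_right (add_le_add (add_le_add (mul_le_mul_right ?_ _) (hl n))
      (mul_le_mul_right (hb n) _)) _)
    exact (lpAlphaNorm_spaceDeriv_le_w1pNorm hΩ (hφ n).1).trans (hw n)
  have hdfin : ∀ n, lpAlphaNorm Ω p α (d (φ n)) < ∞ := fun n => by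
    refine (hdn n).trans_lt (ENNReal.mul_lt_top hM₁.lt_top (ENNReal.add_lt_top.2 ⟨ENNReal.add_lt_top.2 ⟨?_, ?_⟩, ?_⟩))
    · exact ENNReal.mul_lt_top hD.lt_top (ENNReal.add_lt_top.2 ⟨hh, hε n⟩)
    · exact ENNReal.add_lt_top.2 ⟨hhfin, hε n⟩
    · exact ENNReal.mul_lt_top hc₃.lt_top (ENNReal.add_lt_top.2 ⟨hTfin, hδ n⟩)
  have hW : ∀ n, HasWeakPartial Ω e (S (φ n)) (d (φ n)) := fun n => hdW _ (hφ n).1 (hφ n).2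
  have hdm : ∀ n, AEStronglyMeasurable (d (φ n)) μ := fun n => (hW n).locInt_deriv.aestronglyMeasurable
  -- The smooth estimate, applied to `φ n - φ m` and split at `h` and at `T`, bounds the distance of
  -- the derivatives by `η n + η m`.
  set η := fun n => M₁ * (D * ε n + ε n + c₃ * δ n) with hη
  have hη0 : Tendsto η atTop (𝓝 0) := by
    have h1 := ((ENNReal.Tendsto.const_mul hε0 (Or.inr hD)).add hε0).add (ENNReal.Tendsto.const_mul hδ0 (Or.inr hc₃))
    have h2 := ENNReal.Tendsto.const_mul h1 (Or.inr hM₁)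
    simpa using h2
  have hcauchy : ∀ n m, lpAlphaNorm Ω p α (d (φ n) - d (φ m)) ≤ η n + η m := fun n m => by
    have hc : ContDiff ℝ 1 (φ n - φ m) := (hφ n).1.sub (hφ m).1
    have hcs : HasCompactSupport (φ n - φ m) := (hφ n).2.sub (hφ m).2
    -- The operator `d` is not assumed to be additive; additivity holds almost everywhere because
    -- both sides are weak derivatives of the same function.
    have hae : d (φ n - φ m) =ᵐ[μ] d (φ n) - d (φ m) := by
      refine HasWeakPartial.ae_eq hΩ ((hdW _ hc hcs).congr hΩ ?_ EventuallyEq.rfl) ((hW n).sub hΩ (hW m))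
      exact hSsub _ _ (hφm n) (hlfin n) (hφm m) (hlfin m)
    have e1 : φ n - φ m = (φ n - h) - (φ m - h) := by simp
    have e2 : φ n - φ m = (φ n - T) - (φ m - T) := by simp
    have a1 : w1pNorm Ω p α (φ n - φ m) ≤ ε n + ε m := by
      conv_lhs => rw [e1]
      exact w1pNorm_sub_le hΩ hp
    have a2 : weightedNorm (boundaryMeasure Ω) p α (φ n - φ m) ≤ δ n + δ m := by
      conv_lhs => rw [e2]
      exact weightedNorm_sub_le hp ((hφb n).sub hT.1) ((hφb m).sub hT.1)
    have a3 : lpAlphaNorm Ω p α (d (φ n) - d (φ m)) = lpAlphaNorm Ω p α (d (φ n - φ m)) :=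
      weightedNorm_congr_ae hae.symm
    rw [a3]
    calc _ ≤ M₁ * (D * (ε n + ε m) + (ε n + ε m) + c₃ * (δ n + δ m)) :=
          (hdB _ hc).trans (mul_le_mul_right (add_le_add (add_le_add (mul_le_mul_right
            ((lpAlphaNorm_spaceDeriv_le_w1pNorm hΩ hc).trans a1) _) (lpAlphaNorm_le_w1pNorm.trans a1))
            (mul_le_mul_right a2 _)) _)
      _ = η n + η m := by simp only [hη]; ring
  obtain ⟨g, hgm, hg⟩ := exists_tendsto_weightedNorm hp hdm hdfin hη0 hcauchy
  have hgd : ∀ n, weightedNorm μ p α g ≤ lpAlphaNorm Ω p α (d (φ n)) + weightedNorm μ p α (d (φ n) - g) := fun n => by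
    have e1 : g = d (φ n) - (d (φ n) - g) := by simp
    conv_lhs => rw [e1]
    exact weightedNorm_sub_le hp (hdm n) ((hdm n).sub hgm)
  have hgle : weightedNorm μ p α g ≤ M₁ * (D * w1pNorm Ω p α h + lpAlphaNorm Ω p α h +
      c₃ * weightedNorm (boundaryMeasure Ω) p α T) := by
    have h1 : Tendsto (fun n => M₁ * (D * (w1pNorm Ω p α h + ε n) + (lpAlphaNorm Ω p α h + ε n) +
        c₃ * (weightedNorm (boundaryMeasure Ω) p α T + δ n)) + weightedNorm μ p α (d (φ n) - g)) atTop
        (𝓝 (M₁ * (D * (w1pNorm Ω p α h + 0) + (lpAlphaNorm Ω p α h + 0) +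
          c₃ * (weightedNorm (boundaryMeasure Ω) p α T + 0)) + 0)) := by
      refine Tendsto.add (ENNReal.Tendsto.const_mul (((ENNReal.Tendsto.const_mul (tendsto_const_nhds.add hε0)
        (Or.inr hD)).add (tendsto_const_nhds.add hε0)).add (ENNReal.Tendsto.const_mul (tendsto_const_nhds.add hδ0)
        (Or.inr hc₃))) (Or.inr hM₁)) hg
    simp only [add_zero] at h1
    exact ge_of_tendsto' h1 fun n => (hgd n).trans (add_le_add_left (hdn n) _)
  have hgfin : weightedNorm μ p α g < ∞ := hgle.trans_lt (ENNReal.mul_lt_top hM₁.lt_top (ENNReal.add_lt_top.2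
    ⟨ENNReal.add_lt_top.2 ⟨ENNReal.mul_lt_top hD.lt_top hh, hhfin⟩, ENNReal.mul_lt_top hc₃.lt_top hTfin⟩))
  have hSfin : ∀ f, AEStronglyMeasurable f μ → lpAlphaNorm Ω p α f < ∞ → lpAlphaNorm Ω p α (S f) < ∞ :=
    fun f h1 h2 => (hS f h1 h2).2.trans_lt (ENNReal.mul_lt_top hM₂.lt_top h2)
  refine ⟨g, HasWeakPartial.of_tendsto hΩ (ENNReal.one_le_ofReal.2 hp) hW
    (fun n => memLp_of_weightedNorm_lt_top hα (hS _ (hφm n) (hlfin n)).1 (hSfin _ (hφm n) (hlfin n)))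
    (fun n => memLp_of_weightedNorm_lt_top hα (hdm n) (hdfin n))
    (memLp_of_weightedNorm_lt_top hα (hS _ hhm hhfin).1 (hSfin _ hhm hhfin))
    (memLp_of_weightedNorm_lt_top hα hgm hgfin) ?_ ?_, hgle⟩
  · have h0 : Tendsto (fun n => M₂ * ε n) atTop (𝓝 0) := by
      have := ENNReal.Tendsto.const_mul hε0 (Or.inr hM₂)
      rwa [mul_zero] at this
    refine tendsto_of_tendsto_of_tendsto_of_le_of_le tendsto_const_nhds h0 (fun _ => zero_le) fun n => ?_
    have hm : AEStronglyMeasurable (φ n - h) μ := (hφm n).sub hhm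
    have hf : lpAlphaNorm Ω p α (φ n - h) < ∞ := lpAlphaNorm_le_w1pNorm.trans_lt (hε n)
    calc _ ≤ weightedNorm μ p α (S (φ n) - S h) := eLpNorm_le_weightedNorm hα _
      _ = lpAlphaNorm Ω p α (S (φ n - h)) :=
          (weightedNorm_congr_ae (hSsub _ _ (hφm n) (hlfin n) hhm hhfin)).symm
      _ ≤ M₂ * lpAlphaNorm Ω p α (φ n - h) := (hS _ hm hf).2
      _ ≤ M₂ * ε n := mul_le_mul_right lpAlphaNorm_le_w1pNorm _
  · exact tendsto_of_tendsto_of_tendsto_of_le_of_le tendsto_const_nhds hg (fun _ => zero_le) fun n =>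
      eLpNorm_le_weightedNorm hα _

/-- The infimum over traces is pulled out of the right-hand side. A trace of infinite norm makes
that side infinite, since the constants are not `0`; if there is no trace, the infimum is `∞` as
well. -/
theorem boundaryNorm_le_of_forall {Ω : Set E3} {p α : ℝ} {h : E3 × E3 → ℝ} {X C A c : ℝ≥0∞} (hC : C ≠ ∞) (hC0 : C ≠ 0)
    (hc : c ≠ ∞) (hc0 : c ≠ 0) (H : ∀ T, IsBoundaryTrace Ω p α h T → weightedNorm (boundaryMeasure Ω) p α T < ∞ →
      X ≤ C * (A + c * weightedNorm (boundaryMeasure Ω) p α T)) : X ≤ C * (A + c * boundaryNorm Ω p α h) := by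
  unfold boundaryNorm
  simp only [ENNReal.mul_iInf_of_ne hc0 hc, ENNReal.add_iInf, ENNReal.mul_iInf_of_ne hC0 hC]
  refine le_iInf₂ fun T hT => ?_
  rcases eq_top_or_lt_top (weightedNorm (boundaryMeasure Ω) p α T) with hi | hi
  · rw [hi, ENNReal.mul_top hc0, add_top, ENNReal.mul_top hC0]
    exact le_top
  · exact H T hT hi

theorem lemma1p7 (ρ γ : ℝ) (ν : E3 → ℝ) (k : E3 → E3 → ℝ) (hA : AssumptionA ρ γ ν k)
    (p α : ℝ) (hp : 2 ≤ p) (hp' : p < 3) (hα : 0 ≤ α) (hα' : α < (1 - ρ) / 2) :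
    ∃ C : ℝ, 0 < C ∧ ∀ Ω : Set E3, IsBoundedConvexC2Domain Ω → HasPositiveGaussianCurvature Ω →
      (∃ C₃ : ℝ, IsChordConstant Ω C₃) ∧
      ∀ C₃ : ℝ, IsChordConstant Ω C₃ → ∀ h : E3 × E3 → ℝ, MemW1p Ω p α h →
        (∀ᵐ y ∂(phaseMeasure Ω), Integrable (fun w => k y.2 w * h (y.1, w))) ∧
        (∀ᵐ y ∂(phaseMeasure Ω), IntervalIntegrable
          (fun s => Real.exp (-(ν y.2 * s)) * opK k h (y.1 - s • y.2, y.2))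
          volume 0 (exitTime Ω y.1 y.2)) ∧
        w1pNorm Ω p α (opS Ω ν (opK k h)) ≤
          ENNReal.ofReal C *
            (ENNReal.ofReal (Metric.diam Ω ^ (1 / p)) * w1pNorm Ω p α h
              + lpAlphaNorm Ω p α h
              + ENNReal.ofReal (C₃ ^ (1 / p)) * boundaryNorm Ω p α h) := by
  obtain ⟨a, B, K, c, hb⟩ := hA.exists_kernelBounds hα hα'
  obtain ⟨M₁, hM₁, hder⟩ := hb.exists_lpAlphaNorm_rayTermDeriv_le hp hp'
  obtain ⟨M₂, hM₂, hlp⟩ := hb.exists_lpAlphaNorm_opS_opK_le hA hp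
  have hp1 : 1 ≤ p := by linarith
  -- One `M₂` for the function itself, and one `M₁` for each of the three components of the two
  -- gradients.
  set M : ℝ≥0∞ := M₂ + 3 * M₁ + 3 * M₁ with hM
  have hMt : M ≠ ∞ := by
    have h3 : (3 : ℝ≥0∞) * M₁ ≠ ∞ := ENNReal.mul_ne_top (by simp) hM₁
    exact ENNReal.add_ne_top.2 ⟨ENNReal.add_ne_top.2 ⟨hM₂, h3⟩, h3⟩
  -- The summand `1` makes the constant positive. It is chosen before `Ω`, so it does not depend on
  -- the domain.
  refine ⟨M.toReal + 1, by positivity, fun Ω hΩ hκ => ⟨hΩ.exists_isChordConstant hκ, fun C₃ hC₃ h hh => ?_⟩⟩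
  have hhloc := locallyIntegrableOn_of_memW1p hh
  obtain ⟨hSm, hKint, hSint, hSle⟩ := hlp Ω hΩ h hhloc.aestronglyMeasurable (lpAlphaNorm_le_w1pNorm.trans_lt hh)
  refine ⟨hKint, hSint, ?_⟩
  have hC : M ≤ ENNReal.ofReal (M.toReal + 1) := by
    rw [ENNReal.ofReal_add ENNReal.toReal_nonneg zero_le_one, ENNReal.ofReal_toReal hMt]
    exact le_self_add
  refine boundaryNorm_le_of_forall ENNReal.ofReal_ne_top (by simp; positivity) ENNReal.ofReal_ne_top
    (by simpa using Real.rpow_pos_of_pos hC₃.1 _) fun T hT hTfin => ?_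
  set R := ENNReal.ofReal (Metric.diam Ω ^ (1 / p)) * w1pNorm Ω p α h + lpAlphaNorm Ω p α h +
    ENNReal.ofReal (C₃ ^ (1 / p)) * weightedNorm (boundaryMeasure Ω) p α T with hR
  have hpart : ∀ e : E3 × E3, ‖e.1‖ ≤ 1 → ‖e.2‖ ≤ 1 → ∃ g, HasWeakPartial Ω e (opS Ω ν (opK k h)) g ∧
      lpAlphaNorm Ω p α g ≤ M₁ * R := fun e he1 he2 =>
    exists_hasWeakPartial_of_isBoundaryTrace hΩ.isOpen hp1 hα (S := fun f => opS Ω ν (opK k f))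
      (d := fun f y => ∫ π, rayTermDeriv Ω ν k f e π y ∂rayMeasure) hM₁ hM₂ ENNReal.ofReal_ne_top
      ENNReal.ofReal_ne_top (fun f h1 h2 => ⟨(hlp Ω hΩ f h1 h2).1, (hlp Ω hΩ f h1 h2).2.2.2⟩)
      (fun f g h1 h2 h3 h4 => opS_sub_ae hΩ (hlp Ω hΩ f h1 h2).2.1 (hlp Ω hΩ g h3 h4).2.1
        (hlp Ω hΩ f h1 h2).2.2.1 (hlp Ω hΩ g h3 h4).2.2.1)
      (fun f h1 h2 => hΩ.hasWeakPartial_opS_opK hA h1 h2 he1 he2)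
      (fun f h1 => hder Ω hΩ C₃ hC₃ f h1 e he1 he2) hh hT hTfin
  -- The gradients in `x` and `v` are treated together; their basis directions have components of
  -- norm at most one, as the directional estimate requires.
  have hgrad : ∀ L : E3 →L[ℝ] E3 × E3, (∀ x, ‖x‖ ≤ 1 → ‖(L x).1‖ ≤ 1 ∧ ‖(L x).2‖ ≤ 1) →
      gradNorm L Ω p α (opS Ω ν (opK k h)) ≤ 3 * M₁ * R := fun L hL => by
    set b := EuclideanSpace.basisFun (Fin 3) ℝ with hbd
    have hLb : ∀ i, ‖(L (b i)).1‖ ≤ 1 ∧ ‖(L (b i)).2‖ ≤ 1 := fun i => hL _ (b.norm_eq_one i).le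
    choose g hg1 hg2 using fun i => hpart (L (b i)) (hLb i).1 (hLb i).2
    refine (gradNorm_le_sum hΩ.isOpen hp1 b (hg1 0).locInt hg1).trans ?_
    refine (Finset.sum_le_sum fun i _ => hg2 i).trans (le_of_eq ?_)
    rw [Finset.sum_const, Finset.card_univ, Fintype.card_fin, nsmul_eq_mul, mul_assoc]
    norm_num
  rw [w1pNorm_eq]
  have hhR : lpAlphaNorm Ω p α h ≤ R := by
    rw [hR]
    exact (le_add_self.trans le_self_add)
  calc _ ≤ M₂ * R + 3 * M₁ * R + 3 * M₁ * R := by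
        refine add_le_add (add_le_add (hSle.trans (mul_le_mul_right hhR _)) (hgrad _ fun x hx => ?_))
          (hgrad _ fun x hx => ?_)
        · simpa using hx
        · simpa using hx
    _ = M * R := by rw [hM]; ring
    _ ≤ _ := mul_le_mul_left hC _
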